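/- Let $\ell,p,n\ge 1$ be integers with $p\mid\ell$, and let $\zeta\in\mathbb C$ be a primitive $\ell$-th root of unity. Let $W=G(\ell,p,n)\subset GL_n(\mathbb C)$ be the group of monomial matrices whose nonzero entries are $\ell$-th roots of unity with product an $(\ell/p)$-th root of unity. Write $t_i$ for the diagonal matrix with $i$-th entry $\zeta$ and all other diagonal entries $1$. Fix $\hbar\in\mathbb C\setminus\{0\}$, $\kappa\in\mathbb C$ and $c_m\in\mathbb C$ ($m\ge 0$) with $c_m=0$ unless $p\mid m$. For a reflection $s\in W$ put $c_s=\kappa$ if $s=t_i^mt_j^{-m}(i,j)$ with $i\ne j$, and $c_s=c_m$ if $s=t_i^m$ with $0<m<\ell$. Let $x_1,\dots,x_n$ be the standard basis of $\mathfrak h=\mathbb C^n$ and $y_1,\dots,y_n$ the dual basis of $\mathfrak h^*$. The rational Cherednik algebra $H$ is the $\mathbb C$-algebra generated by $W$, $\mathfrak h$ and $\mathfrak h^*$ with the relations of the group $W$, $gxg^{-1}=g(x)$, $gyg^{-1}=g(y)$, $[x,x']=[y,y']=0$ and $$[x,y]=\hbar\langle y,x\rangle-\sum_{s}c_s\langle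 y-s(y),x\rangle\,s ,$$ where $s$ runs over the reflections in $W$. Let $e=\frac1{|W|}\sum_{g\in W}g$; the spherical subalgebra is $eHe$, with unit $e$. Let $\Lambda=\mathbb C[U_1,\dots,U_n]$, $L=\mathbb C(U_1,\dots,U_n)$, let $S_n$ permute the $U_i$, and let $\mu_i(U_j)=U_j+\hbar\delta_{ij}$. Let $T=\langle\mu_1^{\pm\ell},\dots,\mu_n^{\pm\ell},(\mu_1\cdots\mu_n)^{\pm\ell/p}\rangle\subset\operatorname{Aut}(\Lambda)$, let $L\star T$ be the skew group ring, with $(a\mu)(b\nu)=a\mu(b)\,\mu\nu$, and put $\Gamma=\Lambda^{S_n}$, $K=L^{S_n}$, $\mathcal K=(L\star T)^{S_n}$, where $w\in S_n$ acts by $w(a\mu)=w(a)\,w\mu w^{-1}$. An element $X=\sum a_\mu\mu\in L\star T$ acts on $L$ by $X(f)=\sum a_\mu\mu(f)$. **Proposition.** (1) Put $k=-\kappa$, $P(u)=-\sum_{0<m<\ell}c_mu^m$, $\sigma=x_1(1,\dots,n)$ and $\tau=y_n(n,\dots,1)$, where $(1,\dots,n)$ is the permutation matrix of $1\mapsto2\mapsto\cdots\mapsto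 n\mapsto1$ and $(n,\dots,1)$ is its inverse. There is a representation of $H$ on $\mathscr P=\mathbb C[U_1,\dots,U_n;T_1,\dots,T_n]/(T_i^\ell-1)$ in which $\operatorname{diag}(\zeta^{a_1},\dots,\zeta^{a_n})\in W$ acts by multiplication by $\prod_iT_i^{a_i}$ and $$(i,i+1)\cdot f=f^{(i,i+1)}+k\,\frac{f^{(i,i+1)}-f}{U_{i+1}-U_i}\sum_{m=0}^{\ell-1}T_i^mT_{i+1}^{-m},$$ $$\sigma\cdot f=\bigl(U_1-P(\zeta^{-1}T_1)+\hbar\bigr)\,f(U_2,\dots,U_n,U_1+\hbar;\,T_2,\dots,T_n,\zeta^{-1}T_1),$$ $$\tau\cdot f=f(U_n-\hbar,U_1,\dots,U_{n-1};\,\zeta T_n,T_1,\dots,T_{n-1}),$$ where $f^{(i,i+1)}$ is $f$ with $U_i,U_{i+1}$ exchanged and $T_i,T_{i+1}$ exchanged. (2) Let $E'\in\mathscr P$ be the average of the monomials $T^a$ over all $a\in(\mathbb Z/\ell)^n$ with $p\mid\sum_ia_i$. In this representation $eHe$ preserves $\Gamma E'$, and there is a ring isomorphism $\varphi$ from $eHe$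 onto a subring $U$ of $L\star T$ such that $a\cdot(fE')=\bigl(\varphi(a)(f)\bigr)E'$ for all $a\in eHe$ and $f\in\Gamma$. (3) $U$ is a principal Galois $\Gamma$-order in $\mathcal K$. That is: - $\Lambda$ is integrally closed, $S_n$ acts as a finite subgroup of $\operatorname{Aut}(\Lambda)$ that normalizes $T$ and meets $T$ trivially, and $\Lambda$ is a noetherian $\Gamma$-module; - $\Gamma\subseteq U\subseteq\mathcal K$ and $UK=\mathcal K=KU$; - for every finite-dimensional left (respectively right) $K$-subspace $V\subseteq\mathcal K$, the intersection $V\cap U$ is a finitely generated left (respectively right) $\Gamma$-module; - $X(\Gamma)\subseteq\Gamma$ for every $X\in U$. -/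

import Mathlib

/-! ### Principal Galois orders in invariants of skew monoid rings -/

namespace GaloisOrder

noncomputable section

variable {k Λ : Type} [Field k] [CommRing Λ] [IsDomain Λ] [Algebra k Λ]

/-- Automorphisms of a domain `Λ` act on its fraction field `L = Frac Λ`. -/
instance fracAction : MulSemiringAction (Λ ≃ₐ[k] Λ) (FractionRing Λ) :=
  IsFractionRing.mulSemiringAction (Λ ≃ₐ[k] Λ) Λ (FractionRing Λ)

/-- The standing assumptions on `(Λ, G, M)`: `Λ` is integrally closed, `G ⊆ Aut Λ` is finite,
`M M⁻¹ ∩ G = 1` (separation), `M` is stable under conjugation by `G` (invariance), and `Λ` is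
noetherian as a module over `Λ ^ G` (finiteness). -/
structure IsSetting (G : Subgroup (Λ ≃ₐ[k] Λ)) (M : Submonoid (Λ ≃ₐ[k] Λ)) : Prop where
  integrallyClosed : IsIntegrallyClosed Λ
  finite : Finite G
  separation : ∀ μ ∈ M, ∀ ν ∈ M, μ * ν⁻¹ ∈ G → μ * ν⁻¹ = 1
  invariance : ∀ g ∈ G, ∀ μ ∈ M, g * μ * g⁻¹ ∈ M
  noetherian : IsNoetherian (FixedPoints.subalgebra k Λ G) Λ

/-- The skew monoid ring `L ⋆ M`, with `(a μ) (b ν) = (a μ(b)) (μ ν)`. -/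
abbrev SkewRing (M : Submonoid (Λ ≃ₐ[k] Λ)) : Type := SkewMonoidAlgebra (FractionRing Λ) M

/-- `K = L ^ G`. -/
def fixedField (G : Subgroup (Λ ≃ₐ[k] Λ)) : Subring (FractionRing Λ) :=
  FixedPoints.subring (FractionRing Λ) G

/-- `Γ = Λ ^ G`, as a subring of `L`. -/
def invariantSubring (G : Subgroup (Λ ≃ₐ[k] Λ)) : Subring (FractionRing Λ) :=
  (FixedPoints.subring Λ G).map (algebraMap Λ (FractionRing Λ))

/-- `𝒦 = (L ⋆ M) ^ G`, where `g ∈ G` acts by `g (a μ) = g(a) (g μ g⁻¹)`. -/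
def invariants (G : Subgroup (Λ ≃ₐ[k] Λ)) (M : Submonoid (Λ ≃ₐ[k] Λ)) :
    AddSubgroup (SkewRing M) where
  carrier := {X | ∀ g : G, ∀ μ ν : M, (ν : Λ ≃ₐ[k] Λ) = g * μ * (g : Λ ≃ₐ[k] Λ)⁻¹ →
    X.coeff ν = g • X.coeff μ}
  zero_mem' := by intro g μ ν _; simp
  add_mem' := by
    intro X Y hX hY g μ ν h
    simp [hX g μ ν h, hY g μ ν h]
  neg_mem' := by
    intro X hX g μ ν h
    simp [hX g μ ν h]

variable {M : Submonoid (Λ ≃ₐ[k] Λ)}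

/-- Evaluation `X(f) = ∑ a_μ μ(f)` of `X = ∑ a_μ μ ∈ L ⋆ M` at `f ∈ L`. -/
def eval (X : SkewRing M) (f : FractionRing Λ) : FractionRing Λ :=
  X.sum fun μ a => a * μ • f

/-- The left `R`-submodule `R S` of `L ⋆ M` generated by `S`, for a subring `R ⊆ L`. -/
def leftSpan (R : Subring (FractionRing Λ)) (S : Set (SkewRing M)) : AddSubgroup (SkewRing M) :=
  AddSubgroup.closure {X | ∃ r ∈ R, ∃ s ∈ S, X = SkewMonoidAlgebra.single 1 r * s}

/-- The right `R`-submodule `S R` of `L ⋆ M` generated by `S`, for a subring `R ⊆ L`. -/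
def rightSpan (R : Subring (FractionRing Λ)) (S : Set (SkewRing M)) : AddSubgroup (SkewRing M) :=
  AddSubgroup.closure {X | ∃ r ∈ R, ∃ s ∈ S, X = s * SkewMonoidAlgebra.single 1 r}

/-- `U` is a Galois `Γ`-ring in `𝒦`: a subring of `𝒦` containing `Γ` with
`U K = 𝒦 = K U`. -/
structure IsGaloisRing (G : Subgroup (Λ ≃ₐ[k] Λ)) (M : Submonoid (Λ ≃ₐ[k] Λ))
    (U : Subring (SkewRing M)) : Prop where
  le_invariants : ∀ X ∈ U, X ∈ invariants G M
  invariantSubring_le : ∀ γ ∈ invariantSubring G, SkewMonoidAlgebra.single 1 γ ∈ U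
  rightSpan_eq : rightSpan (fixedField G) (U : Set (SkewRing M)) = invariants G M
  leftSpan_eq : leftSpan (fixedField G) (U : Set (SkewRing M)) = invariants G M

/-- `U` is a Galois `Γ`-order in `𝒦`: a Galois `Γ`-ring such that for every finite-dimensional
left (right) `K`-subspace `W = K S` (`W = S K`) of `𝒦`, with `S` finite, `W ∩ U` is a finitely
generated left (right) `Γ`-module. -/
structure IsGaloisOrder (G : Subgroup (Λ ≃ₐ[k] Λ)) (M : Submonoid (Λ ≃ₐ[k] Λ))
    (U : Subring (SkewRing M)) : Prop extends IsGaloisRing G M U where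
  left_fg : ∀ S : Set (SkewRing M), S.Finite → S ⊆ invariants G M →
    ∃ B : Set (SkewRing M), B.Finite ∧
      leftSpan (fixedField G) S ⊓ U.toAddSubgroup = leftSpan (invariantSubring G) B
  right_fg : ∀ S : Set (SkewRing M), S.Finite → S ⊆ invariants G M →
    ∃ B : Set (SkewRing M), B.Finite ∧
      rightSpan (fixedField G) S ⊓ U.toAddSubgroup = rightSpan (invariantSubring G) B

/-- `U` is a principal Galois `Γ`-order in `𝒦`: a Galois `Γ`-order that maps `Γ` into `Γ` under
evaluation. -/
structure IsPrincipalGaloisOrder (G : Subgroup (Λ ≃ₐ[k] Λ)) (M : Submonoid (Λ ≃ₐ[k] Λ))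
    (U : Subring (SkewRing M)) : Prop extends IsSetting G M, IsGaloisOrder G M U where
  principal : ∀ X ∈ U, ∀ γ ∈ invariantSubring G, eval X γ ∈ invariantSubring G

end

end GaloisOrder

/-! ### Rational Cherednik algebras -/

namespace Cherednik

noncomputable section

variable {n : ℕ}

/-- Generators of the rational Cherednik algebra of `W ⊆ GL_n(ℂ)`: the elements of `W`, the
standard basis `x_i` of `𝔥 = ℂⁿ` and the dual basis `y_i` of `𝔥*`. -/
inductive Gen (W : Subgroup (GL (Fin n) ℂ)) : Type
  | grp (g : W) : Gen W
  | x (i : Fin n) : Gen W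
  | y (i : Fin n) : Gen W

/-- A reflection: `g - 1` has rank one. -/
def IsReflection (g : GL (Fin n) ℂ) : Prop := ((g : Matrix (Fin n) (Fin n) ℂ) - 1).rank = 1

open Classical in
/-- The defining relations. Those named `grp_x` and `grp_y` say `g x g⁻¹ = g(x)` and
`g y g⁻¹ = g(y)`. In `x_y`, which is
`[x, y] = ħ ⟨y, x⟩ - ∑_s c_s ⟨α_s, x⟩ ⟨y, α_s^∨⟩ s`, one has
`⟨α_s, x⟩ ⟨y, α_s^∨⟩ = ⟨y - s y, x⟩` because `s y = y - ⟨y, α_s^∨⟩ α_s`, and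
`⟨s y_j, x_i⟩ = (s⁻¹)_{ji}`. -/
inductive Rel (W : Subgroup (GL (Fin n) ℂ)) [Fintype W] (ħ : ℂ) (c : W → ℂ) :
    FreeAlgebra ℂ (Gen W) → FreeAlgebra ℂ (Gen W) → Prop
  | grp_one : Rel W ħ c (FreeAlgebra.ι ℂ (Gen.grp 1)) 1
  | grp_mul (g h : W) : Rel W ħ c (FreeAlgebra.ι ℂ (Gen.grp g) * FreeAlgebra.ι ℂ (Gen.grp h))
      (FreeAlgebra.ι ℂ (Gen.grp (g * h)))
  | grp_x (g : W) (j : Fin n) : Rel W ħ c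
      (FreeAlgebra.ι ℂ (Gen.grp g) * FreeAlgebra.ι ℂ (Gen.x j))
      ((∑ i, ((g : GL (Fin n) ℂ) : Matrix (Fin n) (Fin n) ℂ) i j • FreeAlgebra.ι ℂ (Gen.x i)) *
        FreeAlgebra.ι ℂ (Gen.grp g))
  | grp_y (g : W) (j : Fin n) : Rel W ħ c
      (FreeAlgebra.ι ℂ (Gen.grp g) * FreeAlgebra.ι ℂ (Gen.y j))
      ((∑ i, (((g⁻¹ : W) : GL (Fin n) ℂ) : Matrix (Fin n) (Fin n) ℂ) j i •
        FreeAlgebra.ι ℂ (Gen.y i)) * FreeAlgebra.ι ℂ (Gen.grp g))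
  | x_x (i j : Fin n) : Rel W ħ c
      (FreeAlgebra.ι ℂ (Gen.x i) * FreeAlgebra.ι ℂ (Gen.x j))
      (FreeAlgebra.ι ℂ (Gen.x j) * FreeAlgebra.ι ℂ (Gen.x i))
  | y_y (i j : Fin n) : Rel W ħ c
      (FreeAlgebra.ι ℂ (Gen.y i) * FreeAlgebra.ι ℂ (Gen.y j))
      (FreeAlgebra.ι ℂ (Gen.y j) * FreeAlgebra.ι ℂ (Gen.y i))
  | x_y (i j : Fin n) : Rel W ħ c
      (FreeAlgebra.ι ℂ (Gen.x i) * FreeAlgebra.ι ℂ (Gen.y j) -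
        FreeAlgebra.ι ℂ (Gen.y j) * FreeAlgebra.ι ℂ (Gen.x i))
      (algebraMap ℂ _ (if i = j then ħ else 0) -
        ∑ s ∈ Finset.univ.filter (fun s : W => IsReflection (s : GL (Fin n) ℂ)),
          (c s * ((if i = j then 1 else 0) -
            (((s⁻¹ : W) : GL (Fin n) ℂ) : Matrix (Fin n) (Fin n) ℂ) j i)) •
            FreeAlgebra.ι ℂ (Gen.grp s))

/-- The rational Cherednik algebra of a finite group `W ⊆ GL_n(ℂ)` with parameters `ħ` and
`c_s` (only the values of `c` at reflections matter). -/
abbrev RCA (W : Subgroup (GL (Fin n) ℂ)) [Fintype W] (ħ : ℂ) (c : W → ℂ) : Type :=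
  RingQuot (Rel W ħ c)

variable (W : Subgroup (GL (Fin n) ℂ)) [Fintype W] (ħ : ℂ) (c : W → ℂ)

/-- The element of the rational Cherednik algebra given by a generator. -/
def RCA.gen (a : Gen W) : RCA W ħ c := RingQuot.mkAlgHom ℂ (Rel W ħ c) (FreeAlgebra.ι ℂ a)

/-- The idempotent `e = |W|⁻¹ ∑ g`. -/
def RCA.e : RCA W ħ c := (Fintype.card W : ℂ)⁻¹ • ∑ g : W, RCA.gen W ħ c (Gen.grp g)

theorem RCA.gen_grp_mul (g h : W) :
    RCA.gen W ħ c (Gen.grp g) * RCA.gen W ħ c (Gen.grp h) = RCA.gen W ħ c (Gen.grp (g * h)) := by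
  unfold RCA.gen
  rw [← map_mul]
  exact RingQuot.mkAlgHom_rel ℂ (Rel.grp_mul g h)

theorem RCA.isIdempotentElem_e : IsIdempotentElem (RCA.e W ħ c) := by
  have h : ∀ g : W, RCA.gen W ħ c (Gen.grp g) * ∑ h : W, RCA.gen W ħ c (Gen.grp h) =
      ∑ h : W, RCA.gen W ħ c (Gen.grp h) := by
    intro g
    rw [Finset.mul_sum]
    simp_rw [RCA.gen_grp_mul]
    exact Function.Bijective.sum_comp (Group.mulLeft_bijective g)
      (fun h => RCA.gen W ħ c (Gen.grp h))
  have hc : (Fintype.card W : ℂ) ≠ 0 := by exact_mod_cast Fintype.card_ne_zero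
  unfold IsIdempotentElem RCA.e
  rw [smul_mul_smul_comm, Finset.sum_mul, Finset.sum_congr rfl (fun g _ => h g),
    Finset.sum_const, Finset.card_univ, ← Nat.cast_smul_eq_nsmul ℂ, smul_smul]
  congr 1
  field_simp

/-- The spherical subalgebra `e H e`, with unit `e`. -/
abbrev Spherical : Type := (RCA.isIdempotentElem_e W ħ c).Corner

/-! ### The group `G(ℓ, p, n)` -/

/-- The monomial matrix with entry `a_{w(j)}` in position `(w(j), j)`: the product of
`diag(a)` and of the permutation matrix sending `e_j` to `e_{w(j)}`. -/
def monomialMatrix (a : Fin n → ℂ) (w : Equiv.Perm (Fin n)) : Matrix (Fin n) (Fin n) ℂ :=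
  Matrix.of fun i j => if i = w j then a i else 0

theorem monomialMatrix_mul (a b : Fin n → ℂ) (v w : Equiv.Perm (Fin n)) :
    monomialMatrix a v * monomialMatrix b w =
      monomialMatrix (fun i => a i * b (v.symm i)) (v * w) := by
  ext i j
  simp only [monomialMatrix, Matrix.mul_apply, Matrix.of_apply, Equiv.Perm.mul_apply]
  rw [Finset.sum_eq_single (w j)]
  · by_cases h : i = v (w j)
    · subst h; simp
    · simp [h]
  · intro k _ hk; simp [hk]
  · simp

theorem monomialMatrix_one : monomialMatrix (1 : Fin n → ℂ) 1 = 1 := by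
  ext i j
  by_cases h : i = j
  · subst h; simp [monomialMatrix]
  · simp [monomialMatrix, h]

/-- `G(ℓ, p, n)`: the `n × n` monomial matrices whose nonzero entries are `ℓ`-th roots of unity
with product an `(ℓ / p)`-th root of unity. -/
def complexReflectionGroup (ℓ p n : ℕ) : Subgroup (GL (Fin n) ℂ) where
  carrier := {g | ∃ (a : Fin n → ℂˣ) (w : Equiv.Perm (Fin n)), (∀ i, a i ^ ℓ = 1) ∧
    (∏ i, a i) ^ (ℓ / p) = 1 ∧
    (g : Matrix (Fin n) (Fin n) ℂ) = monomialMatrix (fun i => (a i : ℂ)) w}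
  one_mem' := ⟨1, 1, by simp, by simp, by
    rw [Units.val_one, ← monomialMatrix_one]; rfl⟩
  mul_mem' := by
    rintro g h ⟨a, v, ha, ha', hg⟩ ⟨b, w, hb, hb', hh⟩
    refine ⟨fun i => a i * b (v.symm i), v * w, fun i => ?_, ?_, ?_⟩
    · rw [mul_pow, ha, hb, one_mul]
    · rw [Finset.prod_mul_distrib, Equiv.prod_comp v.symm b, mul_pow, ha', hb', one_mul]
    · rw [Units.val_mul, hg, hh, monomialMatrix_mul]
      simp
  inv_mem' := by
    rintro g ⟨a, v, ha, ha', hg⟩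
    refine ⟨fun i => (a (v i))⁻¹, v⁻¹, fun i => ?_, ?_, ?_⟩
    · rw [inv_pow, ha, inv_one]
    · rw [Finset.prod_inv_distrib, Equiv.prod_comp v a, inv_pow, ha', inv_one]
    · rw [Matrix.coe_units_inv]
      refine Matrix.inv_eq_right_inv ?_
      rw [hg, monomialMatrix_mul, mul_inv_cancel, ← monomialMatrix_one]
      congr 1
      funext i
      simp

instance (ℓ p n : ℕ) [NeZero ℓ] : Finite (complexReflectionGroup ℓ p n) := by
  have key : ∀ g : complexReflectionGroup ℓ p n, ∃ b : (Fin n → rootsOfUnity ℓ ℂ) ×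
      Equiv.Perm (Fin n), ((g : GL (Fin n) ℂ) : Matrix (Fin n) (Fin n) ℂ) =
        monomialMatrix (fun i => ((b.1 i : ℂˣ) : ℂ)) b.2 := by
    rintro ⟨g, a, w, ha, -, hg⟩
    exact ⟨(fun i => ⟨a i, (mem_rootsOfUnity ℓ _).2 (ha i)⟩, w), hg⟩
  choose f hf using key
  refine Finite.of_injective f fun g h hgh => Subtype.ext (Units.ext ?_)
  rw [hf g, hf h, hgh]

instance (ℓ p n : ℕ) [NeZero ℓ] : Fintype (complexReflectionGroup ℓ p n) := Fintype.ofFinite _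

/-- The permutation matrix `e_j ↦ e_{w(j)}` as an element of `G(ℓ, p, n)`. -/
def permElt (ℓ p : ℕ) (w : Equiv.Perm (Fin n)) : complexReflectionGroup ℓ p n :=
  ⟨⟨monomialMatrix 1 w, monomialMatrix 1 w⁻¹,
    by rw [monomialMatrix_mul, mul_inv_cancel, ← monomialMatrix_one]; congr 1; funext i; simp,
    by rw [monomialMatrix_mul, inv_mul_cancel, ← monomialMatrix_one]; congr 1; funext i; simp⟩,
    1, w, by simp, by simp, rfl⟩

open Classical in
/-- The parameter function on reflections of `G(ℓ, p, n)`: the value is `c_m` at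
`t_i ^ m = diag(1, …, ζ ^ m, …, 1)` and `κ` at every reflection `t_i ^ m t_j ^ (-m) (i, j)`. -/
def parameter (ℓ p n : ℕ) (ζ κ : ℂ) (c : ℕ → ℂ) (g : complexReflectionGroup ℓ p n) : ℂ :=
  if ((g : GL (Fin n) ℂ) : Matrix (Fin n) (Fin n) ℂ).IsDiag then
    ∑ i : Fin n, ∑ m ∈ Finset.Ico 1 ℓ,
      if ((g : GL (Fin n) ℂ) : Matrix (Fin n) (Fin n) ℂ) =
        Matrix.diagonal (Function.update 1 i (ζ ^ m)) then c m else 0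
  else κ

/-- The rational Cherednik algebra of `G(ℓ, p, n)`. -/
abbrev H (ℓ p n : ℕ) [NeZero ℓ] (ζ ħ κ : ℂ) (c : ℕ → ℂ) : Type :=
  RCA (complexReflectionGroup ℓ p n) ħ (parameter ℓ p n ζ κ c)

/-- The spherical subalgebra of the rational Cherednik algebra of `G(ℓ, p, n)`. -/
abbrev SphericalH (ℓ p n : ℕ) [NeZero ℓ] (ζ ħ κ : ℂ) (c : ℕ → ℂ) : Type :=
  Spherical (complexReflectionGroup ℓ p n) ħ (parameter ℓ p n ζ κ c)

/-! ### The polynomial representation -/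

/-- `ℂ[U_1, …, U_n]`. -/
abbrev PolyU (n : ℕ) : Type := MvPolynomial (Fin n) ℂ

/-- `ℂ[U_1, …, U_n; T_1, …, T_n] / (T_i ^ ℓ - 1)`: the group algebra over `ℂ[U_1, …, U_n]` of
`(ℤ/ℓ)ⁿ`, whose basis element at `a` is `T ^ a = ∏ T_i ^ {a_i}`. -/
abbrev PolyUT (ℓ n : ℕ) : Type := AddMonoidAlgebra (PolyU n) (Fin n → ZMod ℓ)

/-- The substitution `U_i ↦ U_{w(i)} + v_i`, `T_i ↦ z_i T_{w(i)}` (for `z_i ^ ℓ = 1`). -/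
def substitute {ℓ : ℕ} (w : Equiv.Perm (Fin n)) (v z : Fin n → ℂ) (f : PolyUT ℓ n) :
    PolyUT ℓ n :=
  f.coeff.sum fun a q => AddMonoidAlgebra.single (a ∘ w.symm)
    ((∏ i, z i ^ (a i).val) •
      MvPolynomial.aeval (fun i => MvPolynomial.X (w i) + MvPolynomial.C (v i)) q)

/-- `∑_{0 < m < ℓ} c_m (z T_i) ^ m`. -/
def paramPoly {ℓ : ℕ} (c : ℕ → ℂ) (z : ℂ) (i : Fin n) : PolyUT ℓ n :=
  ∑ m ∈ Finset.Ico 1 ℓ,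
    AddMonoidAlgebra.single (Pi.single i (m : ZMod ℓ)) (MvPolynomial.C (c m * z ^ m))

/-- `∑_{0 ≤ m < ℓ} T_i ^ m T_j ^ (-m)`. -/
def pairSum {ℓ : ℕ} (i j : Fin n) : PolyUT ℓ n :=
  ∑ m ∈ Finset.range ℓ,
    AddMonoidAlgebra.single (Pi.single i (m : ZMod ℓ) - Pi.single j (m : ZMod ℓ)) 1

open Classical in
/-- The idempotent `E' = |A|⁻¹ ∑_{a ∈ A} T ^ a`, where `A ⊆ G(ℓ, p, n)` is the group of
diagonal matrices `diag(ζ ^ {a_i})` in it, that is, those with `p ∣ ∑ a_i`. -/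
def diagIdempotent (ℓ p n : ℕ) [NeZero ℓ] : PolyUT ℓ n :=
  ((Finset.univ.filter fun a : Fin n → ZMod ℓ => (p : ZMod ℓ) ∣ ∑ i, a i).card : ℂ)⁻¹ •
    ∑ a ∈ Finset.univ.filter fun a : Fin n → ZMod ℓ => (p : ZMod ℓ) ∣ ∑ i, a i,
      AddMonoidAlgebra.single a 1

/-- The last index in `Fin n`, for `n ≠ 0`. -/
def lastIdx (n : ℕ) [NeZero n] : Fin n := ⟨n - 1, Nat.sub_lt (NeZero.pos n) one_pos⟩

/-- `ρ` is the polynomial representation on `ℂ[U; T] / (T_i ^ ℓ - 1)`. With `k = -κ` and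
`p(u) = -∑_{0 < m < ℓ} c_m u ^ m`, and with `σ = x_1 (1, …, n)` and `τ = y_n (n, …, 1)` for the
cycle `(1, …, n) : 1 ↦ 2 ↦ ⋯ ↦ n ↦ 1`, it is given by
* `t · f = T ^ a f` for `t = diag(ζ ^ {a_i})`,
* `(i, i+1) · f = f^{(i,i+1)} + k (f^{(i,i+1)} - f) / (U_{i+1} - U_i) ∑_m T_i ^ m T_{i+1} ^ (-m)`
  (multiplied here by the non-zero-divisor `U_{i+1} - U_i`),
* `σ · f = (U_1 - p(ζ⁻¹ T_1) + ħ) f(U_2, …, U_n, U_1 + ħ; T_2, …, T_n, ζ⁻¹ T_1)`,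
* `τ · f = f(U_n - ħ, U_1, …, U_{n-1}; ζ T_n, T_1, …, T_{n-1})`.
(`σ`, `τ` and `G(ℓ, p, n)` generate the algebra, so there is at most one such `ρ`.) -/
structure IsPolynomialRepresentation (ℓ p n : ℕ) [NeZero ℓ] [NeZero n] (ζ ħ κ : ℂ) (c : ℕ → ℂ)
    (ρ : H ℓ p n ζ ħ κ c →ₐ[ℂ] Module.End ℂ (PolyUT ℓ n)) : Prop where
  diag : ∀ (g : complexReflectionGroup ℓ p n) (a : Fin n → ZMod ℓ),
    ((g : GL (Fin n) ℂ) : Matrix (Fin n) (Fin n) ℂ) =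
      Matrix.diagonal (fun i => ζ ^ (a i).val) →
    ∀ f, ρ (RCA.gen _ _ _ (Gen.grp g)) f = AddMonoidAlgebra.single a 1 * f
  transposition : ∀ i j : Fin n, (i : ℕ) + 1 = j → ∀ f,
    (MvPolynomial.X j - MvPolynomial.X i : PolyU n) •
      ρ (RCA.gen _ _ _ (Gen.grp (permElt ℓ p (Equiv.swap i j)))) f =
    (MvPolynomial.X j - MvPolynomial.X i : PolyU n) • substitute (Equiv.swap i j) 0 1 f +
      (-κ) • (substitute (Equiv.swap i j) 0 1 f - f) * pairSum i j
  sigma : ∀ f,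
    ρ (RCA.gen _ _ _ (Gen.x 0) * RCA.gen _ _ _ (Gen.grp (permElt ℓ p (finRotate n)))) f =
      (AddMonoidAlgebra.single 0 (MvPolynomial.X 0 + MvPolynomial.C ħ) -
        paramPoly (fun m => -c m) ζ⁻¹ 0) *
      substitute (finRotate n) (Pi.single (lastIdx n) ħ)
        (Function.update 1 (lastIdx n) ζ⁻¹) f
  tau : ∀ f,
    ρ (RCA.gen _ _ _ (Gen.y (lastIdx n)) *
        RCA.gen _ _ _ (Gen.grp (permElt ℓ p (finRotate n)⁻¹))) f =
      substitute (finRotate n)⁻¹ (Pi.single 0 (-ħ)) (Function.update 1 0 ζ) f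

/-! ### The translation lattice and the symmetric group -/

/-- The automorphism `U_j ↦ U_j + v_j` of `ℂ[U_1, …, U_n]`. -/
def translation (v : Fin n → ℂ) : PolyU n ≃ₐ[ℂ] PolyU n :=
  AlgEquiv.ofAlgHom
    (MvPolynomial.aeval fun j => MvPolynomial.X j + MvPolynomial.C (v j))
    (MvPolynomial.aeval fun j => MvPolynomial.X j - MvPolynomial.C (v j))
    (by ext j; simp) (by ext j; simp)

/-- `μ_i : U_j ↦ U_j + ħ δ_{ij}`. -/
def mu (ħ : ℂ) (i : Fin n) : PolyU n ≃ₐ[ℂ] PolyU n := translation (Pi.single i ħ)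

/-- `T = ⟨μ_1 ^ {±ℓ}, …, μ_n ^ {±ℓ}, (μ_1 ⋯ μ_n) ^ {±ℓ/p}⟩`. -/
def lattice (ℓ p n : ℕ) (ħ : ℂ) : Subgroup (PolyU n ≃ₐ[ℂ] PolyU n) :=
  Subgroup.closure (Set.range (fun i : Fin n => mu ħ i ^ ℓ) ∪
    {(List.ofFn fun i : Fin n => mu ħ i).prod ^ (ℓ / p)})

/-- `S_n`, acting on `ℂ[U_1, …, U_n]` by permutations of the variables. -/
def symmetricGroup (n : ℕ) : Subgroup (PolyU n ≃ₐ[ℂ] PolyU n) where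
  carrier := Set.range fun w : Equiv.Perm (Fin n) => MvPolynomial.renameEquiv ℂ w
  one_mem' := ⟨1, by ext; simp⟩
  mul_mem' := by
    rintro _ _ ⟨v, rfl⟩ ⟨w, rfl⟩
    exact ⟨v * w, by ext; simp [AlgEquiv.mul_apply]⟩
  inv_mem' := by
    rintro _ ⟨w, rfl⟩
    exact ⟨w⁻¹, rfl⟩

end

end Cherednik

/-! Fix the additive character `e` of ℤ/ℓ with `e 1 = ζ`. For a triple q = (w, d, χ), substituting
U_i ↦ U_{w(i)} + ħ d_i and T_i ↦ e(-χ_i) sends a vector of the polynomial module to ℂ[U]; this is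
`ev q`, and `row q` when read in the fraction field. These functionals separate vectors by linear
independence of characters (`ev_ext`), so an operator is known from its rows (`end_ext`). For the
deformed transpositions, σ and τ, each row is a short combination of rows with rational coefficients
(`row_defSwap`, `row_sigmaOp`, `row_tauOp`), so the relations of H become identities of rational
functions.

The action of S_n exists by its Coxeter presentation; the braid relation is the classical
Yang-Baxter equation `rcoef_yangBaxter`. The x_j and y_j are the conjugates of σ c⁻¹ and τ c, with c
the long cycle. Their relations follow formally from few relations of σ and τ with permutations
(`IsCyclicPair`, `x_mul_y_self`, `x_mul_y_of_ne`), and the commutators match the sum over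
reflections once rank-one monomial matrices are classified (`rank_monomial_sub_one`).

The idempotent E' takes the value 1 at the good χ, the constant vectors with entry in (ℓ/p)ℤ/ℓ, and
0 at all others (`ev_diagIdempotent`). A vector in the image of e is supported on the good χ and
symmetric in U; since the twists T_i ↦ e(-(ℓ/p)t) T_i commute with H, applying eHe to f E' gives a
vector with the same value at every good χ, hence an element of Γ E' (`exists_isSymmetric`). On
symmetric f a row reduces to a translation of f with a coefficient, so each element of eHe acts on Γ
E' through an element of L ⋆ T, unique because U_1⋯U_n separates translations.

Injectivity and size come from leading terms for the degree of rational functions: x_j has leading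
term U_j μ_j and y_j has leading term μ_j⁻¹. As H is spanned by products of monomials in x,
monomials in y and group elements, eHe is z e with z a combination of monomials x^s y^t such that s
- t is good. Such a monomial has leading term U^s μ^{s-t}, which determines (s, t), so no nonzero z
acts by zero (`eq_zero_of_represents_zero`). Averaging x^s y^t over W makes every translation of T
occur (`exists_mem_range_coeff_ne_zero`).

The order property follows from a general criterion, `GaloisOrder.isPrincipalGaloisOrder`: U
contains Γ, preserves Γ and involves every element of T, and some γ in Γ separates T. The values
X(γ^t) = ∑ a_μ μ(γ)^t determine the a_μ with bounded denominators, so noetherianity of Λ over Γ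
gives finite generation; Lagrange interpolation at the nodes μ(γ) isolates single S_n-orbits in T
and gives UK = 𝒦 = KU. Finally Γ ⊆ U because U_1 is στ up to diagonal operators, and the other U_i
follow by the degenerate affine Hecke relation. -/

/-! ### The Coxeter presentation of the symmetric group -/

namespace SymmetricPresentation

open Equiv Equiv.Perm

/-- The Coxeter relations of type `A_m`, for a family of elements of a monoid. -/
structure IsBraidFamily {M : Type*} [Monoid M] {m : ℕ} (t : Fin m → M) : Prop where
  sq : ∀ i, t i * t i = 1
  comm : ∀ i j : Fin m, (i : ℕ) + 1 < j → t i * t j = t j * t i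
  braid : ∀ i j : Fin m, (i : ℕ) + 1 = j → t i * t j * t i = t j * t i * t j

/-- `e` as a permutation of `Fin (m + 1)` fixing `0`. -/
def fixZero {m : ℕ} (e : Perm (Fin m)) : Perm (Fin (m + 1)) := decomposeFin.symm (0, e)

@[simp] theorem fixZero_zero {m : ℕ} (e : Perm (Fin m)) : fixZero e 0 = 0 := by
  simp [fixZero]

@[simp] theorem fixZero_succ {m : ℕ} (e : Perm (Fin m)) (i : Fin m) :
    fixZero e i.succ = (e i).succ := by
  simp [fixZero]

theorem fixZero_mul {m : ℕ} (e e' : Perm (Fin m)) : fixZero (e * e') = fixZero e * fixZero e' := by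
  ext i
  refine Fin.cases ?_ (fun i => ?_) i <;> simp

theorem fixZero_one {m : ℕ} : fixZero (1 : Perm (Fin m)) = 1 := by
  ext i
  refine Fin.cases ?_ (fun i => ?_) i <;> simp

theorem fixZero_swap {m : ℕ} (a b : Fin m) : fixZero (swap a b) = swap a.succ b.succ := by
  ext i
  refine Fin.cases ?_ (fun i => ?_) i
  · simp [swap_apply_of_ne_of_ne (Fin.succ_ne_zero a).symm (Fin.succ_ne_zero b).symm]
  · rw [fixZero_succ, Function.Injective.map_swap (Fin.succ_injective m)]

theorem fixZero_injective {m : ℕ} : Function.Injective (fixZero (m := m)) := by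
  intro a b h
  simpa [fixZero] using h

theorem exists_fixZero {m : ℕ} (w : Perm (Fin (m + 1))) (hw : w 0 = 0) :
    ∃ e : Perm (Fin m), fixZero e = w := by
  obtain ⟨⟨p, e⟩, rfl⟩ := decomposeFin.symm.surjective w
  simp only [decomposeFin_symm_apply_zero] at hw
  exact ⟨e, by rw [hw]; rfl⟩

variable {M : Type*} [Monoid M]

/-- `t_{p-1} ⋯ t_0`. -/
def descend {m : ℕ} (t : Fin m → M) : Fin (m + 1) → M :=
  Fin.induction 1 fun i c => t i * c

@[simp] theorem descend_zero {m : ℕ} (t : Fin m → M) : descend t 0 = 1 := rfl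

@[simp] theorem descend_succ {m : ℕ} (t : Fin m → M) (i : Fin m) :
    descend t i.succ = t i * descend t i.castSucc := by
  simp [descend]

theorem mul_descend_of_lt {m : ℕ} {t : Fin m → M} (ht : IsBraidFamily t) (i : Fin m)
    (p : Fin (m + 1)) (h : p < i.castSucc) : t i * descend t p = descend t p * t i := by
  induction p using Fin.induction with
  | zero => simp
  | succ p ih =>
    have h' : (p : ℕ) + 1 < i := by simpa [Fin.lt_def] using h
    rw [descend_succ, ← mul_assoc, ← ht.comm p i h', mul_assoc, ih (by rw [Fin.lt_def, Fin.val_castSucc, Fin.val_castSucc]; omega),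
      mul_assoc]

/-- The factor `t i` commutes with everything down to `t j`; a braid move there turns it into `t j`,
which commutes with all remaining factors. -/
theorem mul_descend_of_gt {m : ℕ} {t : Fin m → M} (ht : IsBraidFamily t) (i j : Fin m)
    (hij : (i : ℕ) + 1 = j) (p : Fin (m + 1)) (h : j.castSucc < p) :
    t i * descend t p = descend t p * t j := by
  induction p using Fin.induction with
  | zero => simp at h
  | succ p ih =>
    have h' : (j : ℕ) ≤ p := by simpa [Fin.lt_def, Nat.lt_succ_iff] using h
    rcases h'.eq_or_lt with h' | h'
    · have hp : j = p := Fin.ext h'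
      subst hp
      have e : j.castSucc = i.succ := Fin.ext (by simp [hij])
      rw [descend_succ, e, descend_succ]
      have hc := mul_descend_of_lt ht j i.castSucc
        (by rw [Fin.lt_def, Fin.val_castSucc, Fin.val_castSucc]; omega)
      calc t i * (t j * (t i * descend t i.castSucc))
          = (t i * t j * t i) * descend t i.castSucc := by simp only [mul_assoc]
        _ = t j * t i * (t j * descend t i.castSucc) := by rw [ht.braid i j hij]; simp only [mul_assoc]
        _ = _ := by rw [hc]; simp only [mul_assoc]
    · rw [descend_succ, ← mul_assoc, ht.comm i p (by omega), mul_assoc,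
        ih (by rwa [Fin.lt_def, Fin.val_castSucc, Fin.val_castSucc]), mul_assoc]

/-- Inverting gives for `(Fin.cycleRange p)⁻¹` the recursion that defines `descend`, so `descend t
p` is the intended image of this coset representative. -/
theorem cycleRange_succ_mul_swap {m : ℕ} (i : Fin m) :
    (Fin.cycleRange i.succ) * swap i.castSucc i.succ = Fin.cycleRange i.castSucc := by
  ext x
  rw [Perm.mul_apply]
  rcases lt_trichotomy x i.castSucc with h | h | h
  · rw [swap_apply_of_ne_of_ne h.ne (h.trans (Fin.castSucc_lt_succ)).ne,
      Fin.coe_cycleRange_of_lt h, Fin.coe_cycleRange_of_lt (h.trans (Fin.castSucc_lt_succ))]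
  · subst h; simp
  · rw [Fin.cycleRange_of_gt h]
    rcases eq_or_ne x i.succ with h' | h'
    · subst h'
      rw [swap_apply_right, Fin.coe_cycleRange_of_lt (Fin.castSucc_lt_succ)]
      simp
    · rw [swap_apply_of_ne_of_ne h.ne' h', Fin.cycleRange_of_gt]
      simp only [Fin.lt_def, Fin.val_castSucc, Fin.val_succ, ne_eq, Fin.ext_iff] at *
      omega

/-- Coset decomposition with respect to the stabilizer of `0`: the coset of `w` is determined by `w
0`, and `Fin.cycleRange (w 0)` moves `w 0` back to `0`. -/
theorem exists_factor {m : ℕ} (w : Perm (Fin (m + 1))) :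
    ∃ e : Perm (Fin m), w = (Fin.cycleRange (w 0))⁻¹ * fixZero e := by
  obtain ⟨e, he⟩ := exists_fixZero (Fin.cycleRange (w 0) * w) (by simp)
  exact ⟨e, by rw [he, inv_mul_cancel_left]⟩

/-- The value at `w` of the extension of `t` to the symmetric group, given the extension `f` of
`t ∘ succ` to the stabilizer of `0`. -/
noncomputable def extend {m : ℕ} (t : Fin (m + 1) → M) (f : Perm (Fin (m + 1)) →* M)
    (w : Perm (Fin (m + 2))) : M :=
  descend t (w 0) * f (exists_factor w).choose

theorem extend_eq {m : ℕ} (t : Fin (m + 1) → M) (f : Perm (Fin (m + 1)) →* M) (p : Fin (m + 2))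
    (e : Perm (Fin (m + 1))) :
    extend t f ((Fin.cycleRange p)⁻¹ * fixZero e) = descend t p * f e := by
  set w := (Fin.cycleRange p)⁻¹ * fixZero e with hw
  have h0 : w 0 = p := by simp [hw, Perm.inv_def]
  have h : (exists_factor w).choose = e := by
    have h := (exists_factor w).choose_spec
    generalize (exists_factor w).choose = e' at h
    rw [h0] at h
    exact (fixZero_injective (mul_left_cancel (hw.symm.trans h))).symm
  unfold extend
  rw [h, h0]

/-- An adjacent transposition either exchanges two neighbouring coset representatives (`p = i` or `p
= i + 1`) or passes through the representative and becomes an adjacent transposition of the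
stabilizer. The images satisfy the same rule by the Coxeter relations. -/
theorem extend_swap_mul {m : ℕ} {t : Fin (m + 1) → M} (ht : IsBraidFamily t)
    (f : Perm (Fin (m + 1)) →* M) (hf : ∀ i : Fin m, f (swap i.castSucc i.succ) = t i.succ)
    (i : Fin (m + 1)) (w : Perm (Fin (m + 2))) :
    extend t f (swap i.castSucc i.succ * w) = t i * extend t f w := by
  obtain ⟨e, he⟩ := exists_factor w
  generalize w 0 = p at he
  subst he
  rw [extend_eq]
  have key := cycleRange_succ_mul_swap i
  have conj (i' : Fin m) (h : Fin.cycleRange p * swap i.castSucc i.succ * (Fin.cycleRange p)⁻¹ =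
      swap i'.castSucc.succ i'.succ.succ) (ht' : t i * descend t p = descend t p * t i'.succ) :
      extend t f (swap i.castSucc i.succ * ((Fin.cycleRange p)⁻¹ * fixZero e)) =
        t i * (descend t p * f e) := by
    have : swap i.castSucc i.succ * ((Fin.cycleRange p)⁻¹ * fixZero e) =
        (Fin.cycleRange p)⁻¹ * fixZero (swap i'.castSucc i'.succ * e) := by
      rw [fixZero_mul, fixZero_swap, ← h]
      group
    rw [this, extend_eq, map_mul, hf, ← mul_assoc, ← ht', mul_assoc]
  rcases lt_trichotomy p i.castSucc with h | h | h
  · obtain ⟨i', rfl⟩ : ∃ i' : Fin m, i'.succ = i :=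
      ⟨i.pred (by rintro rfl; simp at h), by simp⟩
    refine conj i' ?_ (mul_descend_of_lt ht _ p h)
    rw [mul_swap_eq_swap_mul, mul_inv_cancel_right, Fin.cycleRange_of_gt h,
      Fin.cycleRange_of_gt (h.trans Fin.castSucc_lt_succ)]
    rfl
  · subst h
    rw [← mul_assoc, ← key]
    have : swap i.castSucc i.succ * ((Fin.cycleRange i.succ) * swap i.castSucc i.succ)⁻¹ =
        (Fin.cycleRange i.succ)⁻¹ := by
      rw [mul_inv_rev, swap_inv, ← mul_assoc, swap_mul_self, one_mul]
    rw [this, extend_eq, descend_succ, mul_assoc]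
  · rcases eq_or_ne p i.succ with h' | h'
    · subst h'
      have : swap i.castSucc i.succ * ((Fin.cycleRange i.succ)⁻¹ * fixZero e) =
          (Fin.cycleRange i.castSucc)⁻¹ * fixZero e := by
        rw [← key, mul_inv_rev, swap_inv, mul_assoc]
      rw [this, extend_eq, descend_succ, ← mul_assoc, ← mul_assoc, ht.sq, one_mul]
    · have hlt : i.succ < p := by
        simp only [Fin.lt_def, Fin.val_castSucc, Fin.val_succ, ne_eq, Fin.ext_iff] at *
        omega
      have hi : (i : ℕ) < m := by
        have := p.2
        simp only [Fin.lt_def, Fin.val_succ] at hlt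
        omega
      have hi' : i = (⟨i, hi⟩ : Fin m).castSucc := rfl
      refine conj ⟨i, hi⟩ ?_ (mul_descend_of_gt ht _ _ (by simp) p
        (by simpa [Fin.lt_def] using hlt))
      rw [mul_swap_eq_swap_mul, mul_inv_cancel_right]
      congr 1
      · ext; rw [Fin.coe_cycleRange_of_lt h]; simp
      · ext; rw [Fin.coe_cycleRange_of_lt hlt]; simp

/-- The symmetric group is presented by the Coxeter relations of the adjacent transpositions. -/
theorem IsBraidFamily.exists_hom {m : ℕ} {t : Fin m → M} (ht : IsBraidFamily t) :
    ∃ f : Perm (Fin (m + 1)) →* M, ∀ i : Fin m, f (swap i.castSucc i.succ) = t i := by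
  induction m with
  | zero => exact ⟨1, fun i => i.elim0⟩
  | succ m ih =>
    obtain ⟨f, hf⟩ := ih (t := fun i => t i.succ)
      ⟨fun i => ht.sq _, fun i j h => ht.comm _ _ (by simpa using h),
        fun i j h => ht.braid _ _ (by simpa using h)⟩
    have h1 : extend t f 1 = 1 := by
      have := extend_eq t f 0 1
      rwa [fixZero_one, mul_one, Fin.cycleRange_zero, inv_one, map_one, mul_one,
        descend_zero] at this
    -- Left multiplication by a generator is already understood, so writing `v` as a word in
    -- generators gives multiplicativity.
    have hmul (v w) : extend t f (v * w) = extend t f v * extend t f w := by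
      have hv : v ∈ Submonoid.closure
          (Set.range fun i : Fin (m + 1) => swap i.castSucc i.succ) := by
        rw [mclosure_swap_castSucc_succ]; trivial
      induction hv using Submonoid.closure_induction_left with
      | one => rw [h1, one_mul, one_mul]
      | mul_left x hx y _ ih =>
        obtain ⟨i, rfl⟩ := hx
        simp only at *
        rw [mul_assoc, extend_swap_mul ht f hf, ih, extend_swap_mul ht f hf, mul_assoc]
    refine ⟨⟨⟨extend t f, h1⟩, hmul⟩, fun i => ?_⟩
    have := extend_swap_mul ht f hf i 1
    rwa [mul_one, h1, mul_one] at this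

end SymmetricPresentation


/-! ### Substitutions and evaluations on the polynomial module -/

namespace Cherednik

noncomputable section

open Equiv Equiv.Perm SymmetricPresentation

/-- The substitutions `U_i ↦ U_{w(i)} + ħ d_i`, `T_i ↦ e(-χ_i) T_{w(i)}`, for a fixed parameter `ħ`
and a fixed additive character `e` of `ℤ/ℓ`. -/
@[ext] structure Subst (ℓ n : ℕ) : Type where
  w : Perm (Fin n)
  d : Fin n → ℤ
  χ : Fin n → ZMod ℓ

namespace Subst

variable {ℓ n : ℕ}

instance : One (Subst ℓ n) := ⟨⟨1, 0, 0⟩⟩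
-- The order is the one for which `act` is multiplicative: U_i goes to U_{r(i)} + ħ d_i under `r`,
-- and then `q` adds its own shift at index r(i).
instance : Mul (Subst ℓ n) := ⟨fun q r => ⟨q.w * r.w, q.d ∘ r.w + r.d, q.χ ∘ r.w + r.χ⟩⟩

@[simp] theorem one_w : (1 : Subst ℓ n).w = 1 := rfl
@[simp] theorem one_d : (1 : Subst ℓ n).d = 0 := rfl
@[simp] theorem one_χ : (1 : Subst ℓ n).χ = 0 := rfl
@[simp] theorem mul_w (q r : Subst ℓ n) : (q * r).w = q.w * r.w := rfl
@[simp] theorem mul_d (q r : Subst ℓ n) : (q * r).d = q.d ∘ r.w + r.d := rfl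
@[simp] theorem mul_χ (q r : Subst ℓ n) : (q * r).χ = q.χ ∘ r.w + r.χ := rfl

instance : Monoid (Subst ℓ n) where
  mul_assoc q r s := by ext i <;> simp [add_assoc]
  one_mul q := by ext i <;> simp
  mul_one q := by ext i <;> simp

/-- The substitution permuting the variables. -/
def perm (v : Perm (Fin n)) : Subst ℓ n := ⟨v, 0, 0⟩

@[simp] theorem perm_w (v : Perm (Fin n)) : (perm v : Subst ℓ n).w = v := rfl
@[simp] theorem perm_d (v : Perm (Fin n)) : (perm v : Subst ℓ n).d = 0 := rfl
@[simp] theorem perm_χ (v : Perm (Fin n)) : (perm v : Subst ℓ n).χ = 0 := rfl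

theorem perm_mul (v w : Perm (Fin n)) : (perm (v * w) : Subst ℓ n) = perm v * perm w := by
  ext i <;> simp

theorem perm_one : (perm 1 : Subst ℓ n) = 1 := rfl

variable (ħ : ℂ) (e : AddChar (ZMod ℓ) ℂ)

/-- The images of the `U_i`. -/
def val (q : Subst ℓ n) (i : Fin n) : PolyU n := MvPolynomial.X (q.w i) + MvPolynomial.C (ħ * q.d i)

/-- The action on `ℂ[U]`. -/
def onU (q : Subst ℓ n) : PolyU n →ₐ[ℂ] PolyU n := MvPolynomial.aeval (q.val ħ)

@[simp] theorem onU_X (q : Subst ℓ n) (i : Fin n) : q.onU ħ (MvPolynomial.X i) = q.val ħ i := by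
  simp [onU]

@[simp] theorem onU_C (q : Subst ℓ n) (z : ℂ) : q.onU ħ (MvPolynomial.C z) = MvPolynomial.C z :=
  MvPolynomial.algHom_C _ _

theorem onU_onU (q r : Subst ℓ n) (p : PolyU n) : q.onU ħ (r.onU ħ p) = (q * r).onU ħ p := by
  have : (q.onU ħ).comp (r.onU ħ) = (q * r).onU ħ := by
    ext i
    simp only [AlgHom.comp_apply, onU_X, val, map_add, onU_C, mul_w, Perm.mul_apply, mul_d,
      Pi.add_apply, Function.comp_apply]
    push_cast
    rw [mul_add, MvPolynomial.C_add, add_assoc]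
  rw [← this]; rfl

@[simp] theorem onU_one (p : PolyU n) : (1 : Subst ℓ n).onU ħ p = p := by
  have : (1 : Subst ℓ n).onU ħ = AlgHom.id ℂ (PolyU n) := by
    ext i
    simp [val]
  rw [this]; rfl

theorem onU_perm (v : Perm (Fin n)) (p : PolyU n) :
    (perm v : Subst ℓ n).onU ħ p = MvPolynomial.rename v p := by
  have : (perm v : Subst ℓ n).onU ħ = MvPolynomial.rename v := by
    ext i
    simp [val]
  rw [this]

/-- The scalar factor `∏ e(-χ_i)^{a_i}`. -/
def scal (q : Subst ℓ n) (a : Fin n → ZMod ℓ) : ℂ := e (-∑ i, q.χ i * a i)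

theorem scal_add (q : Subst ℓ n) (a b : Fin n → ZMod ℓ) :
    q.scal e (a + b) = q.scal e a * q.scal e b := by
  simp only [scal, Pi.add_apply, mul_add, Finset.sum_add_distrib, neg_add, AddChar.map_add_eq_mul]

@[simp] theorem scal_zero (q : Subst ℓ n) : q.scal e 0 = 1 := by simp [scal]

theorem scal_mul (q r : Subst ℓ n) (a : Fin n → ZMod ℓ) :
    (q * r).scal e a = q.scal e (a ∘ r.w.symm) * r.scal e a := by
  simp only [scal, mul_χ, Pi.add_apply, Function.comp_apply, add_mul, Finset.sum_add_distrib,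
    neg_add, AddChar.map_add_eq_mul]
  congr 3
  exact Fintype.sum_equiv r.w _ _ (by simp)

@[simp] theorem scal_perm (v : Perm (Fin n)) (a : Fin n → ZMod ℓ) :
    (perm v : Subst ℓ n).scal e a = 1 := by simp [scal]

/-- The substitution, as an algebra endomorphism. -/
def act (q : Subst ℓ n) : PolyUT ℓ n →ₐ[ℂ] PolyUT ℓ n :=
  { AddMonoidAlgebra.liftNCRingHom
      ((AddMonoidAlgebra.singleZeroRingHom : PolyU n →+* PolyUT ℓ n).comp (q.onU ħ).toRingHom)
      { toFun := fun a => AddMonoidAlgebra.single (a.toAdd ∘ q.w.symm)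
          (MvPolynomial.C (q.scal e a.toAdd))
        map_one' := by
          simp only [toAdd_one, scal_zero, map_one]
          rfl
        map_mul' := fun a b => by
          rw [AddMonoidAlgebra.single_mul_single, toAdd_mul, scal_add, MvPolynomial.C_mul]
          rfl }
      (fun _ _ => Commute.all _ _) with
    commutes' := fun z => by
      have : algebraMap ℂ (PolyUT ℓ n) z =
          AddMonoidAlgebra.single 0 (MvPolynomial.C z) := rfl
      rw [this]
      simp only [AlgHom.toRingHom_eq_coe, RingHom.toMonoidHom_eq_coe, OneHom.toFun_eq_coe,
        MonoidHom.toOneHom_coe, MonoidHom.coe_coe, AddMonoidAlgebra.liftNCRingHom_single]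
      simp [AddMonoidAlgebra.singleZeroRingHom, AddMonoidAlgebra.single_mul_single] }

theorem act_single (q : Subst ℓ n) (a : Fin n → ZMod ℓ) (p : PolyU n) :
    q.act ħ e (AddMonoidAlgebra.single a p) =
      AddMonoidAlgebra.single (a ∘ q.w.symm) (q.scal e a • q.onU ħ p) := by
  have : q.act ħ e (AddMonoidAlgebra.single a p) = _ :=
    AddMonoidAlgebra.liftNCRingHom_single _ _ (fun _ _ => Commute.all _ _) a p
  rw [this]
  simp [AddMonoidAlgebra.singleZeroRingHom, AddMonoidAlgebra.single_mul_single,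
    MvPolynomial.smul_eq_C_mul, mul_comm]

theorem act_act (q r : Subst ℓ n) (f : PolyUT ℓ n) :
    q.act ħ e (r.act ħ e f) = (q * r).act ħ e f := by
  induction f using AddMonoidAlgebra.induction_linear with
  | zero => simp
  | add f g hf hg => simp only [map_add, hf, hg]
  | single a p =>
    simp only [act_single, map_smul, scal_mul, onU_onU, smul_smul]
    rw [mul_comm]
    rfl

end Subst

variable {ℓ n : ℕ} (ħ : ℂ) (e : AddChar (ZMod ℓ) ℂ)

/-- `T_i ↦ 1`. -/
def aug : PolyUT ℓ n →ₐ[PolyU n] PolyU n :=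
  AddMonoidAlgebra.lift (PolyU n) (PolyU n) (Fin n → ZMod ℓ) 1

@[simp] theorem aug_single (a : Fin n → ZMod ℓ) (p : PolyU n) :
    aug (AddMonoidAlgebra.single a p) = p := by
  simp [aug]

/-- `U_i ↦ U_{w(i)} + ħ d_i`, `T_i ↦ e(-χ_i)`. -/
def ev (q : Subst ℓ n) : PolyUT ℓ n →ₐ[ℂ] PolyU n := (aug.restrictScalars ℂ).comp (q.act ħ e)

theorem ev_single (q : Subst ℓ n) (a : Fin n → ZMod ℓ) (p : PolyU n) :
    ev ħ e q (AddMonoidAlgebra.single a p) = q.scal e a • q.onU ħ p := by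
  simp [ev, Subst.act_single]

theorem ev_act (q r : Subst ℓ n) (f : PolyUT ℓ n) :
    ev ħ e q (r.act ħ e f) = ev ħ e (q * r) f := by
  simp [ev, Subst.act_act]

theorem ev_smul (q : Subst ℓ n) (p : PolyU n) (f : PolyUT ℓ n) :
    ev ħ e q (p • f) = q.onU ħ p * ev ħ e q f := by
  have : p • f = AddMonoidAlgebra.single 0 p * f := by
    ext a
    rw [AddMonoidAlgebra.coeff_single_zero_mul]
    simp
  rw [this, map_mul, ev_single]
  simp

/-- Two elements on which all `ev q` agree are equal. -/
theorem ev_ext (he : Function.Injective e) {f g : PolyUT ℓ n} (h : ∀ q, ev ħ e q f = ev ħ e q g) :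
    f = g := by
  rw [← sub_eq_zero]
  set f' := f - g
  replace h (q : Subst ℓ n) : ev ħ e q f' = 0 := by rw [map_sub, h, sub_self]
  -- The value of T^a at T = e(-χ), as a character in χ. Injectivity of `e` makes these characters
  -- distinct for distinct `a`, and distinct characters into a domain are linearly independent.
  let F : (Fin n → ZMod ℓ) → (Multiplicative (Fin n → ZMod ℓ) →* PolyU n) := fun a =>
    { toFun := fun χ => MvPolynomial.C (e (-∑ i, χ.toAdd i * a i))
      map_one' := by simp
      map_mul' := fun x y => by
        simp only [toAdd_mul, Pi.add_apply, add_mul, Finset.sum_add_distrib, neg_add,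
          AddChar.map_add_eq_mul, MvPolynomial.C_mul] }
  have hF : Function.Injective F := by
    intro a b hab
    funext i
    have := DFunLike.congr_fun hab (Multiplicative.ofAdd (Pi.single i 1))
    simp only [F, MonoidHom.coe_mk, OneHom.coe_mk, toAdd_ofAdd] at this
    have := he (MvPolynomial.C_injective _ _ this)
    simpa [Pi.single_apply] using this
  have li := (linearIndependent_monoidHom (Multiplicative (Fin n → ZMod ℓ)) (PolyU n)).comp F hF
  rw [linearIndependent_iff] at li
  have := li f'.coeff (by
    funext χ
    -- Substitutions that leave U untouched are enough: they give a linear relation between the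
    -- characters whose coefficients are those of `f'`.
    have h1 := h ⟨1, 0, χ.toAdd⟩
    have h2 : ev ħ e ⟨1, 0, χ.toAdd⟩ f' =
        f'.coeff.sum fun a p => p * MvPolynomial.C (e (-∑ i, χ.toAdd i * a i)) := by
      generalize f' = g
      induction g using AddMonoidAlgebra.induction_linear with
      | zero => simp
      | add f g hf hg =>
        rw [map_add, hf, hg, AddMonoidAlgebra.coeff_add, Finsupp.sum_add_index'] <;> simp [add_mul]
      | single a p =>
        rw [ev_single, AddMonoidAlgebra.coeff_single, Finsupp.sum_single_index (by simp)]
        have : (⟨1, 0, χ.toAdd⟩ : Subst ℓ n).onU ħ p = p := by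
          have : (⟨1, 0, χ.toAdd⟩ : Subst ℓ n).onU ħ = (1 : Subst ℓ n).onU ħ := rfl
          rw [this, Subst.onU_one]
        rw [this, MvPolynomial.smul_eq_C_mul, mul_comm]
        rfl
    rw [h2] at h1
    rw [Finsupp.linearCombination_apply, Finsupp.sum_apply']
    simpa [F] using h1)
  exact AddMonoidAlgebra.coeff_eq_zero.1 this

end

end Cherednik


/-! ### Deformed transpositions and their Coxeter relations -/

namespace Cherednik

noncomputable section

open Equiv Equiv.Perm SymmetricPresentation

variable {ℓ n : ℕ} (ħ : ℂ) (e : AddChar (ZMod ℓ) ℂ)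

theorem sum_range_zmod [NeZero ℓ] {M : Type*} [AddCommMonoid M] (f : ZMod ℓ → M) :
    ∑ m ∈ Finset.range ℓ, f m = ∑ x, f x := by
  refine Finset.sum_nbij' (fun m => (m : ZMod ℓ)) (fun x => x.val) (fun _ _ => Finset.mem_univ _)
    (fun x _ => Finset.mem_range.2 x.val_lt) (fun m hm => ?_) (fun x _ => by simp)
    (fun _ _ => rfl)
  exact ZMod.val_cast_of_lt (Finset.mem_range.1 hm)

theorem pairSum_eq [NeZero ℓ] (i j : Fin n) : (pairSum i j : PolyUT ℓ n) =
    ∑ x : ZMod ℓ, AddMonoidAlgebra.single (Pi.single i x - Pi.single j x) 1 := by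
  unfold pairSum
  rw [← sum_range_zmod]

theorem single_pair_mul_pairSum [NeZero ℓ] (i j : Fin n) (y : ZMod ℓ) :
    AddMonoidAlgebra.single (Pi.single i y - Pi.single j y) 1 * (pairSum i j : PolyUT ℓ n) =
      pairSum i j := by
  rw [pairSum_eq, Finset.mul_sum]
  refine Fintype.sum_equiv (Equiv.addLeft y) _ _ fun x => ?_
  rw [AddMonoidAlgebra.single_mul_single, one_mul, Equiv.coe_addLeft, Pi.single_add, Pi.single_add]
  congr 1
  abel

/-- Exchanging T_i and T_j changes T^a by a power of T_i T_j⁻¹, which the sum over all such powers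
absorbs. -/
theorem single_comp_swap_mul_pairSum [NeZero ℓ] (i j : Fin n) (a : Fin n → ZMod ℓ) (p : PolyU n) :
    AddMonoidAlgebra.single (a ∘ swap i j) p * (pairSum i j : PolyUT ℓ n) =
      AddMonoidAlgebra.single a p * pairSum i j := by
  have : a ∘ swap i j = a + (Pi.single i (a j - a i) - Pi.single j (a j - a i)) := by
    funext x
    rcases eq_or_ne i j with rfl | hij
    · simp
    simp only [Function.comp_apply, Pi.add_apply, Pi.sub_apply, Pi.single_apply, swap_apply_def]
    split_ifs with h1 h2 h3 <;> simp_all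
  rw [this, ← mul_one p, ← AddMonoidAlgebra.single_mul_single, mul_assoc, single_pair_mul_pairSum,
    mul_one]

/-- Orthogonality of characters; an injective character of ℤ/ℓ is primitive. -/
theorem sum_char_mul [NeZero ℓ] (he : Function.Injective e) (b : ZMod ℓ) :
    ∑ x : ZMod ℓ, e (x * b) = if b = 0 then (ℓ : ℂ) else 0 := by
  have h := AddChar.sum_mulShift (ψ := e) b (by
    intro a ha h
    have h1 := DFunLike.congr_fun h 1
    simp only [AddChar.mulShift_apply, mul_one, AddChar.one_apply] at h1
    exact ha (he (by rw [h1, AddChar.map_zero_eq_one])))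
  rw [h, ZMod.card]
  simp

/-- The value of `∑ T_i^m T_j^{-m}` at `T = e(-χ)`. -/
def pairVal (χ : Fin n → ZMod ℓ) (i j : Fin n) : ℂ := if χ i = χ j then (ℓ : ℂ) else 0

theorem ev_pairSum [NeZero ℓ] (he : Function.Injective e) (q : Subst ℓ n) (i j : Fin n) :
    ev ħ e q (pairSum i j) = MvPolynomial.C (pairVal q.χ i j) := by
  rw [pairSum_eq, map_sum]
  simp_rw [ev_single, map_one, MvPolynomial.smul_eq_C_mul, mul_one]
  rw [← map_sum]
  congr 1
  have (x : ZMod ℓ) : q.scal e (Pi.single i x - Pi.single j x) = e (x * (q.χ j - q.χ i)) := by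
    unfold Subst.scal
    congr 1
    simp only [Pi.sub_apply, mul_sub, Finset.sum_sub_distrib, Pi.single_apply, mul_ite, mul_zero,
      Finset.sum_ite_eq', Finset.mem_univ, if_true]
    ring
  simp_rw [this]
  rw [sum_char_mul e he, pairVal]
  simp only [sub_eq_zero, eq_comm (a := q.χ j)]

/-- `X_j - X_i` divides `p^{(i,j)} - p`. -/
theorem sub_dvd_rename_swap_sub (i j : Fin n) (p : PolyU n) :
    (MvPolynomial.X j - MvPolynomial.X i : PolyU n) ∣ MvPolynomial.rename (swap i j) p - p := by
  induction p using MvPolynomial.induction_on with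
  | C a => simp
  | add p q hp hq =>
    rw [map_add, add_sub_add_comm]
    exact dvd_add hp hq
  | mul_X p l hp =>
    rw [map_mul, MvPolynomial.rename_X]
    have : MvPolynomial.rename (swap i j) p * MvPolynomial.X (swap i j l) - p * MvPolynomial.X l =
        (MvPolynomial.rename (swap i j) p - p) * MvPolynomial.X (swap i j l) +
          p * (MvPolynomial.X (swap i j l) - MvPolynomial.X l) := by ring
    rw [this]
    refine dvd_add (hp.mul_right _) (Dvd.dvd.mul_left ?_ _)
    rw [swap_apply_def]
    split_ifs with h1 h2
    · subst h1; rfl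
    · subst h2; exact ⟨-1, by ring⟩
    · simp

theorem X_sub_X_ne_zero {i j : Fin n} (h : i ≠ j) :
    (MvPolynomial.X j - MvPolynomial.X i : PolyU n) ≠ 0 := by
  rw [sub_ne_zero]
  exact fun h' => h (MvPolynomial.X_injective h').symm

/-- The divided difference `p ↦ (p^{(i,j)} - p) / (X_j - X_i)`. -/
def divDiff (i j : Fin n) (h : i ≠ j) : PolyU n →ₗ[ℂ] PolyU n where
  toFun p := (sub_dvd_rename_swap_sub i j p).choose
  map_add' p q := by
    apply mul_left_cancel₀ (X_sub_X_ne_zero h)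
    rw [mul_add, ← (sub_dvd_rename_swap_sub i j p).choose_spec,
      ← (sub_dvd_rename_swap_sub i j q).choose_spec,
      ← (sub_dvd_rename_swap_sub i j (p + q)).choose_spec, map_add, add_sub_add_comm]
  map_smul' z p := by
    apply mul_left_cancel₀ (X_sub_X_ne_zero h)
    rw [RingHom.id_apply, mul_smul_comm, ← (sub_dvd_rename_swap_sub i j p).choose_spec,
      ← (sub_dvd_rename_swap_sub i j (z • p)).choose_spec, map_smul, smul_sub]

theorem mul_divDiff {i j : Fin n} (h : i ≠ j) (p : PolyU n) :
    (MvPolynomial.X j - MvPolynomial.X i) * divDiff i j h p =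
      MvPolynomial.rename (swap i j) p - p :=
  (sub_dvd_rename_swap_sub i j p).choose_spec.symm

/-- The deformed transposition
`f ↦ f^{(i,j)} + k (f^{(i,j)} - f) / (U_j - U_i) ∑ T_i^m T_j^{-m}`. -/
def defSwap (k : ℂ) (i j : Fin n) (h : i ≠ j) : Module.End ℂ (PolyUT ℓ n) :=
  ((Subst.perm (swap i j)).act ħ e).toLinearMap +
    k • (LinearMap.mulRight ℂ (pairSum i j)).comp
      ((AddMonoidAlgebra.coeffLinearEquiv ℂ).symm.toLinearMap ∘ₗ
        Finsupp.mapRange.linearMap (divDiff i j h) ∘ₗ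
          (AddMonoidAlgebra.coeffLinearEquiv ℂ).toLinearMap)

/-- `defSwap` divides differences in U only. This agrees with the formula in which T_i and T_j are
exchanged as well, because that exchange is invisible after multiplication by `pairSum`. -/
theorem smul_defSwap [NeZero ℓ] (k : ℂ) {i j : Fin n} (h : i ≠ j) (f : PolyUT ℓ n) :
    (MvPolynomial.X j - MvPolynomial.X i : PolyU n) • defSwap ħ e k i j h f =
      (MvPolynomial.X j - MvPolynomial.X i : PolyU n) • (Subst.perm (swap i j)).act ħ e f +
        k • ((Subst.perm (swap i j)).act ħ e f - f) * pairSum i j := by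
  induction f using AddMonoidAlgebra.induction_linear with
  | zero => simp
  | add f g hf hg =>
    rw [map_add, smul_add, hf, hg, map_add]
    simp only [smul_add, smul_sub, add_mul, sub_mul]
    abel
  | single a p =>
    have : defSwap ħ e k i j h (AddMonoidAlgebra.single a p) =
        (Subst.perm (swap i j)).act ħ e (AddMonoidAlgebra.single a p) +
          k • (AddMonoidAlgebra.single a (divDiff i j h p) * pairSum i j) := by
      simp only [defSwap, LinearMap.add_apply, LinearMap.smul_apply, LinearMap.comp_apply,
        LinearMap.mulRight_apply, AlgHom.toLinearMap_apply, LinearEquiv.coe_coe]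
      congr 3
      exact congrArg AddMonoidAlgebra.ofCoeff (Finsupp.mapRange_single (hf := map_zero _))
    rw [this, smul_add, Subst.act_single, Subst.scal_perm, one_smul, Subst.onU_perm,
      Subst.perm_w, symm_swap, smul_comm _ k, ← smul_mul_assoc _ _ (pairSum i j),
      AddMonoidAlgebra.smul_single _ a, smul_eq_mul, mul_divDiff, AddMonoidAlgebra.single_sub,
      sub_mul, smul_mul_assoc, sub_mul, single_comp_swap_mul_pairSum]

/-- `ev q`, with values in the field of fractions. -/
def row (q : Subst ℓ n) : PolyUT ℓ n →ₗ[ℂ] FractionRing (PolyU n) :=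
  (IsScalarTower.toAlgHom ℂ (PolyU n) (FractionRing (PolyU n))).toLinearMap.comp
    (ev ħ e q).toLinearMap

theorem row_apply (q : Subst ℓ n) (f : PolyUT ℓ n) :
    row ħ e q f = algebraMap (PolyU n) (FractionRing (PolyU n)) (ev ħ e q f) := rfl

/-- The principle behind all operator identities below: they are checked row by row, where they
become identities between rational functions. -/
theorem end_ext (he : Function.Injective e) {A B : Module.End ℂ (PolyUT ℓ n)}
    (h : ∀ q f, row ħ e q (A f) = row ħ e q (B f)) : A = B := by
  refine LinearMap.ext fun f => ev_ext ħ e he fun q => ?_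
  exact IsFractionRing.injective (PolyU n) (FractionRing (PolyU n)) (h q f)

theorem row_act (q r : Subst ℓ n) (f : PolyUT ℓ n) :
    row ħ e q (r.act ħ e f) = row ħ e (q * r) f := by
  rw [row_apply, ev_act]; rfl

theorem row_mul (q : Subst ℓ n) (f g : PolyUT ℓ n) :
    row ħ e q (f * g) = row ħ e q f * row ħ e q g := by
  simp only [row_apply, map_mul]

theorem row_smul (q : Subst ℓ n) (p : PolyU n) (f : PolyUT ℓ n) :
    row ħ e q (p • f) = algebraMap _ _ (q.onU ħ p) * row ħ e q f := by
  simp only [row_apply, ev_smul, map_mul]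

theorem val_sub_val_ne_zero (q : Subst ℓ n) {i j : Fin n} (h : i ≠ j) :
    q.val ħ j - q.val ħ i ≠ 0 := by
  intro h0
  have h1 := congrArg (MvPolynomial.coeff (Finsupp.single (q.w j) 1)) h0
  have hw : q.w i ≠ q.w j := fun h' => h (q.w.injective h')
  have hw' : Finsupp.single (q.w i) 1 ≠ Finsupp.single (q.w j) 1 := fun h' =>
    hw (Finsupp.single_left_injective one_ne_zero h')
  have hz : (0 : Fin n →₀ ℕ) ≠ Finsupp.single (q.w j) 1 := fun h' =>
    one_ne_zero (Finsupp.single_eq_zero.1 h'.symm)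
  simp only [Subst.val, MvPolynomial.coeff_sub, MvPolynomial.coeff_add, MvPolynomial.coeff_X, hw',
    MvPolynomial.coeff_C, hz, if_false, if_true] at h1
  norm_num at h1

/-- The image of `q.val` in the field of fractions. -/
def lval (q : Subst ℓ n) (i : Fin n) : FractionRing (PolyU n) := algebraMap _ _ (q.val ħ i)

theorem lval_sub_ne_zero (q : Subst ℓ n) {i j : Fin n} (h : i ≠ j) :
    lval ħ q j - lval ħ q i ≠ 0 := by
  unfold lval
  rw [← map_sub]
  exact (map_ne_zero_iff _ (IsFractionRing.injective (PolyU n) (FractionRing (PolyU n)))).2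
    (val_sub_val_ne_zero ħ q h)

/-- The coefficient `k π_{ij} / (U_j - U_i)`, evaluated at `q`. -/
def rcoef (k : ℂ) (q : Subst ℓ n) (i j : Fin n) : FractionRing (PolyU n) :=
  algebraMap ℂ _ (k * pairVal q.χ i j) / (lval ħ q j - lval ħ q i)

/-- Evaluation of `smul_defSwap` at `q`, divided by the nonzero value of U_j - U_i. -/
theorem row_defSwap [NeZero ℓ] (he : Function.Injective e) (k : ℂ) (q : Subst ℓ n) {i j : Fin n}
    (h : i ≠ j) (f : PolyUT ℓ n) :
    row ħ e q (defSwap ħ e k i j h f) =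
      (1 + rcoef ħ k q i j) * row ħ e (q * Subst.perm (swap i j)) f -
        rcoef ħ k q i j * row ħ e q f := by
  have h1 := congrArg (row ħ e q) (smul_defSwap ħ e k h f)
  have h2 := lval_sub_ne_zero ħ q h
  have h3 : row ħ e q (pairSum i j) = algebraMap ℂ _ (pairVal q.χ i j) := by
    rw [row_apply, ev_pairSum ħ e he]; rfl
  rw [map_add, row_smul, row_smul, row_mul, map_smul, map_sub, row_act, map_sub, Subst.onU_X,
    Subst.onU_X, map_sub, h3, Algebra.smul_def] at h1
  change (lval ħ q j - lval ħ q i) * _ = (lval ħ q j - lval ħ q i) * _ + _ at h1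
  apply mul_left_cancel₀ h2
  rw [h1, rcoef, map_mul, row_act]
  field_simp
  ring

theorem lval_mul_perm (q : Subst ℓ n) (v : Perm (Fin n)) (i : Fin n) :
    lval ħ (q * Subst.perm v) i = lval ħ q (v i) := by
  simp [lval, Subst.val]

theorem pairVal_mul_perm (q : Subst ℓ n) (v : Perm (Fin n)) (i j : Fin n) :
    pairVal (q * Subst.perm v).χ i j = pairVal q.χ (v i) (v j) := by
  simp [pairVal]

theorem rcoef_mul_perm (k : ℂ) (q : Subst ℓ n) (v : Perm (Fin n)) (i j : Fin n) :
    rcoef ħ k (q * Subst.perm v) i j = rcoef ħ k q (v i) (v j) := by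
  rw [rcoef, rcoef, lval_mul_perm, lval_mul_perm, pairVal_mul_perm]

theorem pairVal_comm (χ : Fin n → ZMod ℓ) (i j : Fin n) : pairVal χ j i = pairVal χ i j := by
  simp only [pairVal, eq_comm]

theorem rcoef_symm (k : ℂ) (q : Subst ℓ n) (i j : Fin n) :
    rcoef ħ k q j i = - rcoef ħ k q i j := by
  rw [rcoef, rcoef, ← neg_sub (lval ħ q j), pairVal_comm]
  exact div_neg (algebraMap ℂ (FractionRing (PolyU n)) (k * pairVal q.χ i j))

/-- The classical Yang-Baxter equation for the coefficients. -/
theorem rcoef_yangBaxter (k : ℂ) (q : Subst ℓ n) {i j l : Fin n} (hij : i ≠ j) (hjl : j ≠ l)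
    (hil : i ≠ l) : rcoef ħ k q i j * rcoef ħ k q j l =
      rcoef ħ k q i l * (rcoef ħ k q i j + rcoef ħ k q j l) := by
  have h1 := lval_sub_ne_zero ħ q hij
  have h2 := lval_sub_ne_zero ħ q hjl
  have h3 := lval_sub_ne_zero ħ q hil
  unfold rcoef
  by_cases hχ : q.χ i = q.χ j
  -- If χ_i = χ_j, either both values involving `l` vanish or all three equal ℓ; the latter is the
  -- partial fraction identity for the three differences.
  · have e1 : pairVal q.χ i l = pairVal q.χ j l := by simp [pairVal, hχ]
    have e2 : pairVal q.χ j l * (pairVal q.χ i j - pairVal q.χ j l) = 0 := by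
      simp only [pairVal, hχ, if_true]
      split_ifs <;> simp
    have e3 : (algebraMap ℂ (FractionRing (PolyU n)) (pairVal q.χ j l)) *
        (algebraMap ℂ (FractionRing (PolyU n)) (pairVal q.χ i j) -
          algebraMap ℂ (FractionRing (PolyU n)) (pairVal q.χ j l)) = 0 := by
      rw [← map_sub, ← map_mul, e2, map_zero]
    rw [e1, map_mul, map_mul]
    field_simp
    linear_combination (algebraMap ℂ (FractionRing (PolyU n)) k) ^ 2 *
      (lval ħ q j - lval ħ q i) * e3
  -- If χ_i ≠ χ_j, then χ_l agrees with at most one of them, so both sides vanish.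
  · have e1 : pairVal q.χ i j = 0 := by simp [pairVal, hχ]
    have e2 : pairVal q.χ i l * pairVal q.χ j l = 0 := by
      simp only [pairVal]
      split_ifs with a b <;> simp_all
    have e3 : (algebraMap ℂ (FractionRing (PolyU n)) (pairVal q.χ i l)) *
        (algebraMap ℂ (FractionRing (PolyU n)) (pairVal q.χ j l)) = 0 := by
      rw [← map_mul, e2, map_zero]
    rw [e1, mul_zero, map_zero, map_mul, map_mul, zero_div, zero_mul, zero_add]
    symm
    rw [div_mul_div_comm]
    refine div_eq_zero_iff.2 (Or.inl ?_)
    linear_combination (algebraMap ℂ (FractionRing (PolyU n)) k) ^ 2 * e3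

variable [NeZero ℓ]

/-- The coefficient r changes sign under the transposition, so the cross terms cancel and (1 + r)(1
- r) + r² = 1 remains. -/
theorem defSwap_sq (he : Function.Injective e) (k : ℂ) {i j : Fin n} (h : i ≠ j) :
    (defSwap ħ e k i j h * defSwap ħ e k i j h : Module.End ℂ (PolyUT ℓ n)) = 1 := by
  refine end_ext ħ e he fun q f => ?_
  rw [Module.End.mul_apply, Module.End.one_apply]
  simp only [row_defSwap ħ e he, rcoef_mul_perm, swap_apply_left, swap_apply_right, mul_assoc,
    ← Subst.perm_mul, swap_mul_self, Subst.perm_one, mul_one]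
  rw [rcoef_symm ħ k q i j]
  ring

theorem defSwap_comm (he : Function.Injective e) (k : ℂ) {i j a b : Fin n} (h : i ≠ j)
    (h' : a ≠ b) (hia : i ≠ a) (hib : i ≠ b) (hja : j ≠ a) (hjb : j ≠ b) :
    (defSwap ħ e k i j h * defSwap ħ e k a b h' : Module.End ℂ (PolyUT ℓ n)) =
      defSwap ħ e k a b h' * defSwap ħ e k i j h := by
  refine end_ext ħ e he fun q f => ?_
  rw [Module.End.mul_apply, Module.End.mul_apply]
  have hs : swap i j * swap a b = swap a b * swap i j := by
    rw [swap_mul_eq_mul_swap, swap_inv, swap_apply_of_ne_of_ne hia hib,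
      swap_apply_of_ne_of_ne hja hjb]
  simp only [row_defSwap ħ e he, rcoef_mul_perm, mul_assoc, ← Subst.perm_mul, hs,
    swap_apply_of_ne_of_ne hia hib, swap_apply_of_ne_of_ne hja hjb,
    swap_apply_of_ne_of_ne hia.symm hja.symm, swap_apply_of_ne_of_ne hib.symm hjb.symm]
  ring

theorem defSwap_braid (he : Function.Injective e) (k : ℂ) {i j l : Fin n} (h : i ≠ j)
    (h' : j ≠ l) (hil : i ≠ l) :
    (defSwap ħ e k i j h * defSwap ħ e k j l h' * defSwap ħ e k i j h :
      Module.End ℂ (PolyUT ℓ n)) =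
      defSwap ħ e k j l h' * defSwap ħ e k i j h * defSwap ħ e k j l h' := by
  refine end_ext ħ e he fun q f => ?_
  simp only [Module.End.mul_apply]
  have hs : swap i j * (swap j l * swap i j) = swap j l * (swap i j * swap j l) := by
    have h1 := swap_mul_swap_mul_swap h'.symm hil.symm
    rw [swap_comm j i, swap_comm l j, swap_comm i l] at h1
    rw [← mul_assoc, ← mul_assoc, h1, swap_mul_swap_mul_swap h hil]
  simp only [row_defSwap ħ e he, rcoef_mul_perm, mul_assoc, ← Subst.perm_mul, hs,
    Perm.mul_apply, swap_apply_left, swap_apply_right, swap_mul_self, Subst.perm_one, mul_one,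
    swap_apply_of_ne_of_ne h hil, swap_apply_of_ne_of_ne hil.symm h'.symm]
  -- The two triple products agree on the longest substitution; the differences of the other
  -- coefficients are multiples of the Yang-Baxter identity.
  have hy := rcoef_yangBaxter ħ k q h h' hil
  rw [rcoef_symm ħ k q i j, rcoef_symm ħ k q j l]
  generalize rcoef ħ k q i j = a at *
  generalize rcoef ħ k q j l = b at *
  generalize rcoef ħ k q i l = c at *
  linear_combination ((1 + a) * row ħ e (q * Subst.perm (swap i j)) f -
    (1 + b) * row ħ e (q * Subst.perm (swap j l)) f - (a - b) * row ħ e q f) * hy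

end

end Cherednik


/-! ### Constructing commuting x_j and y_j from σ, τ and permutations -/

namespace CyclicPresentation

open Equiv Equiv.Perm

variable {α A : Type*} [Ring A]

theorem perm_apply_inv (w : Perm α) (x : α) : w (w⁻¹ x) = x := w.apply_symm_apply x

theorem perm_inv_apply (w : Perm α) (x : α) : w⁻¹ (w x) = x := w.symm_apply_apply x

variable [DecidableEq α]

/-- Elements `σ`, `τ` of a ring on which the symmetric group acts, with the commutation relations of
`σ = x_o c` and `τ = y_{c⁻¹ o} c⁻¹` with permutations, for a base point `o` and a permutation `c`. -/
structure IsCyclicPair (o : α) (c : Perm α) (R : Perm α →* A) (σ τ : A) : Prop where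
  perm_sigma : ∀ u : Perm α, u o = o → R u * σ = σ * R (c⁻¹ * u * c)
  perm_tau : ∀ u : Perm α, u o = o → R (c⁻¹ * u * c) * τ = τ * R u
  swap_sigma : c o ≠ o → R (swap o (c o)) * (σ * σ) =
    (σ * σ) * R (swap (c⁻¹ (c⁻¹ o)) (c⁻¹ o))
  swap_tau : c o ≠ o → R (swap (c⁻¹ (c⁻¹ o)) (c⁻¹ o)) * (τ * τ) = (τ * τ) * R (swap o (c o))

/-- The element `x_j`. -/
def xOp (o : α) (c : Perm α) (R : Perm α →* A) (σ : A) (j : α) : A :=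
  R (swap o j) * (σ * R c⁻¹) * R (swap o j)

/-- The element `y_j`. -/
def yOp (o : α) (c : Perm α) (R : Perm α →* A) (τ : A) (j : α) : A :=
  R (swap (c⁻¹ o) j) * (τ * R c) * R (swap (c⁻¹ o) j)

variable {o : α} {c : Perm α} {R : Perm α →* A} {σ τ : A}

theorem map_swap_self (p : α) : R (swap p p) = 1 := by
  rw [swap_self, ← Perm.one_def, map_one]

theorem map_swap_mul_self (i j : α) : R (swap i j) * R (swap i j) = 1 := by
  rw [← map_mul, swap_mul_self, map_one]

/-- An element commuting with the stabilizer of `p` has conjugates that depend only on the image of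
`p`, so they form an equivariant family. It is applied to σ c⁻¹ and to τ c. -/
theorem equivariant_of_stabilizer {p : α} {z : A} (h : ∀ u : Perm α, u p = p → R u * z = z * R u)
    (w : Perm α) (j : α) :
    R w * (R (swap p j) * z * R (swap p j)) =
      R (swap p (w j)) * z * R (swap p (w j)) * R w := by
  have h1 := h (swap p (w j) * w * swap p j) (by simp)
  calc R w * (R (swap p j) * z * R (swap p j))
      = R (swap p (w j)) * (R (swap p (w j)  * w * swap p j) * z) * R (swap p j) := by
        simp only [map_mul, ← mul_assoc, map_swap_mul_self, one_mul]
    _ = _ := by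
        rw [h1]
        simp only [map_mul, mul_assoc, map_swap_mul_self, mul_one]

theorem swap_conj (w : Perm α) (i j : α) : w * swap i j * w⁻¹ = swap (w i) (w j) := by
  rw [mul_swap_eq_swap_mul, mul_inv_cancel_right]

theorem exists_perm_pair {a b i j : α} (hab : a ≠ b) (hij : i ≠ j) :
    ∃ w : Perm α, w a = i ∧ w b = j := by
  refine ⟨swap (swap a i b) j * swap a i, ?_, by simp⟩
  rw [Perm.mul_apply, swap_apply_left, swap_apply_of_ne_of_ne _ hij]
  intro h
  have := congrArg (swap a i) h
  simp only [swap_apply_right, swap_apply_self] at this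
  exact hab this

/-- Two equivariant families commute if one pair of members commutes. -/
theorem commute_of_equivariant {x : α → A} (hx : ∀ w j, R w * x j = x (w j) * R w) {a b : α}
    (hab : a ≠ b) (h : x a * x b = x b * x a) (i j : α) : x i * x j = x j * x i := by
  rcases eq_or_ne i j with rfl | hij
  · rfl
  -- The symmetric group is 2-transitive, so any pair of distinct indices is a conjugate of the
  -- given one.
  obtain ⟨w, rfl, rfl⟩ := exists_perm_pair hab hij
  have hw (u v : α) : x (w u) * x (w v) = R w * (x u * x v) * R w⁻¹ := by
    rw [← mul_assoc, hx, mul_assoc (x (w u)), hx, mul_assoc, mul_assoc, ← map_mul, mul_inv_cancel,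
      map_one, mul_one]
  rw [hw, hw, h]

namespace IsCyclicPair

variable (h : IsCyclicPair o c R σ τ)
include h

theorem perm_tau' (v : Perm α) (hv : v (c⁻¹ o) = c⁻¹ o) : R v * τ = τ * R (c * v * c⁻¹) := by
  have := h.perm_tau (c * v * c⁻¹) (by rw [Perm.mul_apply, Perm.mul_apply, hv, perm_apply_inv])
  rwa [show c⁻¹ * (c * v * c⁻¹) * c = v by group] at this

theorem perm_mul_x (w : Perm α) (j : α) :
    R w * xOp o c R σ j = xOp o c R σ (w j) * R w := by
  refine equivariant_of_stabilizer (fun u hu => ?_) w j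
  rw [← mul_assoc, h.perm_sigma u hu, mul_assoc σ, mul_assoc σ, ← map_mul, ← map_mul]
  group

theorem perm_mul_y (w : Perm α) (j : α) :
    R w * yOp o c R τ j = yOp o c R τ (w j) * R w := by
  refine equivariant_of_stabilizer (fun u hu => ?_) w j
  rw [← mul_assoc, h.perm_tau' u hu, mul_assoc τ, mul_assoc τ, ← map_mul, ← map_mul]
  group

/-- By equivariance one pair suffices. There x_o x_{c(o)} = σ² c⁻², and the product in the other
order is its conjugate by (o c(o)); invariance under this conjugation is `swap_sigma`. -/
theorem x_comm (hc : c o ≠ o) (i j : α) :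
    xOp o c R σ i * xOp o c R σ j = xOp o c R σ j * xOp o c R σ i := by
  refine commute_of_equivariant h.perm_mul_x hc.symm ?_ i j
  set s := swap o (c o)
  have hss : R s * R s = 1 := map_swap_mul_self o (c o)
  have e0 : xOp o c R σ o = σ * R c⁻¹ := by rw [xOp, map_swap_self, one_mul, mul_one]
  have h1 : xOp o c R σ o * xOp o c R σ (c o) = σ * σ * R (c⁻¹ * c⁻¹) := by
    rw [e0, xOp]
    have := h.perm_sigma (c⁻¹ * s) (by simp [s])
    calc σ * R c⁻¹ * (R s * (σ * R c⁻¹) * R s) = σ * (R (c⁻¹ * s) * σ) * R c⁻¹ * R s := by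
          simp only [map_mul, mul_assoc]
      _ = σ * σ * R (c⁻¹ * (c⁻¹ * s) * c * c⁻¹ * s) := by
          rw [this]; simp only [map_mul, mul_assoc]
      _ = _ := by
          rw [mul_inv_cancel_right, mul_assoc c⁻¹, mul_assoc c⁻¹, swap_mul_self, mul_one]
  have h2 : xOp o c R σ (c o) * xOp o c R σ o =
      R s * (xOp o c R σ o * xOp o c R σ (c o)) * R s := by
    rw [e0, xOp]
    simp only [mul_assoc, s, map_swap_mul_self, mul_one]
  rw [h2, h1, ← mul_assoc, h.swap_sigma hc, mul_assoc (σ * σ), mul_assoc (σ * σ), ← map_mul, ← map_mul]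
  congr 2
  have := swap_conj (c⁻¹ * c⁻¹) o (c o)
  simp only [Perm.mul_apply, perm_inv_apply] at this
  rw [← this]
  simp [s, mul_assoc]

theorem y_comm (hc : c o ≠ o) (i j : α) :
    yOp o c R τ i * yOp o c R τ j = yOp o c R τ j * yOp o c R τ i := by
  have hc' : c⁻¹ o ≠ c⁻¹ (c⁻¹ o) := fun h' => hc (by
    have := c⁻¹.injective h'
    rw [Perm.eq_inv_iff_eq] at this; exact this)
  refine commute_of_equivariant h.perm_mul_y hc' ?_ i j
  set s := swap (c⁻¹ (c⁻¹ o)) (c⁻¹ o)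
  have hs : swap (c⁻¹ o) (c⁻¹ (c⁻¹ o)) = s := swap_comm _ _
  have e0 : yOp o c R τ (c⁻¹ o) = τ * R c := by
    rw [yOp, map_swap_self, one_mul, mul_one]
  have h1 : yOp o c R τ (c⁻¹ o) * yOp o c R τ (c⁻¹ (c⁻¹ o)) = τ * τ * R (c * c) := by
    rw [e0, yOp, hs]
    have := h.perm_tau' (c * s) (by simp [s])
    calc τ * R c * (R s * (τ * R c) * R s) = τ * (R (c * s) * τ) * R c * R s := by
          simp only [map_mul, mul_assoc]
      _ = τ * τ * R (c * (c * s) * c⁻¹ * c * s) := by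
          rw [this]; simp only [map_mul, mul_assoc]
      _ = _ := by
          rw [inv_mul_cancel_right, mul_assoc c, mul_assoc c, swap_mul_self, mul_one]
  have h2 : yOp o c R τ (c⁻¹ (c⁻¹ o)) * yOp o c R τ (c⁻¹ o) =
      R s * (yOp o c R τ (c⁻¹ o) * yOp o c R τ (c⁻¹ (c⁻¹ o))) * R s := by
    rw [e0, yOp, hs]
    simp only [mul_assoc, s, map_swap_mul_self, mul_one]
  rw [h2, h1, ← mul_assoc, h.swap_tau hc, mul_assoc (τ * τ), mul_assoc (τ * τ), ← map_mul, ← map_mul]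
  congr 2
  have := swap_conj (c * c) (c⁻¹ (c⁻¹ o)) (c⁻¹ o)
  simp only [Perm.mul_apply, perm_apply_inv] at this
  rw [← this]
  simp [s, mul_assoc]

theorem y_base : yOp o c R τ o = R c * τ := by
  have h1 := h.perm_mul_y c (c⁻¹ o)
  rw [perm_apply_inv] at h1
  have h2 : yOp o c R τ (c⁻¹ o) = τ * R c := by
    rw [yOp, map_swap_self, one_mul, mul_one]
  have h3 := congrArg (· * R c⁻¹) h1
  simp only [mul_assoc, h2, ← map_mul, mul_inv_cancel, map_one, mul_one] at h3
  exact h3.symm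

theorem x_mul_y_base : xOp o c R σ o * yOp o c R τ o = σ * τ := by
  rw [h.y_base, xOp, map_swap_self, one_mul, mul_one]
  rw [mul_assoc, ← mul_assoc (R c⁻¹), ← map_mul, inv_mul_cancel, map_one, one_mul]

theorem y_mul_x_base : yOp o c R τ o * xOp o c R σ o = R c * (τ * σ) * R c⁻¹ := by
  rw [h.y_base, xOp, map_swap_self, one_mul, mul_one]
  simp only [mul_assoc]

/-- The commutator at one pair of distinct indices. Equivariance carries it to all other pairs, so
only the mixed expression on the right has to be computed in the representation. -/
theorem x_mul_y_sub :
    xOp o c R σ o * yOp o c R τ (c⁻¹ o) - yOp o c R τ (c⁻¹ o) * xOp o c R σ o =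
      (σ * R (swap (c⁻¹ (c⁻¹ o)) (c⁻¹ o)) * τ - τ * R (swap o (c o)) * σ) *
        R (swap o (c⁻¹ o)) := by
  have e0 : yOp o c R τ (c⁻¹ o) = τ * R c := by
    rw [yOp, map_swap_self, one_mul, mul_one]
  have e1 : xOp o c R σ o = σ * R c⁻¹ := by rw [xOp, map_swap_self, one_mul, mul_one]
  set s := swap (c⁻¹ (c⁻¹ o)) (c⁻¹ o) with hs
  set t := swap o (c o) with ht
  have hss : s * s = 1 := swap_mul_self _ _
  have htt : t * t = 1 := swap_mul_self _ _
  have h1 := h.perm_tau' (s * c⁻¹) (by simp [s])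
  have h2 := h.perm_sigma (t * c) (by simp [t])
  have h3 : c * s * c⁻¹ = swap o (c⁻¹ o) := by
    rw [hs, swap_conj, perm_apply_inv, perm_apply_inv, swap_comm]
  have h4 : c⁻¹ * t * c = swap o (c⁻¹ o) := by
    have := swap_conj c⁻¹ o (c o)
    rw [inv_inv, perm_inv_apply, swap_comm (c⁻¹ o)] at this
    rw [← this]
  rw [e0, e1, sub_mul]
  congr 1
  · calc σ * R c⁻¹ * (τ * R c) = σ * (R s * (R (s * c⁻¹) * τ) * R c) := by
          simp only [map_mul, mul_assoc]
          rw [← mul_assoc (R s) (R s), ← map_mul, hss, map_one, one_mul]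
      _ = σ * R s * τ * R (c * s * c⁻¹ * (c⁻¹ * c)) := by
          rw [h1]; simp only [map_mul, mul_assoc]
      _ = _ := by rw [inv_mul_cancel, mul_one, h3]
  · calc τ * R c * (σ * R c⁻¹) = τ * (R t * (R (t * c) * σ) * R c⁻¹) := by
          simp only [map_mul, mul_assoc]
          rw [← mul_assoc (R t) (R t), ← map_mul, htt, map_one, one_mul]
      _ = τ * R t * σ * R (c⁻¹ * t * c * (c * c⁻¹)) := by
          rw [h2]; simp only [map_mul, mul_assoc]
      _ = _ := by rw [mul_inv_cancel, mul_one, h4]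

end IsCyclicPair

end CyclicPresentation


/-! ### Commutators of the x_i and y_j -/

namespace CyclicPresentation

open Equiv Equiv.Perm SymmetricPresentation

variable {m : ℕ} {A : Type*} [Ring A] [Algebra ℂ A] {R : Perm (Fin (m + 1)) →* A}
  {U : Fin (m + 1) → A} {Q : Fin (m + 1) → Fin (m + 1) → A} {k : ℂ}

/-- In a degenerate affine Hecke algebra, conjugation by the cycle `(0 1 ⋯ i)` maps `U_i` to
a Jucys–Murphy element. -/
theorem cycle_mul_of_swap_mul
    (hU : ∀ i : Fin m, R (swap i.castSucc i.succ) * U i.castSucc =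
      U i.succ * R (swap i.castSucc i.succ) + k • Q i.castSucc i.succ)
    (hQ : ∀ w i j, R w * Q i j = Q (w i) (w j) * R w) (hQ' : ∀ i j, Q i j = Q j i)
    (i : Fin (m + 1)) :
    R (Fin.cycleRange i) * U i =
      (U 0 - k • ∑ l ∈ Finset.Ioc 0 i, Q 0 l * R (swap 0 l)) * R (Fin.cycleRange i) := by
  induction i using Fin.induction with
  | zero => simp
  | succ i ih =>
    have hc : Fin.cycleRange i.succ = Fin.cycleRange i.castSucc * swap i.castSucc i.succ := by
      rw [← cycleRange_succ_mul_swap, mul_assoc, swap_mul_self, mul_one]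
    have h1 := hU i
    set s := R (swap i.castSucc i.succ) with hs
    have hss : s * s = 1 := map_swap_mul_self _ _
    -- The Hecke relation conjugated by `s`: it lowers the index of U by one and contributes one
    -- Jucys–Murphy summand.
    have h2 : s * U i.succ = (U i.castSucc - k • (Q i.castSucc i.succ * s)) * s := by
      have h3 : Q i.castSucc i.succ * s = s * (Q i.castSucc i.succ) := by
        rw [hs, hQ, swap_apply_left, swap_apply_right, hQ']
      calc s * U i.succ = s * (U i.succ * s) * s := by
            rw [mul_assoc, mul_assoc, hss, mul_one]
        _ = s * (s * U i.castSucc - k • Q i.castSucc i.succ) * s := by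
            rw [h1, add_sub_cancel_right]
        _ = _ := by
            rw [mul_sub, ← mul_assoc, hss, one_mul, mul_smul_comm, h3]
    have hI : Finset.Ioc 0 i.succ = insert i.succ (Finset.Ioc 0 i.castSucc) := by
      ext x
      simp only [Finset.mem_Ioc, Finset.mem_insert, Fin.lt_def, Fin.le_def, Fin.ext_iff,
        Fin.val_succ, Fin.val_castSucc, Fin.val_zero]
      omega
    have hnot : i.succ ∉ Finset.Ioc 0 i.castSucc := by
      simp [Fin.lt_def, Fin.le_def]
    have hfix : Fin.cycleRange i.castSucc i.succ = i.succ :=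
      Fin.cycleRange_of_gt Fin.castSucc_lt_succ
    have h4 : R (Fin.cycleRange i.castSucc) * (Q i.castSucc i.succ * s) =
        (Q 0 i.succ * R (swap 0 i.succ)) * R (Fin.cycleRange i.castSucc) := by
      rw [← mul_assoc, hQ, Fin.cycleRange_self, hfix, mul_assoc, mul_assoc, hs,
        ← map_mul, ← map_mul, mul_swap_eq_swap_mul, Fin.cycleRange_self, hfix]
    rw [hc, map_mul, ← hs, mul_assoc, h2, ← mul_assoc, mul_sub, ih, mul_smul_comm, h4, hI,
      Finset.sum_insert hnot, ← smul_mul_assoc, ← sub_mul, smul_add, mul_assoc]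
    congr 1
    abel

variable {σ τ : A} (h : IsCyclicPair 0 (finRotate (m + 1)) R σ τ)
include h

set_option linter.unusedSectionVars false

/-- The commutator `[x_i, y_i]`. -/
theorem IsCyclicPair.x_mul_y_self {ħ : ℂ} {D D' : Fin (m + 1) → A}
    (hU : ∀ i : Fin m, R (swap i.castSucc i.succ) * U i.castSucc =
      U i.succ * R (swap i.castSucc i.succ) + k • Q i.castSucc i.succ)
    (hQ : ∀ w i j, R w * Q i j = Q (w i) (w j) * R w) (hQ' : ∀ i j, Q i j = Q j i)
    (hD : ∀ w i, R w * D i = D (w i) * R w) (hD' : ∀ w i, R w * D' i = D' (w i) * R w)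
    (hστ : σ * τ = U 0 + algebraMap ℂ A ħ + D' 0) (hτσ : τ * σ = U (Fin.last m) + D (Fin.last m))
    (i : Fin (m + 1)) :
    xOp 0 (finRotate (m + 1)) R σ i * yOp 0 (finRotate (m + 1)) R τ i -
      yOp 0 (finRotate (m + 1)) R τ i * xOp 0 (finRotate (m + 1)) R σ i =
      algebraMap ℂ A ħ + (D' i - D i) +
        k • ∑ l ∈ Finset.univ.erase i, Q i l * R (swap i l) := by
  -- At index 0 the two products are στ and c(τσ)c⁻¹. Conjugation by the full cycle carries U_last
  -- to U_0 minus the Jucys–Murphy sum over all l ≠ 0, so U_0 cancels.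
  have h0 : xOp 0 (finRotate (m + 1)) R σ 0 * yOp 0 (finRotate (m + 1)) R τ 0 -
      yOp 0 (finRotate (m + 1)) R τ 0 * xOp 0 (finRotate (m + 1)) R σ 0 =
      algebraMap ℂ A ħ + (D' 0 - D 0) +
        k • ∑ l ∈ Finset.univ.erase 0, Q 0 l * R (swap 0 l) := by
    have h1 := cycle_mul_of_swap_mul hU hQ hQ' (Fin.last m)
    have hl : finRotate (m + 1) (Fin.last m) = 0 := finRotate_last
    rw [Fin.cycleRange_last] at h1
    have hI : Finset.Ioc 0 (Fin.last m) = Finset.univ.erase 0 := by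
      ext x
      simp [Fin.le_last, Fin.pos_iff_ne_zero]
    rw [h.x_mul_y_base, h.y_mul_x_base, hστ, hτσ, mul_add, h1, hD, hl, ← add_mul, mul_assoc,
      ← map_mul, mul_inv_cancel, map_one, mul_one, hI]
    abel
  have hx := h.perm_mul_x (swap 0 i) 0
  have hy := h.perm_mul_y (swap 0 i) 0
  rw [swap_apply_left] at hx hy
  set w := swap 0 i with hw
  have hww : R w * R w = 1 := map_swap_mul_self _ _
  have hw0 : w 0 = i := swap_apply_left _ _
  -- Conjugation of the case of index 0 by (0 i).
  have key : (xOp 0 (finRotate (m + 1)) R σ i * yOp 0 (finRotate (m + 1)) R τ i -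
      yOp 0 (finRotate (m + 1)) R τ i * xOp 0 (finRotate (m + 1)) R σ i) * R w =
      (algebraMap ℂ A ħ + (D' i - D i) +
        k • ∑ l ∈ Finset.univ.erase i, Q i l * R (swap i l)) * R w := by
    rw [sub_mul, mul_assoc, ← hy, ← mul_assoc, ← hx, mul_assoc, mul_assoc _ _ (R w), ← hx,
      ← mul_assoc _ (R w), ← hy, mul_assoc (R w), ← mul_sub, h0, mul_add, mul_add, mul_sub, hD,
      hD', hw0, add_mul, add_mul, sub_mul, Algebra.commutes, mul_smul_comm, smul_mul_assoc,
      Finset.mul_sum, Finset.sum_mul]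
    congr 2
    refine Finset.sum_nbij' w w ?_ ?_ ?_ ?_ ?_
    · intro a ha
      simpa [← hw0] using ha
    · intro a ha
      have : w i = 0 := swap_apply_right _ _
      simpa [← this] using ha
    · intro a _; exact swap_apply_self _ _ _
    · intro a _; exact swap_apply_self _ _ _
    · intro a _
      rw [← mul_assoc, hQ, hw0, mul_assoc, mul_assoc, ← map_mul, ← map_mul, mul_swap_eq_swap_mul,
        hw0]
  calc _ = _ * R w * R w := by rw [mul_assoc, hww, mul_one]
    _ = _ := by rw [key, mul_assoc, hww, mul_one]

/-- The commutator `[x_i, y_j]` for `i ≠ j`. -/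
theorem IsCyclicPair.x_mul_y_of_ne {N : Fin (m + 1) → Fin (m + 1) → A}
    (hN : ∀ w i j, R w * N i j = N (w i) (w j) * R w)
    (hm : (0 : Fin (m + 1)) ≠ Fin.last m → σ * R (swap ((finRotate (m + 1))⁻¹
      ((finRotate (m + 1))⁻¹ 0)) ((finRotate (m + 1))⁻¹ 0)) * τ -
        τ * R (swap 0 (finRotate (m + 1) 0)) * σ = N 0 (Fin.last m))
    {i j : Fin (m + 1)} (hij : i ≠ j) :
    xOp 0 (finRotate (m + 1)) R σ i * yOp 0 (finRotate (m + 1)) R τ j -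
      yOp 0 (finRotate (m + 1)) R τ j * xOp 0 (finRotate (m + 1)) R σ i =
      N i j * R (swap i j) := by
  have hl : (finRotate (m + 1))⁻¹ 0 = Fin.last m := by
    rw [Perm.inv_eq_iff_eq]
    exact finRotate_last.symm
  have hne : (0 : Fin (m + 1)) ≠ Fin.last m := by
    intro h'
    have : m = 0 := by simpa using (congrArg Fin.val h').symm
    subst this
    exact hij (Subsingleton.elim (α := Fin 1) _ _)
  have h0 := h.x_mul_y_sub
  rw [hm hne, hl] at h0
  -- The pair (0, last) is known from `x_mul_y_sub`; `w` carries it to (i, j).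
  obtain ⟨w, rfl, rfl⟩ := exists_perm_pair hne hij
  have hx := h.perm_mul_x w 0
  have hy := h.perm_mul_y w (Fin.last m)
  have key := congrArg (R w * · ) h0
  simp only [mul_sub, ← mul_assoc, hx, hN] at key
  rw [mul_assoc _ (R w), hy, mul_assoc _ (R w), hx, mul_assoc (N _ _), ← map_mul,
    mul_swap_eq_swap_mul, map_mul, ← mul_assoc, ← mul_assoc, ← mul_assoc, ← sub_mul] at key
  calc _ = _ * R w * R w⁻¹ := by rw [mul_assoc, ← map_mul, mul_inv_cancel, map_one, mul_one]
    _ = _ := by rw [key, mul_assoc, ← map_mul, mul_inv_cancel, map_one, mul_one]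

end CyclicPresentation


/-! ### The operators σ and τ and their commutation with permutations -/

namespace Cherednik

noncomputable section

open Equiv Equiv.Perm SymmetricPresentation CyclicPresentation

set_option linter.unusedSectionVars false

variable {ℓ m : ℕ} [NeZero ℓ] (ħ k : ℂ) (e : AddChar (ZMod ℓ) ℂ) (c : ℕ → ℂ)

theorem isBraidFamily_defSwap (he : Function.Injective e) :
    IsBraidFamily fun i : Fin m =>
      (defSwap ħ e k i.castSucc i.succ Fin.castSucc_lt_succ.ne :
        Module.End ℂ (PolyUT ℓ (m + 1))) where
  sq i := defSwap_sq ħ e he k _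
  comm i j h := by
    refine defSwap_comm ħ e he k _ _ ?_ ?_ ?_ ?_ <;>
    · simp only [ne_eq, Fin.ext_iff, Fin.val_castSucc, Fin.val_succ]
      omega
  braid i j h := by
    have : i.succ = j.castSucc := Fin.ext (by simpa using h)
    have h1 : (defSwap ħ e k i.castSucc i.succ Fin.castSucc_lt_succ.ne :
        Module.End ℂ (PolyUT ℓ (m + 1))) = defSwap ħ e k i.castSucc j.castSucc
          (this ▸ Fin.castSucc_lt_succ.ne) := by
      congr 1
    rw [h1]
    refine defSwap_braid ħ e he k _ _ ?_
    simp only [ne_eq, Fin.ext_iff, Fin.val_castSucc, Fin.val_succ]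
    omega

/-- The deformed action of the symmetric group. -/
def permRep (he : Function.Injective e) : Perm (Fin (m + 1)) →* Module.End ℂ (PolyUT ℓ (m + 1)) :=
  (isBraidFamily_defSwap ħ k e he).exists_hom.choose

theorem permRep_swap (he : Function.Injective e) (i : Fin m) :
    permRep ħ k e he (swap i.castSucc i.succ) =
      defSwap ħ e k i.castSucc i.succ Fin.castSucc_lt_succ.ne :=
  (isBraidFamily_defSwap ħ k e he).exists_hom.choose_spec i

theorem permRep_swap_of_eq (he : Function.Injective e) (i j : Fin (m + 1))
    (h : (i : ℕ) + 1 = j) :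
    permRep ħ k e he (swap i j) = defSwap ħ e k i j (by rintro rfl; simp at h) := by
  obtain ⟨i', rfl⟩ : ∃ i' : Fin m, i'.castSucc = i := ⟨⟨i, by omega⟩, rfl⟩
  obtain rfl : i'.succ = j := Fin.ext h
  exact permRep_swap ħ k e he i'

/-- The substitution of `σ`. -/
def sigmaSub : Subst ℓ (m + 1) :=
  ⟨finRotate (m + 1), Pi.single (Fin.last m) 1, Pi.single (Fin.last m) 1⟩

/-- The substitution of `τ`. -/
def tauSub : Subst ℓ (m + 1) := ⟨(finRotate (m + 1))⁻¹, Pi.single 0 (-1), Pi.single 0 (-1)⟩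

theorem rotate_last : finRotate (m + 1) (Fin.last m) = 0 := finRotate_last

theorem rotate_inv_zero : (finRotate (m + 1))⁻¹ 0 = Fin.last m := by
  rw [← rotate_last, perm_inv_apply]

theorem rotate_castSucc (i : Fin m) : finRotate (m + 1) i.castSucc = i.succ := by
  rw [finRotate_apply, Fin.coeSucc_eq_succ]

theorem rotate_inv_succ (i : Fin m) : (finRotate (m + 1))⁻¹ i.succ = i.castSucc := by
  rw [← rotate_castSucc, perm_inv_apply]

theorem single_comp_perm {α β : Type*} [DecidableEq α] [Zero β] (i : α) (b : β) (v : Perm α) :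
    (Pi.single i b : α → β) ∘ v = Pi.single (v⁻¹ i) b := by
  funext j
  simp only [Function.comp_apply, Pi.single_apply]
  congr 1
  exact propext ⟨fun h => by rw [← h, perm_inv_apply], fun h => by rw [h, perm_apply_inv]⟩

/-- σ shifts only the last variable, and the cycle sends the last index to 0; as `u` fixes 0, its
conjugate fixes the last index and leaves the shift in place. -/
theorem perm_mul_sigmaSub (u : Perm (Fin (m + 1))) (hu : u 0 = 0) :
    Subst.perm u * (sigmaSub : Subst ℓ (m + 1)) =
      sigmaSub * Subst.perm ((finRotate (m + 1))⁻¹ * u * finRotate (m + 1)) := by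
  have h : ((finRotate (m + 1))⁻¹ * u * finRotate (m + 1))⁻¹ (Fin.last m) = Fin.last m := by
    rw [Perm.inv_eq_iff_eq, Perm.mul_apply, Perm.mul_apply, rotate_last, hu, rotate_inv_zero]
  refine Subst.ext ?_ ?_ ?_
  · simp only [Subst.mul_w, Subst.perm_w, sigmaSub]
    group
  · simp only [Subst.mul_d, Subst.perm_d, sigmaSub, Subst.perm_w, single_comp_perm, h, add_zero]
    exact zero_add _
  · simp only [Subst.mul_χ, Subst.perm_χ, sigmaSub, Subst.perm_w, single_comp_perm, h, add_zero]
    exact zero_add _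

theorem sigmaSub_mul_tauSub : (sigmaSub * tauSub : Subst ℓ (m + 1)) = 1 := by
  refine Subst.ext ?_ ?_ ?_
  · simp [sigmaSub, tauSub]
  · simp only [Subst.mul_d, sigmaSub, tauSub, single_comp_perm, inv_inv, rotate_last,
      ← Pi.single_add, add_neg_cancel, Pi.single_zero, Subst.one_d]
  · simp only [Subst.mul_χ, sigmaSub, tauSub, single_comp_perm, inv_inv, rotate_last,
      ← Pi.single_add, add_neg_cancel, Pi.single_zero, Subst.one_χ]

theorem tauSub_mul_sigmaSub : (tauSub * sigmaSub : Subst ℓ (m + 1)) = 1 := by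
  refine Subst.ext ?_ ?_ ?_
  · simp [sigmaSub, tauSub]
  · simp only [Subst.mul_d, sigmaSub, tauSub, single_comp_perm, rotate_inv_zero,
      ← Pi.single_add, neg_add_cancel, Pi.single_zero, Subst.one_d]
  · simp only [Subst.mul_χ, sigmaSub, tauSub, single_comp_perm, rotate_inv_zero,
      ← Pi.single_add, neg_add_cancel, Pi.single_zero, Subst.one_χ]

theorem perm_mul_tauSub (u : Perm (Fin (m + 1))) (hu : u 0 = 0) :
    Subst.perm ((finRotate (m + 1))⁻¹ * u * finRotate (m + 1)) * (tauSub : Subst ℓ (m + 1)) =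
      tauSub * Subst.perm u := by
  have h := congrArg (fun x => tauSub * x * tauSub) (perm_mul_sigmaSub (ℓ := ℓ) u hu)
  simp only [mul_assoc, sigmaSub_mul_tauSub, mul_one] at h
  simp only [← mul_assoc, tauSub_mul_sigmaSub, one_mul] at h
  simp only [mul_assoc]
  exact h.symm

theorem rotate_zero_ne_zero (hm : m ≠ 0) : finRotate (m + 1) 0 ≠ 0 := by
  obtain ⟨m, rfl⟩ := Nat.exists_eq_succ_of_ne_zero hm
  rw [← Fin.castSucc_zero, rotate_castSucc]
  exact Fin.succ_ne_zero _

/-- Applying σ twice shifts the variables at c⁻¹(0) and c⁻²(0) by the same amount, so exchanging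
these two is harmless. -/
theorem swap_mul_sigmaSub_sq :
    Subst.perm (swap 0 (finRotate (m + 1) 0)) * (sigmaSub * sigmaSub : Subst ℓ (m + 1)) =
      sigmaSub * sigmaSub * Subst.perm (swap ((finRotate (m + 1))⁻¹ ((finRotate (m + 1))⁻¹ 0))
        ((finRotate (m + 1))⁻¹ 0)) := by
  have h (β : Type) [AddCommMonoid β] (b : β) :
      (Pi.single (Fin.last m) b ∘ finRotate (m + 1) + Pi.single (Fin.last m) b) ∘
        swap ((finRotate (m + 1))⁻¹ ((finRotate (m + 1))⁻¹ 0)) ((finRotate (m + 1))⁻¹ 0) =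
      Pi.single (Fin.last m) b ∘ finRotate (m + 1) + Pi.single (Fin.last m) b := by
    rw [single_comp_perm, rotate_inv_zero]
    change Pi.single _ b ∘ _ + Pi.single _ b ∘ _ = _
    rw [single_comp_perm, single_comp_perm, swap_inv, swap_apply_left, swap_apply_right]
    exact add_comm _ _
  refine Subst.ext ?_ ?_ ?_
  · have := swap_conj ((finRotate (m + 1))⁻¹ * (finRotate (m + 1))⁻¹) 0 (finRotate (m + 1) 0)
    simp only [Perm.mul_apply, perm_inv_apply] at this
    simp only [Subst.mul_w, Subst.perm_w, sigmaSub, ← this]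
    simp only [mul_inv_rev, inv_inv, mul_assoc, mul_inv_cancel_left]
  · simp only [Subst.mul_d, Subst.perm_d, sigmaSub, Subst.perm_w, h, add_zero]
    exact zero_add _
  · simp only [Subst.mul_χ, Subst.perm_χ, sigmaSub, Subst.perm_w, h, add_zero]
    exact zero_add _

theorem swap_mul_tauSub_sq :
    Subst.perm (swap ((finRotate (m + 1))⁻¹ ((finRotate (m + 1))⁻¹ 0))
        ((finRotate (m + 1))⁻¹ 0)) * (tauSub * tauSub : Subst ℓ (m + 1)) =
      tauSub * tauSub * Subst.perm (swap 0 (finRotate (m + 1) 0)) := by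
  have h := congrArg (fun x => tauSub * (tauSub * x * tauSub) * tauSub)
    (swap_mul_sigmaSub_sq (ℓ := ℓ) (m := m))
  have h' : (sigmaSub * (sigmaSub * (tauSub * tauSub)) : Subst ℓ (m + 1)) = 1 := by
    rw [← mul_assoc sigmaSub tauSub, sigmaSub_mul_tauSub, one_mul, sigmaSub_mul_tauSub]
  simp only [mul_assoc, h', mul_one] at h
  rw [← mul_assoc tauSub sigmaSub, tauSub_mul_sigmaSub, one_mul, ← mul_assoc tauSub sigmaSub,
    tauSub_mul_sigmaSub, one_mul] at h
  rw [mul_assoc, h]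

theorem lval_mul_sigmaSub (q : Subst ℓ (m + 1)) (i : Fin (m + 1)) :
    lval ħ (q * sigmaSub) i = lval ħ q (finRotate (m + 1) i) +
      if i = Fin.last m then algebraMap ℂ _ ħ else 0 := by
  have : (q * sigmaSub).val ħ i = q.val ħ (finRotate (m + 1) i) +
      if i = Fin.last m then MvPolynomial.C ħ else 0 := by
    simp only [Subst.val, Subst.mul_w, Subst.mul_d, sigmaSub, Perm.mul_apply, Pi.add_apply,
      Function.comp_apply, Pi.single_apply]
    split_ifs
    · push_cast; rw [mul_add, MvPolynomial.C_add, mul_one, add_assoc]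
    · simp
  rw [lval, this, map_add, lval]
  split_ifs
  · rfl
  · simp

theorem χ_mul_sigmaSub (q : Subst ℓ (m + 1)) (i : Fin (m + 1)) :
    (q * sigmaSub).χ i = q.χ (finRotate (m + 1) i) + if i = Fin.last m then 1 else 0 := by
  simp [sigmaSub, Pi.single_apply]

theorem lval_mul_tauSub (q : Subst ℓ (m + 1)) (i : Fin (m + 1)) :
    lval ħ (q * tauSub) i = lval ħ q ((finRotate (m + 1))⁻¹ i) -
      if i = 0 then algebraMap ℂ _ ħ else 0 := by
  have h := lval_mul_sigmaSub ħ (q * tauSub) ((finRotate (m + 1))⁻¹ i)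
  rw [mul_assoc, tauSub_mul_sigmaSub, mul_one, perm_apply_inv] at h
  rw [h, ← rotate_inv_zero]
  simp only [EmbeddingLike.apply_eq_iff_eq]
  ring

theorem χ_mul_tauSub (q : Subst ℓ (m + 1)) (i : Fin (m + 1)) :
    (q * tauSub).χ i = q.χ ((finRotate (m + 1))⁻¹ i) - if i = 0 then 1 else 0 := by
  have h := χ_mul_sigmaSub (q * tauSub) ((finRotate (m + 1))⁻¹ i)
  rw [mul_assoc, tauSub_mul_sigmaSub, mul_one, perm_apply_inv] at h
  rw [h, ← rotate_inv_zero]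
  simp only [EmbeddingLike.apply_eq_iff_eq]
  ring

/-- `∑_{0 < m < ℓ} c_m e(m t)`. -/
def charSum (t : ZMod ℓ) : ℂ := ∑ j ∈ Finset.Ico 1 ℓ, c j * e (j * t)

theorem ev_paramPoly {n : ℕ} (q : Subst ℓ n) (y : ZMod ℓ) (i : Fin n) :
    ev ħ e q (paramPoly c (e y) i) = MvPolynomial.C (charSum e c (y - q.χ i)) := by
  simp only [paramPoly, map_sum, charSum]
  refine Finset.sum_congr rfl fun j _ => ?_
  rw [ev_single, Subst.onU_C, MvPolynomial.smul_eq_C_mul, ← MvPolynomial.C_mul]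
  congr 1
  have : q.scal e (Pi.single i (j : ZMod ℓ)) = e (-(j * q.χ i)) := by
    simp [Subst.scal, Pi.single_apply, mul_comm]
  rw [this, ← AddChar.map_nsmul_eq_pow, nsmul_eq_mul, mul_sub, sub_eq_add_neg (_ * y),
    AddChar.map_add_eq_mul]
  ring

/-- The factor `U_1 - P(ζ⁻¹ T_1) + ħ`. -/
def sigmaFactor : PolyUT ℓ (m + 1) :=
  AddMonoidAlgebra.single 0 (MvPolynomial.X 0 + MvPolynomial.C ħ) -
    paramPoly (fun j => -c j) (e (-1)) 0

/-- The operator `σ`. -/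
def sigmaOp : Module.End ℂ (PolyUT ℓ (m + 1)) :=
  (LinearMap.mulLeft ℂ (sigmaFactor ħ e c)).comp (sigmaSub.act ħ e).toLinearMap

/-- The operator `τ`. -/
def tauOp : Module.End ℂ (PolyUT ℓ (m + 1)) := (tauSub.act ħ e).toLinearMap

/-- The value of the factor of `σ`. -/
def sigmaVal (q : Subst ℓ (m + 1)) : FractionRing (PolyU (m + 1)) :=
  lval ħ q 0 + algebraMap ℂ _ (ħ + charSum e c (-1 - q.χ 0))

theorem charSum_neg (t : ZMod ℓ) : charSum e (fun j => - c j) t = - charSum e c t := by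
  simp [charSum]

theorem row_sigmaFactor (q : Subst ℓ (m + 1)) :
    row ħ e q (sigmaFactor ħ e c) = sigmaVal ħ e c q := by
  rw [row_apply, sigmaFactor, map_sub, ev_paramPoly, ev_single, Subst.scal_zero, one_smul, map_add,
    Subst.onU_X, Subst.onU_C, charSum_neg, MvPolynomial.C_neg, sub_neg_eq_add, add_assoc,
    ← MvPolynomial.C_add, map_add]
  rfl

theorem row_sigmaOp (q : Subst ℓ (m + 1)) (f : PolyUT ℓ (m + 1)) :
    row ħ e q (sigmaOp ħ e c f) = sigmaVal ħ e c q * row ħ e (q * sigmaSub) f := by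
  rw [sigmaOp, LinearMap.comp_apply, LinearMap.mulLeft_apply, row_mul, row_sigmaFactor,
    AlgHom.toLinearMap_apply, row_act]

theorem row_tauOp (q : Subst ℓ (m + 1)) (f : PolyUT ℓ (m + 1)) :
    row ħ e q (tauOp ħ e f) = row ħ e (q * tauSub) f := by
  rw [tauOp, AlgHom.toLinearMap_apply, row_act]

theorem sigmaVal_mul_perm (q : Subst ℓ (m + 1)) (v : Perm (Fin (m + 1))) (hv : v 0 = 0) :
    sigmaVal ħ e c (q * Subst.perm v) = sigmaVal ħ e c q := by
  simp [sigmaVal, lval_mul_perm, hv]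

theorem pairVal_mul_sigmaSub (q : Subst ℓ (m + 1)) {i j : Fin (m + 1)}
    (hi : i ≠ Fin.last m) (hj : j ≠ Fin.last m) :
    pairVal (q * sigmaSub).χ i j =
      pairVal q.χ (finRotate (m + 1) i) (finRotate (m + 1) j) := by
  simp only [pairVal, χ_mul_sigmaSub, hi, hj, if_false, add_zero]

/-- Neither index is the last one, so σ shifts neither variable and the coefficient of the
transposition carries over; the factor of σ only sees index 0, which the rotated indices avoid. -/
theorem defSwap_sigma (he : Function.Injective e) {i j : Fin (m + 1)} (h : i ≠ j)
    (hi : i ≠ Fin.last m) (hj : j ≠ Fin.last m) {i' j' : Fin (m + 1)} (h' : i' ≠ j')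
    (hi' : finRotate (m + 1) i = i') (hj' : finRotate (m + 1) j = j') :
    defSwap ħ e k i' j' h' * sigmaOp ħ e c = sigmaOp ħ e c * defSwap ħ e k i j h := by
  subst hi' hj'
  refine end_ext ħ e he fun q f => ?_
  have h0 {x : Fin (m + 1)} (hx : x ≠ Fin.last m) : (0 : Fin (m + 1)) ≠ finRotate (m + 1) x := by
    rw [← rotate_last]
    exact fun h => hx ((finRotate (m + 1)).injective h).symm
  have hs : swap (finRotate (m + 1) i) (finRotate (m + 1) j) 0 = 0 :=
    swap_apply_of_ne_of_ne (h0 hi) (h0 hj)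
  have hr : rcoef ħ k (q * sigmaSub) i j =
      rcoef ħ k q (finRotate (m + 1) i) (finRotate (m + 1) j) := by
    simp only [rcoef, lval_mul_sigmaSub, pairVal_mul_sigmaSub q hi hj, hi, hj, if_false, add_zero]
  have hp := perm_mul_sigmaSub (ℓ := ℓ) (swap (finRotate (m + 1) i) (finRotate (m + 1) j)) hs
  have hconj : (finRotate (m + 1))⁻¹ * swap (finRotate (m + 1) i) (finRotate (m + 1) j) *
      finRotate (m + 1) = swap i j := by
    rw [← swap_conj]; group
  rw [hconj] at hp
  rw [Module.End.mul_apply, Module.End.mul_apply, row_defSwap ħ e he, row_sigmaOp, row_sigmaOp,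
    row_sigmaOp, row_defSwap ħ e he, sigmaVal_mul_perm ħ e c q _ hs, hr, mul_assoc q, mul_assoc q,
    hp]
  ring

theorem defSwap_tau (he : Function.Injective e) {i j : Fin (m + 1)} (h : i ≠ j)
    (hi : i ≠ Fin.last m) (hj : j ≠ Fin.last m) {i' j' : Fin (m + 1)} (h' : i' ≠ j')
    (hi' : finRotate (m + 1) i = i') (hj' : finRotate (m + 1) j = j') :
    defSwap ħ e k i j h * tauOp ħ e = tauOp ħ e * defSwap ħ e k i' j' h' := by
  subst hi' hj'
  refine end_ext ħ e he fun q f => ?_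
  have h0 {x : Fin (m + 1)} (hx : x ≠ Fin.last m) : (0 : Fin (m + 1)) ≠ finRotate (m + 1) x := by
    rw [← rotate_last]
    exact fun h => hx ((finRotate (m + 1)).injective h).symm
  have hs : swap (finRotate (m + 1) i) (finRotate (m + 1) j) 0 = 0 :=
    swap_apply_of_ne_of_ne (h0 hi) (h0 hj)
  have hr : rcoef ħ k q i j =
      rcoef ħ k (q * tauSub) (finRotate (m + 1) i) (finRotate (m + 1) j) := by
    simp only [rcoef, lval_mul_tauSub, pairVal, χ_mul_tauSub, (h0 hi).symm, (h0 hj).symm,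
      if_false, sub_zero, perm_inv_apply]
  have hp := perm_mul_tauSub (ℓ := ℓ) (swap (finRotate (m + 1) i) (finRotate (m + 1) j)) hs
  have hconj : (finRotate (m + 1))⁻¹ * swap (finRotate (m + 1) i) (finRotate (m + 1) j) *
      finRotate (m + 1) = swap i j := by
    rw [← swap_conj]; group
  rw [hconj] at hp
  rw [Module.End.mul_apply, Module.End.mul_apply, row_defSwap ħ e he, row_tauOp, row_tauOp,
    row_tauOp, row_defSwap ħ e he, hr, mul_assoc q, mul_assoc q, hp]

/-- The stabilizer of 0 is generated by the adjacent transpositions away from 0, and each of these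
is a rotated adjacent transposition of non-last indices, the case covered by `defSwap_sigma` and
`defSwap_tau`. -/
theorem stabilizer_induction (P : Perm (Fin (m + 1)) → Prop) (h1 : P 1)
    (hmul : ∀ u v, P u → P v → P (u * v))
    (hs : ∀ i j i' j' : Fin (m + 1), (i : ℕ) + 1 = j → i ≠ Fin.last m → j ≠ Fin.last m →
      finRotate (m + 1) i = i' → finRotate (m + 1) j = j' → (i' : ℕ) + 1 = j' → P (swap i' j'))
    (u : Perm (Fin (m + 1))) (hu : u 0 = 0) : P u := by
  obtain ⟨v, rfl⟩ := exists_fixZero u hu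
  cases m with
  | zero => rwa [Subsingleton.elim v 1, fixZero_one]
  | succ m =>
    have hv : v ∈ Submonoid.closure (Set.range fun i : Fin m => swap i.castSucc i.succ) := by
      rw [mclosure_swap_castSucc_succ]; trivial
    clear hu
    induction hv using Submonoid.closure_induction with
    | one => rwa [fixZero_one]
    | mul x y _ _ hx hy => rw [fixZero_mul]; exact hmul _ _ hx hy
    | mem x hx =>
      obtain ⟨i, rfl⟩ := hx
      rw [fixZero_swap]
      refine hs i.castSucc.castSucc i.succ.castSucc _ _ (by simp) ?_ ?_
        (rotate_castSucc _) (rotate_castSucc _) (by simp)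
      · exact (Fin.castSucc_lt_last _).ne
      · exact (Fin.castSucc_lt_last _).ne

theorem perm_sigma_aux (he : Function.Injective e) (u : Perm (Fin (m + 1))) (hu : u 0 = 0) :
    permRep ħ k e he u * sigmaOp ħ e c =
      sigmaOp ħ e c * permRep ħ k e he ((finRotate (m + 1))⁻¹ * u * finRotate (m + 1)) := by
  revert u
  refine stabilizer_induction _ (by simp) (fun u v hu hv => ?_)
    (fun i j i' j' hij hi hj hi' hj' hij' => ?_)
  · rw [map_mul, mul_assoc, hv, ← mul_assoc, hu, mul_assoc, ← map_mul]
    congr 2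
    group
  · have hconj : (finRotate (m + 1))⁻¹ * swap i' j' * finRotate (m + 1) = swap i j := by
      rw [← hi', ← hj', ← swap_conj]; group
    rw [hconj, permRep_swap_of_eq _ _ _ _ _ _ hij, permRep_swap_of_eq _ _ _ _ _ _ hij']
    exact defSwap_sigma ħ k e c he _ hi hj _ hi' hj'

theorem perm_tau_aux (he : Function.Injective e) (u : Perm (Fin (m + 1))) (hu : u 0 = 0) :
    permRep ħ k e he ((finRotate (m + 1))⁻¹ * u * finRotate (m + 1)) * tauOp ħ e =
      tauOp ħ e * permRep ħ k e he u := by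
  revert u
  refine stabilizer_induction _ (by simp) (fun u v hu hv => ?_)
    (fun i j i' j' hij hi hj hi' hj' hij' => ?_)
  · have : (finRotate (m + 1))⁻¹ * (u * v) * finRotate (m + 1) =
      ((finRotate (m + 1))⁻¹ * u * finRotate (m + 1)) *
        ((finRotate (m + 1))⁻¹ * v * finRotate (m + 1)) := by group
    rw [this, map_mul, mul_assoc, hv, ← mul_assoc, hu, mul_assoc, ← map_mul]
  · have hconj : (finRotate (m + 1))⁻¹ * swap i' j' * finRotate (m + 1) = swap i j := by
      rw [← hi', ← hj', ← swap_conj]; group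
    rw [hconj, permRep_swap_of_eq _ _ _ _ _ _ hij, permRep_swap_of_eq _ _ _ _ _ _ hij']
    exact defSwap_tau ħ k e he _ hi hj _ hi' hj'

end

end Cherednik


/-! ### Quadratic relations of σ and τ, and the mixed relation -/

namespace Cherednik

noncomputable section

open Equiv Equiv.Perm SymmetricPresentation CyclicPresentation

set_option linter.unusedSectionVars false

variable {ℓ m : ℕ} [NeZero ℓ] (ħ k : ℂ) (e : AddChar (ZMod ℓ) ℂ) (c : ℕ → ℂ)

theorem rotate_inv_last_add_one (hm : m ≠ 0) :
    (((finRotate (m + 1))⁻¹ (Fin.last m) : Fin (m + 1)) : ℕ) + 1 = (Fin.last m : Fin (m + 1)) := by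
  obtain ⟨m, rfl⟩ := Nat.exists_eq_succ_of_ne_zero hm
  rw [← Fin.succ_last, rotate_inv_succ]
  simp

theorem rotate_zero_val (hm : m ≠ 0) : ((0 : Fin (m + 1)) : ℕ) + 1 = finRotate (m + 1) 0 := by
  obtain ⟨m, rfl⟩ := Nat.exists_eq_succ_of_ne_zero hm
  rw [← Fin.castSucc_zero, rotate_castSucc]
  simp

theorem ne_zero_of_rotate (h : finRotate (m + 1) 0 ≠ 0) : m ≠ 0 := by
  rintro rfl
  exact h (Subsingleton.elim (α := Fin 1) _ _)

theorem rotate_inv_last_ne (hm : m ≠ 0) : (finRotate (m + 1))⁻¹ (Fin.last m) ≠ Fin.last m := by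
  intro h
  have := rotate_inv_last_add_one hm
  rw [h] at this
  omega

theorem χ_mul_perm {n : ℕ} (q : Subst ℓ n) (v : Perm (Fin n)) (i : Fin n) :
    (q * Subst.perm v).χ i = q.χ (v i) := by
  simp

theorem swap_sigma_aux (he : Function.Injective e) (h : finRotate (m + 1) 0 ≠ 0) :
    permRep ħ k e he (swap 0 (finRotate (m + 1) 0)) * (sigmaOp ħ e c * sigmaOp ħ e c) =
      (sigmaOp ħ e c * sigmaOp ħ e c) * permRep ħ k e he
        (swap ((finRotate (m + 1))⁻¹ ((finRotate (m + 1))⁻¹ 0)) ((finRotate (m + 1))⁻¹ 0)) := by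
  have hm := ne_zero_of_rotate h
  have hsub := swap_mul_sigmaSub_sq (ℓ := ℓ) (m := m)
  have hl := rotate_inv_last_ne hm
  have h0 : (0 : Fin (m + 1)) ≠ Fin.last m := fun h' => hm (by simpa using (congrArg Fin.val h').symm)
  rw [rotate_inv_zero] at *
  rw [permRep_swap_of_eq _ _ _ _ _ _ (rotate_zero_val hm),
    permRep_swap_of_eq _ _ _ _ _ _ (rotate_inv_last_add_one hm)]
  refine end_ext ħ e he fun q f => ?_
  -- σ² shifts both variables by ħ and both exponents by 1, so the differences that enter the
  -- coefficient do not change.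
  have hr : rcoef ħ k (q * sigmaSub * sigmaSub) ((finRotate (m + 1))⁻¹ (Fin.last m)) (Fin.last m) =
      rcoef ħ k q 0 (finRotate (m + 1) 0) := by
    simp only [rcoef, lval_mul_sigmaSub, pairVal, χ_mul_sigmaSub, perm_apply_inv, rotate_last,
      if_true, hl, if_false, h0, add_zero, add_sub_add_right_eq_sub, add_left_inj]
  simp only [Module.End.mul_apply, row_defSwap ħ e he, row_sigmaOp, hr]
  -- The two factors of σ² are one function of (U, χ) taken at index 0 and at the next index, so
  -- their product is symmetric under the transposition.
  have e1 (q : Subst ℓ (m + 1)) : sigmaVal ħ e c (q * sigmaSub) =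
      lval ħ q (finRotate (m + 1) 0) +
        algebraMap ℂ _ (ħ + charSum e c (-1 - q.χ (finRotate (m + 1) 0))) := by
    simp only [sigmaVal, lval_mul_sigmaSub, χ_mul_sigmaSub, h0, if_false, add_zero]
  have e2 : sigmaVal ħ e c (q * Subst.perm (swap 0 (finRotate (m + 1) 0))) =
      lval ħ q (finRotate (m + 1) 0) +
        algebraMap ℂ _ (ħ + charSum e c (-1 - q.χ (finRotate (m + 1) 0))) := by
    simp [sigmaVal, lval_mul_perm]
  have e3 : sigmaVal ħ e c (q * Subst.perm (swap 0 (finRotate (m + 1) 0)) * sigmaSub) =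
      sigmaVal ħ e c q := by
    rw [e1, lval_mul_perm, swap_apply_right]
    simp [sigmaVal]
  rw [e3, e2, e1, mul_assoc (q * _) sigmaSub sigmaSub, mul_assoc q, hsub]
  simp only [← mul_assoc]
  ring

theorem swap_tau_aux (he : Function.Injective e) (h : finRotate (m + 1) 0 ≠ 0) :
    permRep ħ k e he
        (swap ((finRotate (m + 1))⁻¹ ((finRotate (m + 1))⁻¹ 0)) ((finRotate (m + 1))⁻¹ 0)) *
          (tauOp ħ e * tauOp ħ e) =
      (tauOp ħ e * tauOp ħ e) * permRep ħ k e he (swap 0 (finRotate (m + 1) 0)) := by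
  have hm := ne_zero_of_rotate h
  have hsub := swap_mul_tauSub_sq (ℓ := ℓ) (m := m)
  have h0 : (0 : Fin (m + 1)) ≠ Fin.last m := fun h' => hm (by simpa using (congrArg Fin.val h').symm)
  rw [rotate_inv_zero] at *
  rw [permRep_swap_of_eq _ _ _ _ _ _ (rotate_zero_val hm),
    permRep_swap_of_eq _ _ _ _ _ _ (rotate_inv_last_add_one hm)]
  refine end_ext ħ e he fun q f => ?_
  have hr : rcoef ħ k (q * tauSub * tauSub) 0 (finRotate (m + 1) 0) =
      rcoef ħ k q ((finRotate (m + 1))⁻¹ (Fin.last m)) (Fin.last m) := by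
    simp only [rcoef, lval_mul_tauSub, pairVal, χ_mul_tauSub, perm_inv_apply, rotate_inv_zero,
      if_true, h, if_false, h0.symm, sub_zero, sub_sub_sub_cancel_right, sub_left_inj]
  simp only [Module.End.mul_apply, row_defSwap ħ e he, row_tauOp, hr]
  rw [mul_assoc (q * _) tauSub tauSub, mul_assoc q, hsub]
  simp only [← mul_assoc]

theorem isCyclicPair (he : Function.Injective e) :
    IsCyclicPair 0 (finRotate (m + 1)) (permRep ħ k e he) (sigmaOp ħ e c) (tauOp ħ e) where
  perm_sigma := perm_sigma_aux ħ k e c he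
  perm_tau := perm_tau_aux ħ k e he
  swap_sigma := swap_sigma_aux ħ k e c he
  swap_tau := swap_tau_aux ħ k e he

/-- `σ τ` and `τ σ` are multiplication operators. -/
theorem row_sigma_mul_tau (q : Subst ℓ (m + 1)) (f : PolyUT ℓ (m + 1)) :
    row ħ e q ((sigmaOp ħ e c * tauOp ħ e : Module.End ℂ (PolyUT ℓ (m + 1))) f) = sigmaVal ħ e c q * row ħ e q f := by
  rw [Module.End.mul_apply, row_sigmaOp, row_tauOp, mul_assoc, sigmaSub_mul_tauSub, mul_one]

theorem sigmaVal_mul_tauSub (q : Subst ℓ (m + 1)) :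
    sigmaVal ħ e c (q * tauSub) =
      lval ħ q (Fin.last m) + algebraMap ℂ _ (charSum e c (- q.χ (Fin.last m))) := by
  simp only [sigmaVal, lval_mul_tauSub, χ_mul_tauSub, if_true, rotate_inv_zero]
  rw [map_add, show -1 - (q.χ (Fin.last m) - 1) = - q.χ (Fin.last m) by ring]
  ring

theorem row_tau_mul_sigma (q : Subst ℓ (m + 1)) (f : PolyUT ℓ (m + 1)) :
    row ħ e q ((tauOp ħ e * sigmaOp ħ e c : Module.End ℂ (PolyUT ℓ (m + 1))) f) =
      (lval ħ q (Fin.last m) + algebraMap ℂ _ (charSum e c (- q.χ (Fin.last m)))) *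
        row ħ e q f := by
  rw [Module.End.mul_apply, row_tauOp, row_sigmaOp, mul_assoc, tauSub_mul_sigmaSub, mul_one,
    sigmaVal_mul_tauSub]

/-- Both products contain the same permuted row with the same coefficient, and these cancel. What
remains is -B/Δ times the difference of the values of στ and τσ, and on the support of B this
difference is exactly Δ. -/
theorem row_mixed (he : Function.Injective e) (h : finRotate (m + 1) 0 ≠ 0)
    (q : Subst ℓ (m + 1)) (f : PolyUT ℓ (m + 1)) :
    row ħ e q ((sigmaOp ħ e c * permRep ħ k e he
        (swap ((finRotate (m + 1))⁻¹ ((finRotate (m + 1))⁻¹ 0)) ((finRotate (m + 1))⁻¹ 0)) *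
          tauOp ħ e - tauOp ħ e * permRep ħ k e he (swap 0 (finRotate (m + 1) 0)) *
            sigmaOp ħ e c : Module.End ℂ (PolyUT ℓ (m + 1))) f) =
      algebraMap ℂ _ (-k * if q.χ 0 + 1 = q.χ (Fin.last m) then (ℓ : ℂ) else 0) *
        row ħ e q f := by
  have hm := ne_zero_of_rotate h
  have h0 : (0 : Fin (m + 1)) ≠ Fin.last m := fun h' => hm (by simpa using (congrArg Fin.val h').symm)
  have hsub : sigmaSub * Subst.perm (swap ((finRotate (m + 1))⁻¹ ((finRotate (m + 1))⁻¹ 0))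
        ((finRotate (m + 1))⁻¹ 0)) * (tauSub : Subst ℓ (m + 1)) =
      tauSub * Subst.perm (swap 0 (finRotate (m + 1) 0)) * sigmaSub := by
    have h1 := congrArg (fun x => tauSub * x * tauSub) (swap_mul_sigmaSub_sq (ℓ := ℓ) (m := m))
    simp only [mul_assoc, sigmaSub_mul_tauSub, mul_one] at h1
    rw [← mul_assoc tauSub sigmaSub, tauSub_mul_sigmaSub, one_mul] at h1
    rw [mul_assoc, mul_assoc, h1]
  have hs0 : sigmaVal ħ e c (q * tauSub * Subst.perm (swap 0 (finRotate (m + 1) 0))) =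
      sigmaVal ħ e c q := by
    simp only [sigmaVal, lval_mul_perm, swap_apply_left, lval_mul_tauSub, perm_inv_apply,
      h, if_false, sub_zero, χ_mul_perm, χ_mul_tauSub]
  rw [rotate_inv_zero] at *
  rw [permRep_swap_of_eq _ _ _ _ _ _ (rotate_zero_val hm),
    permRep_swap_of_eq _ _ _ _ _ _ (rotate_inv_last_add_one hm)]
  have hl := rotate_inv_last_ne hm
  set B := algebraMap ℂ (FractionRing (PolyU (m + 1)))
    (k * if q.χ 0 + 1 = q.χ (Fin.last m) then (ℓ : ℂ) else 0) with hB
  set Δ := lval ħ q 0 + algebraMap ℂ _ ħ - lval ħ q (Fin.last m) with hΔ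
  have hr : rcoef ħ k (q * sigmaSub) ((finRotate (m + 1))⁻¹ (Fin.last m)) (Fin.last m) = B / Δ := by
    simp only [rcoef, lval_mul_sigmaSub, pairVal, χ_mul_sigmaSub, perm_apply_inv, rotate_last,
      if_true, hl, if_false, add_zero, hB, hΔ, eq_comm]
  have hr' : rcoef ħ k (q * tauSub) 0 (finRotate (m + 1) 0) = B / Δ := by
    simp only [rcoef, lval_mul_tauSub, pairVal, χ_mul_tauSub, perm_inv_apply, rotate_inv_zero,
      if_true, h, if_false, sub_zero, hB, hΔ, sub_eq_iff_eq_add, sub_sub_eq_add_sub,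
      eq_comm (a := q.χ (Fin.last m))]
  have hΔ0 : Δ ≠ 0 := by
    have := lval_sub_ne_zero ħ (q * sigmaSub) hl
    rwa [lval_mul_sigmaSub, lval_mul_sigmaSub, perm_apply_inv, if_pos rfl, if_neg hl, rotate_last,
      add_zero] at this
  -- B is zero unless χ_0 + 1 = χ_last, and then the character sums of the two values coincide.
  have hdiff : B * (sigmaVal ħ e c q - sigmaVal ħ e c (q * tauSub)) = B * Δ := by
    rw [sigmaVal_mul_tauSub, sigmaVal, hB]
    split_ifs with hχ
    · rw [← hχ, show -1 - q.χ 0 = -(q.χ 0 + 1) by ring, map_add, hΔ]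
      ring
    · simp
  have hneg : algebraMap ℂ (FractionRing (PolyU (m + 1)))
      (-k * if q.χ 0 + 1 = q.χ (Fin.last m) then (ℓ : ℂ) else 0) = -B := by
    rw [neg_mul, map_neg]
  rw [LinearMap.sub_apply, map_sub, hneg]
  simp only [Module.End.mul_apply, row_defSwap ħ e he, row_sigmaOp, row_tauOp, hr, hr', hs0]
  simp only [mul_assoc] at hsub ⊢
  rw [hsub, sigmaSub_mul_tauSub, tauSub_mul_sigmaSub, mul_one]
  field_simp
  linear_combination (-row ħ e q f) * hdiff

end

end Cherednik


/-! ### Diagonal operators and the degenerate affine Hecke relations -/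

namespace Cherednik

noncomputable section

open Equiv Equiv.Perm SymmetricPresentation CyclicPresentation

set_option linter.unusedSectionVars false

variable {ℓ m : ℕ} [NeZero ℓ] (ħ k : ℂ) (e : AddChar (ZMod ℓ) ℂ) (c : ℕ → ℂ)

/-- Multiplication by `T^a`. -/
def diagOp {n : ℕ} (a : Fin n → ZMod ℓ) : Module.End ℂ (PolyUT ℓ n) :=
  LinearMap.mulLeft ℂ (AddMonoidAlgebra.single a 1)

/-- Multiplication by `U_i`. -/
def varOp {n : ℕ} (i : Fin n) : Module.End ℂ (PolyUT ℓ n) :=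
  LinearMap.mulLeft ℂ (AddMonoidAlgebra.single 0 (MvPolynomial.X i))

theorem diagOp_apply {n : ℕ} (a : Fin n → ZMod ℓ) (f : PolyUT ℓ n) :
    diagOp a f = AddMonoidAlgebra.single a 1 * f := rfl

theorem diagOp_add {n : ℕ} (a b : Fin n → ZMod ℓ) :
    (diagOp (a + b) : Module.End ℂ (PolyUT ℓ n)) = diagOp a * diagOp b := by
  refine LinearMap.ext fun f => ?_
  rw [Module.End.mul_apply, diagOp_apply, diagOp_apply, diagOp_apply, ← mul_assoc,
    AddMonoidAlgebra.single_mul_single, one_mul]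

theorem diagOp_zero {n : ℕ} : (diagOp 0 : Module.End ℂ (PolyUT ℓ n)) = 1 :=
  LinearMap.ext fun f => one_mul f

theorem row_diagOp {n : ℕ} (q : Subst ℓ n) (a : Fin n → ZMod ℓ) (f : PolyUT ℓ n) :
    row ħ e q (diagOp a f) = algebraMap ℂ _ (q.scal e a) * row ħ e q f := by
  rw [diagOp_apply, row_mul, row_apply ħ e q (AddMonoidAlgebra.single a 1), ev_single, map_one,
    Algebra.smul_def, mul_one]
  rfl

theorem row_varOp {n : ℕ} (q : Subst ℓ n) (i : Fin n) (f : PolyUT ℓ n) :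
    row ħ e q (varOp i f) = lval ħ q i * row ħ e q f := by
  rw [varOp, LinearMap.mulLeft_apply, row_mul, row_apply ħ e q (AddMonoidAlgebra.single _ _),
    ev_single, Subst.scal_zero, one_smul, Subst.onU_X]
  rfl

/-- The class function `∑_x T_i^x T_j^{-x}`, as an operator. -/
def pairOp {n : ℕ} (i j : Fin n) : Module.End ℂ (PolyUT ℓ n) :=
  ∑ x : ZMod ℓ, diagOp (Pi.single i x - Pi.single j x)

theorem pairOp_apply {n : ℕ} (i j : Fin n) (f : PolyUT ℓ n) : pairOp i j f = pairSum i j * f := by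
  rw [pairOp, pairSum_eq, LinearMap.sum_apply, Finset.sum_mul]
  rfl

theorem row_pairOp (he : Function.Injective e) {n : ℕ} (q : Subst ℓ n) (i j : Fin n)
    (f : PolyUT ℓ n) :
    row ħ e q (pairOp i j f) = algebraMap ℂ _ (pairVal q.χ i j) * row ħ e q f := by
  rw [pairOp_apply, row_mul, row_apply ħ e q (pairSum i j), ev_pairSum ħ e he]
  rfl

/-- The correction term of the transposition lives where χ_i = χ_j, and there T^a and T^{a∘(i j)}
have the same value. -/
theorem defSwap_mul_diagOp (he : Function.Injective e) {n : ℕ} {i j : Fin n} (h : i ≠ j)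
    (a : Fin n → ZMod ℓ) :
    defSwap ħ e k i j h * diagOp a = diagOp (a ∘ swap i j) * defSwap ħ e k i j h := by
  refine end_ext ħ e he fun q f => ?_
  have h1 : (q * Subst.perm (swap i j)).scal e a = q.scal e (a ∘ swap i j) := by
    rw [Subst.scal_mul, Subst.scal_perm, mul_one]
    rfl
  have h2 : rcoef ħ k q i j * algebraMap ℂ _ (q.scal e a) =
      rcoef ħ k q i j * algebraMap ℂ _ (q.scal e (a ∘ swap i j)) := by
    by_cases hχ : q.χ i = q.χ j
    · congr 2
      unfold Subst.scal
      congr 2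
      refine Fintype.sum_equiv (swap i j) _ _ fun x => ?_
      rw [Function.comp_apply, swap_apply_self]
      congr 1
      rw [swap_apply_def]
      split_ifs with hx hx
      · rw [hx, hχ]
      · rw [hx, hχ]
      · rfl
    · simp [rcoef, pairVal, hχ]
  simp only [Module.End.mul_apply, row_defSwap ħ e he, row_diagOp, h1]
  linear_combination (-row ħ e q f) * h2

/-- The degenerate affine Hecke relation: moving U_i across multiplies the correction coefficient by
U_j - U_i, which clears its denominator. -/
theorem defSwap_mul_varOp (he : Function.Injective e) {n : ℕ} {i j : Fin n} (h : i ≠ j) :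
    defSwap ħ e k i j h * varOp i =
      varOp j * defSwap ħ e k i j h + k • (pairOp i j : Module.End ℂ (PolyUT ℓ n)) := by
  refine end_ext ħ e he fun q f => ?_
  have h2 := lval_sub_ne_zero ħ q h
  rw [LinearMap.add_apply, map_add, LinearMap.smul_apply, map_smul]
  simp only [Module.End.mul_apply, row_defSwap ħ e he, row_varOp, row_pairOp ħ e he,
    lval_mul_perm, swap_apply_left, Algebra.smul_def, rcoef, map_mul]
  field_simp
  ring

theorem perm_induction (P : Perm (Fin (m + 1)) → Prop) (h1 : P 1)
    (hmul : ∀ u v, P u → P v → P (u * v)) (hs : ∀ i : Fin m, P (swap i.castSucc i.succ))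
    (u : Perm (Fin (m + 1))) : P u := by
  have hv : u ∈ Submonoid.closure (Set.range fun i : Fin m => swap i.castSucc i.succ) := by
    rw [mclosure_swap_castSucc_succ]; trivial
  induction hv using Submonoid.closure_induction with
  | one => exact h1
  | mul x y _ _ hx hy => exact hmul _ _ hx hy
  | mem x hx => obtain ⟨i, rfl⟩ := hx; exact hs i

theorem permRep_mul_diagOp (he : Function.Injective e) (w : Perm (Fin (m + 1)))
    (a : Fin (m + 1) → ZMod ℓ) :
    permRep ħ k e he w * diagOp a = diagOp (a ∘ ⇑(w⁻¹)) * permRep ħ k e he w := by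
  revert a
  refine perm_induction (fun w => ∀ a : Fin (m + 1) → ZMod ℓ, permRep ħ k e he w * diagOp a =
    diagOp (a ∘ ⇑(w⁻¹)) * permRep ħ k e he w) ?_ ?_ ?_ w
  · intro a; simp
  · intro u v hu hv a
    rw [map_mul, mul_assoc, hv, ← mul_assoc, hu, mul_assoc]
    rfl
  · intro i a
    rw [permRep_swap, swap_inv, defSwap_mul_diagOp ħ k e he]

theorem single_comp_inv {α β : Type*} [DecidableEq α] [Zero β] (w : Perm α) (i : α) (b : β) :
    (Pi.single i b : α → β) ∘ ⇑(w⁻¹) = Pi.single (w i) b := by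
  rw [single_comp_perm, inv_inv]

theorem single_sub_comp_inv {α β : Type*} [DecidableEq α] [AddGroup β] (w : Perm α) (i j : α)
    (a b : β) : (Pi.single i a - Pi.single j b : α → β) ∘ ⇑(w⁻¹) =
      Pi.single (w i) a - Pi.single (w j) b := by
  rw [← single_comp_inv, ← single_comp_inv w j]
  rfl

theorem permRep_mul_pairOp (he : Function.Injective e) (w : Perm (Fin (m + 1)))
    (i j : Fin (m + 1)) :
    permRep ħ k e he w * pairOp i j = pairOp (w i) (w j) * permRep ħ k e he w := by
  simp only [pairOp, Finset.mul_sum, Finset.sum_mul, permRep_mul_diagOp, single_sub_comp_inv]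

/-- The operator `x_j`. -/
def xRep (he : Function.Injective e) (j : Fin (m + 1)) : Module.End ℂ (PolyUT ℓ (m + 1)) :=
  xOp 0 (finRotate (m + 1)) (permRep ħ k e he) (sigmaOp ħ e c) j

/-- The operator `y_j`. -/
def yRep (he : Function.Injective e) (j : Fin (m + 1)) : Module.End ℂ (PolyUT ℓ (m + 1)) :=
  yOp 0 (finRotate (m + 1)) (permRep ħ k e he) (tauOp ħ e) j

theorem permRep_mul_xRep (he : Function.Injective e) (w : Perm (Fin (m + 1))) (j : Fin (m + 1)) :
    permRep ħ k e he w * xRep ħ k e c he j = xRep ħ k e c he (w j) * permRep ħ k e he w :=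
  (isCyclicPair ħ k e c he).perm_mul_x w j

theorem permRep_mul_yRep (he : Function.Injective e) (w : Perm (Fin (m + 1))) (j : Fin (m + 1)) :
    permRep ħ k e he w * yRep ħ k e he j = yRep ħ k e he (w j) * permRep ħ k e he w :=
  (isCyclicPair ħ k e (fun _ => 0) he).perm_mul_y w j

theorem xRep_comm (he : Function.Injective e) (i j : Fin (m + 1)) :
    xRep ħ k e c he i * xRep ħ k e c he j = xRep ħ k e c he j * xRep ħ k e c he i := by
  rcases eq_or_ne (finRotate (m + 1) 0) 0 with h | h
  · have hm : m = 0 := by by_contra hm; exact rotate_zero_ne_zero hm h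
    subst hm
    rw [Subsingleton.elim (α := Fin 1) i j]
  · exact (isCyclicPair ħ k e c he).x_comm h i j

theorem yRep_comm (he : Function.Injective e) (i j : Fin (m + 1)) :
    yRep ħ k e he i * yRep ħ k e he j = yRep ħ k e he j * yRep ħ k e he i := by
  rcases eq_or_ne (finRotate (m + 1) 0) 0 with h | h
  · have hm : m = 0 := by by_contra hm; exact rotate_zero_ne_zero hm h
    subst hm
    rw [Subsingleton.elim (α := Fin 1) i j]
  · exact (isCyclicPair ħ k e (fun _ => 0) he).y_comm h i j

theorem diagOp_mul_sigmaOp (he : Function.Injective e) (a : Fin (m + 1) → ZMod ℓ) :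
    diagOp a * sigmaOp ħ e c =
      e (a 0) • (sigmaOp ħ e c * diagOp (a ∘ finRotate (m + 1))) := by
  refine end_ext ħ e he fun q f => ?_
  have hs : (sigmaSub : Subst ℓ (m + 1)).scal e (a ∘ finRotate (m + 1)) = e (- a 0) := by
    simp [Subst.scal, sigmaSub, Pi.single_apply]
  have hs' : (a ∘ finRotate (m + 1)) ∘ ⇑(sigmaSub : Subst ℓ (m + 1)).w.symm = a := by
    funext x
    simp [sigmaSub]
  have h1 : (algebraMap ℂ (FractionRing (PolyU (m + 1))) (e (a 0))) *
      algebraMap ℂ (FractionRing (PolyU (m + 1))) (e (- a 0)) = 1 := by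
    rw [← map_mul, ← AddChar.map_add_eq_mul]; simp
  rw [LinearMap.smul_apply, map_smul, Algebra.smul_def]
  simp only [Module.End.mul_apply, row_diagOp, row_sigmaOp,
    Subst.scal_mul, hs, map_mul, hs']
  linear_combination (-(algebraMap ℂ (FractionRing (PolyU (m + 1)))) (Subst.scal e q a) *
    sigmaVal ħ e c q * row ħ e (q * sigmaSub) f) * h1

theorem diagOp_mul_tauOp (he : Function.Injective e) (a : Fin (m + 1) → ZMod ℓ) :
    diagOp a * tauOp ħ e =
      e (-(a (Fin.last m))) • (tauOp ħ e * diagOp (a ∘ ⇑(finRotate (m + 1))⁻¹)) := by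
  refine end_ext ħ e he fun q f => ?_
  have hs : (tauSub : Subst ℓ (m + 1)).scal e (a ∘ ⇑(finRotate (m + 1))⁻¹) =
      e (a (Fin.last m)) := by
    simp only [Subst.scal, tauSub, Pi.single_apply, Function.comp_apply, ite_mul, zero_mul,
      Finset.sum_ite_eq', Finset.mem_univ, if_true, rotate_inv_zero]
    simp
  have hs' : (a ∘ ⇑(finRotate (m + 1))⁻¹) ∘ ⇑(tauSub : Subst ℓ (m + 1)).w.symm = a := by
    funext x
    exact congrArg a ((finRotate (m + 1)).symm_apply_apply x)
  have h1 : (algebraMap ℂ (FractionRing (PolyU (m + 1))) (e (-(a (Fin.last m))))) *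
      algebraMap ℂ (FractionRing (PolyU (m + 1))) (e (a (Fin.last m))) = 1 := by
    rw [← map_mul, ← AddChar.map_add_eq_mul]; simp
  rw [LinearMap.smul_apply, map_smul, Algebra.smul_def]
  simp only [Module.End.mul_apply, row_diagOp, row_tauOp,
    Subst.scal_mul, hs, map_mul, hs']
  linear_combination (-(algebraMap ℂ (FractionRing (PolyU (m + 1)))) (Subst.scal e q a) *
    row ħ e (q * tauSub) f) * h1

theorem xRep_eq (he : Function.Injective e) (w : Perm (Fin (m + 1))) (j : Fin (m + 1)) :
    xRep ħ k e c he (w j) =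
      permRep ħ k e he w * xRep ħ k e c he j * permRep ħ k e he w⁻¹ := by
  rw [permRep_mul_xRep, mul_assoc, ← map_mul, mul_inv_cancel, map_one, mul_one]

theorem yRep_eq (he : Function.Injective e) (w : Perm (Fin (m + 1))) (j : Fin (m + 1)) :
    yRep ħ k e he (w j) =
      permRep ħ k e he w * yRep ħ k e he j * permRep ħ k e he w⁻¹ := by
  rw [permRep_mul_yRep, mul_assoc, ← map_mul, mul_inv_cancel, map_one, mul_one]

theorem xRep_zero (he : Function.Injective e) : xRep ħ k e c he (0 : Fin (m + 1)) =
    sigmaOp ħ e c * permRep ħ k e he (finRotate (m + 1))⁻¹ := by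
  rw [xRep, xOp, swap_self, show permRep ħ k e he (Equiv.refl _) = 1 from map_one _, one_mul, mul_one]

theorem yRep_last (he : Function.Injective e) : yRep ħ k e he (Fin.last m) =
    tauOp ħ e * permRep ħ k e he (finRotate (m + 1)) := by
  rw [yRep, yOp, rotate_inv_zero, swap_self, show permRep ħ k e he (Equiv.refl _) = 1 from map_one _, one_mul, mul_one]

theorem comp_swap_comp {α β : Type*} (a : α → β) (w : Perm α) : (a ∘ w) ∘ ⇑(w⁻¹) = a := by
  funext x
  exact congrArg a (perm_apply_inv w x)

theorem diagOp_mul_xRep (he : Function.Injective e) (a : Fin (m + 1) → ZMod ℓ)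
    (j : Fin (m + 1)) :
    diagOp a * xRep ħ k e c he j = e (a j) • (xRep ħ k e c he j * diagOp a) := by
  have h0 (a : Fin (m + 1) → ZMod ℓ) : diagOp a * xRep ħ k e c he 0 =
      e (a 0) • (xRep ħ k e c he 0 * diagOp a) := by
    rw [xRep_zero, ← mul_assoc, diagOp_mul_sigmaOp ħ e c he, smul_mul_assoc, mul_assoc, mul_assoc,
      permRep_mul_diagOp, inv_inv]
  have hw := permRep_mul_diagOp ħ k e he (swap 0 j) (a ∘ swap 0 j)
  rw [comp_swap_comp] at hw
  have hx := xRep_eq ħ k e c he (swap 0 j) 0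
  rw [swap_apply_left, swap_inv] at hx
  have hw' := permRep_mul_diagOp ħ k e he (swap 0 j) a
  rw [swap_inv] at hw'
  rw [hx, ← mul_assoc, ← mul_assoc, ← hw, mul_assoc (permRep ħ k e he _), h0, mul_smul_comm,
    smul_mul_assoc, Function.comp_apply, swap_apply_left]
  simp only [mul_assoc, hw']

theorem diagOp_mul_yRep (he : Function.Injective e) (a : Fin (m + 1) → ZMod ℓ)
    (j : Fin (m + 1)) :
    diagOp a * yRep ħ k e he j = e (-(a j)) • (yRep ħ k e he j * diagOp a) := by
  have h0 (a : Fin (m + 1) → ZMod ℓ) : diagOp a * yRep ħ k e he (Fin.last m) =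
      e (-(a (Fin.last m))) • (yRep ħ k e he (Fin.last m) * diagOp a) := by
    rw [yRep_last, ← mul_assoc, diagOp_mul_tauOp ħ e he, smul_mul_assoc, mul_assoc, mul_assoc,
      permRep_mul_diagOp]
  have hw := permRep_mul_diagOp ħ k e he (swap (Fin.last m) j) (a ∘ swap (Fin.last m) j)
  rw [comp_swap_comp] at hw
  have hx := yRep_eq ħ k e he (swap (Fin.last m) j) (Fin.last m)
  rw [swap_apply_left, swap_inv] at hx
  have hw' := permRep_mul_diagOp ħ k e he (swap (Fin.last m) j) a
  rw [swap_inv] at hw'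
  rw [hx, ← mul_assoc, ← mul_assoc, ← hw, mul_assoc (permRep ħ k e he _), h0, mul_smul_comm,
    smul_mul_assoc, Function.comp_apply, swap_apply_left]
  simp only [mul_assoc, hw']

end

end Cherednik


/-! ### The commutators as sums of group elements -/

namespace Cherednik

noncomputable section

open Equiv Equiv.Perm SymmetricPresentation CyclicPresentation

set_option linter.unusedSectionVars false

variable {ℓ m : ℕ} [NeZero ℓ] (ħ k : ℂ) (e : AddChar (ZMod ℓ) ℂ) (c : ℕ → ℂ)

theorem end_eq_sub_of_add_eq {V : Type*} [AddCommGroup V] [Module ℂ V] {A B C : Module.End ℂ V}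
    (h : A + C = B) : A = B - C := eq_sub_of_add_eq h

theorem end_add_eq_sub {V : Type*} [AddCommGroup V] [Module ℂ V] (A B C : Module.End ℂ V)
    (h : B + C = 0) : A + B = A - C := eq_sub_of_add_eq (by rw [add_assoc, h, add_zero])

/-- The operator `∑_j c_j T_i^j`. -/
def charOp {n : ℕ} (c : ℕ → ℂ) (i : Fin n) : Module.End ℂ (PolyUT ℓ n) :=
  ∑ j ∈ Finset.Ico 1 ℓ, c j • diagOp (Pi.single i (j : ZMod ℓ))

theorem scal_single {n : ℕ} (q : Subst ℓ n) (i : Fin n) (x : ZMod ℓ) :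
    q.scal e (Pi.single i x) = e (x * -q.χ i) := by
  simp only [Subst.scal, Pi.single_apply, mul_ite, mul_zero, Finset.sum_ite_eq', Finset.mem_univ,
    if_true]
  congr 1
  ring

theorem scal_single_sub {n : ℕ} (q : Subst ℓ n) (i j : Fin n) (x : ZMod ℓ) :
    q.scal e (Pi.single i x - Pi.single j x) = e (x * (q.χ j - q.χ i)) := by
  rw [sub_eq_add_neg, Subst.scal_add, ← Pi.single_neg, scal_single, scal_single,
    ← AddChar.map_add_eq_mul]
  congr 1
  ring

theorem row_charOp {n : ℕ} (q : Subst ℓ n) (i : Fin n) (f : PolyUT ℓ n) :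
    row ħ e q (charOp c i f) = algebraMap ℂ _ (charSum e c (- q.χ i)) * row ħ e q f := by
  simp only [charOp, LinearMap.sum_apply, map_sum, LinearMap.smul_apply, map_smul, row_diagOp,
    scal_single, charSum, Finset.sum_mul, map_mul, mul_assoc]
  simp only [Algebra.smul_def]

theorem charOp_add {n : ℕ} (c d : ℕ → ℂ) (i : Fin n) :
    (charOp (c + d) i : Module.End ℂ (PolyUT ℓ n)) = charOp c i + charOp d i := by
  simp only [charOp, Pi.add_apply, add_smul, Finset.sum_add_distrib]

theorem charOp_zero {n : ℕ} (i : Fin n) : (charOp 0 i : Module.End ℂ (PolyUT ℓ n)) = 0 := by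
  simp only [charOp, Pi.zero_apply, zero_smul, Finset.sum_const_zero]

theorem charSum_shift (t : ZMod ℓ) :
    charSum e (fun j => c j * e (-(j : ZMod ℓ))) t = charSum e c (-1 + t) := by
  unfold charSum
  refine Finset.sum_congr rfl fun j _ => ?_
  rw [mul_assoc, ← AddChar.map_add_eq_mul]
  congr 2
  ring

theorem permRep_mul_charOp (he : Function.Injective e) (w : Perm (Fin (m + 1)))
    (i : Fin (m + 1)) :
    permRep ħ k e he w * charOp c i = charOp c (w i) * permRep ħ k e he w := by
  simp only [charOp, Finset.mul_sum, Finset.sum_mul, mul_smul_comm, smul_mul_assoc,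
    permRep_mul_diagOp, single_comp_inv]

/-- The operator `∑_x e(-x) T_i^x T_j^{-x}`. -/
def twistedPairOp {n : ℕ} (i j : Fin n) : Module.End ℂ (PolyUT ℓ n) :=
  ∑ x : ZMod ℓ, e (-x) • diagOp (Pi.single i x - Pi.single j x)

/-- The weights e(-x) move the support of the character sum from χ_i = χ_j to χ_i + 1 = χ_j, the
condition found in `row_mixed`. -/
theorem row_twistedPairOp (he : Function.Injective e) {n : ℕ} (q : Subst ℓ n) (i j : Fin n)
    (f : PolyUT ℓ n) :
    row ħ e q (twistedPairOp e i j f) =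
      algebraMap ℂ _ (if q.χ i + 1 = q.χ j then (ℓ : ℂ) else 0) * row ħ e q f := by
  have h : (if q.χ i + 1 = q.χ j then (ℓ : ℂ) else 0) =
      if q.χ j - q.χ i - 1 = 0 then (ℓ : ℂ) else 0 := by
    congr 1
    rw [eq_iff_iff, sub_sub, sub_eq_zero]
    exact eq_comm
  rw [h, ← sum_char_mul e he]
  simp only [twistedPairOp, LinearMap.sum_apply, map_sum, LinearMap.smul_apply, map_smul,
    row_diagOp, scal_single_sub, Finset.sum_mul]
  refine Finset.sum_congr rfl fun x _ => ?_
  rw [Algebra.smul_def, ← mul_assoc, ← map_mul, ← AddChar.map_add_eq_mul]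
  congr 3
  ring

theorem permRep_mul_twistedPairOp (he : Function.Injective e) (w : Perm (Fin (m + 1)))
    (i j : Fin (m + 1)) :
    permRep ħ k e he w * twistedPairOp e i j =
      twistedPairOp e (w i) (w j) * permRep ħ k e he w := by
  simp only [twistedPairOp, Finset.mul_sum, Finset.sum_mul, mul_smul_comm, smul_mul_assoc,
    permRep_mul_diagOp, single_sub_comp_inv]

theorem pairOp_comm {n : ℕ} (i j : Fin n) :
    (pairOp i j : Module.End ℂ (PolyUT ℓ n)) = pairOp j i := by
  unfold pairOp
  refine Fintype.sum_equiv (Equiv.neg _) _ _ fun x => ?_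
  simp only [Equiv.neg_apply, Pi.single_neg]
  congr 1
  abel

/-- The diagonal part is a difference of two character sums: στ carries the weights c_j e(-j),
because σ involves ζ⁻¹T_1, and τσ carries the weights c_j. -/
theorem xRep_mul_yRep_self (he : Function.Injective e) (i : Fin (m + 1)) :
    xRep ħ k e c he i * yRep ħ k e he i - yRep ħ k e he i * xRep ħ k e c he i =
      algebraMap ℂ _ ħ + charOp (fun j => c j * (e (-(j : ZMod ℓ)) - 1)) i +
        k • ∑ l ∈ Finset.univ.erase i, pairOp i l * permRep ħ k e he (swap i l) := by
  have hc : (charOp (fun j => c j * e (-(j : ZMod ℓ))) i : Module.End ℂ (PolyUT ℓ (m + 1))) =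
      charOp (fun j => c j * (e (-(j : ZMod ℓ)) - 1)) i + charOp c i := by
    rw [← charOp_add]
    congr 1
    funext j
    simp only [Pi.add_apply]
    ring
  have hsub : (charOp (fun j => c j * (e (-(j : ZMod ℓ)) - 1)) i :
      Module.End ℂ (PolyUT ℓ (m + 1))) =
      charOp (fun j => c j * e (-(j : ZMod ℓ))) i - charOp c i := end_eq_sub_of_add_eq hc.symm
  rw [hsub]
  refine (isCyclicPair ħ k e c he).x_mul_y_self (U := varOp) (fun i => ?_)
    (permRep_mul_pairOp ħ k e he) pairOp_comm (permRep_mul_charOp ħ k e c he)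
    (permRep_mul_charOp ħ k e _ he) ?_ ?_ i
  · rw [permRep_swap]
    exact defSwap_mul_varOp ħ k e he _
  · refine end_ext ħ e he fun q f => ?_
    rw [row_sigma_mul_tau, LinearMap.add_apply, LinearMap.add_apply, map_add, map_add, row_varOp,
      row_charOp, charSum_shift, Module.algebraMap_end_apply, map_smul, Algebra.smul_def, sigmaVal,
      map_add, sub_eq_add_neg]
    ring
  · refine end_ext ħ e he fun q f => ?_
    rw [row_tau_mul_sigma, LinearMap.add_apply, map_add, row_varOp, row_charOp]
    ring

theorem xRep_mul_yRep_of_ne (he : Function.Injective e) {i j : Fin (m + 1)} (hij : i ≠ j) :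
    xRep ħ k e c he i * yRep ħ k e he j - yRep ħ k e he j * xRep ħ k e c he i =
      (-k) • twistedPairOp e i j * permRep ħ k e he (swap i j) := by
  refine (isCyclicPair ħ k e c he).x_mul_y_of_ne (N := fun i j => (-k) • twistedPairOp e i j)
    (fun w i j => ?_) (fun hm => ?_) hij
  · simp only [mul_smul_comm, smul_mul_assoc, permRep_mul_twistedPairOp]
  · have hm' : finRotate (m + 1) 0 ≠ 0 := by
      refine rotate_zero_ne_zero ?_
      rintro rfl
      exact hm rfl
    refine end_ext ħ e he fun q f => ?_
    refine (row_mixed ħ k e c he hm' q f).trans ?_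
    rw [LinearMap.smul_apply, map_smul, row_twistedPairOp ħ e he, Algebra.smul_def, map_mul]
    ring

end

end Cherednik


/-! ### Reflections among monomial matrices -/

namespace Cherednik

noncomputable section

open Equiv Equiv.Perm SymmetricPresentation CyclicPresentation

set_option linter.unusedSectionVars false

/-- A square matrix of rank one is a product of a column and a row. -/
theorem exists_vecMulVec_of_rank_eq_one {n : ℕ} {M : Matrix (Fin n) (Fin n) ℂ} (h : M.rank = 1) :
    ∃ v c : Fin n → ℂ, ∀ i j, M i j = v i * c j := by
  obtain ⟨v, -, hv⟩ := finrank_eq_one_iff'.1 h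
  have : ∀ j, ∃ c : ℂ, ∀ i, M i j = v.1 i * c := fun j => by
    obtain ⟨c, hc⟩ := hv ⟨M.mulVecLin (Pi.single j 1), _, rfl⟩
    refine ⟨c, fun i => ?_⟩
    have := congrFun (congrArg Subtype.val hc) i
    simp only [Submodule.coe_smul, Pi.smul_apply, smul_eq_mul, Matrix.mulVecLin_apply,
      Matrix.mulVec_single_one, Matrix.col_apply] at this
    rw [← this, mul_comm]
  choose c hc using this
  exact ⟨v.1, c, fun i j => hc j i⟩

theorem rank_eq_one_of_eq_mul {n : ℕ} {M : Matrix (Fin n) (Fin n) ℂ} {v c : Fin n → ℂ}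
    (h : ∀ i j, M i j = v i * c j) (hM : M ≠ 0) : M.rank = 1 := by
  have hM' : M = Matrix.vecMulVec v c := by
    ext i j
    exact h i j
  refine le_antisymm (hM' ▸ Matrix.rank_vecMulVec_le v c) (Nat.one_le_iff_ne_zero.2 fun h0 => hM ?_)
  rw [Matrix.rank, Submodule.finrank_eq_zero, LinearMap.range_eq_bot] at h0
  ext i j
  have := congrFun (LinearMap.congr_fun h0 (Pi.single j 1)) i
  simpa using this

variable {ℓ n : ℕ} [NeZero ℓ] (e : AddChar (ZMod ℓ) ℂ)

/-- The monomial matrix with entry `e(α_{w(j)})` in position `(w(j), j)`. -/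
def monomial (α : Fin n → ZMod ℓ) (w : Perm (Fin n)) : Matrix (Fin n) (Fin n) ℂ :=
  monomialMatrix (fun i => e (α i)) w

theorem monomial_apply (α : Fin n → ZMod ℓ) (w : Perm (Fin n)) (i j : Fin n) :
    monomial e α w i j = if i = w j then e (α i) else 0 := rfl

theorem char_ne_zero (x : ZMod ℓ) : e x ≠ 0 := by
  intro h
  have : e (x + -x) = 1 := by simp
  rw [AddChar.map_add_eq_mul, h, zero_mul] at this
  exact zero_ne_one this

theorem char_eq_one (he : Function.Injective e) {x : ZMod ℓ} : e x = 1 ↔ x = 0 :=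
  ⟨fun h => he (h.trans e.map_zero_eq_one.symm), fun h => by rw [h, e.map_zero_eq_one]⟩

theorem monomial_injective (he : Function.Injective e) {α β : Fin n → ZMod ℓ}
    {v w : Perm (Fin n)} (h : monomial e α v = monomial e β w) : α = β ∧ v = w := by
  have hvw : v = w := by
    ext j
    have := congrFun (congrFun h (v j)) j
    rw [monomial_apply, monomial_apply, if_pos rfl] at this
    by_contra hne
    rw [if_neg (fun h' => hne (congrArg Fin.val h'))] at this
    exact char_ne_zero e _ this
  subst hvw
  refine ⟨funext fun i => he ?_, rfl⟩
  have := congrFun (congrFun h i) (v⁻¹ i)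
  rw [monomial_apply, monomial_apply, if_pos (by rw [perm_apply_inv]),
    if_pos (by rw [perm_apply_inv])] at this
  exact this

theorem monomial_mul (α β : Fin n → ZMod ℓ) (v w : Perm (Fin n)) :
    monomial e α v * monomial e β w = monomial e (α + β ∘ ⇑v⁻¹) (v * w) := by
  unfold monomial
  rw [monomialMatrix_mul]
  congr 1
  funext i
  rw [Pi.add_apply, AddChar.map_add_eq_mul]
  rfl

theorem monomial_one : monomial e (0 : Fin n → ZMod ℓ) 1 = 1 := by
  rw [← monomialMatrix_one]
  unfold monomial
  congr 1
  funext i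
  simp

theorem monomial_diag (α : Fin n → ZMod ℓ) :
    monomial e α 1 = Matrix.diagonal fun i => e (α i) := by
  ext i j
  rw [monomial_apply, Matrix.diagonal_apply, Perm.one_apply]

theorem isDiag_monomial (α : Fin n → ZMod ℓ) (w : Perm (Fin n)) :
    (monomial e α w).IsDiag ↔ w = 1 := by
  constructor
  · intro h
    ext j
    by_contra hne
    have := h (i := w j) (j := j) (fun h' => hne (by rw [h']; rfl))
    change monomial e α w (w j) j = 0 at this
    rw [monomial_apply, if_pos rfl] at this
    exact char_ne_zero e _ this
  · rintro rfl
    rw [monomial_diag]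
    exact Matrix.isDiag_diagonal _

/-- With M - 1 written as a column times a row, one nonzero column forces strong vanishing
elsewhere. If M is diagonal, only one diagonal entry can differ from 1; if `w` moves `a`, everything
is concentrated on `a` and `w a`. -/
theorem rank_monomial_sub_one (he : Function.Injective e) (α : Fin n → ZMod ℓ)
    (w : Perm (Fin n)) :
    (monomial e α w - 1).rank = 1 ↔
      (w = 1 ∧ ∃ a x, x ≠ 0 ∧ α = Pi.single a x) ∨
        ∃ a b x, a ≠ b ∧ w = swap a b ∧ α = Pi.single a x - Pi.single b x := by
  have hent (α : Fin n → ZMod ℓ) (w : Perm (Fin n)) (i j : Fin n) :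
      (monomial e α w - 1) i j = (if i = w j then e (α i) else 0) - if i = j then 1 else 0 := by
    rw [Matrix.sub_apply, Matrix.one_apply, monomial_apply]
  constructor
  · intro h
    obtain ⟨v, c, hvc⟩ := exists_vecMulVec_of_rank_eq_one h
    have hM : monomial e α w - 1 ≠ 0 := by
      intro h0
      rw [h0, Matrix.rank_zero] at h
      exact zero_ne_one h
    simp only [hent] at hvc
    by_cases hw : w = 1
    · left
      subst hw
      have hex : ∃ a, α a ≠ 0 := by
        by_contra! h0
        apply hM
        rw [show α = 0 from funext h0, monomial_one, sub_self]
      obtain ⟨a, ha⟩ := hex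
      refine ⟨rfl, a, α a, ha, funext fun i => ?_⟩
      rcases eq_or_ne i a with rfl | hi
      · simp
      rw [Pi.single_eq_of_ne hi]
      have h1 := hvc a a
      have h2 := hvc i a
      have h3 := hvc i i
      rw [if_neg (show i ≠ (1 : Perm (Fin n)) a from hi), if_neg hi, sub_zero] at h2
      rw [if_pos (show a = (1 : Perm (Fin n)) a from rfl), if_pos rfl] at h1
      rw [if_pos (show i = (1 : Perm (Fin n)) i from rfl), if_pos rfl] at h3
      have hca : c a ≠ 0 := by
        intro h0
        rw [h0, mul_zero, sub_eq_zero] at h1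
        exact ha ((char_eq_one e he).1 h1)
      rcases mul_eq_zero.1 h2.symm with h0 | h0
      · rw [h0, zero_mul, sub_eq_zero] at h3
        exact (char_eq_one e he).1 h3
      · exact absurd h0 hca
    · right
      obtain ⟨a, ha⟩ : ∃ a, w a ≠ a := by
        by_contra! h0
        exact hw (Equiv.ext h0)
      set b := w a with hb
      have hwb : w b ≠ b := fun h0 => ha (w.injective h0)
      have hba := hvc b a
      have haa := hvc a a
      have hbb := hvc b b
      have hab := hvc a b
      rw [if_pos hb, if_neg ha, sub_zero] at hba
      rw [if_neg (fun h0 => ha (hb.trans h0.symm)), if_pos rfl, zero_sub] at haa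
      rw [if_neg (fun h0 => hwb h0.symm), if_pos rfl, zero_sub] at hbb
      have hca : c a ≠ 0 := by rintro h0; simp [h0] at haa
      have hcb : c b ≠ 0 := by rintro h0; simp [h0] at hbb
      have hva : v a ≠ 0 := by rintro h0; simp [h0] at haa
      -- The entry of M - 1 at (a, b) is `v a * c b`, a product of nonzero numbers, so M has a
      -- nonzero entry there.
      have hwb' : a = w b := by
        by_contra h0
        rw [if_neg h0, if_neg ha.symm, sub_zero] at hab
        exact mul_ne_zero hva hcb hab.symm
      rw [if_pos hwb', if_neg ha.symm, sub_zero] at hab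
      -- The 2 × 2 minor of M - 1 on the indices a, b vanishes.
      have hsum : α a + α b = 0 := by
        rw [← char_eq_one e he, AddChar.map_add_eq_mul, hab, hba]
        linear_combination (-(v b * c b)) * haa + hbb
      -- Column `a` has zero entry in row `i` while `c a ≠ 0`, so `v i = 0` and the whole row `i` of
      -- M - 1 is zero.
      have hother (i : Fin n) (hia : i ≠ a) (hib : i ≠ b) : w i = i ∧ α i = 0 := by
        have h1 := hvc i a
        rw [if_neg hib, if_neg hia, sub_zero] at h1
        have hvi : v i = 0 := (mul_eq_zero.1 h1.symm).resolve_right hca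
        have h2 := hvc i i
        rw [hvi, zero_mul, if_pos rfl] at h2
        by_cases h3 : i = w i
        · rw [if_pos h3, sub_eq_zero, char_eq_one e he] at h2
          exact ⟨h3.symm, h2⟩
        · rw [if_neg h3] at h2
          norm_num at h2
      refine ⟨a, b, α a, ha.symm, ?_, ?_⟩
      · ext i
        congr 1
        rcases eq_or_ne i a with rfl | hia
        · rw [swap_apply_left]
        rcases eq_or_ne i b with rfl | hib
        · rw [swap_apply_right, ← hwb']
        rw [swap_apply_of_ne_of_ne hia hib, (hother i hia hib).1]
      · funext i
        rw [Pi.sub_apply]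
        rcases eq_or_ne i a with rfl | hia
        · rw [Pi.single_eq_same, Pi.single_eq_of_ne ha.symm, sub_zero]
        rcases eq_or_ne i b with rfl | hib
        · rw [Pi.single_eq_same, Pi.single_eq_of_ne hia, zero_sub]
          exact eq_neg_of_add_eq_zero_right hsum
        rw [Pi.single_eq_of_ne hia, Pi.single_eq_of_ne hib, (hother i hia hib).2, sub_zero]
  · rintro (⟨rfl, a, x, hx, rfl⟩ | ⟨a, b, x, hab, rfl, rfl⟩)
    · refine rank_eq_one_of_eq_mul (v := Pi.single a (e x - 1)) (c := Pi.single a 1)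
        (fun i j => ?_) fun h0 => ?_
      · rw [hent, Perm.one_apply]
        rcases eq_or_ne i j with rfl | hij
        · rcases eq_or_ne i a with rfl | hia <;> simp [*]
        · rcases eq_or_ne i a with rfl | hia
          · simp [hij, hij.symm]
          · simp [*]
      · have := congrFun (congrFun h0 a) a
        rw [hent, Perm.one_apply, if_pos rfl, if_pos rfl, Pi.single_eq_same] at this
        exact hx ((char_eq_one e he).1 (sub_eq_zero.1 this))
    -- The only nonzero block of M - 1 has rows (-1, e(x)) and (e(-x), -1), which is the product of
    -- this column and this row.
    · refine rank_eq_one_of_eq_mul (v := Pi.single a 1 - Pi.single b (e (-x)))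
        (c := Pi.single b (e x) - Pi.single a 1) (fun i j => ?_) fun h0 => ?_
      · have h1 : e (-x) * e x = 1 := by rw [← AddChar.map_add_eq_mul]; simp
        rw [hent]
        simp only [Pi.sub_apply, Pi.single_apply, swap_apply_def]
        rcases eq_or_ne i a with rfl | hia
        · rcases eq_or_ne j i with rfl | hja
          · simp [hab]
          · rcases eq_or_ne j b with rfl | hjb <;> simp [*, hja.symm]
        · rcases eq_or_ne i b with rfl | hib
          · rcases eq_or_ne j i with rfl | hjb
            · simp [hia, h1]
            · rcases eq_or_ne j a with rfl | hja <;> simp [*, hjb.symm]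
          · rcases eq_or_ne i j with rfl | hij
            · simp [*]
            · rcases eq_or_ne j a with rfl | hja
              · simp [*]
              · rcases eq_or_ne j b with rfl | hjb <;> simp [*]
      · have := congrFun (congrFun h0 b) a
        rw [hent, swap_apply_left, if_pos rfl, if_neg hab.symm, sub_zero] at this
        exact char_ne_zero e _ this

end

end Cherednik


/-! ### Exponents and permutations as coordinates on G(ℓ, p, n) -/

namespace Cherednik

noncomputable section

open Equiv Equiv.Perm SymmetricPresentation CyclicPresentation

set_option linter.unusedSectionVars false

section Group

variable {ℓ n : ℕ} [NeZero ℓ] (p : ℕ) (e : AddChar (ZMod ℓ) ℂ)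

theorem pow_char (j : ℕ) (x : ZMod ℓ) : e x ^ j = e (j * x) := by
  rw [← nsmul_eq_mul, AddChar.map_nsmul_eq_pow]

theorem char_sum (α : Fin n → ZMod ℓ) : e (∑ i, α i) = ∏ i, e (α i) := by
  have := map_prod e.toMonoidHom (fun i => Multiplicative.ofAdd (α i)) Finset.univ
  exact this

/-- This translates the condition that the product of the entries be an (ℓ/p)-th root of unity into
divisibility by p of the sum of the exponents. -/
theorem dvd_iff_mul_eq_zero (hp : p ∣ ℓ) (x : ZMod ℓ) :
    (p : ZMod ℓ) ∣ x ↔ ((ℓ / p : ℕ) : ZMod ℓ) * x = 0 := by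
  obtain ⟨r, hr⟩ := hp
  have hℓ := NeZero.ne ℓ
  have hp0 : p ≠ 0 := by rintro rfl; simp at hr; exact hℓ hr
  have hr0 : r ≠ 0 := by rintro rfl; simp at hr; exact hℓ hr
  have hdiv : ℓ / p = r := by rw [hr, Nat.mul_div_cancel_left _ (Nat.pos_of_ne_zero hp0)]
  rw [hdiv]
  constructor
  · rintro ⟨y, rfl⟩
    rw [← mul_assoc, ← Nat.cast_mul, mul_comm r, ← hr, ZMod.natCast_self, zero_mul]
  · intro h
    rw [← ZMod.natCast_zmod_val x, ← Nat.cast_mul, ZMod.natCast_eq_zero_iff] at h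
    have h' : r * p ∣ r * x.val := by rwa [mul_comm r p, ← hr]
    obtain ⟨y, hy⟩ := Nat.dvd_of_mul_dvd_mul_left (Nat.pos_of_ne_zero hr0) h'
    refine ⟨y, ?_⟩
    rw [← Nat.cast_mul, ← hy, ZMod.natCast_zmod_val]

theorem monomial_mul_inv (α : Fin n → ZMod ℓ) (w : Perm (Fin n)) :
    monomial e α w * monomial e (-α ∘ w) w⁻¹ = 1 := by
  rw [monomial_mul, mul_inv_cancel, ← monomial_one e]
  congr 1
  funext i
  simp

theorem monomial_inv_mul (α : Fin n → ZMod ℓ) (w : Perm (Fin n)) :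
    monomial e (-α ∘ w) w⁻¹ * monomial e α w = 1 := by
  rw [monomial_mul, inv_mul_cancel, ← monomial_one e]
  congr 1
  funext i
  simp

/-- The element of `G(ℓ, p, n)` with monomial matrix given by `α` and `w`. -/
def monomialElt (hp : p ∣ ℓ) (α : Fin n → ZMod ℓ) (w : Perm (Fin n))
    (h : (p : ZMod ℓ) ∣ ∑ i, α i) : complexReflectionGroup ℓ p n :=
  ⟨⟨monomial e α w, monomial e (-α ∘ w) w⁻¹, monomial_mul_inv e α w, monomial_inv_mul e α w⟩,
    fun i => Units.mk0 (e (α i)) (char_ne_zero e _), w, fun i => Units.ext (by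
      rw [Units.val_pow_eq_pow_val, Units.val_mk0, pow_char, ZMod.natCast_self, zero_mul,
        e.map_zero_eq_one, Units.val_one]), Units.ext (by
      rw [Units.val_pow_eq_pow_val, Units.coe_prod, Units.val_one]
      simp only [Units.val_mk0]
      rw [← char_sum, pow_char, (dvd_iff_mul_eq_zero p hp _).1 h,
        e.map_zero_eq_one]), rfl⟩

/-- The matrix of an element of `G(ℓ, p, n)`. -/
abbrev mat (g : complexReflectionGroup ℓ p n) : Matrix (Fin n) (Fin n) ℂ :=
  ((g : GL (Fin n) ℂ) : Matrix (Fin n) (Fin n) ℂ)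

theorem exists_monomial (hp : p ∣ ℓ) (he : Function.Injective e)
    (g : complexReflectionGroup ℓ p n) :
    ∃ αw : (Fin n → ZMod ℓ) × Perm (Fin n), mat p g = monomial e αw.1 αw.2 ∧
      (p : ZMod ℓ) ∣ ∑ i, αw.1 i := by
  obtain ⟨g, a, w, ha, ha', hg⟩ := g
  have hζ : IsPrimitiveRoot (e 1) ℓ := by
    refine IsPrimitiveRoot.iff_def _ _ |>.2 ⟨?_, fun j hj => ?_⟩
    · rw [pow_char, ZMod.natCast_self, zero_mul, e.map_zero_eq_one]
    · rw [pow_char, mul_one, char_eq_one e he, ZMod.natCast_eq_zero_iff] at hj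
      exact hj
  have hx (i : Fin n) : ∃ x : ZMod ℓ, e x = a i := by
    have h1 : (a i : ℂ) ^ ℓ = 1 := by
      have := congrArg Units.val (ha i)
      rwa [Units.val_pow_eq_pow_val, Units.val_one] at this
    obtain ⟨j, -, hj⟩ := hζ.eq_pow_of_pow_eq_one h1
    exact ⟨j, by rw [← hj, pow_char, mul_one]⟩
  choose α hα using hx
  refine ⟨(α, w), ?_, ?_⟩
  · refine hg.trans ?_
    unfold monomial
    congr 1
    funext i
    exact (hα i).symm
  · have := congrArg Units.val ha'
    rw [Units.val_pow_eq_pow_val, Units.coe_prod, Units.val_one] at this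
    simp only [← hα] at this
    rw [← char_sum, pow_char, char_eq_one e he, ← dvd_iff_mul_eq_zero p hp] at this
    exact this

/-- The exponents and the permutation of an element of `G(ℓ, p, n)`. -/
def data (hp : p ∣ ℓ) (he : Function.Injective e) (g : complexReflectionGroup ℓ p n) :
    (Fin n → ZMod ℓ) × Perm (Fin n) := (exists_monomial p e hp he g).choose

theorem mat_eq (hp : p ∣ ℓ) (he : Function.Injective e) (g : complexReflectionGroup ℓ p n) :
    mat p g = monomial e (data p e hp he g).1 (data p e hp he g).2 :=
  (exists_monomial p e hp he g).choose_spec.1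

theorem dvd_data (hp : p ∣ ℓ) (he : Function.Injective e) (g : complexReflectionGroup ℓ p n) :
    (p : ZMod ℓ) ∣ ∑ i, (data p e hp he g).1 i :=
  (exists_monomial p e hp he g).choose_spec.2

theorem data_eq (hp : p ∣ ℓ) (he : Function.Injective e) {g : complexReflectionGroup ℓ p n}
    {α : Fin n → ZMod ℓ} {w : Perm (Fin n)} (h : mat p g = monomial e α w) :
    data p e hp he g = (α, w) := by
  rw [mat_eq p e hp he] at h
  obtain ⟨h1, h2⟩ := monomial_injective e he h
  exact Prod.ext h1 h2

theorem ext_data (hp : p ∣ ℓ) (he : Function.Injective e) {g h : complexReflectionGroup ℓ p n}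
    (hgh : data p e hp he g = data p e hp he h) : g = h := by
  refine Subtype.ext (Units.ext ?_)
  change mat p g = mat p h
  rw [mat_eq p e hp he, mat_eq p e hp he, hgh]

theorem data_monomialElt (hp : p ∣ ℓ) (he : Function.Injective e) (α : Fin n → ZMod ℓ)
    (w : Perm (Fin n)) (h : (p : ZMod ℓ) ∣ ∑ i, α i) :
    data p e hp he (monomialElt p e hp α w h) = (α, w) := data_eq p e hp he rfl

theorem data_one (hp : p ∣ ℓ) (he : Function.Injective e) :
    data p e hp he (1 : complexReflectionGroup ℓ p n) = (0, 1) :=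
  data_eq p e hp he (monomial_one e).symm

theorem data_mul (hp : p ∣ ℓ) (he : Function.Injective e) (g h : complexReflectionGroup ℓ p n) :
    data p e hp he (g * h) = ((data p e hp he g).1 + (data p e hp he h).1 ∘
      ⇑(data p e hp he g).2⁻¹, (data p e hp he g).2 * (data p e hp he h).2) := by
  refine data_eq p e hp he ?_
  rw [← monomial_mul, ← mat_eq, ← mat_eq]
  rfl

theorem data_inv (hp : p ∣ ℓ) (he : Function.Injective e) (g : complexReflectionGroup ℓ p n) :
    data p e hp he g⁻¹ = (-(data p e hp he g).1 ∘ (data p e hp he g).2,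
      (data p e hp he g).2⁻¹) := by
  refine data_eq p e hp he ?_
  change (((g⁻¹ : complexReflectionGroup ℓ p n) : GL (Fin n) ℂ) : Matrix (Fin n) (Fin n) ℂ) = _
  rw [Subgroup.coe_inv, Matrix.coe_units_inv]
  refine Matrix.inv_eq_right_inv ?_
  rw [show ((g : GL (Fin n) ℂ) : Matrix (Fin n) (Fin n) ℂ) = _ from mat_eq p e hp he g,
    monomial_mul_inv]

theorem data_permElt (hp : p ∣ ℓ) (he : Function.Injective e) (w : Perm (Fin n)) :
    data p e hp he (permElt ℓ p w) = (0, w) := by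
  refine data_eq p e hp he ?_
  change monomialMatrix 1 w = monomialMatrix _ w
  congr 1
  funext i
  simp

theorem inv_apply (hp : p ∣ ℓ) (he : Function.Injective e) (g : complexReflectionGroup ℓ p n)
    (i j : Fin n) : mat p g⁻¹ j i =
      if i = (data p e hp he g).2 j then e (-(data p e hp he g).1 i) else 0 := by
  rw [mat_eq p e hp he, data_inv, monomial_apply]
  have h : (j = (data p e hp he g).2⁻¹ i) ↔ i = (data p e hp he g).2 j := by
    rw [Perm.eq_inv_iff_eq, eq_comm]
  by_cases h' : i = (data p e hp he g).2 j
  · rw [if_pos (h.2 h'), if_pos h', h']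
    rfl
  · rw [if_neg (fun h0 => h' (h.1 h0)), if_neg h']

theorem isReflection_iff (hp : p ∣ ℓ) (he : Function.Injective e)
    (g : complexReflectionGroup ℓ p n) : IsReflection (g : GL (Fin n) ℂ) ↔
      (∃ a x, x ≠ 0 ∧ data p e hp he g = (Pi.single a x, 1)) ∨
        ∃ a b x, a ≠ b ∧ data p e hp he g = (Pi.single a x - Pi.single b x, swap a b) := by
  unfold IsReflection
  rw [show ((g : GL (Fin n) ℂ) : Matrix (Fin n) (Fin n) ℂ) = _ from mat_eq p e hp he g,
    rank_monomial_sub_one e he]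
  simp only [Prod.ext_iff]
  refine or_congr ⟨?_, ?_⟩ ⟨?_, ?_⟩
  · rintro ⟨h, a, x, hx, h'⟩; exact ⟨a, x, hx, h', h⟩
  · rintro ⟨a, x, hx, h', h⟩; exact ⟨h, a, x, hx, h'⟩
  · rintro ⟨a, b, x, h1, h2, h3⟩; exact ⟨a, b, x, h1, h3, h2⟩
  · rintro ⟨a, b, x, h1, h2, h3⟩; exact ⟨a, b, x, h1, h3, h2⟩

theorem parameter_swap (hp : p ∣ ℓ) (he : Function.Injective e) (κ : ℂ) (c : ℕ → ℂ)
    {g : complexReflectionGroup ℓ p n} {a b : Fin n} {α : Fin n → ZMod ℓ} (hab : a ≠ b)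
    (hg : data p e hp he g = (α, swap a b)) : parameter ℓ p n (e 1) κ c g = κ := by
  unfold parameter
  rw [if_neg]
  rw [show ((g : GL (Fin n) ℂ) : Matrix (Fin n) (Fin n) ℂ) = _ from mat_eq p e hp he g,
    isDiag_monomial, hg]
  exact fun h => hab (swap_eq_one_iff.1 h)

/-- The double sum in `parameter` has exactly one nonzero condition, since the matrices t_i^m with 0
< m < ℓ are pairwise distinct. -/
theorem parameter_diag (hp : p ∣ ℓ) (he : Function.Injective e) (κ : ℂ) (c : ℕ → ℂ)
    {g : complexReflectionGroup ℓ p n} {a : Fin n} {j : ℕ} (hj : j ∈ Finset.Ico 1 ℓ)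
    (hg : data p e hp he g = (Pi.single a (j : ZMod ℓ), 1)) :
    parameter ℓ p n (e 1) κ c g = c j := by
  have hupd (i : Fin n) (t : ℕ) : (Matrix.diagonal (Function.update 1 i (e 1 ^ t)) :
      Matrix (Fin n) (Fin n) ℂ) = monomial e (Pi.single i (t : ZMod ℓ)) 1 := by
    rw [monomial_diag]
    congr 1
    funext x
    rcases eq_or_ne x i with rfl | hx
    · rw [Function.update_self, Pi.single_eq_same, pow_char, mul_one]
    · rw [Function.update_of_ne hx, Pi.single_eq_of_ne hx, e.map_zero_eq_one, Pi.one_apply]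
  have hcast {t : ℕ} (ht : t ∈ Finset.Ico 1 ℓ) : (t : ZMod ℓ) ≠ 0 := by
    rw [Ne, ZMod.natCast_eq_zero_iff]
    exact Nat.not_dvd_of_pos_of_lt (Finset.mem_Ico.1 ht).1 (Finset.mem_Ico.1 ht).2
  unfold parameter
  rw [show ((g : GL (Fin n) ℂ) : Matrix (Fin n) (Fin n) ℂ) = _ from mat_eq p e hp he g, hg,
    if_pos ((isDiag_monomial e _ _).2 rfl), Finset.sum_eq_single a, Finset.sum_eq_single j]
  · rw [if_pos (hupd a j).symm]
  · intro t ht htj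
    rw [if_neg]
    rw [hupd]
    intro h
    have h1 := congrFun (monomial_injective e he h).1 a
    dsimp only at h1
    rw [Pi.single_eq_same, Pi.single_eq_same, ZMod.natCast_eq_natCast_iff'] at h1
    rw [Nat.mod_eq_of_lt (Finset.mem_Ico.1 hj).2, Nat.mod_eq_of_lt (Finset.mem_Ico.1 ht).2] at h1
    exact htj h1.symm
  · exact fun h => absurd hj h
  · intro i _ hi
    refine Finset.sum_eq_zero fun t ht => ?_
    rw [if_neg]
    rw [hupd]
    intro h
    have h1 := congrFun (monomial_injective e he h).1 i
    dsimp only at h1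
    rw [Pi.single_eq_same, Pi.single_eq_of_ne hi] at h1
    exact hcast ht h1.symm
  · exact fun h => absurd (Finset.mem_univ _) h

end Group

end

end Cherednik


/-! ### The group action and the sum over reflections -/

namespace Cherednik

noncomputable section

open Equiv Equiv.Perm SymmetricPresentation CyclicPresentation

set_option linter.unusedSectionVars false

variable {ℓ m : ℕ} [NeZero ℓ] (p : ℕ) (ħ κ : ℂ) (e : AddChar (ZMod ℓ) ℂ) (c : ℕ → ℂ)
  (hp : p ∣ ℓ) (he : Function.Injective e)

/-- The action of `G(ℓ, p, n)`. -/
def groupRep (g : complexReflectionGroup ℓ p (m + 1)) : Module.End ℂ (PolyUT ℓ (m + 1)) :=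
  diagOp (data p e hp he g).1 * permRep ħ (-κ) e he (data p e hp he g).2

theorem groupRep_one : groupRep (m := m) p ħ κ e hp he 1 = 1 := by
  rw [groupRep, data_one, map_one, diagOp_zero, one_mul]

theorem groupRep_mul (g h : complexReflectionGroup ℓ p (m + 1)) :
    groupRep p ħ κ e hp he (g * h) = groupRep p ħ κ e hp he g * groupRep p ħ κ e hp he h := by
  unfold groupRep
  rw [data_mul, diagOp_add, map_mul, mul_assoc, mul_assoc, ← mul_assoc (permRep _ _ _ _ _),
    permRep_mul_diagOp, mul_assoc]

theorem groupRep_mul_xRep (g : complexReflectionGroup ℓ p (m + 1)) (j : Fin (m + 1)) :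
    groupRep p ħ κ e hp he g * xRep ħ (-κ) e c he j =
      (∑ i, mat p g i j • xRep ħ (-κ) e c he i) * groupRep p ħ κ e hp he g := by
  rw [Finset.sum_eq_single ((data p e hp he g).2 j)]
  · rw [mat_eq p e hp he, monomial_apply, if_pos rfl, groupRep, mul_assoc, permRep_mul_xRep,
      ← mul_assoc, diagOp_mul_xRep, smul_mul_assoc, smul_mul_assoc, mul_assoc]
  · intro i _ hi
    rw [mat_eq p e hp he, monomial_apply, if_neg hi, zero_smul]
  · exact fun h => absurd (Finset.mem_univ _) h

theorem groupRep_mul_yRep (g : complexReflectionGroup ℓ p (m + 1)) (j : Fin (m + 1)) :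
    groupRep p ħ κ e hp he g * yRep ħ (-κ) e he j =
      (∑ i, mat p g⁻¹ j i • yRep ħ (-κ) e he i) * groupRep p ħ κ e hp he g := by
  rw [Finset.sum_eq_single ((data p e hp he g).2 j)]
  · rw [inv_apply p e hp he, if_pos rfl, groupRep, mul_assoc, permRep_mul_yRep,
      ← mul_assoc, diagOp_mul_yRep, smul_mul_assoc, smul_mul_assoc, mul_assoc]
  · intro i _ hi
    rw [inv_apply p e hp he, if_neg hi, zero_smul]
  · exact fun h => absurd (Finset.mem_univ _) h

theorem natCast_ne_zero {j : ℕ} (hj : j ∈ Finset.Ico 1 ℓ) : (j : ZMod ℓ) ≠ 0 := by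
  rw [Ne, ZMod.natCast_eq_zero_iff]
  exact Nat.not_dvd_of_pos_of_lt (Finset.mem_Ico.1 hj).1 (Finset.mem_Ico.1 hj).2

theorem natCast_injOn {j t : ℕ} (hj : j ∈ Finset.Ico 1 ℓ) (ht : t ∈ Finset.Ico 1 ℓ)
    (h : (j : ZMod ℓ) = t) : j = t := by
  rw [ZMod.natCast_eq_natCast_iff', Nat.mod_eq_of_lt (Finset.mem_Ico.1 hj).2,
    Nat.mod_eq_of_lt (Finset.mem_Ico.1 ht).2] at h
  exact h

theorem sum_single {n : ℕ} (i : Fin n) (x : ZMod ℓ) : ∑ a, (Pi.single i x : Fin n → ZMod ℓ) a = x := by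
  simp

theorem sum_single_sub {n : ℕ} (i l : Fin n) (x : ZMod ℓ) :
    ∑ a, (Pi.single i x - Pi.single l x : Fin n → ZMod ℓ) a = 0 := by
  simp

/-- The summand at `s` of the commutation relation of `x_i` and `y_j`. -/
def reflTerm (i j : Fin (m + 1)) (s : complexReflectionGroup ℓ p (m + 1)) :
    Module.End ℂ (PolyUT ℓ (m + 1)) :=
  (parameter ℓ p (m + 1) (e 1) κ c s * ((if i = j then 1 else 0) - mat p s⁻¹ j i)) •
    groupRep p ħ κ e hp he s

theorem reflTerm_diag {i j a : Fin (m + 1)} {t : ℕ} (ht : t ∈ Finset.Ico 1 ℓ)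
    {s : complexReflectionGroup ℓ p (m + 1)} (hs : data p e hp he s = (Pi.single a (t : ZMod ℓ), 1)) :
    reflTerm p ħ κ e c hp he i j s = if i = j ∧ a = i then
      (c t * (1 - e (-(t : ZMod ℓ)))) • diagOp (Pi.single i (t : ZMod ℓ)) else 0 := by
  rw [reflTerm, parameter_diag p e hp he κ c ht hs, inv_apply p e hp he, groupRep, hs, map_one,
    mul_one, Perm.one_apply]
  dsimp only
  rcases eq_or_ne i j with rfl | hij
  · rcases eq_or_ne a i with rfl | ha
    · simp
    · rw [if_pos rfl, if_pos rfl, Pi.single_eq_of_ne ha.symm, neg_zero, e.map_zero_eq_one, sub_self,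
        mul_zero, zero_smul, if_neg (fun h => ha h.2)]
  · rw [if_neg hij, if_neg hij, sub_zero, mul_zero, zero_smul, if_neg (fun h => hij h.1)]

theorem reflTerm_swap {i j a b : Fin (m + 1)} {x : ZMod ℓ} (hab : a ≠ b)
    {s : complexReflectionGroup ℓ p (m + 1)}
    (hs : data p e hp he s = (Pi.single a x - Pi.single b x, swap a b)) :
    reflTerm p ħ κ e c hp he i j s =
      (κ * ((if i = j then 1 else 0) -
        if i = swap a b j then e (-(Pi.single a x - Pi.single b x : _ → ZMod ℓ) i) else 0)) •
        (diagOp (Pi.single a x - Pi.single b x) * permRep ħ (-κ) e he (swap a b)) := by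
  rw [reflTerm, parameter_swap p e hp he κ c hab hs, inv_apply p e hp he, groupRep, hs]

/-- A reflection that exchanges two coordinates other than the i-th fixes x_i, so the pairing ⟨y -
s(y), x_i⟩ vanishes. -/
theorem reflTerm_eq_zero {i j a b : Fin (m + 1)} {x : ZMod ℓ} (hab : a ≠ b) (ha : a ≠ i)
    (hb : b ≠ i) {s : complexReflectionGroup ℓ p (m + 1)}
    (hs : data p e hp he s = (Pi.single a x - Pi.single b x, swap a b)) :
    reflTerm p ħ κ e c hp he i j s = 0 := by
  have h : i = swap a b j ↔ i = j := by
    rw [← swap_apply_of_ne_of_ne ha.symm hb.symm, EmbeddingLike.apply_eq_iff_eq,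
      swap_apply_of_ne_of_ne ha.symm hb.symm]
  rw [reflTerm_swap p ħ κ e c hp he hab hs, Pi.sub_apply, Pi.single_eq_of_ne ha.symm,
    Pi.single_eq_of_ne hb.symm, sub_self, neg_zero, e.map_zero_eq_one]
  simp only [h, sub_self, mul_zero, zero_smul]

-- The group contains t_i^m only for p ∣ m, whereas `charOp` sums over all m. The missing terms have
-- c_m = 0, hence the comparison over nonzero terms only.
open Classical in
theorem sum_diag_reflections (hc : ∀ j, ¬ p ∣ j → c j = 0) (i j : Fin (m + 1)) :
    ∑ s ∈ Finset.univ.filter (fun s : complexReflectionGroup ℓ p (m + 1) =>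
      IsReflection (s : GL (Fin (m + 1)) ℂ) ∧ (data p e hp he s).2 = 1),
        reflTerm p ħ κ e c hp he i j s =
      if i = j then charOp (fun t => c t * (1 - e (-(t : ZMod ℓ)))) i else 0 := by
  have hrefl (s : complexReflectionGroup ℓ p (m + 1)) (hs : IsReflection (s : GL (Fin (m + 1)) ℂ) ∧
      (data p e hp he s).2 = 1) : ∃ a, ∃ t ∈ Finset.Ico 1 ℓ,
        data p e hp he s = (Pi.single a (t : ZMod ℓ), 1) := by
    rcases (isReflection_iff p e hp he s).1 hs.1 with ⟨a, x, hx, h⟩ | ⟨a, b, x, hab, h⟩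
    · refine ⟨a, x.val, Finset.mem_Ico.2 ⟨Nat.one_le_iff_ne_zero.2 fun h0 => hx ?_, x.val_lt⟩, ?_⟩
      · exact (ZMod.val_eq_zero x).1 h0
      · rw [ZMod.natCast_zmod_val, h]
    · rw [h] at hs
      exact absurd (swap_eq_one_iff.1 hs.2) hab
  split_ifs with hij
  · subst hij
    rw [charOp]
    have hdvd {t : ℕ} (ht : c t ≠ 0) :
        (p : ZMod ℓ) ∣ ∑ a, (Pi.single i (t : ZMod ℓ) : Fin (m + 1) → ZMod ℓ) a := by
      rw [sum_single]
      exact Nat.cast_dvd_cast (by by_contra h; exact ht (hc t h))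
    have hdvd' {t : ℕ} (ht : (c t * (1 - e (-(t : ZMod ℓ)))) •
        (diagOp (Pi.single i (t : ZMod ℓ)) : Module.End ℂ (PolyUT ℓ (m + 1))) ≠ 0) : c t ≠ 0 := by
      rintro h
      apply ht
      rw [h, zero_mul, zero_smul]
    symm
    refine Finset.sum_bij_ne_zero
      (fun t _ h => monomialElt p e hp (Pi.single i (t : ZMod ℓ)) 1 (hdvd (hdvd' h))) ?_ ?_ ?_ ?_
    · intro t ht h
      rw [Finset.mem_filter, data_monomialElt]
      refine ⟨Finset.mem_univ _, (isReflection_iff p e hp he _).2 (Or.inl ⟨i, t, ?_, ?_⟩), rfl⟩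
      · exact natCast_ne_zero ht
      · rw [data_monomialElt]
    · intro t ht h t' ht' h' heq
      have := congrArg (data p e hp he) heq
      rw [data_monomialElt, data_monomialElt] at this
      have := congrFun (congrArg Prod.fst this) i
      simp only [Pi.single_eq_same] at this
      exact natCast_injOn ht ht' this
    · intro s hs h
      obtain ⟨a, t, ht, hd⟩ := hrefl s (Finset.mem_filter.1 hs).2
      rw [reflTerm_diag p ħ κ e c hp he ht hd] at h
      have ha : a = i := by
        by_contra ha
        rw [if_neg (fun h => ha h.2)] at h
        exact h rfl
      subst ha
      rw [if_pos ⟨rfl, rfl⟩] at h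
      refine ⟨t, ht, h, ext_data p e hp he ?_⟩
      rw [data_monomialElt, hd]
    · intro t ht h
      rw [reflTerm_diag p ħ κ e c hp he ht (data_monomialElt p e hp he _ _ _), if_pos ⟨rfl, rfl⟩]
  · refine Finset.sum_eq_zero fun s hs => ?_
    obtain ⟨a, t, ht, hd⟩ := hrefl s (Finset.mem_filter.1 hs).2
    rw [reflTerm_diag p ħ κ e c hp he ht hd, if_neg (fun h => hij h.1)]

-- Only reflections that move coordinate i contribute, and each of these has a unique form with i as
-- the first index; reordering the two indices replaces x by -x.
open Classical in
theorem sum_swap_reflections (i j : Fin (m + 1)) :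
    ∑ s ∈ Finset.univ.filter (fun s : complexReflectionGroup ℓ p (m + 1) =>
      IsReflection (s : GL (Fin (m + 1)) ℂ) ∧ (data p e hp he s).2 ≠ 1),
        reflTerm p ħ κ e c hp he i j s =
      ∑ l ∈ Finset.univ.erase i, ∑ x : ZMod ℓ,
        (κ * ((if i = j then 1 else 0) - if i = swap i l j then e (-x) else 0)) •
          (diagOp (Pi.single i x - Pi.single l x) * permRep ħ (-κ) e he (swap i l)) := by
  rw [Finset.sum_sigma']
  symm
  have hdvd (l : Fin (m + 1)) (x : ZMod ℓ) :
      (p : ZMod ℓ) ∣ ∑ a, (Pi.single i x - Pi.single l x : Fin (m + 1) → ZMod ℓ) a := by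
    rw [sum_single_sub]; exact dvd_zero _
  have hval {l : Fin (m + 1)} (hl : l ≠ i) (x : ZMod ℓ) :
      (Pi.single i x - Pi.single l x : Fin (m + 1) → ZMod ℓ) i = x := by
    rw [Pi.sub_apply, Pi.single_eq_same, Pi.single_eq_of_ne hl.symm, sub_zero]
  refine Finset.sum_bij_ne_zero (fun lx _ _ => monomialElt p e hp
    (Pi.single i lx.2 - Pi.single lx.1 lx.2) (swap i lx.1) (hdvd _ _)) ?_ ?_ ?_ ?_
  · rintro ⟨l, x⟩ hlx -
    have hl : l ≠ i := by simpa using hlx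
    rw [Finset.mem_filter, data_monomialElt]
    refine ⟨Finset.mem_univ _, (isReflection_iff p e hp he _).2 (Or.inr ⟨i, l, x, hl.symm, ?_⟩),
      fun h => hl.symm (swap_eq_one_iff.1 h)⟩
    rw [data_monomialElt]
  · rintro ⟨l, x⟩ hlx - ⟨l', x'⟩ hlx' - heq
    have hl : l ≠ i := by simpa using hlx
    have hl' : l' ≠ i := by simpa using hlx'
    have := congrArg (data p e hp he) heq
    rw [data_monomialElt, data_monomialElt, Prod.mk.injEq] at this
    have h1 : l = l' := by
      have := congrFun (congrArg (fun w : Perm _ => (w : Fin (m + 1) → Fin (m + 1))) this.2) i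
      simpa using this
    have h2 := congrFun this.1 i
    dsimp only at h2
    rw [hval hl, hval hl'] at h2
    rw [h1, h2]
  · intro s hs h
    obtain ⟨-, hs1, hs2⟩ := Finset.mem_filter.1 hs
    rcases (isReflection_iff p e hp he s).1 hs1 with ⟨a, x, hx, hd⟩ | ⟨a, b, x, hab, hd⟩
    · rw [hd] at hs2
      exact absurd rfl hs2
    have hex : ∃ l y, l ≠ i ∧ data p e hp he s = (Pi.single i y - Pi.single l y, swap i l) := by
      by_cases ha : a = i
      · subst ha
        exact ⟨b, x, hab.symm, hd⟩
      · by_cases hb : b = i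
        · subst hb
          refine ⟨a, -x, hab, ?_⟩
          rw [hd, swap_comm, Pi.single_neg, Pi.single_neg]
          congr 1
          abel
        · exact absurd (reflTerm_eq_zero p ħ κ e c hp he hab ha hb hd) h
    obtain ⟨l, y, hl, hd⟩ := hex
    refine ⟨⟨l, y⟩, by simpa using hl, ?_, ?_⟩
    · rw [reflTerm_swap p ħ κ e c hp he hl.symm hd, hval hl] at h
      exact h
    · refine ext_data p e hp he ?_
      rw [data_monomialElt, hd]
  · rintro ⟨l, x⟩ hlx -
    have hl : l ≠ i := by simpa using hlx
    rw [reflTerm_swap p ħ κ e c hp he hl.symm (data_monomialElt p e hp he _ _ _), hval hl]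

-- For i = j every l ≠ i contributes and the swap terms give the sum of `pairOp`; for i ≠ j only l =
-- j survives, and its weights -e(-x) produce `twistedPairOp`.
open Classical in
theorem sum_reflections (hc : ∀ j, ¬ p ∣ j → c j = 0) (i j : Fin (m + 1)) :
    xRep ħ (-κ) e c he i * yRep ħ (-κ) e he j - yRep ħ (-κ) e he j * xRep ħ (-κ) e c he i =
      algebraMap ℂ _ (if i = j then ħ else 0) -
        ∑ s ∈ Finset.univ.filter (fun s : complexReflectionGroup ℓ p (m + 1) =>
          IsReflection (s : GL (Fin (m + 1)) ℂ)), reflTerm p ħ κ e c hp he i j s := by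
  rw [← Finset.sum_filter_add_sum_filter_not _ (fun s => (data p e hp he s).2 = 1),
    Finset.filter_filter, Finset.filter_filter, sum_diag_reflections p ħ κ e c hp he hc,
    sum_swap_reflections]
  rcases eq_or_ne i j with rfl | hij
  · have h1 : ∑ l ∈ Finset.univ.erase i, ∑ x : ZMod ℓ,
        (κ * ((if i = i then 1 else 0) - if i = swap i l i then e (-x) else 0)) •
          (diagOp (Pi.single i x - Pi.single l x) * permRep ħ (-κ) e he (swap i l)) =
        κ • ∑ l ∈ Finset.univ.erase i, pairOp i l * permRep ħ (-κ) e he (swap i l) := by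
      rw [Finset.smul_sum]
      refine Finset.sum_congr rfl fun l hl => ?_
      have hl : l ≠ i := by simpa using hl
      rw [pairOp, Finset.sum_mul, Finset.smul_sum]
      refine Finset.sum_congr rfl fun x _ => ?_
      rw [if_pos rfl, swap_apply_left, if_neg hl.symm, sub_zero, mul_one]
    rw [if_pos rfl, if_pos rfl, h1, xRep_mul_yRep_self, add_assoc]
    refine end_add_eq_sub _ _ _ ?_
    rw [add_add_add_comm, ← charOp_add, ← add_smul, neg_add_cancel, zero_smul, add_zero,
      ← charOp_zero i]
    congr 1
    funext t
    simp only [Pi.add_apply, Pi.zero_apply]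
    ring
  · rw [if_neg hij, if_neg hij, zero_add, xRep_mul_yRep_of_ne _ _ _ _ _ hij,
      Finset.sum_eq_single j]
    · refine Eq.trans ?_ (end_add_eq_sub (algebraMap ℂ _ 0) (-(-κ) • twistedPairOp e i j *
        permRep ħ (-κ) e he (swap i j)) _ ?_)
      · rw [map_zero, zero_add]
      rw [twistedPairOp, neg_neg, smul_mul_assoc, Finset.sum_mul, Finset.smul_sum,
        ← Finset.sum_add_distrib]
      refine Finset.sum_eq_zero fun x _ => ?_
      rw [if_neg hij, swap_apply_right, if_pos rfl, zero_sub, smul_mul_assoc, smul_smul, ← add_smul,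
        mul_neg, add_neg_cancel, zero_smul]
    · intro l hl hlj
      have hl : l ≠ i := by simpa using hl
      refine Finset.sum_eq_zero fun x _ => ?_
      rw [if_neg hij, swap_apply_of_ne_of_ne hij.symm hlj.symm, if_neg hij, sub_zero, mul_zero,
        zero_smul]
    · intro h
      exact absurd (Finset.mem_erase.2 ⟨hij.symm, Finset.mem_univ _⟩) h

end

end Cherednik


/-! ### The polynomial representation -/

namespace Cherednik

noncomputable section

open Equiv Equiv.Perm SymmetricPresentation CyclicPresentation

set_option linter.unusedSectionVars false

variable {ℓ m : ℕ} [NeZero ℓ] (p : ℕ) (ħ κ : ℂ) (e : AddChar (ZMod ℓ) ℂ) (c : ℕ → ℂ)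
  (hp : p ∣ ℓ) (he : Function.Injective e)

theorem scal_eq_prod {n : ℕ} (q : Subst ℓ n) (a : Fin n → ZMod ℓ) :
    q.scal e a = ∏ i, e (-q.χ i) ^ (a i).val := by
  rw [Subst.scal, ← Finset.sum_neg_distrib, char_sum]
  refine Finset.prod_congr rfl fun i _ => ?_
  rw [pow_char, ZMod.natCast_zmod_val]
  congr 1
  ring

theorem substitute_eq_act {n : ℕ} (q : Subst ℓ n) {w : Perm (Fin n)} {v z : Fin n → ℂ}
    (hw : w = q.w) (hv : ∀ i, v i = ħ * q.d i) (hz : ∀ i, z i = e (-q.χ i)) (f : PolyUT ℓ n) :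
    substitute w v z f = q.act ħ e f := by
  subst hw
  obtain rfl : z = fun i => e (-q.χ i) := funext hz
  obtain rfl : v = fun i => ħ * q.d i := funext hv
  have hs (a b : Fin n → ZMod ℓ) (x : PolyU n) (h : a = b) :
      substitute q.w (fun i => ħ * (q.d i : ℂ)) (fun i => e (-q.χ i))
        (AddMonoidAlgebra.single a x) = q.act ħ e (AddMonoidAlgebra.single b x) := by
    subst h
    rw [substitute, Subst.act_single, scal_eq_prod]
    refine (Finsupp.sum_single_index ?_).trans rfl
    rw [map_zero, smul_zero, AddMonoidAlgebra.single_zero]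
  induction f using AddMonoidAlgebra.induction_linear with
  | zero =>
    rw [map_zero]
    rfl
  | single a x => exact hs a a x rfl
  | add f g hf hg =>
    rw [map_add, ← hf, ← hg]
    unfold substitute
    rw [AddMonoidAlgebra.coeff_add, Finsupp.sum_add_index']
    · intro a; rw [map_zero, smul_zero, AddMonoidAlgebra.single_zero]
    · intro a x y; rw [map_add, smul_add, AddMonoidAlgebra.single_add]

/-- The images of the generators. -/
def genRep : Gen (complexReflectionGroup ℓ p (m + 1)) → Module.End ℂ (PolyUT ℓ (m + 1))
  | .grp g => groupRep p ħ κ e hp he g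
  | .x i => xRep ħ (-κ) e c he i
  | .y i => yRep ħ (-κ) e he i

theorem genRep_rel (hc : ∀ j, ¬ p ∣ j → c j = 0)
    {a b : FreeAlgebra ℂ (Gen (complexReflectionGroup ℓ p (m + 1)))}
    (h : Rel (complexReflectionGroup ℓ p (m + 1)) ħ (parameter ℓ p (m + 1) (e 1) κ c) a b) :
    FreeAlgebra.lift ℂ (genRep p ħ κ e c hp he) a =
      FreeAlgebra.lift ℂ (genRep p ħ κ e c hp he) b := by
  classical
  induction h with
  | grp_one =>
    rw [FreeAlgebra.lift_ι_apply, map_one]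
    exact groupRep_one p ħ κ e hp he
  | grp_mul g h =>
    rw [map_mul, FreeAlgebra.lift_ι_apply, FreeAlgebra.lift_ι_apply, FreeAlgebra.lift_ι_apply]
    exact (groupRep_mul p ħ κ e hp he g h).symm
  | grp_x g j =>
    rw [map_mul, map_mul, map_sum]
    simp only [map_smul, FreeAlgebra.lift_ι_apply]
    exact groupRep_mul_xRep p ħ κ e c hp he g j
  | grp_y g j =>
    rw [map_mul, map_mul, map_sum]
    simp only [map_smul, FreeAlgebra.lift_ι_apply]
    exact groupRep_mul_yRep p ħ κ e hp he g j
  | x_x i j =>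
    rw [map_mul, map_mul, FreeAlgebra.lift_ι_apply, FreeAlgebra.lift_ι_apply]
    exact xRep_comm ħ (-κ) e c he i j
  | y_y i j =>
    rw [map_mul, map_mul, FreeAlgebra.lift_ι_apply, FreeAlgebra.lift_ι_apply]
    exact yRep_comm ħ (-κ) e he i j
  | x_y i j =>
    refine (map_sub _ _ _).trans (Eq.trans ?_ (map_sub _ _ _).symm)
    rw [map_mul, map_mul, FreeAlgebra.lift_ι_apply, FreeAlgebra.lift_ι_apply, map_sum,
      AlgHom.commutes]
    simp only [map_smul, FreeAlgebra.lift_ι_apply]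
    refine (sum_reflections p ħ κ e c hp he hc i j).trans ?_
    congr! 2

/-- The polynomial representation. -/
def polyRep (hc : ∀ j, ¬ p ∣ j → c j = 0) :
    H ℓ p (m + 1) (e 1) ħ κ c →ₐ[ℂ] Module.End ℂ (PolyUT ℓ (m + 1)) :=
  RingQuot.liftAlgHom ℂ ⟨FreeAlgebra.lift ℂ (genRep p ħ κ e c hp he),
    fun _ _ h => genRep_rel p ħ κ e c hp he hc h⟩

theorem polyRep_gen (hc : ∀ j, ¬ p ∣ j → c j = 0)
    (a : Gen (complexReflectionGroup ℓ p (m + 1))) :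
    polyRep p ħ κ e c hp he hc (RCA.gen _ _ _ a) = genRep p ħ κ e c hp he a := by
  unfold polyRep RCA.gen
  rw [RingQuot.liftAlgHom_mkAlgHom_apply, FreeAlgebra.lift_ι_apply]

theorem groupRep_permElt (w : Perm (Fin (m + 1))) :
    groupRep p ħ κ e hp he (permElt ℓ p w) = permRep ħ (-κ) e he w := by
  rw [groupRep, data_permElt, diagOp_zero, one_mul]

theorem isPolynomialRepresentation (hc : ∀ j, ¬ p ∣ j → c j = 0) :
    IsPolynomialRepresentation ℓ p (m + 1) (e 1) ħ κ c (polyRep p ħ κ e c hp he hc) where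
  diag g a hg f := by
    have hd : data p e hp he g = (a, 1) := by
      refine data_eq p e hp he (hg.trans ?_)
      rw [monomial_diag]
      congr 1
      funext i
      rw [pow_char, ZMod.natCast_zmod_val, mul_one]
    rw [polyRep_gen, genRep, groupRep, hd, map_one, mul_one, diagOp_apply]
  transposition i j hij f := by
    rw [polyRep_gen, genRep, groupRep_permElt, permRep_swap_of_eq ħ (-κ) e he i j hij,
      substitute_eq_act ħ e (Subst.perm (swap i j)) (w := swap i j) rfl (by simp) (by simp)]
    exact smul_defSwap ..
  sigma f := by
    rw [map_mul, polyRep_gen, polyRep_gen, genRep, genRep, groupRep_permElt,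
      show lastIdx (m + 1) = Fin.last m from rfl, xRep_zero, mul_assoc,
      ← map_mul, inv_mul_cancel, map_one, mul_one,
      substitute_eq_act ħ e sigmaSub (w := finRotate (m + 1)) rfl]
    · rw [← AddChar.map_neg_eq_inv]
      rfl
    · intro i
      simp only [sigmaSub, Pi.single_apply]
      split_ifs <;> simp_all
    · intro i
      rw [← AddChar.map_neg_eq_inv]
      simp only [sigmaSub, Pi.single_apply, Function.update_apply]
      split_ifs <;> simp_all
  tau f := by
    rw [map_mul, polyRep_gen, polyRep_gen, genRep, genRep, groupRep_permElt,
      show lastIdx (m + 1) = Fin.last m from rfl, yRep_last, mul_assoc,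
      ← map_mul, mul_inv_cancel, map_one, mul_one,
      substitute_eq_act ħ e tauSub (w := (finRotate (m + 1))⁻¹) rfl]
    · rfl
    · intro i
      simp only [tauSub, Pi.single_apply]
      split_ifs <;> simp_all
    · intro i
      simp only [tauSub, Pi.single_apply, Function.update_apply]
      split_ifs <;> simp_all

end

end Cherednik


/-! ### Interpolation and finite generation for families of coefficients -/

namespace GaloisOrder

noncomputable section

section Family

variable {V L I G : Type*} [AddCommGroup V] [Field L]

theorem exists_interpolation (x : I → L) (hx : Function.Injective x) (s : Finset I) (v : I → L) :
    ∃ R : Polynomial L, R.degree < s.card ∧ ∀ i ∈ s, R.eval (x i) = v i := by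
  classical
  exact ⟨Lagrange.interpolate s x v, Lagrange.degree_interpolate_lt v hx.injOn,
    fun i hi => Lagrange.eval_interpolate_at_node v hx.injOn hi⟩

/-- Interpolation of equivariant values at equivariant nodes has invariant coefficients. -/
theorem exists_interpolation_fixed [Group G] [MulSemiringAction G L] {conj : G → I → I}
    (x : I → L) (hx : Function.Injective x) (hxc : ∀ g i, x (conj g i) = g • x i) (s : Finset I)
    (hs : ∀ g, ∀ i ∈ s, ∃ j ∈ s, conj g j = i) (v : I → L)
    (hv : ∀ g, ∀ i ∈ s, v (conj g i) = g • v i) :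
    ∃ R : Polynomial L, (∀ g : G, ∀ j, g • R.coeff j = R.coeff j) ∧
      ∀ i ∈ s, R.eval (x i) = v i := by
  obtain ⟨R, hR, hRv⟩ := exists_interpolation x hx s v
  refine ⟨R, fun g j => ?_, hRv⟩
  -- Equivariance of nodes and values shows that `g` applied to R solves the same interpolation
  -- problem in the same degree, so it is R.
  have h : R.map (MulSemiringAction.toRingHom G L g) = R := by
    refine Polynomial.eq_of_degrees_lt_of_eval_index_eq s (v := x) hx.injOn
      (lt_of_le_of_lt Polynomial.degree_map_le hR) hR fun i hi => ?_
    obtain ⟨j, hj, rfl⟩ := hs g i hi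
    have hm := Polynomial.eval_map_apply (MulSemiringAction.toRingHom G L g) (p := R) (x j)
    rw [MulSemiringAction.toRingHom_apply, MulSemiringAction.toRingHom_apply] at hm
    rw [hRv _ hi, hxc, hm, hRv _ hj, hv _ _ hj]
  have := congrArg (fun p : Polynomial L => p.coeff j) h
  simpa using this

/-- The subgroup generated by the `act r s` with `r ∈ R` and `s ∈ S`. -/
def spanBy (act : L → V → V) (R : Set L) (S : Set V) : AddSubgroup V :=
  AddSubgroup.closure {X | ∃ r ∈ R, ∃ s ∈ S, X = act r s}

variable {φ : V →+ (I →₀ L)} {act : L → V → V} {tw : V → V} {x : I → L}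

theorem coeff_iterate (htw : ∀ X i, φ (tw X) i = x i * φ X i) (X : V) (i : I) (j : ℕ) :
    φ (tw^[j] X) i = x i ^ j * φ X i := by
  induction j with
  | zero => simp
  | succ j ih => rw [Function.iterate_succ_apply', htw, ih, pow_succ]; ring

/-- A polynomial in the twist `tw` acts on the coefficient at `i` through its value at the node `x
i`. This lets interpolation select coefficients. -/
theorem coeff_polynomial (hact : ∀ r X i, φ (act r X) i = r * φ X i)
    (htw : ∀ X i, φ (tw X) i = x i * φ X i) (R : Polynomial L) (X : V) (i : I) :
    φ (∑ j ∈ Finset.range (R.natDegree + 1), act (R.coeff j) (tw^[j] X)) i =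
      R.eval (x i) * φ X i := by
  rw [map_sum, Finsupp.finsetSum_apply, Polynomial.eval_eq_sum_range, Finset.sum_mul]
  refine Finset.sum_congr rfl fun j _ => ?_
  rw [hact, coeff_iterate htw, mul_assoc]

/-- Every invariant element lies in the span of `U` over the fixed field. -/
theorem mem_spanBy_of_invariant [Group G] [MulSemiringAction G L] {conj : G → I → I}
    (hc1 : ∀ i, conj 1 i = i) (hcm : ∀ g h i, conj (g * h) i = conj g (conj h i))
    (hφ : Function.Injective φ) (hact : ∀ r X i, φ (act r X) i = r * φ X i)
    (htw : ∀ X i, φ (tw X) i = x i * φ X i) (hx : Function.Injective x)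
    (hxc : ∀ g i, x (conj g i) = g • x i) {U : Set V}
    (hU : ∀ X ∈ U, ∀ g i, φ X (conj g i) = g • φ X i) (hUt : ∀ X ∈ U, tw X ∈ U)
    (hUs : ∀ i, ∃ X ∈ U, φ X i ≠ 0) {Y : V} (hY : ∀ (g : G) i, φ Y (conj g i) = g • φ Y i) :
    Y ∈ spanBy act {r | ∀ g : G, g • r = r} U := by
  classical
  induction hN : (φ Y).support.card using Nat.strong_induction_on generalizing Y with
  | _ N ih =>
  rcases eq_or_ne Y 0 with rfl | hY0
  · exact zero_mem _
  obtain ⟨i₀, hi₀⟩ : ∃ i, φ Y i ≠ 0 := by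
    by_contra! h
    exact hY0 (hφ (by rw [map_zero]; exact Finsupp.ext h))
  obtain ⟨X, hXU, hX⟩ := hUs i₀
  have hcc (g : G) (i : I) : conj g (conj g⁻¹ i) = i := by rw [← hcm, mul_inv_cancel, hc1]
  have hcc' (g : G) (i : I) : conj g⁻¹ (conj g i) = i := by rw [← hcm, inv_mul_cancel, hc1]
  have horb (g : G) (i : I) : (∃ h, conj g i = conj h i₀) ↔ ∃ h, i = conj h i₀ := by
    constructor
    · rintro ⟨h, hh⟩; exact ⟨g⁻¹ * h, by rw [hcm, ← hh, hcc']⟩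
    · rintro ⟨h, rfl⟩; exact ⟨g * h, by rw [hcm]⟩
  have hinvX := hU X hXU
  -- R takes the value Y/X on the orbit of `i₀` and 0 on the rest of the support of X, so the
  -- resulting Z agrees with Y on that orbit and vanishes elsewhere. Subtracting Z shrinks the
  -- support of Y.
  obtain ⟨R, hRf, hR⟩ := exists_interpolation_fixed x hx hxc (φ X).support
    (fun g i hi => ⟨conj g⁻¹ i, by
      rw [Finsupp.mem_support_iff] at hi ⊢
      rw [hinvX]
      exact (smul_ne_zero_iff_ne _).2 hi, hcc g i⟩)
    (fun i => if ∃ h, i = conj h i₀ then φ Y i / φ X i else 0) (fun g i _ => by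
      simp only [horb, hinvX, hY]
      split_ifs
      · rw [div_eq_mul_inv, div_eq_mul_inv, smul_mul', smul_inv'']
      · rw [smul_zero])
  set Z := ∑ j ∈ Finset.range (R.natDegree + 1), act (R.coeff j) (tw^[j] X) with hZ
  have hZi (i : I) : φ Z i = if ∃ h, i = conj h i₀ then φ Y i else 0 := by
    rw [hZ, coeff_polynomial hact htw]
    by_cases hi : i ∈ (φ X).support
    · rw [hR i hi]
      split_ifs
      · exact div_mul_cancel₀ _ (Finsupp.mem_support_iff.1 hi)
      · rw [zero_mul]
    · rw [Finsupp.notMem_support_iff.1 hi, mul_zero, if_neg]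
      rintro ⟨h, rfl⟩
      rw [Finsupp.notMem_support_iff, hinvX] at hi
      exact (smul_ne_zero_iff_ne _).2 hX hi
  have hYZ (i : I) : φ (Y - Z) i = if ∃ h, i = conj h i₀ then 0 else φ Y i := by
    rw [map_sub, Finsupp.sub_apply, hZi]
    split_ifs <;> simp
  have hit (j : ℕ) : tw^[j] X ∈ U := by
    induction j with
    | zero => exact hXU
    | succ j ihj => rw [Function.iterate_succ_apply']; exact hUt _ ihj
  have hZmem : Z ∈ spanBy act {r | ∀ g : G, g • r = r} U := by
    refine sum_mem fun j _ => AddSubgroup.subset_closure ⟨_, fun g => hRf g j, tw^[j] X, hit j, rfl⟩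
  have hsub : Y - Z ∈ spanBy act {r | ∀ g : G, g • r = r} U := by
    refine ih _ ?_ (fun g i => ?_) rfl
    · rw [← hN]
      refine Finset.card_lt_card (Finset.ssubset_iff_of_subset (fun i hi => ?_) |>.2
        ⟨i₀, Finsupp.mem_support_iff.2 hi₀, ?_⟩)
      · rw [Finsupp.mem_support_iff, hYZ] at hi
        rw [Finsupp.mem_support_iff]
        intro h
        rw [h, ite_self] at hi
        exact hi rfl
      · rw [Finsupp.notMem_support_iff, hYZ, if_pos ⟨1, (hc1 _).symm⟩]
    · rw [hYZ, hYZ]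
      simp only [horb, hY]
      split_ifs
      · rw [smul_zero]
      · rfl
  have := add_mem hsub hZmem
  rwa [sub_add_cancel] at this

/-- The intersection of a finite-dimensional space with a module of bounded denominators is finitely
generated. -/
theorem exists_finite_spanBy {Λ : Type*} [CommRing Λ] [Algebra Λ L] [FaithfulSMul Λ L]
    (A : Subring Λ) [IsNoetherian A Λ] (K : Subring L) (hAK : A.map (algebraMap Λ L) ≤ K)
    (hφ : Function.Injective φ) (hact : ∀ r X i, φ (act r X) i = r * φ X i)
    (U : AddSubgroup V) (hU : ∀ X ∈ U, ∀ r ∈ A, act (algebraMap Λ L r) X ∈ U)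
    (hden : ∀ F : Finset I, ∃ D : L, D ≠ 0 ∧ ∀ X ∈ U, (φ X).support ⊆ F →
      ∀ i, ∃ a : Λ, D * φ X i = algebraMap Λ L a) {S : Set V} (hS : S.Finite) :
    ∃ B : Set V, B.Finite ∧ spanBy act K S ⊓ U = spanBy act (A.map (algebraMap Λ L)) B := by
  classical
  have hact_mul (r r' : L) (X : V) : act r (act r' X) = act (r * r') X :=
    hφ (Finsupp.ext fun i => by simp only [hact, mul_assoc])
  have hact_add (r : L) (X Y : V) : act r (X + Y) = act r X + act r Y :=
    hφ (Finsupp.ext fun i => by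
      simp only [map_add, Finsupp.add_apply, hact, mul_add])
  have hact_zero (r : L) : act r (0 : V) = 0 :=
    hφ (Finsupp.ext fun i => by simp only [map_zero, Finsupp.zero_apply, hact, mul_zero])
  have hact_neg (r : L) (X : V) : act r (-X) = -act r X :=
    hφ (Finsupp.ext fun i => by simp only [map_neg, Finsupp.neg_apply, hact, mul_neg])
  have hspan_act (R : Subring L) (T : Set V) {r : L} (hr : r ∈ R) {X : V} (hX : X ∈ spanBy act R T) :
      act r X ∈ spanBy act R T := by
    induction hX using AddSubgroup.closure_induction with
    | mem X hX =>
      obtain ⟨r', hr', s, hs, rfl⟩ := hX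
      rw [hact_mul]
      exact AddSubgroup.subset_closure ⟨_, mul_mem hr hr', s, hs, rfl⟩
    | zero => rw [hact_zero]; exact zero_mem _
    | add X Y _ _ hX hY => rw [hact_add]; exact add_mem hX hY
    | neg X _ hX => rw [hact_neg]; exact neg_mem hX
  let F : Finset I := hS.toFinset.biUnion fun s => (φ s).support
  have hF {X : V} (hX : X ∈ spanBy act K S) : (φ X).support ⊆ F := by
    induction hX using AddSubgroup.closure_induction with
    | mem X hX =>
      obtain ⟨r, -, s, hs, rfl⟩ := hX
      intro i hi
      rw [Finsupp.mem_support_iff, hact] at hi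
      exact Finset.mem_biUnion.2 ⟨s, hS.mem_toFinset.2 hs,
        Finsupp.mem_support_iff.2 (right_ne_zero_of_mul hi)⟩
    | zero => simp
    | add X Y _ _ hX hY =>
      rw [map_add]
      exact Finsupp.support_add.trans (Finset.union_subset hX hY)
    | neg X _ hX => rw [map_neg, Finsupp.support_neg]; exact hX
  obtain ⟨D, hD0, hD⟩ := hden F
  let W : AddSubgroup V := spanBy act K S ⊓ U
  have hWact {r : Λ} (hr : r ∈ A) {X : V} (hX : X ∈ W) : act (algebraMap Λ L r) X ∈ W :=
    ⟨hspan_act K S (hAK ⟨r, hr, rfl⟩) hX.1, hU X hX.2 r hr⟩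
  -- After multiplication by the common denominator D, the intersection becomes a submodule of the
  -- noetherian module Λ^F; generators of N are lifted back.
  let N : Submodule A (F → Λ) :=
    { carrier := {v | ∃ X ∈ W, ∀ i : F, D * φ X i = algebraMap Λ L (v i)}
      add_mem' := by
        rintro v w ⟨X, hX, hv⟩ ⟨Y, hY, hw⟩
        refine ⟨X + Y, add_mem hX hY, fun i => ?_⟩
        rw [map_add, Finsupp.add_apply, mul_add, hv, hw, Pi.add_apply, map_add]
      zero_mem' := ⟨0, zero_mem _, fun i => by simp⟩
      smul_mem' := by
        rintro r v ⟨X, hX, hv⟩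
        refine ⟨act (algebraMap Λ L r) X, hWact r.2 hX, fun i => ?_⟩
        rw [hact, mul_left_comm, hv, Pi.smul_apply, Subring.smul_def, smul_eq_mul, map_mul] }
  obtain ⟨T, hT⟩ := IsNoetherian.noetherian N
  have hTN (v : T) : ∃ X ∈ W, ∀ i : F, D * φ X i = algebraMap Λ L (v.1 i) := by
    have : v.1 ∈ N := by rw [← hT]; exact Submodule.subset_span v.2
    exact this
  choose b hbW hb using hTN
  refine ⟨Set.range b, Set.finite_range b, le_antisymm (fun X hX => ?_) ?_⟩
  · have hspan (v : F → Λ) (hv : v ∈ Submodule.span A (T : Set (F → Λ))) :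
        ∃ X ∈ spanBy act (A.map (algebraMap Λ L)) (Set.range b), X ∈ W ∧
          ∀ i : F, D * φ X i = algebraMap Λ L (v i) := by
      induction hv using Submodule.span_induction with
      | mem v hv =>
        refine ⟨b ⟨v, hv⟩, ?_, hbW _, hb ⟨v, hv⟩⟩
        refine AddSubgroup.subset_closure ⟨1, one_mem _, b ⟨v, hv⟩, ⟨⟨v, hv⟩, rfl⟩, ?_⟩
        exact hφ (Finsupp.ext fun i => by rw [hact, one_mul])
      | zero => exact ⟨0, zero_mem _, zero_mem _, fun i => by simp⟩
      | add v w _ _ hv hw =>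
        obtain ⟨X, hX, hXW, hX'⟩ := hv
        obtain ⟨Y, hY, hYW, hY'⟩ := hw
        refine ⟨X + Y, add_mem hX hY, add_mem hXW hYW, fun i => ?_⟩
        rw [map_add, Finsupp.add_apply, mul_add, hX', hY', Pi.add_apply, map_add]
      | smul r v _ hv =>
        obtain ⟨X, hX, hXW, hX'⟩ := hv
        have hr : algebraMap Λ L r ∈ A.map (algebraMap Λ L) := Subring.mem_map.2 ⟨(r : Λ), r.2, rfl⟩
        refine ⟨act (algebraMap Λ L r) X, hspan_act (A.map (algebraMap Λ L)) (Set.range b) hr hX,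
          hWact r.2 hXW, fun i => ?_⟩
        rw [hact, mul_left_comm, hX', Pi.smul_apply, Subring.smul_def, smul_eq_mul, map_mul]
    have hden' := hD X hX.2 (hF hX.1)
    choose a ha using hden'
    have haN : (fun i : F => a i) ∈ Submodule.span A (T : Set (F → Λ)) := by
      rw [hT]
      exact ⟨X, hX, fun i => ha i⟩
    obtain ⟨Y, hY, hYW, hY'⟩ := hspan _ haN
    have : X = Y := by
      refine hφ (Finsupp.ext fun i => ?_)
      by_cases hi : i ∈ F
      · refine mul_left_cancel₀ hD0 ?_
        rw [hY' ⟨i, hi⟩, ha]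
      · rw [Finsupp.notMem_support_iff.1 (fun h => hi (hF hX.1 h)),
          Finsupp.notMem_support_iff.1 (fun h => hi (hF hYW.1 h))]
    rw [this]
    exact hY
  · refine (AddSubgroup.closure_le _).2 ?_
    rintro _ ⟨_, ⟨r, hr, rfl⟩, _, ⟨v, rfl⟩, rfl⟩
    exact hWact hr (hbW v)

/-- Lagrange's trick: coefficients times differences of nodes are combinations of moments. -/
theorem mul_prod_sub [DecidableEq I] (a : I →₀ L) (s : Finset I) (hs : a.support ⊆ s) {i : I}
    (hi : i ∈ s) (x : I → L) :
    a i * ∏ j ∈ s.erase i, (x i - x j) =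
      ∑ t ∈ Finset.range ((∏ j ∈ s.erase i, (Polynomial.X - Polynomial.C (x j))).natDegree + 1),
        (∏ j ∈ s.erase i, (Polynomial.X - Polynomial.C (x j))).coeff t *
          a.sum fun j b => b * x j ^ t := by
  set P := ∏ j ∈ s.erase i, (Polynomial.X - Polynomial.C (x j)) with hP
  have hev (y : L) : P.eval y = ∏ j ∈ s.erase i, (y - x j) := by
    rw [hP, Polynomial.eval_prod]
    simp
  -- P vanishes at every node of `s` other than that of `i`.
  have h1 : ∑ j ∈ s, a j * P.eval (x j) = a i * ∏ j ∈ s.erase i, (x i - x j) := by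
    rw [Finset.sum_eq_single i]
    · rw [hev]
    · intro j hj hji
      rw [hev, Finset.prod_eq_zero (Finset.mem_erase.2 ⟨hji, hj⟩) (sub_self _), mul_zero]
    · exact fun h => absurd hi h
  rw [← h1]
  have h2 (t : ℕ) : (a.sum fun j b => b * x j ^ t) = ∑ j ∈ s, a j * x j ^ t :=
    Finsupp.sum_of_support_subset a hs _ (by simp)
  simp only [h2, Polynomial.eval_eq_sum_range, Finset.mul_sum]
  rw [Finset.sum_comm]
  refine Finset.sum_congr rfl fun t _ => Finset.sum_congr rfl fun j _ => by ring

end Family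

end

end GaloisOrder


/-! ### Moments, denominators and invariance in the skew group ring -/

namespace GaloisOrder

noncomputable section

section Denominators

variable {L I : Type*} [Field L]

theorem coeff_prod_sub_mem (R : Subring L) {x : I → L} (hx : ∀ i, x i ∈ R) (s : Finset I) (t : ℕ) :
    (∏ j ∈ s, (Polynomial.X - Polynomial.C (x j))).coeff t ∈ R := by
  have h : ∏ j ∈ s, (Polynomial.X - Polynomial.C (x j)) =
      (∏ j ∈ s, (Polynomial.X - Polynomial.C (⟨x j, hx j⟩ : R))).map R.subtype := by
    rw [Polynomial.map_prod]
    simp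
  rw [h, Polynomial.coeff_map]
  exact Subtype.prop _

/-- If all moments lie in a subring, the coefficients have a common denominator. -/
theorem denominator_mul_mem [DecidableEq I] (R : Subring L) {x : I → L} (hx : ∀ i, x i ∈ R)
    {a : I →₀ L} {F : Finset I} (ha : a.support ⊆ F)
    (hm : ∀ t : ℕ, (a.sum fun j b => b * x j ^ t) ∈ R) (i : I) :
    (∏ j ∈ F, ∏ l ∈ F.erase j, (x j - x l)) * a i ∈ R := by
  by_cases hi : i ∈ F
  · have h1 : a i * ∏ l ∈ F.erase i, (x i - x l) ∈ R := by
      rw [mul_prod_sub a F ha hi]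
      exact sum_mem fun t _ => mul_mem (coeff_prod_sub_mem R hx _ _) (hm t)
    rw [← Finset.mul_prod_erase F _ hi, mul_comm, ← mul_assoc]
    exact mul_mem h1 (prod_mem fun j _ => prod_mem fun l _ => sub_mem (hx j) (hx l))
  · rw [Finsupp.notMem_support_iff.1 (fun h => hi (ha h)), mul_zero]
    exact zero_mem _

theorem denominator_ne_zero [DecidableEq I] {x : I → L} (hx : Function.Injective x)
    (F : Finset I) : ∏ j ∈ F, ∏ l ∈ F.erase j, (x j - x l) ≠ 0 :=
  Finset.prod_ne_zero_iff.2 fun _ _ => Finset.prod_ne_zero_iff.2 fun _ hl =>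
    sub_ne_zero.2 (hx.ne (Finset.ne_of_mem_erase hl).symm)

/-- Coefficients are determined by moments. -/
theorem eq_zero_of_moments {x : I → L} (hx : Function.Injective x) {a : I →₀ L}
    (hm : ∀ t : ℕ, (a.sum fun j b => b * x j ^ t) = 0) : a = 0 := by
  classical
  ext i
  by_cases hi : i ∈ a.support
  · have h := mul_prod_sub a a.support subset_rfl hi x
    simp only [hm, mul_zero, Finset.sum_const_zero] at h
    refine (mul_eq_zero.1 h).resolve_right (Finset.prod_ne_zero_iff.2 fun l hl => ?_)
    exact sub_ne_zero.2 (hx.ne (Finset.ne_of_mem_erase hl).symm)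
  · exact Finsupp.notMem_support_iff.1 hi

theorem eq_of_moments {x : I → L} (hx : Function.Injective x) {a b : I →₀ L}
    (hm : ∀ t : ℕ, (a.sum fun j b => b * x j ^ t) = b.sum fun j b => b * x j ^ t) : a = b := by
  refine sub_eq_zero.1 (eq_zero_of_moments hx fun t => ?_)
  rw [Finsupp.sum_sub_index (fun i b c => sub_mul b c _), hm, sub_self]

end Denominators

section Skew

set_option linter.unusedSectionVars false

variable {k Λ : Type} [Field k] [CommRing Λ] [IsDomain Λ] [Algebra k Λ]

theorem smul_algebraMap (g : Λ ≃ₐ[k] Λ) (a : Λ) :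
    g • algebraMap Λ (FractionRing Λ) a = algebraMap Λ (FractionRing Λ) (g a) :=
  IsFractionRing.ringEquivOfRingEquiv_algebraMap ..

variable {G : Subgroup (Λ ≃ₐ[k] Λ)} {T : Subgroup (Λ ≃ₐ[k] Λ)}

theorem mem_invariantSubring {a : FractionRing Λ} : a ∈ invariantSubring G ↔
    ∃ b : Λ, (∀ g ∈ G, g b = b) ∧ algebraMap Λ (FractionRing Λ) b = a := by
  unfold invariantSubring
  rw [Subring.mem_map]
  refine exists_congr fun b => and_congr ⟨fun h g hg => h ⟨g, hg⟩, fun h g => h g g.2⟩ Iff.rfl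

theorem invariantSubring_le_fixedField : invariantSubring G ≤ fixedField G := by
  intro a ha
  obtain ⟨b, hb, rfl⟩ := mem_invariantSubring.1 ha
  intro g
  exact (smul_algebraMap _ _).trans (by rw [hb g g.2])

/-- The node of `μ`: the image of the separating element. -/
def node (T : Subgroup (Λ ≃ₐ[k] Λ)) (γ : Λ) (μ : T.toSubmonoid) : FractionRing Λ :=
  algebraMap Λ (FractionRing Λ) ((μ : Λ ≃ₐ[k] Λ) γ)

theorem node_injective {γ : Λ} (hγ : ∀ μ ∈ T, ∀ ν ∈ T, μ γ = ν γ → μ = ν) :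
    Function.Injective (node T γ) := fun μ ν h =>
  Subtype.ext (hγ μ μ.2 ν ν.2 (IsFractionRing.injective Λ (FractionRing Λ) h))

theorem eval_pow (X : SkewRing T.toSubmonoid) (γ : Λ) (t : ℕ) :
    eval X (algebraMap Λ (FractionRing Λ) γ ^ t) =
      X.coeff.sum fun μ a => a * node T γ μ ^ t := by
  unfold eval
  rw [SkewMonoidAlgebra.sum_def']
  rw [Finsupp.sum]
  refine Finset.sum_congr rfl fun μ _ => ?_
  rw [smul_pow', Submonoid.smul_def, smul_algebraMap]
  rfl

/-- An element of the skew group ring is determined by its values on `Γ`. -/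
theorem eq_of_eval {γ : Λ} (hγ : ∀ μ ∈ T, ∀ ν ∈ T, μ γ = ν γ → μ = ν)
    {X Y : SkewRing T.toSubmonoid} (h : ∀ t : ℕ, eval X (algebraMap Λ (FractionRing Λ) (γ ^ t)) =
      eval Y (algebraMap Λ (FractionRing Λ) (γ ^ t))) : X = Y := by
  refine SkewMonoidAlgebra.coeff_injective (eq_of_moments (node_injective hγ) fun t => ?_)
  rw [← eval_pow, ← eval_pow, ← map_pow, h]

theorem eval_add (X Y : SkewRing T.toSubmonoid) (f : FractionRing Λ) :
    eval (X + Y) f = eval X f + eval Y f :=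
  SkewMonoidAlgebra.sum_add_index' (fun _ => zero_mul _) (fun _ _ _ => add_mul _ _ _)

theorem eval_zero (f : FractionRing Λ) : eval (0 : SkewRing T.toSubmonoid) f = 0 :=
  SkewMonoidAlgebra.sum_zero_index

theorem eval_single (μ : T.toSubmonoid) (a f : FractionRing Λ) :
    eval (SkewMonoidAlgebra.single μ a) f = a * μ • f :=
  SkewMonoidAlgebra.sum_single_index (zero_mul _)

theorem eval_one (f : FractionRing Λ) : eval (1 : SkewRing T.toSubmonoid) f = f := by
  rw [SkewMonoidAlgebra.one_def, eval_single, one_mul, one_smul]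

theorem eval_add_right (X : SkewRing T.toSubmonoid) (f g : FractionRing Λ) :
    eval X (f + g) = eval X f + eval X g := by
  induction X using SkewMonoidAlgebra.induction_on with
  | zero => simp only [eval_zero, add_zero]
  | single μ a => simp only [eval_single, smul_add, mul_add]
  | add X Y hX hY => simp only [eval_add, hX, hY]; ring

theorem eval_mul (X Y : SkewRing T.toSubmonoid) (f : FractionRing Λ) :
    eval (X * Y) f = eval X (eval Y f) := by
  induction X using SkewMonoidAlgebra.induction_on with
  | zero => rw [zero_mul, eval_zero, eval_zero]
  | add X X' hX hX' => rw [add_mul, eval_add, eval_add, hX, hX']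
  | single μ a =>
    induction Y using SkewMonoidAlgebra.induction_on with
    | zero => rw [mul_zero, eval_zero, eval_single, smul_zero, mul_zero]
    | add Y Y' hY hY' => rw [mul_add, eval_add, eval_add, eval_add_right, hY, hY']
    | single ν b =>
      rw [SkewMonoidAlgebra.single_mul_single, eval_single, eval_single, eval_single, smul_mul',
        mul_smul, mul_assoc]

/-- Conjugation by an element of `G`. -/
def conj (S : ∀ g ∈ G, ∀ μ ∈ T.toSubmonoid, g * μ * g⁻¹ ∈ T.toSubmonoid) (g : G)
    (μ : T.toSubmonoid) : T.toSubmonoid :=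
  ⟨g * μ * (g : Λ ≃ₐ[k] Λ)⁻¹, S g g.2 μ μ.2⟩

section

variable (S : ∀ g ∈ G, ∀ μ ∈ T.toSubmonoid, g * μ * g⁻¹ ∈ T.toSubmonoid)

theorem conj_one (μ : T.toSubmonoid) : conj S 1 μ = μ := by
  apply Subtype.ext
  change 1 * (μ : Λ ≃ₐ[k] Λ) * 1⁻¹ = μ
  group

theorem conj_mul (g h : G) (μ : T.toSubmonoid) : conj S (g * h) μ = conj S g (conj S h μ) := by
  apply Subtype.ext
  change (g * h : Λ ≃ₐ[k] Λ) * μ * (g * h : Λ ≃ₐ[k] Λ)⁻¹ = g * (h * μ * (h : Λ ≃ₐ[k] Λ)⁻¹) * (g : Λ ≃ₐ[k] Λ)⁻¹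
  group

theorem conj_injective (g : G) : Function.Injective (conj S g) := fun μ ν h => by
  have := congrArg (conj S g⁻¹) h
  rwa [← conj_mul, ← conj_mul, inv_mul_cancel, conj_one, conj_one] at this

theorem inv_apply_of_fixed {γ : Λ} (hγG : ∀ g ∈ G, g γ = γ) (g : G) :
    (g : Λ ≃ₐ[k] Λ)⁻¹ γ = γ := hγG _ (inv_mem g.2)

theorem node_conj {γ : Λ} (hγG : ∀ g ∈ G, g γ = γ) (g : G) (μ : T.toSubmonoid) :
    node T γ (conj S g μ) = g • node T γ μ := by
  refine Eq.trans ?_ (smul_algebraMap _ _).symm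
  unfold node conj
  congr 1
  change (g : Λ ≃ₐ[k] Λ) ((μ : Λ ≃ₐ[k] Λ) ((g : Λ ≃ₐ[k] Λ)⁻¹ γ)) = _
  rw [inv_apply_of_fixed hγG]

theorem mem_invariants_iff {X : SkewRing T.toSubmonoid} : X ∈ invariants G T.toSubmonoid ↔
    ∀ (g : G) μ, X.coeff (conj S g μ) = g • X.coeff μ := by
  refine ⟨fun h g μ => h g μ _ rfl, fun h g μ ν hν => ?_⟩
  rw [← h g μ]
  congr 1
  exact Subtype.ext hν

/-- An element of the skew group ring that preserves `Γ` is invariant. -/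
theorem mem_invariants_of_eval (S : ∀ g ∈ G, ∀ μ ∈ T.toSubmonoid, g * μ * g⁻¹ ∈ T.toSubmonoid) {γ : Λ} (hγG : ∀ g ∈ G, g γ = γ)
    (hγ : ∀ μ ∈ T, ∀ ν ∈ T, μ γ = ν γ → μ = ν) {X : SkewRing T.toSubmonoid}
    (hX : ∀ a ∈ invariantSubring G, eval X a ∈ invariantSubring G) :
    X ∈ invariants G T.toSubmonoid := by
  rw [mem_invariants_iff S]
  intro g μ
  have hpow (t : ℕ) : algebraMap Λ (FractionRing Λ) γ ^ t ∈ invariantSubring G :=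
    pow_mem (mem_invariantSubring.2 ⟨γ, hγG, rfl⟩) t
  -- The left side is X conjugated by `g`. Its moments are g(X(γ^t)), which equal X(γ^t) because X
  -- preserves Γ, and moments determine coefficients.
  have h : (X.coeff.mapRange (fun a => g • a) (smul_zero g)).mapDomain (conj S g) = X.coeff := by
    refine eq_of_moments (node_injective hγ) fun t => ?_
    rw [Finsupp.sum_mapDomain_index (fun _ => zero_mul _) (fun _ _ _ => add_mul _ _ _),
      Finsupp.sum_mapRange_index (fun _ => zero_mul _), ← eval_pow]
    have := invariantSubring_le_fixedField (hX _ (hpow t)) g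
    rw [eval_pow, Finsupp.sum] at this
    rw [eval_pow, Finsupp.sum, Finsupp.sum, ← this]
    refine Eq.trans ?_ Finset.smul_sum.symm
    refine Finset.sum_congr rfl fun ν _ => ?_
    rw [node_conj S hγG]
    exact ((congrArg _ (smul_pow' _ _ _).symm).trans (smul_mul' _ _ _).symm)
  conv_lhs => rw [← h]
  rw [Finsupp.mapDomain_apply (conj_injective S g), Finsupp.mapRange_apply]

end

end Skew

end

end GaloisOrder


/-! ### A criterion for principal Galois orders -/

namespace GaloisOrder

noncomputable section

set_option linter.unusedSectionVars false

variable {k Λ : Type} [Field k] [CommRing Λ] [IsDomain Λ] [Algebra k Λ]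
  {G : Subgroup (Λ ≃ₐ[k] Λ)} {T : Subgroup (Λ ≃ₐ[k] Λ)}

/-- The coefficients of `∑ a_μ μ`. -/
def leftCoeff (T : Subgroup (Λ ≃ₐ[k] Λ)) :
    SkewRing T.toSubmonoid →+ (T.toSubmonoid →₀ FractionRing Λ) where
  toFun X := X.coeff
  map_zero' := rfl
  map_add' := SkewMonoidAlgebra.coeff_add

theorem leftCoeff_injective : Function.Injective (leftCoeff T) := fun _ _ h =>
  SkewMonoidAlgebra.coeff_injective h

/-- The coefficients `μ⁻¹(a_μ)` of `∑ a_μ μ = ∑ μ μ⁻¹(a_μ)`. -/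
def rightCoeff (T : Subgroup (Λ ≃ₐ[k] Λ)) :
    SkewRing T.toSubmonoid →+ (T.toSubmonoid →₀ FractionRing Λ) where
  toFun X := Finsupp.onFinset X.coeff.support
    (fun μ => (μ : Λ ≃ₐ[k] Λ)⁻¹ • X.coeff μ) (fun μ hμ => by
      rw [Finsupp.mem_support_iff]
      intro h
      rw [h, smul_zero] at hμ
      exact hμ rfl)
  map_zero' := by
    ext μ
    simp
  map_add' _ _ := by
    ext μ
    simp

theorem rightCoeff_apply (X : SkewRing T.toSubmonoid) (μ : T.toSubmonoid) :
    rightCoeff T X μ = (μ : Λ ≃ₐ[k] Λ)⁻¹ • X.coeff μ := rfl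

theorem rightCoeff_injective : Function.Injective (rightCoeff T) := fun _ _ h =>
  SkewMonoidAlgebra.ext fun μ => smul_left_cancel _ (DFunLike.congr_fun h μ)

theorem rightCoeff_support_subset (X : SkewRing T.toSubmonoid) :
    X.coeff.support ⊆ (rightCoeff T X).support := fun μ hμ => by
  rw [Finsupp.mem_support_iff] at hμ ⊢
  rw [rightCoeff_apply]
  exact (smul_ne_zero_iff_ne _).2 hμ

theorem smul_mem_range (g : Λ ≃ₐ[k] Λ) {a : FractionRing Λ}
    (ha : a ∈ (algebraMap Λ (FractionRing Λ)).range) :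
    g • a ∈ (algebraMap Λ (FractionRing Λ)).range := by
  obtain ⟨b, rfl⟩ := ha
  exact ⟨g b, (smul_algebraMap g b).symm⟩

theorem leftSpan_eq (R : Subring (FractionRing Λ)) (S : Set (SkewRing T.toSubmonoid)) :
    leftSpan R S = spanBy (fun r X => SkewMonoidAlgebra.single 1 r * X) R S := rfl

theorem rightSpan_eq (R : Subring (FractionRing Λ)) (S : Set (SkewRing T.toSubmonoid)) :
    rightSpan R S = spanBy (fun r X => X * SkewMonoidAlgebra.single 1 r) R S := rfl

theorem leftCoeff_left (r : FractionRing Λ) (X : SkewRing T.toSubmonoid) (μ : T.toSubmonoid) :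
    leftCoeff T (SkewMonoidAlgebra.single 1 r * X) μ = r * leftCoeff T X μ :=
  X.coeff_single_one_mul r μ

theorem leftCoeff_right (γ : Λ) (X : SkewRing T.toSubmonoid) (μ : T.toSubmonoid) :
    leftCoeff T (X * SkewMonoidAlgebra.single 1 (algebraMap Λ (FractionRing Λ) γ)) μ =
      node T γ μ * leftCoeff T X μ := by
  refine (X.coeff_mul_single_one _ μ).trans ?_
  rw [Submonoid.smul_def, smul_algebraMap, mul_comm]
  rfl

/-- The node of `μ⁻¹`. -/
def conode (T : Subgroup (Λ ≃ₐ[k] Λ)) (γ : Λ) (μ : T.toSubmonoid) : FractionRing Λ :=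
  algebraMap Λ (FractionRing Λ) ((μ : Λ ≃ₐ[k] Λ)⁻¹ γ)

theorem conode_injective {γ : Λ} (hγ : ∀ μ ∈ T, ∀ ν ∈ T, μ γ = ν γ → μ = ν) :
    Function.Injective (conode T γ) := fun μ ν h =>
  Subtype.ext (inv_injective (hγ _ (T.inv_mem μ.2) _ (T.inv_mem ν.2)
    (IsFractionRing.injective Λ (FractionRing Λ) h)))

theorem rightCoeff_right (r : FractionRing Λ) (X : SkewRing T.toSubmonoid) (μ : T.toSubmonoid) :
    rightCoeff T (X * SkewMonoidAlgebra.single 1 r) μ = r * rightCoeff T X μ := by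
  rw [rightCoeff_apply, rightCoeff_apply, X.coeff_mul_single_one, Submonoid.smul_def, smul_mul',
    inv_smul_smul, mul_comm]

theorem rightCoeff_left (γ : Λ) (X : SkewRing T.toSubmonoid) (μ : T.toSubmonoid) :
    rightCoeff T (SkewMonoidAlgebra.single 1 (algebraMap Λ (FractionRing Λ) γ) * X) μ =
      conode T γ μ * rightCoeff T X μ := by
  rw [rightCoeff_apply, rightCoeff_apply, X.coeff_single_one_mul, smul_mul', smul_algebraMap]
  rfl

variable (S : ∀ g ∈ G, ∀ μ ∈ T.toSubmonoid, g * μ * g⁻¹ ∈ T.toSubmonoid)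

theorem conode_conj {γ : Λ} (hγG : ∀ g ∈ G, g γ = γ) (g : G) (μ : T.toSubmonoid) :
    conode T γ (conj S g μ) = g • conode T γ μ := by
  refine Eq.trans ?_ (smul_algebraMap _ _).symm
  unfold conode conj
  congr 1
  dsimp only
  rw [show ((g : Λ ≃ₐ[k] Λ) * μ * (g : Λ ≃ₐ[k] Λ)⁻¹)⁻¹ =
    g * (μ : Λ ≃ₐ[k] Λ)⁻¹ * (g : Λ ≃ₐ[k] Λ)⁻¹ by group]
  change (g : Λ ≃ₐ[k] Λ) ((μ : Λ ≃ₐ[k] Λ)⁻¹ ((g : Λ ≃ₐ[k] Λ)⁻¹ γ)) = _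
  rw [inv_apply_of_fixed hγG]

theorem rightCoeff_conj {X : SkewRing T.toSubmonoid} (hX : X ∈ invariants G T.toSubmonoid) (g : G)
    (μ : T.toSubmonoid) : rightCoeff T X (conj S g μ) = g • rightCoeff T X μ := by
  rw [rightCoeff_apply, rightCoeff_apply, (mem_invariants_iff S).1 hX]
  unfold conj
  dsimp only
  rw [Subgroup.smul_def, Subgroup.smul_def, smul_smul, smul_smul]
  congr 1
  group

theorem mem_invariants_iff_rightCoeff {X : SkewRing T.toSubmonoid} :
    X ∈ invariants G T.toSubmonoid ↔
      ∀ (g : G) μ, rightCoeff T X (conj S g μ) = g • rightCoeff T X μ := by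
  refine ⟨fun h g μ => rightCoeff_conj S h g μ, fun h => (mem_invariants_iff S).2 fun g μ => ?_⟩
  have := h g μ
  rw [rightCoeff_apply, rightCoeff_apply, inv_smul_eq_iff] at this
  rw [this]
  unfold conj
  dsimp only
  rw [Subgroup.smul_def, Subgroup.smul_def, smul_smul, smul_smul]
  congr 1
  group

theorem isNoetherian_subring (h : IsNoetherian (FixedPoints.subalgebra k Λ G) Λ) :
    IsNoetherian (FixedPoints.subalgebra k Λ G).toSubring Λ := h

/-- A subring of `L ⋆ T` that contains `Γ`, preserves `Γ`, and has large supports, is a principal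
Galois order. -/
theorem isPrincipalGaloisOrder (hS : IsSetting G T.toSubmonoid) {γ : Λ}
    (hγG : ∀ g ∈ G, g γ = γ) (hγ : ∀ μ ∈ T, ∀ ν ∈ T, μ γ = ν γ → μ = ν)
    {U : Subring (SkewRing T.toSubmonoid)}
    (hΓ : ∀ a ∈ invariantSubring G, SkewMonoidAlgebra.single 1 a ∈ U)
    (hprin : ∀ X ∈ U, ∀ a ∈ invariantSubring G, eval X a ∈ invariantSubring G)
    (hsupp : ∀ μ : T.toSubmonoid, ∃ X ∈ U, X.coeff μ ≠ 0) :
    IsPrincipalGaloisOrder G T.toSubmonoid U := by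
  classical
  have S := hS.invariance
  have hU (X) (hX : X ∈ U) : X ∈ invariants G T.toSubmonoid :=
    mem_invariants_of_eval S hγG hγ (hprin X hX)
  have hγΓ : algebraMap Λ (FractionRing Λ) γ ∈ invariantSubring G :=
    mem_invariantSubring.2 ⟨γ, hγG, rfl⟩
  have hleft_inv {r : FractionRing Λ} (hr : r ∈ fixedField G) {X : SkewRing T.toSubmonoid}
      (hX : X ∈ invariants G T.toSubmonoid) :
      SkewMonoidAlgebra.single 1 r * X ∈ invariants G T.toSubmonoid := by
    rw [mem_invariants_iff S] at hX ⊢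
    intro g μ
    rw [X.coeff_single_one_mul, X.coeff_single_one_mul, hX]
    exact ((congrArg (· * g • X.coeff μ) (hr g).symm).trans (smul_mul' g r _).symm)
  have hright_inv {r : FractionRing Λ} (hr : r ∈ fixedField G) {X : SkewRing T.toSubmonoid}
      (hX : X ∈ invariants G T.toSubmonoid) :
      X * SkewMonoidAlgebra.single 1 r ∈ invariants G T.toSubmonoid := by
    rw [mem_invariants_iff_rightCoeff S] at hX ⊢
    intro g μ
    rw [rightCoeff_right, rightCoeff_right, hX]
    exact ((congrArg (· * g • rightCoeff T X μ) (hr g).symm).trans (smul_mul' g r _).symm)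
  have hfix : ((fixedField G : Subring (FractionRing Λ)) : Set (FractionRing Λ)) =
      {r | ∀ g : G, g • r = r} := rfl
  -- The moments X(γ^t) lie in Λ, so the product of differences of nodes clears the denominators for
  -- all X in U supported on F at once.
  have hden (F : Finset T.toSubmonoid) : ∃ D : Λ, D ≠ 0 ∧ ∀ X ∈ U, X.coeff.support ⊆ F →
      ∀ μ, algebraMap Λ (FractionRing Λ) D * X.coeff μ ∈
        (algebraMap Λ (FractionRing Λ)).range := by
    have hnode (μ : T.toSubmonoid) : node T γ μ ∈ (algebraMap Λ (FractionRing Λ)).range :=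
      ⟨_, rfl⟩
    have h0 := denominator_ne_zero (node_injective hγ) F
    obtain ⟨D, hD⟩ : ∏ j ∈ F, ∏ l ∈ F.erase j, (node T γ j - node T γ l) ∈
        (algebraMap Λ (FractionRing Λ)).range :=
      prod_mem fun j _ => prod_mem fun l _ => sub_mem (hnode j) (hnode l)
    refine ⟨D, ?_, fun X hX hXF μ => ?_⟩
    · rintro rfl
      rw [map_zero] at hD
      exact h0 hD.symm
    · rw [hD]
      refine denominator_mul_mem _ hnode hXF (fun t => ?_) μ
      rw [← eval_pow]
      obtain ⟨b, -, hb⟩ := mem_invariantSubring.1 (hprin X hX _ (pow_mem hγΓ t))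
      exact ⟨b, hb⟩
  have := isNoetherian_subring hS.noetherian
  have hle : ((FixedPoints.subalgebra k Λ G).toSubring).map
    (algebraMap Λ (FractionRing Λ)) ≤ fixedField G := invariantSubring_le_fixedField
  have hmem {r : Λ} (hr : r ∈ (FixedPoints.subalgebra k Λ G).toSubring) :
      SkewMonoidAlgebra.single 1 (algebraMap Λ (FractionRing Λ) r) ∈ U :=
    hΓ _ (Subring.mem_map.2 ⟨r, hr, rfl⟩)
  refine { toIsSetting := hS, le_invariants := hU, invariantSubring_le := hΓ, principal := hprin,
           rightSpan_eq := ?_, leftSpan_eq := ?_, left_fg := ?_, right_fg := ?_ }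
  · refine le_antisymm ((AddSubgroup.closure_le _).2 ?_) fun Y hY => ?_
    · rintro _ ⟨r, hr, X, hX, rfl⟩
      exact hright_inv hr (hU X hX)
    -- The right-hand version uses the coefficients μ⁻¹(a_μ): right multiplication scales them, and
    -- left multiplication by γ acts through the nodes μ⁻¹(γ).
    · rw [rightSpan_eq, hfix]
      refine mem_spanBy_of_invariant (φ := rightCoeff T) (conj := conj S)
        (tw := fun X => SkewMonoidAlgebra.single 1 (algebraMap Λ (FractionRing Λ) γ) * X)
        (x := conode T γ) (conj_one S) (conj_mul S) rightCoeff_injective rightCoeff_right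
        (rightCoeff_left γ) (conode_injective hγ) (conode_conj S hγG)
        (fun X hX => rightCoeff_conj S (hU X hX)) (fun X hX => mul_mem (hΓ _ hγΓ) hX)
        (fun μ => ?_) (rightCoeff_conj S hY)
      obtain ⟨X, hX, hXμ⟩ := hsupp μ
      refine ⟨X, hX, ?_⟩
      rw [rightCoeff_apply]
      exact (smul_ne_zero_iff_ne _).2 hXμ
  · refine le_antisymm ((AddSubgroup.closure_le _).2 ?_) fun Y hY => ?_
    · rintro _ ⟨r, hr, X, hX, rfl⟩
      exact hleft_inv hr (hU X hX)
    · rw [leftSpan_eq, hfix]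
      exact mem_spanBy_of_invariant (φ := leftCoeff T) (conj := conj S)
        (tw := fun X => X * SkewMonoidAlgebra.single 1 (algebraMap Λ (FractionRing Λ) γ))
        (x := node T γ) (conj_one S) (conj_mul S) leftCoeff_injective leftCoeff_left
        (leftCoeff_right γ) (node_injective hγ) (node_conj S hγG)
        (fun X hX => (mem_invariants_iff S).1 (hU X hX)) (fun X hX => mul_mem hX (hΓ _ hγΓ))
        hsupp ((mem_invariants_iff S).1 hY)
  · intro Q hQ _
    refine exists_finite_spanBy (φ := leftCoeff T) (Λ := Λ) _ (fixedField G) hle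
      leftCoeff_injective leftCoeff_left U.toAddSubgroup
      (fun X hX r hr => U.mul_mem (hmem hr) hX) (fun F => ?_) hQ
    obtain ⟨D, hD0, hD⟩ := hden F
    refine ⟨algebraMap Λ (FractionRing Λ) D, ?_, fun X hX hXF μ => ?_⟩
    · exact (map_ne_zero_iff _ (IsFractionRing.injective Λ (FractionRing Λ))).2 hD0
    · obtain ⟨b, hb⟩ := hD X hX hXF μ
      exact ⟨b, hb.symm⟩
  · intro Q hQ _
    refine exists_finite_spanBy (φ := rightCoeff T) (Λ := Λ) _ (fixedField G) hle
      rightCoeff_injective rightCoeff_right U.toAddSubgroup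
      (fun X hX r hr => U.mul_mem hX (hmem hr)) (fun F => ?_) hQ
    obtain ⟨D, hD0, hD⟩ := hden F
    -- The right coefficient at μ is the left one transported by μ⁻¹, so μ⁻¹(D) clears its
    -- denominator; the product serves all μ in F.
    refine ⟨algebraMap Λ (FractionRing Λ) (∏ μ ∈ F, (μ : Λ ≃ₐ[k] Λ)⁻¹ D), ?_,
      fun X hX hXF μ => ?_⟩
    · refine (map_ne_zero_iff _ (IsFractionRing.injective Λ (FractionRing Λ))).2
        (Finset.prod_ne_zero_iff.2 fun μ _ => ?_)
      exact (map_ne_zero_iff _ (AlgEquiv.injective _)).2 hD0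
    · by_cases hμ : μ ∈ F
      · obtain ⟨b, hb⟩ := smul_mem_range (μ : Λ ≃ₐ[k] Λ)⁻¹
          (hD X hX ((rightCoeff_support_subset X).trans hXF) μ)
        refine ⟨(∏ ν ∈ F.erase μ, (ν : Λ ≃ₐ[k] Λ)⁻¹ D) * b, ?_⟩
        rw [← Finset.mul_prod_erase F _ hμ, map_mul, map_mul, hb, smul_mul', smul_algebraMap,
          rightCoeff_apply]
        ring
      · exact ⟨0, by rw [Finsupp.notMem_support_iff.1 (fun h => hμ (hXF h)), mul_zero, map_zero]⟩

end

end GaloisOrder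


/-! ### Finiteness over invariants, the translation lattice and S_n -/

namespace GaloisOrder

noncomputable section

/-- A finitely generated algebra is a noetherian module over the invariants of a finite group. -/
theorem isNoetherian_fixedPoints {k Λ : Type} [Field k] [CommRing Λ] [Algebra k Λ]
    [Algebra.FiniteType k Λ] (G : Subgroup (Λ ≃ₐ[k] Λ)) [Finite G] :
    IsNoetherian (FixedPoints.subalgebra k Λ G) Λ := by
  have hinv : Algebra.IsInvariant (FixedPoints.subalgebra k Λ G) Λ G :=
    ⟨fun b hb => ⟨⟨b, hb⟩, rfl⟩⟩
  have := Algebra.IsInvariant.isIntegral (FixedPoints.subalgebra k Λ G) Λ G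
  have : Algebra.FiniteType (FixedPoints.subalgebra k Λ G) Λ :=
    Algebra.FiniteType.of_restrictScalars_finiteType k _ _
  have hfin : Module.Finite (FixedPoints.subalgebra k Λ G) Λ := Algebra.IsIntegral.finite
  -- The Artin–Tate lemma.
  have hfg : (⊤ : Subalgebra k (FixedPoints.subalgebra k Λ G)).FG :=
    fg_of_fg_of_fg k (FixedPoints.subalgebra k Λ G) Λ Algebra.FiniteType.out hfin.1
      Subtype.val_injective
  have : Algebra.FiniteType k (FixedPoints.subalgebra k Λ G) := ⟨hfg⟩
  have : IsNoetherianRing (FixedPoints.subalgebra k Λ G) :=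
    Algebra.FiniteType.isNoetherianRing k _
  exact isNoetherian_of_isNoetherianRing_of_finite _ _

end

end GaloisOrder

namespace Cherednik

noncomputable section

open Equiv Equiv.Perm

variable {ℓ n : ℕ} (ħ : ℂ)

theorem translation_X (v : Fin n → ℂ) (i : Fin n) :
    translation v (MvPolynomial.X i) = MvPolynomial.X i + MvPolynomial.C (v i) := by
  simp [translation]

theorem translation_C (v : Fin n → ℂ) (z : ℂ) :
    translation v (MvPolynomial.C z) = MvPolynomial.C z := (translation v).commutes z

theorem translation_mul (v w : Fin n → ℂ) :
    translation v * translation w = translation (v + w) := by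
  refine AlgEquiv.coe_toAlgHom_injective (MvPolynomial.algHom_ext fun i => ?_)
  change translation v (translation w (MvPolynomial.X i)) = translation (v + w) (MvPolynomial.X i)
  rw [translation_X, translation_X, map_add, translation_X, Pi.add_apply, MvPolynomial.C_add,
    translation_C, add_assoc, add_comm (MvPolynomial.C (v i))]

theorem translation_zero : translation (0 : Fin n → ℂ) = 1 := by
  refine AlgEquiv.coe_toAlgHom_injective (MvPolynomial.algHom_ext fun i => ?_)
  change translation 0 (MvPolynomial.X i) = MvPolynomial.X i
  rw [translation_X, Pi.zero_apply, MvPolynomial.C_0, add_zero]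

/-- The translation by `ħ d`. -/
def shift : Multiplicative (Fin n → ℤ) →* (PolyU n ≃ₐ[ℂ] PolyU n) where
  toFun d := translation fun i => ħ * d.toAdd i
  map_one' := by
    rw [← translation_zero]
    congr 1
    funext i
    simp
  map_mul' d d' := by
    rw [translation_mul]
    congr 1
    funext i
    simp [mul_add]

theorem shift_apply (d : Fin n → ℤ) :
    shift ħ (Multiplicative.ofAdd d) = translation fun i => ħ * d i := rfl

theorem mu_eq_shift (i : Fin n) : mu ħ i = shift ħ (Multiplicative.ofAdd (Pi.single i 1)) := by
  rw [shift_apply, mu]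
  congr 1
  funext j
  rcases eq_or_ne j i with rfl | h
  · simp
  · simp [h]

/-- The exponents that are congruent modulo `ℓ` to a constant divisible by `ℓ / p`. -/
def IsGood (ℓ p : ℕ) (χ : Fin n → ZMod ℓ) : Prop := ∃ t : ZMod ℓ, ∀ i, χ i = (ℓ / p : ℕ) * t

theorem isGood_add {p : ℕ} {χ χ' : Fin n → ZMod ℓ} (h : IsGood ℓ p χ) (h' : IsGood ℓ p χ') :
    IsGood ℓ p (χ + χ') := by
  obtain ⟨t, ht⟩ := h
  obtain ⟨t', ht'⟩ := h'
  exact ⟨t + t', fun i => by rw [Pi.add_apply, ht, ht', mul_add]⟩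

theorem isGood_neg {p : ℕ} {χ : Fin n → ZMod ℓ} (h : IsGood ℓ p χ) : IsGood ℓ p (-χ) := by
  obtain ⟨t, ht⟩ := h
  exact ⟨-t, fun i => by rw [Pi.neg_apply, ht, mul_neg]⟩

/-- Reduction of exponents modulo `ℓ`. -/
def red (ℓ : ℕ) (d : Fin n → ℤ) : Fin n → ZMod ℓ := fun i => d i

theorem red_add (d d' : Fin n → ℤ) : red ℓ (d + d') = red ℓ d + red ℓ d' := by
  funext i; simp [red]

theorem red_neg (d : Fin n → ℤ) : red ℓ (-d) = -red ℓ d := by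
  funext i; simp [red]

theorem prod_ofAdd_single : (List.ofFn fun i : Fin n =>
    Multiplicative.ofAdd (Pi.single i (1 : ℤ) : Fin n → ℤ)).prod =
      Multiplicative.ofAdd (fun _ => 1) := by
  rw [List.prod_ofFn, ← ofAdd_sum]
  exact congrArg _ (Finset.univ_sum_single fun _ : Fin n => (1 : ℤ))

theorem prod_mu : (List.ofFn fun i : Fin n => mu ħ i).prod =
    shift ħ (Multiplicative.ofAdd (fun _ => 1)) := by
  have h : (fun i : Fin n => mu ħ i) = shift ħ ∘ fun i =>
      Multiplicative.ofAdd (Pi.single i (1 : ℤ)) := funext (mu_eq_shift ħ)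
  rw [← prod_ofAdd_single, map_list_prod, List.map_ofFn, h]

/-- In coordinates T consists of the translations whose exponents reduce modulo ℓ to a constant
multiple of ℓ/p, the same condition that describes the χ where E' is nonzero. -/
theorem mem_lattice {p : ℕ} {μ : PolyU n ≃ₐ[ℂ] PolyU n} : μ ∈ lattice ℓ p n ħ ↔
    ∃ d : Fin n → ℤ, IsGood ℓ p (red ℓ d) ∧ μ = shift ħ (Multiplicative.ofAdd d) := by
  constructor
  · intro h
    induction h using Subgroup.closure_induction with
    | mem μ hμ =>
      rcases hμ with ⟨i, rfl⟩ | rfl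
      · refine ⟨Pi.single i ℓ, ⟨0, fun j => ?_⟩, ?_⟩
        · rcases eq_or_ne j i with rfl | h
          · simp [red]
          · simp [red, h]
        · dsimp only
          rw [mu_eq_shift, ← map_pow, ← ofAdd_nsmul, ← Pi.single_smul]
          simp
      · refine ⟨fun _ => ((ℓ / p : ℕ) : ℤ), ⟨1, fun j => by
          rw [red, mul_one, Int.cast_natCast]⟩, ?_⟩
        rw [prod_mu, ← map_pow, ← ofAdd_nsmul]
        congr 2
        funext j
        rw [Pi.smul_apply, nsmul_eq_mul, mul_one]
    | one => exact ⟨0, ⟨0, fun i => by simp [red]⟩, by simp⟩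
    | mul μ ν _ _ hμ hν =>
      obtain ⟨d, hd, rfl⟩ := hμ
      obtain ⟨d', hd', rfl⟩ := hν
      exact ⟨d + d', by rw [red_add]; exact isGood_add hd hd', by rw [ofAdd_add, map_mul]⟩
    | inv μ _ hμ =>
      obtain ⟨d, hd, rfl⟩ := hμ
      exact ⟨-d, by rw [red_neg]; exact isGood_neg hd, by rw [ofAdd_neg, map_inv]⟩
  · rintro ⟨d, ⟨t, ht⟩, rfl⟩
    obtain ⟨t, rfl⟩ := ZMod.intCast_surjective t
    have hdvd (i : Fin n) : (ℓ : ℤ) ∣ d i - (ℓ / p : ℕ) * t := by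
      rw [← ZMod.intCast_eq_intCast_iff_dvd_sub, Int.cast_mul, Int.cast_natCast]
      exact (ht i).symm
    choose b hb using hdvd
    have hd : d = (∑ i, b i • (ℓ • Pi.single i (1 : ℤ) : Fin n → ℤ)) +
        t • ((ℓ / p) • (fun _ => 1 : Fin n → ℤ)) := by
      funext j
      rw [Pi.add_apply, Finset.sum_apply, Finset.sum_eq_single j]
      · have h : (b j • (ℓ • Pi.single j (1 : ℤ) : Fin n → ℤ)) j = b j * ℓ := by simp
        have h' : (t • ((ℓ / p) • (fun _ => 1 : Fin n → ℤ))) j = t * (ℓ / p : ℕ) := by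
          rw [Pi.smul_apply, Pi.smul_apply, nsmul_eq_mul, mul_one, smul_eq_mul]
        rw [h, h']
        linear_combination hb j
      · intro i _ hi
        simp [hi.symm]
      · simp
    suffices h : Multiplicative.ofAdd d ∈ (lattice ℓ p n ħ).comap (shift ħ) from h
    rw [hd, ofAdd_add, ofAdd_sum]
    refine mul_mem (Subgroup.prod_mem _ fun i _ => ?_) ?_
    · rw [ofAdd_zsmul, ofAdd_nsmul]
      refine zpow_mem ?_ _
      rw [Subgroup.mem_comap, map_pow, ← mu_eq_shift]
      exact Subgroup.subset_closure (Or.inl ⟨i, rfl⟩)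
    · rw [ofAdd_zsmul, ofAdd_nsmul]
      refine zpow_mem ?_ _
      rw [Subgroup.mem_comap, map_pow, ← prod_mu]
      exact Subgroup.subset_closure (Or.inr rfl)

theorem eval_translation (v u : Fin n → ℂ) (f : PolyU n) :
    MvPolynomial.eval u (translation v f) = MvPolynomial.eval (u + v) f := by
  have : (MvPolynomial.aeval u).comp (translation v : PolyU n →ₐ[ℂ] PolyU n) =
      MvPolynomial.aeval (u + v) := by
    refine MvPolynomial.algHom_ext fun i => ?_
    change MvPolynomial.aeval u (translation v (MvPolynomial.X i)) = _
    simp [translation_X]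
  exact DFunLike.congr_fun this f

/-- The symmetric polynomial U_1⋯U_n separates translations and serves as the element γ of the
criterion. -/
theorem shift_eq_shift_of_prod (hħ : ħ ≠ 0) {d d' : Fin n → ℤ}
    (h : shift ħ (Multiplicative.ofAdd d) (∏ i, MvPolynomial.X i) =
      shift ħ (Multiplicative.ofAdd d') (∏ i, MvPolynomial.X i)) : d = d' := by
  funext i
  -- At this point the i-th factor of the first product is 0, while every factor of the second with
  -- j ≠ i is 1; so its i-th factor ħ(d'_i - d_i) must vanish.
  have := congrArg (MvPolynomial.eval fun j => if j = i then -ħ * d j else 1 - ħ * d' j) h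
  rw [shift_apply, shift_apply, eval_translation, eval_translation, map_prod, map_prod,
    Finset.prod_eq_zero (Finset.mem_univ i) (by simp), eq_comm, Finset.prod_eq_zero_iff] at this
  obtain ⟨j, -, hj⟩ := this
  rcases eq_or_ne j i with rfl | hji
  · simp only [MvPolynomial.eval_X, Pi.add_apply, if_true] at hj
    have : ħ * (d' j - d j) = 0 := by linear_combination hj
    rcases mul_eq_zero.1 this with h0 | h0
    · exact absurd h0 hħ
    · exact_mod_cast (sub_eq_zero.1 h0).symm
  · simp [hji] at hj

theorem shift_injective (hħ : ħ ≠ 0) : Function.Injective (shift (n := n) ħ) := fun _ _ h =>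
  Multiplicative.toAdd.injective (shift_eq_shift_of_prod ħ hħ (DFunLike.congr_fun h _))

theorem renameEquiv_mul_shift (w : Perm (Fin n)) (d : Fin n → ℤ) :
    (MvPolynomial.renameEquiv ℂ w : PolyU n ≃ₐ[ℂ] PolyU n) * shift ħ (Multiplicative.ofAdd d) =
      shift ħ (Multiplicative.ofAdd (d ∘ w.symm)) * MvPolynomial.renameEquiv ℂ w := by
  refine AlgEquiv.coe_toAlgHom_injective (MvPolynomial.algHom_ext fun i => ?_)
  change MvPolynomial.renameEquiv ℂ w (shift ħ (Multiplicative.ofAdd d) (MvPolynomial.X i)) =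
    shift ħ (Multiplicative.ofAdd (d ∘ w.symm)) (MvPolynomial.renameEquiv ℂ w (MvPolynomial.X i))
  rw [shift_apply, shift_apply, translation_X, map_add]
  simp [translation_X]

theorem isGood_comp {p : ℕ} {χ : Fin n → ZMod ℓ} (h : IsGood ℓ p χ) (w : Perm (Fin n)) :
    IsGood ℓ p (χ ∘ w) := by
  obtain ⟨t, ht⟩ := h
  exact ⟨t, fun i => ht _⟩

/-- A permutation of the variables fixes the origin, and a translation fixing the origin is trivial.
-/
theorem shift_eq_one_of_mem {d : Fin n → ℤ}
    (h : shift ħ (Multiplicative.ofAdd d) ∈ symmetricGroup n) :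
    shift ħ (Multiplicative.ofAdd d) = 1 := by
  obtain ⟨w, hw⟩ := h
  rw [← translation_zero, shift_apply]
  congr 1
  funext i
  have := congrArg (MvPolynomial.eval 0) (DFunLike.congr_fun hw (MvPolynomial.X i))
  rw [shift_apply, translation_X] at this
  simpa using this.symm

theorem isSetting (p : ℕ) :
    GaloisOrder.IsSetting (symmetricGroup n) (lattice ℓ p n ħ).toSubmonoid where
  integrallyClosed := inferInstance
  finite := Set.finite_range _
  separation := by
    intro μ hμ ν hν h
    obtain ⟨d, -, rfl⟩ := mem_lattice ħ |>.1 hμ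
    obtain ⟨d', -, rfl⟩ := mem_lattice ħ |>.1 hν
    rw [← map_inv, ← map_mul] at h ⊢
    exact shift_eq_one_of_mem ħ (d := d + -d') h
  invariance := by
    rintro _ ⟨w, rfl⟩ μ hμ
    obtain ⟨d, hd, rfl⟩ := mem_lattice ħ |>.1 hμ
    rw [renameEquiv_mul_shift, mul_inv_cancel_right]
    exact mem_lattice ħ |>.2 ⟨_, isGood_comp hd w.symm, rfl⟩
  noetherian := by
    have : Finite (symmetricGroup n) := Set.finite_range _
    exact GaloisOrder.isNoetherian_fixedPoints _

theorem symmetricGroup_fixes {f : PolyU n} :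
    (∀ g ∈ symmetricGroup n, g f = f) ↔ f.IsSymmetric := by
  refine ⟨fun h w => h _ ⟨w, rfl⟩, ?_⟩
  rintro h _ ⟨w, rfl⟩
  exact h w

theorem isSymmetric_prod_X : (∏ i, MvPolynomial.X i : PolyU n).IsSymmetric := by
  intro w
  rw [map_prod]
  simp only [MvPolynomial.rename_X]
  exact Equiv.prod_comp w MvPolynomial.X

theorem isPrincipalGaloisOrder {p : ℕ} (hħ : ħ ≠ 0)
    {U : Subring (GaloisOrder.SkewRing (lattice ℓ p n ħ).toSubmonoid)}
    (hΓ : ∀ f : PolyU n, f.IsSymmetric →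
      SkewMonoidAlgebra.single 1 (algebraMap _ (FractionRing (PolyU n)) f) ∈ U)
    (hprin : ∀ X ∈ U, ∀ f : PolyU n, f.IsSymmetric → ∃ g : PolyU n, g.IsSymmetric ∧
      GaloisOrder.eval X (algebraMap _ _ f) = algebraMap _ _ g)
    (hsupp : ∀ μ, ∃ X ∈ U, X.coeff μ ≠ 0) :
    GaloisOrder.IsPrincipalGaloisOrder (symmetricGroup n) (lattice ℓ p n ħ).toSubmonoid U := by
  refine GaloisOrder.isPrincipalGaloisOrder (γ := ∏ i, MvPolynomial.X i) (isSetting ħ p)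
    (symmetricGroup_fixes.2 isSymmetric_prod_X) ?_ ?_ ?_ hsupp
  · intro μ hμ ν hν h
    obtain ⟨d, -, rfl⟩ := mem_lattice ħ |>.1 hμ
    obtain ⟨d', -, rfl⟩ := mem_lattice ħ |>.1 hν
    rw [shift_eq_shift_of_prod ħ hħ h]
  · intro a ha
    obtain ⟨f, hf, rfl⟩ := GaloisOrder.mem_invariantSubring.1 ha
    exact hΓ f (symmetricGroup_fixes.1 hf)
  · intro X hX a ha
    obtain ⟨f, hf, rfl⟩ := GaloisOrder.mem_invariantSubring.1 ha
    obtain ⟨g, hg, h⟩ := hprin X hX f (symmetricGroup_fixes.1 hf)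
    exact GaloisOrder.mem_invariantSubring.2 ⟨g, symmetricGroup_fixes.2 hg, h.symm⟩

end

end Cherednik


/-! ### The degree filtration on rational functions -/

namespace Cherednik

noncomputable section

open Equiv Equiv.Perm

variable {ℓ n : ℕ}

/-- The rational functions of degree at most `N`. -/
def Filt (n : ℕ) (N : ℤ) : Submodule ℂ (FractionRing (PolyU n)) where
  carrier := {r | r = 0 ∨ ∃ p q : PolyU n, q ≠ 0 ∧ r * algebraMap _ _ q = algebraMap _ _ p ∧
    (p.totalDegree : ℤ) ≤ q.totalDegree + N}
  zero_mem' := Or.inl rfl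
  add_mem' := by
    rintro r s (rfl | ⟨p, q, hq, h, hd⟩) hs
    · rwa [zero_add]
    rcases hs with rfl | ⟨p', q', hq', h', hd'⟩
    · exact Or.inr ⟨p, q, hq, by rwa [add_zero], hd⟩
    refine Or.inr ⟨p * q' + p' * q, q * q', mul_ne_zero hq hq', ?_, ?_⟩
    · simp only [map_mul, map_add, ← h, ← h']
      ring
    · rw [MvPolynomial.totalDegree_mul_of_isDomain hq hq']
      have h1 := MvPolynomial.totalDegree_add (p * q') (p' * q)
      have h2 := MvPolynomial.totalDegree_mul p q'
      have h3 := MvPolynomial.totalDegree_mul p' q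
      push_cast
      rcases le_max_iff.1 h1 with h1 | h1 <;> omega
  smul_mem' := by
    rintro z r (rfl | ⟨p, q, hq, h, hd⟩)
    · exact Or.inl (smul_zero z)
    refine Or.inr ⟨z • p, q, hq, ?_, ?_⟩
    · rw [smul_mul_assoc, h]
      exact (map_smul (IsScalarTower.toAlgHom ℂ (PolyU n) (FractionRing (PolyU n))) z p).symm
    · have := MvPolynomial.totalDegree_smul_le z p
      omega

theorem filt_mono {N N' : ℤ} (h : N ≤ N') : Filt n N ≤ Filt n N' := by
  rintro r (rfl | ⟨p, q, hq, h', hd⟩)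
  · exact Or.inl rfl
  · exact Or.inr ⟨p, q, hq, h', by omega⟩

theorem mul_mem_filt {N N' : ℤ} {r s : FractionRing (PolyU n)} (hr : r ∈ Filt n N)
    (hs : s ∈ Filt n N') : r * s ∈ Filt n (N + N') := by
  rcases hr with rfl | ⟨p, q, hq, h, hd⟩
  · rw [zero_mul]; exact zero_mem _
  rcases hs with rfl | ⟨p', q', hq', h', hd'⟩
  · rw [mul_zero]; exact zero_mem _
  refine Or.inr ⟨p * p', q * q', mul_ne_zero hq hq', ?_, ?_⟩
  · simp only [map_mul, ← h, ← h']
    ring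
  · rw [MvPolynomial.totalDegree_mul_of_isDomain hq hq']
    have := MvPolynomial.totalDegree_mul p p'
    push_cast
    omega

theorem algebraMap_mem_filt (z : ℂ) : algebraMap ℂ (FractionRing (PolyU n)) z ∈ Filt n 0 :=
  Or.inr ⟨MvPolynomial.C z, 1, one_ne_zero, by
    rw [map_one, mul_one, IsScalarTower.algebraMap_apply ℂ (PolyU n) (FractionRing (PolyU n))]
    rfl, by simp⟩

theorem one_mem_filt : (1 : FractionRing (PolyU n)) ∈ Filt n 0 := by
  have := algebraMap_mem_filt (n := n) 1
  rwa [map_one] at this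

theorem totalDegree_le_of_mem_filt {N : ℤ} {p : PolyU n} (hp : p ≠ 0)
    (h : algebraMap _ _ p ∈ Filt n N) : (p.totalDegree : ℤ) ≤ N := by
  rcases h with h | ⟨p', q, hq, h, hd⟩
  · exact absurd ((IsFractionRing.to_map_eq_zero_iff).1 h) hp
  · rw [← map_mul] at h
    rw [← IsFractionRing.injective (PolyU n) (FractionRing (PolyU n)) h,
      MvPolynomial.totalDegree_mul_of_isDomain hp hq] at hd
    push_cast at hd
    omega

theorem one_notMem_filt : (1 : FractionRing (PolyU n)) ∉ Filt n (-1) := fun h => by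
  rw [← map_one (algebraMap (PolyU n) (FractionRing (PolyU n)))] at h
  have := totalDegree_le_of_mem_filt one_ne_zero h
  simp at this

variable (ħ k : ℂ)

theorem lval_eq (q : Subst ℓ n) (i : Fin n) :
    lval ħ q i = algebraMap (PolyU n) _ (MvPolynomial.X (q.w i)) + algebraMap ℂ _ (ħ * q.d i) := by
  rw [lval, Subst.val, map_add,
    IsScalarTower.algebraMap_apply ℂ (PolyU n) (FractionRing (PolyU n))]
  rfl

theorem lval_mem_filt (q : Subst ℓ n) (i : Fin n) : lval ħ q i ∈ Filt n 1 := by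
  rw [lval_eq]
  refine add_mem (Or.inr ⟨MvPolynomial.X (q.w i), 1, one_ne_zero, by rw [map_one, mul_one], by simp⟩)
    (filt_mono zero_le_one (algebraMap_mem_filt _))

theorem rcoef_mem_filt (q : Subst ℓ n) {i j : Fin n} (h : i ≠ j) :
    rcoef ħ k q i j ∈ Filt n (-1) := by
  refine Or.inr ⟨MvPolynomial.C (k * pairVal q.χ i j), q.val ħ j - q.val ħ i,
    val_sub_val_ne_zero ħ q h, ?_, ?_⟩
  · rw [rcoef, map_sub]
    change _ / _ * (lval ħ q j - lval ħ q i) = _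
    rw [div_mul_cancel₀ _ (lval_sub_ne_zero ħ q h),
      IsScalarTower.algebraMap_apply ℂ (PolyU n) (FractionRing (PolyU n))]
    rfl
  -- The denominator contains the variable U_{w(j)} with coefficient 1, so its degree is at least
  -- one while the numerator is constant.
  · have hs : Finsupp.single (q.w j) 1 ∈ (q.val ħ j - q.val ħ i).support := by
      rw [MvPolynomial.mem_support_iff]
      have h1 : ¬ Finsupp.single (q.w i) 1 = Finsupp.single (q.w j) 1 := fun h' => h
        (q.w.injective ((Finsupp.single_left_inj one_ne_zero).1 h'))
      have h2 : Finsupp.single (q.w j) 1 ≠ (0 : Fin n →₀ ℕ) := fun h' => by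
        have := DFunLike.congr_fun h' (q.w j)
        simp at this
      simp only [Subst.val, MvPolynomial.coeff_sub, MvPolynomial.coeff_add, MvPolynomial.coeff_X,
        MvPolynomial.coeff_C, if_true, if_neg h1, if_neg h2.symm]
      simp
    have := MvPolynomial.le_totalDegree hs
    rw [Finsupp.sum_single_index rfl] at this
    rw [MvPolynomial.totalDegree_C]
    omega

end

end Cherednik


/-! ### Leading terms of operators -/

namespace Cherednik

noncomputable section

open Equiv Equiv.Perm

variable {ℓ n : ℕ} (ħ : ℂ) (e : AddChar (ZMod ℓ) ℂ)

namespace Subst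

/-- The exponents of `T` are determined by the shifts of `U`. -/
def Compatible (q : Subst ℓ n) : Prop := q.χ = red ℓ q.d

theorem compatible_mul {q r : Subst ℓ n} (hq : q.Compatible) (hr : r.Compatible) :
    (q * r).Compatible := by
  unfold Compatible at *
  rw [mul_χ, mul_d, red_add, hq, hr]
  rfl

theorem compatible_perm (w : Perm (Fin n)) : (perm w : Subst ℓ n).Compatible := by
  funext i
  simp [red]

theorem compatible_one : (1 : Subst ℓ n).Compatible := compatible_perm 1

/-- The translation of exponents by `d`. -/
def trans (d : Fin n → ℤ) : Subst ℓ n := ⟨1, d, red ℓ d⟩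

theorem compatible_trans (d : Fin n → ℤ) : (trans d : Subst ℓ n).Compatible := rfl

theorem trans_mul (d d' : Fin n → ℤ) : (trans d * trans d' : Subst ℓ n) = trans (d + d') := by
  rw [trans, trans, trans, red_add]
  rfl

end Subst

/-- The span of the `r ε_q` with `deg r ≤ N` and `q` compatible, where `ε_q` is evaluation
at `q`. -/
def rowSpan (N : ℤ) : Submodule ℂ (PolyUT ℓ n →ₗ[ℂ] FractionRing (PolyU n)) :=
  Submodule.span ℂ {R | ∃ r ∈ Filt n N, ∃ q : Subst ℓ n, q.Compatible ∧ R = r • row ħ e q}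

variable {ħ e}

theorem smul_row_mem {N : ℤ} {r : FractionRing (PolyU n)} (hr : r ∈ Filt n N) {q : Subst ℓ n}
    (hq : q.Compatible) : r • row ħ e q ∈ rowSpan ħ e N :=
  Submodule.subset_span ⟨r, hr, q, hq, rfl⟩

theorem rowSpan_mono {N N' : ℤ} (h : N ≤ N') :
    (rowSpan ħ e N : Submodule ℂ (PolyUT ℓ n →ₗ[ℂ] _)) ≤ rowSpan ħ e N' := by
  refine Submodule.span_mono ?_
  rintro _ ⟨r, hr, q, hq, rfl⟩
  exact ⟨r, filt_mono h hr, q, hq, rfl⟩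

theorem smul_rowSpan {N N' : ℤ} {r : FractionRing (PolyU n)} (hr : r ∈ Filt n N)
    {R : PolyUT ℓ n →ₗ[ℂ] FractionRing (PolyU n)} (hR : R ∈ rowSpan ħ e N') :
    r • R ∈ rowSpan ħ e (N + N') := by
  induction hR using Submodule.span_induction with
  | mem R hR =>
    obtain ⟨s, hs, q, hq, rfl⟩ := hR
    rw [smul_smul]
    exact smul_row_mem (mul_mem_filt hr hs) hq
  | zero => rw [smul_zero]; exact zero_mem _
  | add R S _ _ hR hS => rw [smul_add]; exact add_mem hR hS
  | smul z R _ hR => rw [smul_comm]; exact Submodule.smul_mem _ z hR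

variable (ħ e)

/-- The operator `A` has the leading term `v ε_g`, of degree `M`. -/
def HasSymbol (M : ℤ) (A : Module.End ℂ (PolyUT ℓ n)) (v : Subst ℓ n → FractionRing (PolyU n))
    (g : Subst ℓ n) : Prop :=
  (∀ q, v q ∈ Filt n M) ∧ g.Compatible ∧ ∀ q : Subst ℓ n, q.Compatible →
    (row ħ e q).comp A - v q • row ħ e (q * g) ∈ rowSpan ħ e (M - 1)

variable {ħ e}

variable {M M' : ℤ} {A B : Module.End ℂ (PolyUT ℓ n)} {v v' : Subst ℓ n → FractionRing (PolyU n)}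
  {g g' : Subst ℓ n}

theorem HasSymbol.comp_mem (hA : HasSymbol ħ e M A v g) {N : ℤ}
    {R : PolyUT ℓ n →ₗ[ℂ] FractionRing (PolyU n)} (hR : R ∈ rowSpan ħ e N) :
    R.comp A ∈ rowSpan ħ e (N + M) := by
  induction hR using Submodule.span_induction with
  | mem R hR =>
    obtain ⟨r, hr, q, hq, rfl⟩ := hR
    have h := add_mem (rowSpan_mono (by omega) (hA.2.2 q hq))
      (smul_row_mem (hA.1 q) (Subst.compatible_mul hq hA.2.1))
    rw [sub_add_cancel] at h
    exact smul_rowSpan hr h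
  | zero => rw [LinearMap.zero_comp]; exact zero_mem _
  | add R S _ _ hR hS => rw [LinearMap.add_comp]; exact add_mem hR hS
  | smul z R _ hR => rw [LinearMap.smul_comp]; exact Submodule.smul_mem _ z hR

/-- The leading part of A moves the evaluation point from `q` to `q * g`, where the symbol of B is
then read off; composing the lower-order remainder of A with B stays below the top degree by
`comp_mem`. -/
theorem HasSymbol.mul (hA : HasSymbol ħ e M A v g) (hB : HasSymbol ħ e M' B v' g') :
    HasSymbol ħ e (M + M') (A * B) (fun q => v q * v' (q * g)) (g * g') := by
  refine ⟨fun q => mul_mem_filt (hA.1 q) (hB.1 _), Subst.compatible_mul hA.2.1 hB.2.1,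
    fun q hq => ?_⟩
  have h1 := hB.comp_mem (hA.2.2 q hq)
  have h2 := smul_rowSpan (hA.1 q) (hB.2.2 (q * g) (Subst.compatible_mul hq hA.2.1))
  rw [show M - 1 + M' = M + M' - 1 by ring] at h1
  rw [show M + (M' - 1) = M + M' - 1 by ring] at h2
  convert add_mem h1 h2 using 1
  rw [LinearMap.sub_comp, smul_sub, smul_smul, mul_assoc]
  change (row ħ e q).comp (A.comp B) - _ = _
  rw [← LinearMap.comp_assoc, LinearMap.smul_comp, sub_add_sub_cancel]

theorem HasSymbol.congr (hA : HasSymbol ħ e M A v g) (h : ∀ q, v' q - v q ∈ Filt n (M - 1)) :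
    HasSymbol ħ e M A v' g := by
  refine ⟨fun q => ?_, hA.2.1, fun q hq => ?_⟩
  · have := add_mem (filt_mono (by omega) (h q)) (hA.1 q)
    rwa [sub_add_cancel] at this
  · have := sub_mem (hA.2.2 q hq) (smul_row_mem (ħ := ħ) (e := e) (h q)
      (Subst.compatible_mul hq hA.2.1))
    convert this using 1
    refine LinearMap.ext fun f => ?_
    change row ħ e q (A f) - v' q * row ħ e (q * g) f =
      row ħ e q (A f) - v q * row ħ e (q * g) f - (v' q - v q) * row ħ e (q * g) f
    ring

theorem hasSymbol_of_row (hv : ∀ q, v q ∈ Filt n M) (hg : g.Compatible)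
    (h : ∀ q f, row ħ e q (A f) = v q * row ħ e (q * g) f) : HasSymbol ħ e M A v g := by
  refine ⟨hv, hg, fun q _ => ?_⟩
  have : (row ħ e q).comp A - v q • row ħ e (q * g) = 0 := by
    refine LinearMap.ext fun f => ?_
    simp [h]
  rw [this]
  exact zero_mem _

end

end Cherednik


/-! ### Leading terms of the generators and of monomials -/

namespace Cherednik

noncomputable section

open Equiv Equiv.Perm SymmetricPresentation CyclicPresentation

set_option linter.unusedSectionVars false

variable {ℓ m : ℕ} [NeZero ℓ] (ħ k : ℂ) (e : AddChar (ZMod ℓ) ℂ) (c : ℕ → ℂ)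

/-- The deformation coefficient has degree at most -1, so to leading order a deformed transposition
is the plain exchange of variables. -/
theorem hasSymbol_defSwap (he : Function.Injective e) {n : ℕ} {i j : Fin n} (h : i ≠ j) :
    HasSymbol ħ e 0 (defSwap ħ e k i j h) (fun _ => 1) (Subst.perm (swap i j)) := by
  refine ⟨fun _ => one_mem_filt, Subst.compatible_perm _, fun q hq => ?_⟩
  have hr := rcoef_mem_filt ħ k q h
  have hmem : rcoef ħ k q i j • row ħ e (q * Subst.perm (swap i j)) -
      rcoef ħ k q i j • row ħ e q ∈ rowSpan ħ e (0 - 1) :=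
    sub_mem (smul_row_mem hr (Subst.compatible_mul hq (Subst.compatible_perm (swap i j))))
      (smul_row_mem hr hq)
  convert hmem using 1
  refine LinearMap.ext fun f => ?_
  change row ħ e q (defSwap ħ e k i j h f) - 1 * row ħ e (q * Subst.perm (swap i j)) f =
    rcoef ħ k q i j * row ħ e (q * Subst.perm (swap i j)) f - rcoef ħ k q i j * row ħ e q f
  rw [row_defSwap ħ e he]
  ring

theorem hasSymbol_one {n : ℕ} :
    HasSymbol ħ e 0 (1 : Module.End ℂ (PolyUT ℓ n)) (fun _ => 1) 1 :=
  hasSymbol_of_row (fun _ => one_mem_filt) Subst.compatible_one fun q f => by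
    rw [mul_one, one_mul]
    rfl

theorem hasSymbol_permRep (he : Function.Injective e) (w : Perm (Fin (m + 1))) :
    HasSymbol ħ e 0 (permRep ħ k e he w) (fun _ => 1) (Subst.perm w) := by
  induction w using perm_induction with
  | h1 => rw [map_one]; exact hasSymbol_one ħ e
  | hmul u v hu hv =>
    have := hu.mul hv
    simp only [mul_one, add_zero] at this
    rwa [map_mul, Subst.perm_mul]
  | hs i =>
    rw [permRep_swap]
    exact hasSymbol_defSwap ħ k e he _

theorem compatible_sigmaSub : (sigmaSub : Subst ℓ (m + 1)).Compatible := by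
  funext i
  rcases eq_or_ne i (Fin.last m) with rfl | h
  · simp [red, sigmaSub]
  · simp [red, sigmaSub, h]

theorem compatible_tauSub : (tauSub : Subst ℓ (m + 1)).Compatible := by
  funext i
  rcases eq_or_ne i 0 with rfl | h
  · simp [red, tauSub]
  · simp [red, tauSub, h]

theorem Subst.ext_of_compatible {n : ℕ} {q r : Subst ℓ n} (hq : q.Compatible)
    (hr : r.Compatible) (hw : q.w = r.w) (hd : q.d = r.d) : q = r :=
  Subst.ext hw hd (by rw [hq, hr, hd])

theorem hasSymbol_xRep (he : Function.Injective e) (j : Fin (m + 1)) :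
    HasSymbol ħ e 1 (xRep ħ k e c he j) (fun q => lval ħ q j)
      (Subst.trans (Pi.single j 1)) := by
  have hσ : HasSymbol ħ e 1 (sigmaOp ħ e c) (sigmaVal ħ e c) (sigmaSub (m := m)) :=
    hasSymbol_of_row (fun q => add_mem (lval_mem_filt ħ q 0)
      (filt_mono zero_le_one (algebraMap_mem_filt _))) compatible_sigmaSub
      (row_sigmaOp ħ e c)
  have h := ((hasSymbol_permRep ħ k e he (swap 0 j)).mul
    (hσ.mul (hasSymbol_permRep ħ k e he (finRotate (m + 1))⁻¹))).mul
      (hasSymbol_permRep ħ k e he (swap 0 j)⁻¹)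
  rw [← xRep_zero ħ k e c he, ← xRep_eq, swap_apply_left] at h
  have hg : Subst.perm (swap 0 j) * (sigmaSub * Subst.perm (finRotate (m + 1))⁻¹) *
      Subst.perm (swap 0 j)⁻¹ = (Subst.trans (Pi.single j 1) : Subst ℓ (m + 1)) := by
    refine Subst.ext_of_compatible (Subst.compatible_mul (Subst.compatible_mul
      (Subst.compatible_perm _) (Subst.compatible_mul compatible_sigmaSub
        (Subst.compatible_perm _))) (Subst.compatible_perm _)) rfl ?_ ?_
    · simp [sigmaSub, Subst.trans]
    · simp only [sigmaSub, Subst.trans, Subst.mul_d, Subst.perm_d, Subst.mul_w, Subst.perm_w,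
        add_zero, Pi.zero_comp, zero_add, single_comp_perm, inv_inv, rotate_last,
        swap_apply_left]
  rw [hg, show (0 + (1 + 0) + 0 : ℤ) = 1 by norm_num] at h
  -- The constants added to U_1 in the factor of σ have degree 0 and do not affect the symbol.
  refine h.congr fun q => ?_
  rw [one_mul, mul_one, mul_one, sigmaVal, lval_mul_perm, swap_apply_left, sub_add_cancel_left]
  exact neg_mem (algebraMap_mem_filt _)

theorem hasSymbol_yRep (he : Function.Injective e) (j : Fin (m + 1)) :
    HasSymbol ħ e 0 (yRep ħ k e he j) (fun _ => 1)
      (Subst.trans (Pi.single j (-1))) := by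
  have hτ : HasSymbol ħ e 0 (tauOp ħ e) (fun _ => 1) (tauSub : Subst ℓ (m + 1)) :=
    hasSymbol_of_row (fun q => one_mem_filt) compatible_tauSub fun q f => by
      rw [row_tauOp, one_mul]
  have h := ((hasSymbol_permRep ħ k e he (swap (Fin.last m) j)).mul
    (hτ.mul (hasSymbol_permRep ħ k e he (finRotate (m + 1))))).mul
      (hasSymbol_permRep ħ k e he (swap (Fin.last m) j)⁻¹)
  rw [← yRep_last ħ k e he, ← yRep_eq, swap_apply_left] at h
  have hg : Subst.perm (swap (Fin.last m) j) * (tauSub * Subst.perm (finRotate (m + 1))) *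
      Subst.perm (swap (Fin.last m) j)⁻¹ = (Subst.trans (Pi.single j (-1)) : Subst ℓ (m + 1)) := by
    refine Subst.ext_of_compatible (Subst.compatible_mul (Subst.compatible_mul
      (Subst.compatible_perm _) (Subst.compatible_mul compatible_tauSub
        (Subst.compatible_perm _))) (Subst.compatible_perm _)) rfl ?_ ?_
    · simp [tauSub, Subst.trans]
    · simp only [tauSub, Subst.trans, Subst.mul_d, Subst.perm_d, Subst.mul_w, Subst.perm_w,
        add_zero, Pi.zero_comp, zero_add, single_comp_perm, inv_inv, rotate_inv_zero,
        swap_apply_left]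
  rw [hg] at h
  simpa only [mul_one, add_zero] using h

theorem Subst.trans_zero {n : ℕ} : (Subst.trans 0 : Subst ℓ n) = 1 :=
  Subst.ext_of_compatible (Subst.compatible_trans 0) Subst.compatible_one rfl rfl

/-- The monomial `∏_{i ∈ s} U_i`. -/
def mon {n : ℕ} (s : Multiset (Fin n)) : PolyU n := (s.map MvPolynomial.X).prod

theorem mon_cons {n : ℕ} (i : Fin n) (s : Multiset (Fin n)) :
    mon (i ::ₘ s) = mon s * MvPolynomial.X i := by
  rw [mon, Multiset.map_cons, Multiset.prod_cons, mul_comm]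
  rfl

/-- The multiplicities in a multiset. -/
def mult {n : ℕ} (s : Multiset (Fin n)) : Fin n → ℤ := fun i => s.count i

theorem mult_cons {n : ℕ} (i : Fin n) (s : Multiset (Fin n)) :
    mult (i ::ₘ s) = mult s + Pi.single i 1 := by
  funext j
  rw [mult, Multiset.count_cons, Pi.add_apply, Pi.single_apply, mult]
  push_cast
  rfl

theorem mult_zero {n : ℕ} : mult (0 : Multiset (Fin n)) = 0 := by
  funext j
  simp [mult]

theorem hasSymbol_xMon (he : Function.Injective e)
    {Φ : PolyU (m + 1) →ₐ[ℂ] Module.End ℂ (PolyUT ℓ (m + 1))}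
    (hΦ : ∀ i, Φ (MvPolynomial.X i) = xRep ħ k e c he i) (s : Multiset (Fin (m + 1))) :
    HasSymbol ħ e s.card (Φ (mon s)) (fun q => (s.map (lval ħ q)).prod)
      (Subst.trans (mult s)) := by
  induction s using Multiset.induction_on with
  | empty =>
    simp only [mon, Multiset.map_zero, Multiset.prod_zero, map_one, Multiset.card_zero,
      Nat.cast_zero, mult_zero, Subst.trans_zero]
    exact hasSymbol_one ħ e
  | cons i s ih =>
    have h := ih.mul (hasSymbol_xRep ħ k e c he i)
    rw [← hΦ, ← map_mul, ← mon_cons, Subst.trans_mul, ← mult_cons] at h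
    rw [Multiset.card_cons]
    push_cast
    refine h.congr fun q => ?_
    -- The preceding factors have shifted U_i by a multiple of ħ, again a term of lower degree.
    have hl : lval ħ (q * Subst.trans (mult s)) i =
        lval ħ q i + algebraMap ℂ _ (ħ * mult s i) := by
      rw [lval_eq, lval_eq, add_assoc, ← map_add, ← mul_add]
      congr 3
      simp [Subst.trans]
    rw [Multiset.map_cons, Multiset.prod_cons, hl, mul_comm, ← mul_sub, sub_add_cancel_left,
      add_sub_cancel_right, ← add_zero (s.card : ℤ)]
    exact mul_mem_filt (ih.1 q) (neg_mem (algebraMap_mem_filt _))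

theorem hasSymbol_yMon (he : Function.Injective e)
    {Ψ : PolyU (m + 1) →ₐ[ℂ] Module.End ℂ (PolyUT ℓ (m + 1))}
    (hΨ : ∀ i, Ψ (MvPolynomial.X i) = yRep ħ k e he i) (s : Multiset (Fin (m + 1))) :
    HasSymbol ħ e 0 (Ψ (mon s)) (fun _ => 1) (Subst.trans (-mult s)) := by
  induction s using Multiset.induction_on with
  | empty =>
    simp only [mon, Multiset.map_zero, Multiset.prod_zero, map_one, mult_zero, neg_zero,
      Subst.trans_zero]
    exact hasSymbol_one ħ e
  | cons i s ih =>
    have h := ih.mul (hasSymbol_yRep ħ k e he i)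
    rw [← hΨ, ← map_mul, ← mon_cons, Subst.trans_mul, Pi.single_neg, ← neg_add,
      ← mult_cons] at h
    simpa only [mul_one, add_zero] using h

theorem hasSymbol_mon (he : Function.Injective e)
    {Φ Ψ : PolyU (m + 1) →ₐ[ℂ] Module.End ℂ (PolyUT ℓ (m + 1))}
    (hΦ : ∀ i, Φ (MvPolynomial.X i) = xRep ħ k e c he i)
    (hΨ : ∀ i, Ψ (MvPolynomial.X i) = yRep ħ k e he i) (s t : Multiset (Fin (m + 1))) :
    HasSymbol ħ e s.card (Φ (mon s) * Ψ (mon t)) (fun q => (s.map (lval ħ q)).prod)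
      (Subst.trans (mult s - mult t)) := by
  have h := (hasSymbol_xMon ħ k e c he hΦ s).mul (hasSymbol_yMon ħ k e he hΨ t)
  simpa only [mul_one, add_zero, Subst.trans_mul, ← sub_eq_add_neg] using h

end

end Cherednik


/-! ### The idempotent E' and the passage to the skew group ring -/

namespace Cherednik

noncomputable section

open Equiv Equiv.Perm SymmetricPresentation CyclicPresentation

set_option linter.unusedSectionVars false

variable {ℓ m : ℕ} [NeZero ℓ] (p : ℕ) (ħ k : ℂ) (e : AddChar (ZMod ℓ) ℂ) (c : ℕ → ℂ)

theorem scal_eq_one_of_isGood (hp : p ∣ ℓ) {n : ℕ} {q : Subst ℓ n} (hq : IsGood ℓ p q.χ)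
    {a : Fin n → ZMod ℓ} (ha : (p : ZMod ℓ) ∣ ∑ i, a i) : q.scal e a = 1 := by
  obtain ⟨t, ht⟩ := hq
  rw [Subst.scal, Finset.sum_congr rfl fun i _ => by rw [ht i], ← Finset.mul_sum,
    mul_right_comm, (dvd_iff_mul_eq_zero p hp _).1 ha, zero_mul, neg_zero, AddChar.map_zero_eq_one]

/-- Good vectors form the full annihilator of the exponents of diagonal matrices in the group:
testing on differences of basis vectors makes χ constant, and testing on p times a basis vector
makes the constant divisible by ℓ/p. -/
theorem isGood_of_scal_eq_one (hp : p ∣ ℓ) (he : Function.Injective e) {q : Subst ℓ (m + 1)}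
    (h : ∀ a : Fin (m + 1) → ZMod ℓ, (p : ZMod ℓ) ∣ ∑ i, a i → q.scal e a = 1) :
    IsGood ℓ p q.χ := by
  have hconst (i : Fin (m + 1)) : q.χ i = q.χ 0 := by
    have := h (Pi.single i 1 - Pi.single 0 1) (by rw [sum_single_sub]; exact dvd_zero _)
    rw [scal_single_sub, char_eq_one e he, one_mul] at this
    exact (sub_eq_zero.1 this).symm
  have h0 := h (Pi.single 0 (p : ZMod ℓ)) (by rw [sum_single])
  rw [scal_single, char_eq_one e he, mul_neg, neg_eq_zero] at h0
  have hd : ((ℓ / p : ℕ) : ZMod ℓ) ∣ q.χ 0 := by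
    rw [dvd_iff_mul_eq_zero _ (Nat.div_dvd_of_dvd hp), Nat.div_div_self hp (NeZero.ne ℓ), h0]
  obtain ⟨t, ht⟩ := hd
  exact ⟨t, fun i => by rw [hconst, ht]⟩

-- Orthogonality for the group of exponents `a` with p ∣ ∑ a_i: the average of a character is 1 if
-- the character is trivial and 0 otherwise.
open Classical in
theorem ev_diagIdempotent (hp : p ∣ ℓ) (he : Function.Injective e) (q : Subst ℓ (m + 1)) :
    ev ħ e q (diagIdempotent ℓ p (m + 1)) = if IsGood ℓ p q.χ then 1 else 0 := by
  unfold diagIdempotent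
  rw [map_smul, map_sum]
  simp only [ev_single, map_one]
  rw [← Finset.sum_smul]
  split_ifs with h
  · rw [Finset.sum_congr rfl fun a ha => scal_eq_one_of_isGood p e hp h (Finset.mem_filter.1 ha).2,
      Finset.sum_const, nsmul_one, smul_smul, inv_mul_cancel₀, one_smul]
    rw [Nat.cast_ne_zero, Finset.card_ne_zero]
    exact ⟨0, by simp⟩
  · have : ∃ a : Fin (m + 1) → ZMod ℓ, (p : ZMod ℓ) ∣ ∑ i, a i ∧ q.scal e a ≠ 1 := by
      by_contra! hne
      exact h (isGood_of_scal_eq_one p e hp he hne)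
    obtain ⟨b, hb, hb1⟩ := this
    have hsum : q.scal e b * ∑ a ∈ Finset.univ.filter (fun a : Fin (m + 1) → ZMod ℓ =>
        (p : ZMod ℓ) ∣ ∑ i, a i), q.scal e a = ∑ a ∈ Finset.univ.filter
          (fun a : Fin (m + 1) → ZMod ℓ => (p : ZMod ℓ) ∣ ∑ i, a i), q.scal e a := by
      rw [Finset.mul_sum]
      refine Finset.sum_bij' (fun a _ => b + a) (fun a _ => a - b) ?_ ?_ ?_ ?_ ?_
      · intro a ha
        simp only [Finset.mem_filter, Finset.mem_univ, true_and, Pi.add_apply,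
          Finset.sum_add_distrib] at ha ⊢
        exact dvd_add hb ha
      · intro a ha
        simp only [Finset.mem_filter, Finset.mem_univ, true_and, Pi.sub_apply,
          Finset.sum_sub_distrib] at ha ⊢
        exact dvd_sub ha hb
      · intro a _; simp
      · intro a _; simp
      · intro a _; rw [Subst.scal_add]
    by_cases hS : ∑ a ∈ Finset.univ.filter (fun a : Fin (m + 1) → ZMod ℓ =>
        (p : ZMod ℓ) ∣ ∑ i, a i), q.scal e a = 0
    · rw [hS, zero_smul, smul_zero]
    · exact absurd ((mul_eq_right₀ hS).1 hsum) hb1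

theorem row_smul_diagIdempotent (hp : p ∣ ℓ) (he : Function.Injective e) {q : Subst ℓ (m + 1)}
    (hq : IsGood ℓ p q.χ) (f : PolyU (m + 1)) :
    row ħ e q (f • diagIdempotent ℓ p (m + 1)) = algebraMap _ _ (q.onU ħ f) := by
  rw [row_smul, row_apply, ev_diagIdempotent p ħ e hp he, if_pos hq, map_one, mul_one]

theorem row_smul_diagIdempotent_of_not (hp : p ∣ ℓ) (he : Function.Injective e)
    {q : Subst ℓ (m + 1)} (hq : ¬ IsGood ℓ p q.χ) (f : PolyU (m + 1)) :
    row ħ e q (f • diagIdempotent ℓ p (m + 1)) = 0 := by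
  rw [row_smul, row_apply, ev_diagIdempotent p ħ e hp he, if_neg hq, map_zero, mul_zero]

/-- On symmetric polynomials the permutation in a substitution disappears and a translation remains.
This is how rows become elements of L ⋆ T. -/
theorem onU_of_isSymmetric {n : ℕ} (q : Subst ℓ n) {f : PolyU n} (hf : f.IsSymmetric) :
    q.onU ħ f = shift ħ (Multiplicative.ofAdd (q.d ∘ q.w.symm)) f := by
  have hq : (⟨1, q.d ∘ q.w.symm, 0⟩ : Subst ℓ n) * Subst.perm q.w = ⟨q.w, q.d, 0⟩ := by
    ext i <;> simp
  have h : q.onU ħ f = (⟨q.w, q.d, 0⟩ : Subst ℓ n).onU ħ f := rfl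
  rw [h, ← hq, ← Subst.onU_onU, Subst.onU_perm, hf]
  rfl

/-- The translation by `ħ d`, for good `d`, in the lattice. -/
def latticeShift (d : Fin (m + 1) → ℤ) (hd : IsGood ℓ p (red ℓ d)) :
    (lattice ℓ p (m + 1) ħ).toSubmonoid :=
  ⟨shift ħ (Multiplicative.ofAdd d), (mem_lattice ħ).2 ⟨d, hd, rfl⟩⟩

theorem eval_latticeShift {d : Fin (m + 1) → ℤ} (hd : IsGood ℓ p (red ℓ d))
    (r : FractionRing (PolyU (m + 1))) (f : PolyU (m + 1)) :
    GaloisOrder.eval (SkewMonoidAlgebra.single (latticeShift p ħ d hd) r)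
      (algebraMap _ _ f) = r * algebraMap _ _ (shift ħ (Multiplicative.ofAdd d) f) := by
  rw [GaloisOrder.eval_single]
  exact congrArg _ (GaloisOrder.smul_algebraMap _ _)

/-- `X` computes the restriction of `R` to the multiples of the idempotent by symmetric
polynomials. -/
def Represents (R : PolyUT ℓ (m + 1) →ₗ[ℂ] FractionRing (PolyU (m + 1)))
    (X : GaloisOrder.SkewRing (lattice ℓ p (m + 1) ħ).toSubmonoid) : Prop :=
  ∀ f : PolyU (m + 1), f.IsSymmetric → GaloisOrder.eval X (algebraMap _ _ f) =
    R (f • diagIdempotent ℓ p (m + 1))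

variable {p ħ e}

theorem Represents.add {R S : PolyUT ℓ (m + 1) →ₗ[ℂ] FractionRing (PolyU (m + 1))}
    {X Y : GaloisOrder.SkewRing (lattice ℓ p (m + 1) ħ).toSubmonoid}
    (hX : Represents p ħ R X) (hY : Represents p ħ S Y) : Represents p ħ (R + S) (X + Y) :=
  fun f hf => by rw [GaloisOrder.eval_add, hX f hf, hY f hf, LinearMap.add_apply]

theorem represents_zero : Represents p ħ
    (0 : PolyUT ℓ (m + 1) →ₗ[ℂ] FractionRing (PolyU (m + 1))) 0 :=
  fun f _ => by rw [GaloisOrder.eval_zero, LinearMap.zero_apply]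

theorem Represents.sum {ι : Type*} (s : Finset ι)
    {R : ι → PolyUT ℓ (m + 1) →ₗ[ℂ] FractionRing (PolyU (m + 1))}
    {X : ι → GaloisOrder.SkewRing (lattice ℓ p (m + 1) ħ).toSubmonoid}
    (h : ∀ i ∈ s, Represents p ħ (R i) (X i)) :
    Represents p ħ (∑ i ∈ s, R i) (∑ i ∈ s, X i) := by
  classical
  induction s using Finset.induction_on with
  | empty => simpa using represents_zero
  | insert i s hi ih =>
    rw [Finset.sum_insert hi, Finset.sum_insert hi]
    exact (h i (Finset.mem_insert_self i s)).add
      (ih fun j hj => h j (Finset.mem_insert_of_mem hj))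

theorem coeff_single_mul {n : ℕ} (r : FractionRing (PolyU n))
    (X : GaloisOrder.SkewRing (lattice ℓ p n ħ).toSubmonoid)
    (μ : (lattice ℓ p n ħ).toSubmonoid) :
    (SkewMonoidAlgebra.single 1 r * X).coeff μ = r * X.coeff μ :=
  SkewMonoidAlgebra.coeff_single_one_mul ..

theorem Represents.smul {R : PolyUT ℓ (m + 1) →ₗ[ℂ] FractionRing (PolyU (m + 1))}
    {X : GaloisOrder.SkewRing (lattice ℓ p (m + 1) ħ).toSubmonoid} (hX : Represents p ħ R X)
    (z : ℂ) : Represents p ħ (z • R) (SkewMonoidAlgebra.single 1 (algebraMap ℂ _ z) * X) :=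
  fun f hf => by
    rw [GaloisOrder.eval_mul, hX f hf, GaloisOrder.eval_single, one_smul, LinearMap.smul_apply]
    exact (Algebra.smul_def _ _).symm

theorem represents_row (hp : p ∣ ℓ) (he : Function.Injective e) {q : Subst ℓ (m + 1)}
    (hq : q.Compatible) (hg : IsGood ℓ p (red ℓ (q.d ∘ q.w.symm)))
    (r : FractionRing (PolyU (m + 1))) :
    Represents p ħ (r • row ħ e q)
      (SkewMonoidAlgebra.single (latticeShift p ħ (q.d ∘ q.w.symm) hg) r) := fun f hf => by
  have hq' : IsGood ℓ p q.χ := by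
    have h : q.χ = red ℓ (q.d ∘ q.w.symm) ∘ q.w := by
      rw [hq]
      funext i
      simp [red]
    rw [h]
    exact isGood_comp hg q.w
  rw [eval_latticeShift, LinearMap.smul_apply, row_smul_diagIdempotent p ħ e hp he hq',
    onU_of_isSymmetric ħ q hf, smul_eq_mul]

/-- Rows at a bad χ kill Γ E'; rows at a good χ become a single translation, which lies in T because
compatibility makes the shifts good as well. -/
theorem exists_represents (hp : p ∣ ℓ) (he : Function.Injective e) {N : ℤ}
    {R : PolyUT ℓ (m + 1) →ₗ[ℂ] FractionRing (PolyU (m + 1))} (hR : R ∈ rowSpan ħ e N) :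
    ∃ X : GaloisOrder.SkewRing (lattice ℓ p (m + 1) ħ).toSubmonoid, Represents p ħ R X ∧
      ∀ μ, X.coeff μ ∈ Filt (m + 1) N := by
  classical
  induction hR using Submodule.span_induction with
  | mem R hR =>
    obtain ⟨r, hr, q, hq, rfl⟩ := hR
    by_cases hg : IsGood ℓ p (red ℓ (q.d ∘ q.w.symm))
    · refine ⟨_, represents_row hp he hq hg r, fun μ => ?_⟩
      rw [SkewMonoidAlgebra.coeff_single_apply]
      split_ifs
      exacts [hr, zero_mem _]
    · refine ⟨0, fun f hf => ?_, fun μ => zero_mem _⟩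
      have hq' : ¬ IsGood ℓ p q.χ := fun h => hg (by
        rw [hq] at h
        exact isGood_comp h q.w.symm)
      rw [GaloisOrder.eval_zero, LinearMap.smul_apply,
        row_smul_diagIdempotent_of_not p ħ e hp he hq', smul_zero]
  | zero => exact ⟨0, represents_zero, fun μ => zero_mem _⟩
  | add R S _ _ hR hS =>
    obtain ⟨X, hX, hX'⟩ := hR
    obtain ⟨Y, hY, hY'⟩ := hS
    exact ⟨X + Y, hX.add hY, fun μ => by
      rw [SkewMonoidAlgebra.coeff_add]
      exact add_mem (hX' μ) (hY' μ)⟩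
  | smul z R _ hR =>
    obtain ⟨X, hX, hX'⟩ := hR
    refine ⟨_, hX.smul z, fun μ => ?_⟩
    rw [coeff_single_mul, ← Algebra.smul_def]
    exact Submodule.smul_mem _ _ (hX' μ)

/-- An element of the skew ring is determined by its action on symmetric polynomials. -/
theorem Represents.unique (hħ : ħ ≠ 0)
    {R : PolyUT ℓ (m + 1) →ₗ[ℂ] FractionRing (PolyU (m + 1))}
    {X Y : GaloisOrder.SkewRing (lattice ℓ p (m + 1) ħ).toSubmonoid} (hX : Represents p ħ R X)
    (hY : Represents p ħ R Y) : X = Y := by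
  refine GaloisOrder.eq_of_eval (γ := ∏ i, MvPolynomial.X i) ?_ fun t => ?_
  · intro μ hμ ν hν h
    obtain ⟨d, -, rfl⟩ := (mem_lattice ħ).1 hμ
    obtain ⟨d', -, rfl⟩ := (mem_lattice ħ).1 hν
    rw [shift_eq_shift_of_prod ħ hħ h]
  · have hs : ((∏ i, MvPolynomial.X i : PolyU (m + 1)) ^ t).IsSymmetric := fun w => by
      rw [map_pow, isSymmetric_prod_X]
    rw [hX _ hs, hY _ hs]

end

end Cherednik


/-! ### Twists of T and invariant vectors -/

namespace Cherednik

noncomputable section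

open Equiv Equiv.Perm SymmetricPresentation CyclicPresentation

set_option linter.unusedSectionVars false

theorem RCA.induction {n : ℕ} {W : Subgroup (GL (Fin n) ℂ)} [Fintype W] {ħ : ℂ} {c : W → ℂ}
    {P : RCA W ħ c → Prop} (hz : ∀ z, P (algebraMap ℂ _ z)) (hgen : ∀ a, P (RCA.gen W ħ c a))
    (hmul : ∀ a b, P a → P b → P (a * b)) (hadd : ∀ a b, P a → P b → P (a + b))
    (a : RCA W ħ c) : P a := by
  obtain ⟨a, rfl⟩ := RingQuot.mkAlgHom_surjective ℂ (Rel W ħ c) a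
  induction a using FreeAlgebra.induction with
  | grade0 z => rw [AlgHom.commutes]; exact hz z
  | grade1 a => exact hgen a
  | mul a b ha hb => rw [map_mul]; exact hmul _ _ ha hb
  | add a b ha hb => rw [map_add]; exact hadd _ _ ha hb

variable {ℓ m : ℕ} [NeZero ℓ] (p : ℕ) (ħ k κ : ℂ) (e : AddChar (ZMod ℓ) ℂ) (c : ℕ → ℂ)
  (hp : p ∣ ℓ) (he : Function.Injective e)

/-- The substitution `T_i ↦ e(-(ℓ / p) t) T_i`. -/
def twist {n : ℕ} (t : ZMod ℓ) : Subst ℓ n := ⟨1, 0, fun _ => (ℓ / p : ℕ) * t⟩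

theorem twist_mul {n : ℕ} (t : ZMod ℓ) (r : Subst ℓ n) : twist p t * r = r * twist p t := by
  ext i
  · simp [twist]
  · simp [twist]
  · simp [twist, add_comm]

theorem lval_mul_twist {n : ℕ} (q : Subst ℓ n) (t : ZMod ℓ) (i : Fin n) :
    lval ħ (q * twist p t) i = lval ħ q i := by
  simp [lval_eq, twist]

theorem onU_mul_twist {n : ℕ} (q : Subst ℓ n) (t : ZMod ℓ) (f : PolyU n) :
    (q * twist p t).onU ħ f = q.onU ħ f := by
  have h : (q * twist p t).val ħ = q.val ħ := by
    funext i
    simp [Subst.val, twist]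
  rw [Subst.onU, Subst.onU, h]

theorem rcoef_mul_twist {n : ℕ} (q : Subst ℓ n) (t : ZMod ℓ) (i j : Fin n) :
    rcoef ħ k (q * twist p t) i j = rcoef ħ k q i j := by
  have h : pairVal (q * twist p t).χ i j = pairVal q.χ i j := by
    simp [pairVal, twist]
  rw [rcoef, rcoef, lval_mul_twist, lval_mul_twist, h]

/-- Only indices divisible by p contribute, and for those the product with ℓ/p is zero modulo ℓ. -/
theorem charSum_sub (hp : p ∣ ℓ) (hc : ∀ j, ¬ p ∣ j → c j = 0) (x t : ZMod ℓ) :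
    charSum e c (x - (ℓ / p : ℕ) * t) = charSum e c x := by
  refine Finset.sum_congr rfl fun j _ => ?_
  by_cases hj : p ∣ j
  · obtain ⟨d, rfl⟩ := hj
    have h : ((p * d : ℕ) : ZMod ℓ) * (x - (ℓ / p : ℕ) * t) = (p * d : ℕ) * x := by
      have h0 : (p : ZMod ℓ) * (ℓ / p : ℕ) = 0 := by
        rw [← Nat.cast_mul, Nat.mul_div_cancel' hp, ZMod.natCast_self]
      push_cast
      linear_combination (-(d : ZMod ℓ) * t) * h0
    rw [h]
  · rw [hc j hj, zero_mul, zero_mul]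

theorem sigmaVal_mul_twist (hp : p ∣ ℓ) (hc : ∀ j, ¬ p ∣ j → c j = 0) (q : Subst ℓ (m + 1))
    (t : ZMod ℓ) : sigmaVal ħ e c (q * twist p t) = sigmaVal ħ e c q := by
  have h : -1 - (q * twist p t).χ 0 = (-1 - q.χ 0) - (ℓ / p : ℕ) * t := by
    simp only [twist, Subst.mul_χ, Pi.add_apply, Function.comp_apply, Perm.one_apply]
    ring
  rw [sigmaVal, sigmaVal, lval_mul_twist, h, charSum_sub p e c hp hc]

/-- The operator `T_i ↦ e(-(ℓ / p) t) T_i`. -/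
def twistOp {n : ℕ} (t : ZMod ℓ) : Module.End ℂ (PolyUT ℓ n) := ((twist p t).act ħ e).toLinearMap

theorem row_twistOp {n : ℕ} (q : Subst ℓ n) (t : ZMod ℓ) (f : PolyUT ℓ n) :
    row ħ e q (twistOp p ħ e t f) = row ħ e (q * twist p t) f := row_act ħ e q _ f

include he in
theorem commute_of_row {n : ℕ} {A : Module.End ℂ (PolyUT ℓ n)} {t : ZMod ℓ}
    {v : Subst ℓ n → FractionRing (PolyU n)} {r : Subst ℓ n}
    (hA : ∀ q f, row ħ e q (A f) = v q * row ħ e (q * r) f)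
    (hv : ∀ q, v (q * twist p t) = v q) : Commute (twistOp p ħ e t) A :=
  end_ext ħ e he fun q f => by
    change row ħ e q (twistOp p ħ e t (A f)) = row ħ e q (A (twistOp p ħ e t f))
    rw [row_twistOp, hA, hA, row_twistOp, hv, mul_assoc q, twist_mul, ← mul_assoc]

include he in
theorem commute_defSwap (t : ZMod ℓ) {n : ℕ} {i j : Fin n} (h : i ≠ j) :
    Commute (twistOp p ħ e t) (defSwap ħ e k i j h) :=
  end_ext ħ e he fun q f => by
    change row ħ e q (twistOp p ħ e t (defSwap ħ e k i j h f)) =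
      row ħ e q (defSwap ħ e k i j h (twistOp p ħ e t f))
    rw [row_twistOp, row_defSwap ħ e he, row_defSwap ħ e he, row_twistOp, row_twistOp,
      rcoef_mul_twist, mul_assoc q, twist_mul, ← mul_assoc]

theorem commute_permRep (t : ZMod ℓ) (w : Perm (Fin (m + 1))) :
    Commute (twistOp p ħ e t) (permRep ħ k e he w) := by
  induction w using perm_induction with
  | h1 => rw [map_one]; exact Commute.one_right _
  | hmul u v hu hv => rw [map_mul]; exact hu.mul_right hv
  | hs i =>
    rw [permRep_swap]
    exact commute_defSwap p ħ k e he t _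

include hp he in
theorem commute_diagOp {n : ℕ} (t : ZMod ℓ) {a : Fin n → ZMod ℓ}
    (ha : (p : ZMod ℓ) ∣ ∑ i, a i) : Commute (twistOp p ħ e t) (diagOp a) := by
  refine commute_of_row (r := 1) (v := fun q => algebraMap ℂ _ (q.scal e a)) p ħ e he
    (fun q f => by rw [row_diagOp, mul_one]) fun q => ?_
  have h : (twist p t : Subst ℓ n).scal e a = 1 :=
    scal_eq_one_of_isGood p e hp ⟨t, fun _ => rfl⟩ ha
  rw [Subst.scal_mul, h, mul_one]
  rfl

/-- A twist adds a constant multiple of ℓ/p to χ. Permutations see only differences of the χ_i, the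
factor of σ is unchanged by `charSum_sub`, and the diagonal matrices in the group are unaffected
since p divides the sum of their exponents. -/
theorem commute_polyRep (hc : ∀ j, ¬ p ∣ j → c j = 0) (t : ZMod ℓ)
    (a : H ℓ p (m + 1) (e 1) ħ κ c) :
    Commute (twistOp p ħ e t) (polyRep p ħ κ e c hp he hc a) := by
  induction a using RCA.induction with
  | hz z => rw [AlgHom.commutes]; exact (Algebra.commutes z _).symm
  | hmul a b ha hb => rw [map_mul]; exact ha.mul_right hb
  | hadd a b ha hb => rw [map_add]; exact ha.add_right hb
  | hgen a =>
    rw [polyRep_gen]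
    cases a with
    | grp g =>
      exact (commute_diagOp p ħ e hp he t (dvd_data p e hp he g)).mul_right
        (commute_permRep p ħ _ e he t _)
    | x j =>
      have h : Commute (twistOp p ħ e t) (xRep ħ (-κ) e c he (swap 0 j 0)) := by
        rw [xRep_eq, xRep_zero]
        exact ((commute_permRep p ħ _ e he t _).mul_right ((commute_of_row p ħ e he
          (row_sigmaOp ħ e c) fun q => sigmaVal_mul_twist p ħ e c hp hc q t).mul_right
            (commute_permRep p ħ _ e he t _))).mul_right (commute_permRep p ħ _ e he t _)
      rwa [swap_apply_left] at h
    | y j =>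
      have h : Commute (twistOp p ħ e t) (yRep ħ (-κ) e he (swap (Fin.last m) j (Fin.last m))) := by
        rw [yRep_eq, yRep_last]
        exact ((commute_permRep p ħ _ e he t _).mul_right ((commute_of_row (v := fun _ => 1)
          (r := tauSub) p ħ e he (fun q f => by rw [row_tauOp, one_mul]) fun _ => rfl).mul_right
            (commute_permRep p ħ _ e he t _))).mul_right (commute_permRep p ħ _ e he t _)
      rwa [swap_apply_left] at h

theorem ev_of_χ_eq_zero {n : ℕ} {q : Subst ℓ n} (hq : q.χ = 0) (f : PolyUT ℓ n) :
    ev ħ e q f = q.onU ħ (ev ħ e 1 f) := by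
  induction f using AddMonoidAlgebra.induction_linear with
  | zero => simp
  | add f g hf hg => simp only [map_add, hf, hg]
  | single a r => simp [ev_single, Subst.scal, hq]

include hp he in
/-- The vectors that are invariant under the diagonal matrices of the group and under the
twists are multiples of the idempotent. -/
theorem eq_smul_diagIdempotent {v : PolyUT ℓ (m + 1)}
    (hd : ∀ a : Fin (m + 1) → ZMod ℓ, (p : ZMod ℓ) ∣ ∑ i, a i → diagOp a v = v)
    (ht : ∀ t, twistOp p ħ e t v = v) : v = ev ħ e 1 v • diagIdempotent ℓ p (m + 1) := by
  refine ev_ext ħ e he fun q => IsFractionRing.injective (PolyU (m + 1))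
    (FractionRing (PolyU (m + 1))) ?_
  change row ħ e q v = row ħ e q (ev ħ e 1 v • diagIdempotent ℓ p (m + 1))
  by_cases hq : IsGood ℓ p q.χ
  · rw [row_smul_diagIdempotent p ħ e hp he hq]
    obtain ⟨t, hχ⟩ := hq
    -- The twist by -t brings a good χ to 0, so the value of `v` there is determined by its value at
    -- T = 1.
    have h := row_twistOp p ħ e q (-t) v
    rw [ht] at h
    rw [h, row_apply, ev_of_χ_eq_zero, onU_mul_twist]
    · funext i
      simp only [twist, Subst.mul_χ, Pi.add_apply, Function.comp_apply, Perm.one_apply, hχ,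
        Pi.zero_apply]
      ring
  · rw [row_smul_diagIdempotent_of_not p ħ e hp he hq]
    have : ∃ a : Fin (m + 1) → ZMod ℓ, (p : ZMod ℓ) ∣ ∑ i, a i ∧ q.scal e a ≠ 1 := by
      by_contra! hne
      exact hq (isGood_of_scal_eq_one p e hp he hne)
    obtain ⟨a, ha, ha1⟩ := this
    -- At a bad χ some diagonal matrix of the group multiplies the value by a number different from
    -- 1, so an invariant vector vanishes there.
    have h := row_diagOp ħ e q a v
    rw [hd a ha] at h
    by_contra hv
    refine ha1 ((algebraMap ℂ (FractionRing (PolyU (m + 1)))).injective ?_)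
    rw [map_one]
    exact (right_eq_mul₀ hv).1 h

/-- Invariance under a deformed transposition reads (1 + r)(f^s - f) = 0, and 1 + r ≠ 0 because r
has degree at most -1. -/
theorem isSymmetric_ev {v : PolyUT ℓ (m + 1)} (hv : ∀ w, permRep ħ k e he w v = v) :
    (ev ħ e 1 v).IsSymmetric := by
  intro w
  induction w using perm_induction with
  | h1 => simp
  | hmul u w hu hw =>
    rw [show ((u * w : Perm (Fin (m + 1))) : Fin (m + 1) → Fin (m + 1)) = u ∘ w from rfl,
      ← MvPolynomial.rename_rename, hw, hu]
  | hs i =>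
    have h := congrArg (row ħ e 1) (hv (swap i.castSucc i.succ))
    rw [permRep_swap, row_defSwap ħ e he, one_mul, ← sub_eq_zero] at h
    set r := rcoef ħ k (1 : Subst ℓ (m + 1)) i.castSucc i.succ with hr
    have h2 : (1 + r) * (row ħ e (Subst.perm (swap i.castSucc i.succ)) v - row ħ e 1 v) = 0 := by
      linear_combination h
    have h1r : 1 + r ≠ 0 := fun h0 => one_notMem_filt (n := m + 1) (by
      rw [eq_neg_of_add_eq_zero_left h0]
      exact neg_mem (rcoef_mem_filt ħ k 1 Fin.castSucc_lt_succ.ne))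
    have h3 := sub_eq_zero.1 ((mul_eq_zero.1 h2).resolve_left h1r)
    rw [row_apply, row_apply] at h3
    have h4 := IsFractionRing.injective (PolyU (m + 1)) _ h3
    rwa [ev_of_χ_eq_zero ħ e rfl, Subst.onU_perm] at h4

theorem diagOp_smul_diagIdempotent (hp : p ∣ ℓ) (he : Function.Injective e)
    {a : Fin (m + 1) → ZMod ℓ} (ha : (p : ZMod ℓ) ∣ ∑ i, a i) (f : PolyU (m + 1)) :
    diagOp a (f • diagIdempotent ℓ p (m + 1)) = f • diagIdempotent ℓ p (m + 1) := by
  -- Multiplication by T^a does not involve ħ, so evaluations with ħ = 0 can be used.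
  refine ev_ext 0 e he fun q => IsFractionRing.injective (PolyU (m + 1))
    (FractionRing (PolyU (m + 1))) ?_
  change row 0 e q _ = row 0 e q _
  rw [row_diagOp]
  by_cases hq : IsGood ℓ p q.χ
  · rw [scal_eq_one_of_isGood p e hp hq ha, map_one, one_mul]
  · rw [row_smul_diagIdempotent_of_not p 0 e hp he hq, mul_zero]

theorem isGood_mul_twist {q : Subst ℓ (m + 1)} (t : ZMod ℓ) (h : IsGood ℓ p q.χ) :
    IsGood ℓ p (q * twist p t).χ := isGood_add (isGood_comp h 1) ⟨t, fun _ => rfl⟩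

include hp he in
theorem twistOp_smul_diagIdempotent (t : ZMod ℓ) (f : PolyU (m + 1)) :
    twistOp p ħ e t (f • diagIdempotent ℓ p (m + 1)) = f • diagIdempotent ℓ p (m + 1) := by
  refine ev_ext ħ e he fun q => IsFractionRing.injective (PolyU (m + 1))
    (FractionRing (PolyU (m + 1))) ?_
  change row ħ e q _ = row ħ e q _
  rw [row_twistOp]
  by_cases hq : IsGood ℓ p q.χ
  · rw [row_smul_diagIdempotent p ħ e hp he hq,
      row_smul_diagIdempotent p ħ e hp he (isGood_mul_twist p t hq), onU_mul_twist]
  · rw [row_smul_diagIdempotent_of_not p ħ e hp he hq,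
      row_smul_diagIdempotent_of_not p ħ e hp he fun h => hq ?_]
    have h' := isGood_mul_twist p (-t) h
    have : q * twist p t * twist p (-t) = q := by
      ext i <;> simp [twist]
    rwa [this] at h'

theorem permRep_smul_diagIdempotent (hp : p ∣ ℓ) {f : PolyU (m + 1)} (hf : f.IsSymmetric)
    (w : Perm (Fin (m + 1))) :
    permRep ħ k e he w (f • diagIdempotent ℓ p (m + 1)) = f • diagIdempotent ℓ p (m + 1) := by
  induction w using perm_induction with
  | h1 => rw [map_one]; rfl
  | hmul u w hu hw => 
    rw [map_mul]
    change permRep ħ k e he u (permRep ħ k e he w _) = _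
    rw [hw, hu]
  | hs i =>
    refine ev_ext ħ e he fun q => IsFractionRing.injective (PolyU (m + 1))
      (FractionRing (PolyU (m + 1))) ?_
    change row ħ e q _ = row ħ e q _
    rw [permRep_swap, row_defSwap ħ e he]
    suffices h : row ħ e (q * Subst.perm (swap i.castSucc i.succ))
        (f • diagIdempotent ℓ p (m + 1)) = row ħ e q (f • diagIdempotent ℓ p (m + 1)) by
      rw [h]; ring
    have hχ : (q * Subst.perm (swap i.castSucc i.succ)).χ = q.χ ∘ swap i.castSucc i.succ := by
      simp
    by_cases hq : IsGood ℓ p q.χ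
    · rw [row_smul_diagIdempotent p ħ e hp he hq, row_smul_diagIdempotent p ħ e hp he
        (by rw [hχ]; exact isGood_comp hq _), ← Subst.onU_onU, Subst.onU_perm, hf]
    · rw [row_smul_diagIdempotent_of_not p ħ e hp he hq,
        row_smul_diagIdempotent_of_not p ħ e hp he fun h => hq ?_]
      rw [hχ] at h
      have := isGood_comp h (swap i.castSucc i.succ)
      rwa [Function.comp_assoc, ← Perm.coe_mul, swap_mul_self] at this

end

end Cherednik


/-! ### Spanning by ordered monomials -/

namespace Cherednik

noncomputable section

open Equiv Equiv.Perm

set_option linter.unusedSectionVars false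

open scoped IsMulCommutative in
theorem exists_polyHom {n : ℕ} {A : Type*} [Ring A] [Algebra ℂ A] (f : Fin n → A)
    (hf : ∀ i j, f i * f j = f j * f i) :
    ∃ ξ : PolyU n →ₐ[ℂ] A, ∀ i, ξ (MvPolynomial.X i) = f i := by
  have : IsMulCommutative (Algebra.adjoin ℂ (Set.range f)) := Algebra.isMulCommutative_adjoin ℂ (by
    rintro _ ⟨i, rfl⟩ _ ⟨j, rfl⟩
    exact hf i j)
  refine ⟨(Algebra.adjoin ℂ (Set.range f)).val.comp (MvPolynomial.aeval fun i =>
    ⟨f i, Algebra.subset_adjoin ⟨i, rfl⟩⟩), fun i => ?_⟩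
  rw [AlgHom.comp_apply, MvPolynomial.aeval_X]
  rfl

/-- The homomorphism from the polynomial ring given by commuting elements. -/
def polyHom {n : ℕ} {A : Type*} [Ring A] [Algebra ℂ A] (f : Fin n → A)
    (hf : ∀ i j, f i * f j = f j * f i) : PolyU n →ₐ[ℂ] A := (exists_polyHom f hf).choose

theorem polyHom_X {n : ℕ} {A : Type*} [Ring A] [Algebra ℂ A] (f : Fin n → A)
    (hf : ∀ i j, f i * f j = f j * f i) (i : Fin n) :
    polyHom f hf (MvPolynomial.X i) = f i := (exists_polyHom f hf).choose_spec i

section RCA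

variable {n : ℕ} {W : Subgroup (GL (Fin n) ℂ)} [Fintype W] {ħ : ℂ} {c : W → ℂ}

theorem RCA.gen_grp_one : RCA.gen W ħ c (Gen.grp 1) = 1 :=
  (RingQuot.mkAlgHom_rel ℂ Rel.grp_one).trans (map_one _)

theorem RCA.gen_x_comm (i j : Fin n) : RCA.gen W ħ c (Gen.x i) * RCA.gen W ħ c (Gen.x j) =
    RCA.gen W ħ c (Gen.x j) * RCA.gen W ħ c (Gen.x i) := by
  unfold RCA.gen
  rw [← map_mul, ← map_mul]
  exact RingQuot.mkAlgHom_rel ℂ (Rel.x_x i j)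

theorem RCA.gen_y_comm (i j : Fin n) : RCA.gen W ħ c (Gen.y i) * RCA.gen W ħ c (Gen.y j) =
    RCA.gen W ħ c (Gen.y j) * RCA.gen W ħ c (Gen.y i) := by
  unfold RCA.gen
  rw [← map_mul, ← map_mul]
  exact RingQuot.mkAlgHom_rel ℂ (Rel.y_y i j)

theorem RCA.gen_grp_mul_x (g : W) (j : Fin n) :
    RCA.gen W ħ c (Gen.grp g) * RCA.gen W ħ c (Gen.x j) =
      (∑ i, ((g : GL (Fin n) ℂ) : Matrix (Fin n) (Fin n) ℂ) i j • RCA.gen W ħ c (Gen.x i)) *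
        RCA.gen W ħ c (Gen.grp g) := by
  have h := RingQuot.mkAlgHom_rel ℂ (Rel.grp_x (ħ := ħ) (c := c) g j)
  simp only [map_mul, map_sum, map_smul] at h
  exact h

theorem RCA.gen_grp_mul_y (g : W) (j : Fin n) :
    RCA.gen W ħ c (Gen.grp g) * RCA.gen W ħ c (Gen.y j) =
      (∑ i, (((g⁻¹ : W) : GL (Fin n) ℂ) : Matrix (Fin n) (Fin n) ℂ) j i •
        RCA.gen W ħ c (Gen.y i)) * RCA.gen W ħ c (Gen.grp g) := by
  have h := RingQuot.mkAlgHom_rel ℂ (Rel.grp_y (ħ := ħ) (c := c) g j)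
  simp only [map_mul, map_sum, map_smul] at h
  exact h

variable (W ħ c) in
/-- The span of the group elements. -/
def RCA.grpSpan : Submodule ℂ (RCA W ħ c) :=
  Submodule.span ℂ (Set.range fun g : W => RCA.gen W ħ c (Gen.grp g))

theorem RCA.sub_mem_grpSpan (i j : Fin n) :
    RCA.gen W ħ c (Gen.x i) * RCA.gen W ħ c (Gen.y j) -
      RCA.gen W ħ c (Gen.y j) * RCA.gen W ħ c (Gen.x i) ∈ RCA.grpSpan W ħ c := by
  have h := RingQuot.mkAlgHom_rel ℂ (Rel.x_y (W := W) (ħ := ħ) (c := c) i j)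
  simp only [map_sub, map_mul, map_sum, map_smul, AlgHom.commutes] at h
  have h' : RCA.gen W ħ c (Gen.x i) * RCA.gen W ħ c (Gen.y j) -
      RCA.gen W ħ c (Gen.y j) * RCA.gen W ħ c (Gen.x i) = _ := h
  rw [h']
  refine sub_mem ?_ (Submodule.sum_mem _ fun s _ =>
    Submodule.smul_mem _ _ (Submodule.subset_span ⟨s, rfl⟩))
  rw [Algebra.algebraMap_eq_smul_one, ← RCA.gen_grp_one]
  exact Submodule.smul_mem _ _ (Submodule.subset_span ⟨1, rfl⟩)

theorem RCA.gen_grp_mul_e (g : W) : RCA.gen W ħ c (Gen.grp g) * RCA.e W ħ c = RCA.e W ħ c := by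
  rw [RCA.e, mul_smul_comm, Finset.mul_sum]
  simp_rw [RCA.gen_grp_mul]
  rw [Function.Bijective.sum_comp (Group.mulLeft_bijective g)
    (fun h => RCA.gen W ħ c (Gen.grp h))]

theorem RCA.e_mul_gen_grp (g : W) : RCA.e W ħ c * RCA.gen W ħ c (Gen.grp g) = RCA.e W ħ c := by
  rw [RCA.e, smul_mul_assoc, Finset.sum_mul]
  simp_rw [RCA.gen_grp_mul]
  rw [Function.Bijective.sum_comp (Group.mulRight_bijective g)
    (fun h => RCA.gen W ħ c (Gen.grp h))]

variable (W ħ c) in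
/-- The monomials in the `x_i`. -/
def RCA.xHom : PolyU n →ₐ[ℂ] RCA W ħ c :=
  polyHom (fun i => RCA.gen W ħ c (Gen.x i)) RCA.gen_x_comm

variable (W ħ c) in
/-- The monomials in the `y_i`. -/
def RCA.yHom : PolyU n →ₐ[ℂ] RCA W ħ c :=
  polyHom (fun i => RCA.gen W ħ c (Gen.y i)) RCA.gen_y_comm

theorem RCA.xHom_cons (i : Fin n) (s : Multiset (Fin n)) :
    RCA.xHom W ħ c (mon (i ::ₘ s)) = RCA.xHom W ħ c (mon s) * RCA.gen W ħ c (Gen.x i) := by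
  rw [mon_cons, map_mul, RCA.xHom, polyHom_X]

theorem RCA.xHom_cons' (i : Fin n) (s : Multiset (Fin n)) :
    RCA.xHom W ħ c (mon (i ::ₘ s)) = RCA.gen W ħ c (Gen.x i) * RCA.xHom W ħ c (mon s) := by
  rw [mon_cons, mul_comm, map_mul, RCA.xHom, polyHom_X]

theorem RCA.yHom_cons (i : Fin n) (s : Multiset (Fin n)) :
    RCA.yHom W ħ c (mon (i ::ₘ s)) = RCA.yHom W ħ c (mon s) * RCA.gen W ħ c (Gen.y i) := by
  rw [mon_cons, map_mul, RCA.yHom, polyHom_X]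

theorem RCA.yHom_cons' (i : Fin n) (s : Multiset (Fin n)) :
    RCA.yHom W ħ c (mon (i ::ₘ s)) = RCA.gen W ħ c (Gen.y i) * RCA.yHom W ħ c (mon s) := by
  rw [mon_cons, mul_comm, map_mul, RCA.yHom, polyHom_X]

theorem mon_zero {n : ℕ} : (mon 0 : PolyU n) = 1 := by simp [mon]

end RCA

variable {ℓ p n : ℕ} [NeZero ℓ] {ħ κ : ℂ} {e : AddChar (ZMod ℓ) ℂ} {c : ℕ → ℂ}
  (hp : p ∣ ℓ) (he : Function.Injective e)

theorem grp_mul_x (g : complexReflectionGroup ℓ p n) (j : Fin n) :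
    (RCA.gen _ _ _ (Gen.grp g) * RCA.gen _ _ _ (Gen.x j) : H ℓ p n (e 1) ħ κ c) =
      e ((data p e hp he g).1 ((data p e hp he g).2 j)) •
        (RCA.gen _ _ _ (Gen.x ((data p e hp he g).2 j)) * RCA.gen _ _ _ (Gen.grp g)) := by
  rw [RCA.gen_grp_mul_x, Finset.sum_eq_single ((data p e hp he g).2 j)]
  · have h : mat p g ((data p e hp he g).2 j) j = _ :=
      congrFun (congrFun (mat_eq p e hp he g) _) _
    rw [monomial_apply, if_pos rfl] at h
    rw [← h, ← smul_mul_assoc]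
  · intro i _ hi
    have h : mat p g i j = _ := congrFun (congrFun (mat_eq p e hp he g) _) _
    rw [monomial_apply, if_neg hi] at h
    change mat p g i j • _ = _
    rw [h, zero_smul]
  · simp

theorem grp_mul_y (g : complexReflectionGroup ℓ p n) (j : Fin n) :
    (RCA.gen _ _ _ (Gen.grp g) * RCA.gen _ _ _ (Gen.y j) : H ℓ p n (e 1) ħ κ c) =
      e (-(data p e hp he g).1 ((data p e hp he g).2 j)) •
        (RCA.gen _ _ _ (Gen.y ((data p e hp he g).2 j)) * RCA.gen _ _ _ (Gen.grp g)) := by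
  rw [RCA.gen_grp_mul_y, Finset.sum_eq_single ((data p e hp he g).2 j)]
  · have h := inv_apply p e hp he g ((data p e hp he g).2 j) j
    rw [if_pos rfl] at h
    rw [← h, ← smul_mul_assoc]
  · intro i _ hi
    have h := inv_apply p e hp he g i j
    rw [if_neg hi] at h
    change mat p g⁻¹ j i • _ = _
    rw [h, zero_smul]
  · simp

theorem commutator_mul {A : Type*} [Ring A] (s x y : A) :
    y * (s * x) - s * x * y = (y * s - s * y) * x - s * (x * y - y * x) := by
  noncomm_ring

theorem mul_mul_eq_commutator_add {A : Type*} [Ring A] (s t y g : A) :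
    y * (s * t * g) = (y * s - s * y) * (t * g) + s * (y * t) * g := by
  noncomm_ring

theorem mult_map (w : Perm (Fin n)) (s : Multiset (Fin n)) :
    mult (s.map w) = mult s ∘ w.symm := by
  funext i
  obtain ⟨j, rfl⟩ := w.surjective i
  simp [mult, Multiset.count_map_eq_count' _ _ w.injective]

theorem sum_red_mult_cons (f : Fin n → ZMod ℓ) (i : Fin n) (s : Multiset (Fin n)) :
    ∑ j, red ℓ (mult (i ::ₘ s)) j * f j = ∑ j, red ℓ (mult s) j * f j + f i := by
  rw [mult_cons, red_add]
  simp only [Pi.add_apply, add_mul, Finset.sum_add_distrib]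
  congr 1
  rw [Finset.sum_eq_single i]
  · simp [red]
  · intro j _ hj
    simp [red, hj]
  · simp

theorem grp_mul_xMon (g : complexReflectionGroup ℓ p n) (s : Multiset (Fin n)) :
    (RCA.gen _ _ _ (Gen.grp g) * RCA.xHom _ _ _ (mon s) : H ℓ p n (e 1) ħ κ c) =
      e (∑ j, red ℓ (mult s) j * (data p e hp he g).1 ((data p e hp he g).2 j)) •
        (RCA.xHom _ _ _ (mon (s.map (data p e hp he g).2)) * RCA.gen _ _ _ (Gen.grp g)) := by
  induction s using Multiset.induction_on with
  | empty => simp [mon_zero, mult_zero, red]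
  | cons i s ih =>
    rw [RCA.xHom_cons, ← mul_assoc, ih, smul_mul_assoc, mul_assoc, grp_mul_x hp he, mul_smul_comm,
      smul_smul, ← mul_assoc, sum_red_mult_cons, AddChar.map_add_eq_mul, Multiset.map_cons,
      RCA.xHom_cons]

theorem grp_mul_yMon (g : complexReflectionGroup ℓ p n) (s : Multiset (Fin n)) :
    (RCA.gen _ _ _ (Gen.grp g) * RCA.yHom _ _ _ (mon s) : H ℓ p n (e 1) ħ κ c) =
      e (-∑ j, red ℓ (mult s) j * (data p e hp he g).1 ((data p e hp he g).2 j)) •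
        (RCA.yHom _ _ _ (mon (s.map (data p e hp he g).2)) * RCA.gen _ _ _ (Gen.grp g)) := by
  induction s using Multiset.induction_on with
  | empty => simp [mon_zero, mult_zero, red]
  | cons i s ih =>
    rw [RCA.yHom_cons, ← mul_assoc, ih, smul_mul_assoc, mul_assoc, grp_mul_y hp he, mul_smul_comm,
      smul_smul, ← mul_assoc, sum_red_mult_cons, neg_add, AddChar.map_add_eq_mul,
      Multiset.map_cons, RCA.yHom_cons]

variable (ℓ p n ħ κ e c) in
/-- The products of a monomial in the `x_i` and a monomial in the `y_i`. -/
def xyMon (st : Multiset (Fin n) × Multiset (Fin n)) : H ℓ p n (e 1) ħ κ c :=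
  RCA.xHom _ _ _ (mon st.1) * RCA.yHom _ _ _ (mon st.2)

/-- The scalar sees the monomial only through the difference of multiplicities modulo ℓ, because y_i
carries the weight inverse to that of x_i. -/
theorem grp_mul_xyMon (g : complexReflectionGroup ℓ p n) (st : Multiset (Fin n) × Multiset (Fin n)) :
    RCA.gen _ _ _ (Gen.grp g) * xyMon ℓ p n ħ κ e c st =
      e (∑ j, red ℓ (mult st.1 - mult st.2) j *
        (data p e hp he g).1 ((data p e hp he g).2 j)) •
        (xyMon ℓ p n ħ κ e c (st.1.map (data p e hp he g).2, st.2.map (data p e hp he g).2) *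
          RCA.gen _ _ _ (Gen.grp g)) := by
  rw [xyMon, ← mul_assoc, grp_mul_xMon hp he, smul_mul_assoc, mul_assoc, grp_mul_yMon hp he,
    mul_smul_comm, smul_smul, ← mul_assoc, ← AddChar.map_add_eq_mul]
  congr 2
  rw [sub_eq_add_neg (mult st.1), red_add, red_neg]
  simp only [Pi.add_apply, Pi.neg_apply, add_mul, neg_mul, Finset.sum_add_distrib,
    Finset.sum_neg_distrib]

variable (ℓ p n ħ κ e c) in
/-- The span of the products of a monomial in the `x_i` and a group element. -/
def xSpan : Submodule ℂ (H ℓ p n (e 1) ħ κ c) :=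
  Submodule.span ℂ (Set.range fun sg : Multiset (Fin n) × complexReflectionGroup ℓ p n =>
    RCA.xHom _ _ _ (mon sg.1) * RCA.gen _ _ _ (Gen.grp sg.2))

variable (ℓ p n ħ κ e c) in
/-- The span of the products of an element `xyMon` and a group element. -/
def pbwSpan : Submodule ℂ (H ℓ p n (e 1) ħ κ c) :=
  Submodule.span ℂ (Set.range fun stg : (Multiset (Fin n) × Multiset (Fin n)) ×
    complexReflectionGroup ℓ p n => xyMon ℓ p n ħ κ e c stg.1 * RCA.gen _ _ _ (Gen.grp stg.2))

theorem mem_pbwSpan (st : Multiset (Fin n) × Multiset (Fin n))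
    (g : complexReflectionGroup ℓ p n) :
    xyMon ℓ p n ħ κ e c st * RCA.gen _ _ _ (Gen.grp g) ∈ pbwSpan ℓ p n ħ κ e c :=
  Submodule.subset_span ⟨(st, g), rfl⟩

include hp he in
theorem xSpan_mul_x {a : H ℓ p n (e 1) ħ κ c} (ha : a ∈ xSpan ℓ p n ħ κ e c) (j : Fin n) :
    a * RCA.gen _ _ _ (Gen.x j) ∈ xSpan ℓ p n ħ κ e c := by
  induction ha using Submodule.span_induction with
  | mem a ha =>
    obtain ⟨⟨s, g⟩, rfl⟩ := ha
    dsimp only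
    rw [mul_assoc, grp_mul_x hp he, mul_smul_comm, ← mul_assoc, ← RCA.xHom_cons]
    exact Submodule.smul_mem _ _ (Submodule.subset_span ⟨(_, g), rfl⟩)
  | zero => rw [zero_mul]; exact zero_mem _
  | add a b _ _ ha hb => rw [add_mul]; exact add_mem ha hb
  | smul z a _ ha => rw [smul_mul_assoc]; exact Submodule.smul_mem _ z ha

theorem xMon_mul_grpSpan (s : Multiset (Fin n)) {a : H ℓ p n (e 1) ħ κ c}
    (ha : a ∈ RCA.grpSpan _ _ _) : RCA.xHom _ _ _ (mon s) * a ∈ xSpan ℓ p n ħ κ e c := by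
  induction ha using Submodule.span_induction with
  | mem a ha =>
    obtain ⟨g, rfl⟩ := ha
    exact Submodule.subset_span ⟨(s, g), rfl⟩
  | zero => rw [mul_zero]; exact zero_mem _
  | add a b _ _ ha hb => rw [mul_add]; exact add_mem ha hb
  | smul z a _ ha => rw [mul_smul_comm]; exact Submodule.smul_mem _ z ha

-- Each [x_j, y_i] is a combination of group elements, so moving y_i across a monomial in x leaves
-- only monomials in x times group elements, with no y.
include hp he in
theorem y_mul_xMon_sub_mem (i : Fin n) (s : Multiset (Fin n)) :
    RCA.gen _ _ _ (Gen.y i) * RCA.xHom _ _ _ (mon s) -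
      RCA.xHom _ _ _ (mon s) * RCA.gen _ _ _ (Gen.y i) ∈ xSpan ℓ p n ħ κ e c := by
  induction s using Multiset.induction_on with
  | empty => simp [mon_zero]
  | cons j s ih =>
    rw [RCA.xHom_cons]
    have h := sub_mem (xSpan_mul_x hp he ih j)
      (xMon_mul_grpSpan s (RCA.sub_mem_grpSpan j i))
    rwa [← commutator_mul] at h

include hp he in
theorem xSpan_mul_yMon {a : H ℓ p n (e 1) ħ κ c} (ha : a ∈ xSpan ℓ p n ħ κ e c)
    (t : Multiset (Fin n)) (h : complexReflectionGroup ℓ p n) :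
    a * (RCA.yHom _ _ _ (mon t) * RCA.gen _ _ _ (Gen.grp h)) ∈ pbwSpan ℓ p n ħ κ e c := by
  induction ha using Submodule.span_induction with
  | mem a ha =>
    obtain ⟨⟨s, g⟩, rfl⟩ := ha
    dsimp only
    rw [mul_assoc, ← mul_assoc (RCA.gen _ _ _ (Gen.grp g)), grp_mul_yMon hp he, smul_mul_assoc,
      mul_smul_comm, mul_assoc (RCA.yHom _ _ _ _), RCA.gen_grp_mul, ← mul_assoc]
    exact Submodule.smul_mem _ _ (mem_pbwSpan (s, _) _)
  | zero => rw [zero_mul]; exact zero_mem _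
  | add a b _ _ ha hb => rw [add_mul]; exact add_mem ha hb
  | smul z a _ ha => rw [smul_mul_assoc]; exact Submodule.smul_mem _ z ha

include hp he in
theorem gen_mul_mem_pbwSpan (b : Gen (complexReflectionGroup ℓ p n)) {a : H ℓ p n (e 1) ħ κ c}
    (ha : a ∈ pbwSpan ℓ p n ħ κ e c) : RCA.gen _ _ _ b * a ∈ pbwSpan ℓ p n ħ κ e c := by
  induction ha using Submodule.span_induction with
  | mem a ha =>
    obtain ⟨⟨⟨s, t⟩, g⟩, rfl⟩ := ha
    dsimp only
    cases b with
    | grp h =>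
      rw [← mul_assoc, grp_mul_xyMon hp he, smul_mul_assoc, mul_assoc, RCA.gen_grp_mul]
      exact Submodule.smul_mem _ _ (mem_pbwSpan _ _)
    | x i =>
      rw [xyMon, ← mul_assoc, ← mul_assoc, ← RCA.xHom_cons']
      exact mem_pbwSpan (i ::ₘ s, t) g
    | y i =>
      have h := add_mem (xSpan_mul_yMon hp he (y_mul_xMon_sub_mem hp he i s) t g)
        (mem_pbwSpan (ħ := ħ) (κ := κ) (e := e) (c := c) (s, i ::ₘ t) g)
      rwa [xyMon, RCA.yHom_cons', ← mul_mul_eq_commutator_add] at h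
  | zero => rw [mul_zero]; exact zero_mem _
  | add a b _ _ ha hb => rw [mul_add]; exact add_mem ha hb
  | smul z a _ ha => rw [mul_smul_comm]; exact Submodule.smul_mem _ z ha

include hp he in
/-- The algebra is spanned by the products of monomials in the `x_i`, monomials in the `y_i` and
group elements. -/
theorem pbwSpan_eq_top : pbwSpan ℓ p n ħ κ e c = ⊤ := by
  have key (a : H ℓ p n (e 1) ħ κ c) : ∀ b ∈ pbwSpan ℓ p n ħ κ e c,
      a * b ∈ pbwSpan ℓ p n ħ κ e c := by
    induction a using RCA.induction with
    | hz z =>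
      intro b hb
      rw [← Algebra.smul_def]
      exact Submodule.smul_mem _ z hb
    | hgen a => exact fun b hb => gen_mul_mem_pbwSpan hp he a hb
    | hmul a a' ha ha' => exact fun b hb => by rw [mul_assoc]; exact ha _ (ha' b hb)
    | hadd a a' ha ha' => exact fun b hb => by rw [add_mul]; exact add_mem (ha b hb) (ha' b hb)
  have h1 : (1 : H ℓ p n (e 1) ħ κ c) ∈ pbwSpan ℓ p n ħ κ e c := by
    have := mem_pbwSpan (ħ := ħ) (κ := κ) (e := e) (c := c) (0, 0)
      (1 : complexReflectionGroup ℓ p n)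
    rwa [xyMon, mon_zero, map_one (RCA.xHom _ _ _), map_one (RCA.yHom _ _ _), RCA.gen_grp_one, mul_one, mul_one] at this
  exact Submodule.eq_top_iff'.2 fun a => by simpa using key a 1 h1

end

end Cherednik


/-! ### Good monomials span the spherical subalgebra -/

namespace Cherednik

noncomputable section

open Equiv Equiv.Perm

set_option linter.unusedSectionVars false

theorem mul_mul_eq_zero_of_twist {A : Type*} [Ring A] [Algebra ℂ A] {ε g x : A} {z : ℂ}
    (h1 : ε * g = ε) (h2 : g * ε = ε) (h : g * x = z • (x * g)) (hz : z ≠ 1) :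
    ε * x * ε = 0 := by
  have key : ε * x * ε = z • (ε * x * ε) := by
    calc ε * x * ε = ε * (g * x) * ε := by rw [← mul_assoc ε, h1]
      _ = _ := by rw [h, mul_smul_comm, smul_mul_assoc, ← mul_assoc, mul_assoc _ g, h2]
  have h0 : (1 - z) • (ε * x * ε) = 0 := by rw [sub_smul, one_smul, ← key, sub_self]
  exact (smul_eq_zero.1 h0).resolve_left (sub_ne_zero.2 hz.symm)

variable {ℓ p m : ℕ} [NeZero ℓ] {ħ κ : ℂ} {e : AddChar (ZMod ℓ) ℂ} {c : ℕ → ℂ}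
  (hp : p ∣ ℓ) (he : Function.Injective e)

variable (ℓ p m) in
/-- The exponents of the monomials that commute with the diagonal matrices of the group. -/
abbrev GoodIdx : Type := {st : Multiset (Fin (m + 1)) × Multiset (Fin (m + 1)) //
  IsGood ℓ p (red ℓ (mult st.1 - mult st.2))}

variable (ℓ p m ħ κ e c) in
/-- The span of the monomials that commute with the diagonal matrices of the group. -/
def goodSpan : Submodule ℂ (H ℓ p (m + 1) (e 1) ħ κ c) :=
  Submodule.span ℂ (Set.range fun i : GoodIdx ℓ p m => xyMon ℓ p (m + 1) ħ κ e c i.1)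

-- When the exponent difference is bad, some diagonal matrix of the group scales the monomial
-- nontrivially, and averaging on both sides kills it.
include hp he in
theorem e_mul_xyMon_mul_e_of_not {st : Multiset (Fin (m + 1)) × Multiset (Fin (m + 1))}
    (h : ¬ IsGood ℓ p (red ℓ (mult st.1 - mult st.2))) :
    RCA.e _ _ _ * xyMon ℓ p (m + 1) ħ κ e c st * RCA.e _ _ _ = 0 := by
  set χ := red ℓ (mult st.1 - mult st.2) with hχ
  have : ∃ a : Fin (m + 1) → ZMod ℓ, (p : ZMod ℓ) ∣ ∑ i, a i ∧
      (⟨1, 0, -χ⟩ : Subst ℓ (m + 1)).scal e a ≠ 1 := by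
    by_contra! hne
    have := isGood_neg (isGood_of_scal_eq_one p e hp he hne)
    rw [neg_neg] at this
    exact h this
  obtain ⟨a, ha, ha1⟩ := this
  have hscal : (⟨1, 0, -χ⟩ : Subst ℓ (m + 1)).scal e a = e (∑ j, χ j * a j) := by
    simp [Subst.scal]
  have hmul := grp_mul_xyMon (ħ := ħ) (κ := κ) (c := c) hp he (monomialElt p e hp a 1 ha) st
  rw [data_monomialElt] at hmul
  simp only [Perm.coe_one, Multiset.map_id, id_eq] at hmul
  rw [← hχ, ← hscal] at hmul
  exact mul_mul_eq_zero_of_twist (RCA.e_mul_gen_grp _) (RCA.gen_grp_mul_e _) hmul ha1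

include hp he in
theorem exists_goodSpan_of_corner (a : H ℓ p (m + 1) (e 1) ħ κ c) :
    ∃ z ∈ goodSpan ℓ p m ħ κ e c, RCA.e _ _ _ * a * RCA.e _ _ _ =
      RCA.e _ _ _ * z * RCA.e _ _ _ := by
  have ha : a ∈ pbwSpan ℓ p (m + 1) ħ κ e c := by
    rw [pbwSpan_eq_top hp he]
    trivial
  induction ha using Submodule.span_induction with
  | mem a ha =>
    obtain ⟨⟨st, g⟩, rfl⟩ := ha
    dsimp only
    rw [← mul_assoc, mul_assoc _ (RCA.gen _ _ _ _), RCA.gen_grp_mul_e]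
    by_cases h : IsGood ℓ p (red ℓ (mult st.1 - mult st.2))
    · exact ⟨_, Submodule.subset_span ⟨⟨st, h⟩, rfl⟩, rfl⟩
    · exact ⟨0, zero_mem _, by rw [e_mul_xyMon_mul_e_of_not hp he h, mul_zero, zero_mul]⟩
  | zero => exact ⟨0, zero_mem _, rfl⟩
  | add a b _ _ ha hb =>
    obtain ⟨z, hz, ha⟩ := ha
    obtain ⟨w, hw, hb⟩ := hb
    exact ⟨z + w, add_mem hz hw, by simp only [mul_add, add_mul, ha, hb]⟩
  | smul x a _ ha =>
    obtain ⟨z, hz, ha⟩ := ha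
    exact ⟨x • z, Submodule.smul_mem _ _ hz, by simp only [mul_smul_comm, smul_mul_assoc, ha]⟩

include hp he in
theorem conj_mem_goodSpan {z : H ℓ p (m + 1) (e 1) ħ κ c} (hz : z ∈ goodSpan ℓ p m ħ κ e c)
    (g : complexReflectionGroup ℓ p (m + 1)) :
    RCA.gen _ _ _ (Gen.grp g) * z * RCA.gen _ _ _ (Gen.grp g⁻¹) ∈ goodSpan ℓ p m ħ κ e c := by
  induction hz using Submodule.span_induction with
  | mem a ha =>
    obtain ⟨⟨st, h⟩, rfl⟩ := ha
    dsimp only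
    rw [grp_mul_xyMon hp he, smul_mul_assoc, mul_assoc, RCA.gen_grp_mul, mul_inv_cancel,
      RCA.gen_grp_one, mul_one]
    refine Submodule.smul_mem _ _ (Submodule.subset_span ⟨⟨_, ?_⟩, rfl⟩)
    rw [mult_map, mult_map]
    exact isGood_comp h (data p e hp he g).2.symm
  | zero => rw [mul_zero, zero_mul]; exact zero_mem _
  | add a b _ _ ha hb => rw [mul_add, add_mul]; exact add_mem ha hb
  | smul x a _ ha => rw [mul_smul_comm, smul_mul_assoc]; exact Submodule.smul_mem _ x ha

include hp he in
/-- Every element of `e H e` is of the form `z e`, with `z` in the span of the good monomials. -/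
theorem exists_goodSpan_mul_e (a : H ℓ p (m + 1) (e 1) ħ κ c) :
    ∃ z ∈ goodSpan ℓ p m ħ κ e c, RCA.e _ _ _ * a * RCA.e _ _ _ = z * RCA.e _ _ _ := by
  obtain ⟨z, hz, h⟩ := exists_goodSpan_of_corner hp he a
  -- In e z e the left factor is expanded and each g z e rewritten as (g z g⁻¹) e, so e z e is the
  -- average of the conjugates of z, times e.
  refine ⟨(Fintype.card (complexReflectionGroup ℓ p (m + 1)) : ℂ)⁻¹ • ∑ g,
    RCA.gen _ _ _ (Gen.grp g) * z * RCA.gen _ _ _ (Gen.grp g⁻¹),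
    Submodule.smul_mem _ _ (Submodule.sum_mem _ fun g _ => conj_mem_goodSpan hp he hz g), ?_⟩
  rw [h, smul_mul_assoc, Finset.sum_mul]
  simp_rw [mul_assoc, RCA.gen_grp_mul_e]
  rw [← Finset.sum_mul, ← smul_mul_assoc, RCA.e]

end

end Cherednik


/-! ### Multiplication by polynomials in U belongs to the image of H -/

namespace Cherednik

noncomputable section

open Equiv Equiv.Perm

set_option linter.unusedSectionVars false

theorem mem_of_add_eq {V : Type*} [AddCommGroup V] [Module ℂ V]
    {S : Subalgebra ℂ (Module.End ℂ V)} {a b c : Module.End ℂ V} (h : a + c = b) (hb : b ∈ S)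
    (hc : c ∈ S) : a ∈ S := by
  have : a = b + (-1 : ℂ) • c := by
    rw [← h, neg_smul, one_smul, add_neg_cancel_right]
  rw [this]
  exact add_mem hb (Subalgebra.smul_mem _ hc _)

variable {ℓ m : ℕ} [NeZero ℓ] (p : ℕ) (ħ κ : ℂ) (e : AddChar (ZMod ℓ) ℂ) (c : ℕ → ℂ)
  (hp : p ∣ ℓ) (he : Function.Injective e) (hc : ∀ j, ¬ p ∣ j → c j = 0)

theorem permRep_mem_range (w : Perm (Fin (m + 1))) :
    permRep ħ (-κ) e he w ∈ (polyRep p ħ κ e c hp he hc).range :=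
  ⟨RCA.gen _ _ _ (Gen.grp (permElt ℓ p w)),
    (polyRep_gen p ħ κ e c hp he hc _).trans (groupRep_permElt p ħ κ e hp he w)⟩

theorem polyRep_monomialElt {a : Fin (m + 1) → ZMod ℓ} (ha : (p : ZMod ℓ) ∣ ∑ i, a i) :
    polyRep p ħ κ e c hp he hc (RCA.gen _ _ _ (Gen.grp (monomialElt p e hp a 1 ha))) =
      diagOp a := by
  rw [polyRep_gen, genRep, groupRep, data_monomialElt, map_one, mul_one]

theorem diagOp_mem_range {a : Fin (m + 1) → ZMod ℓ} (ha : (p : ZMod ℓ) ∣ ∑ i, a i) :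
    diagOp a ∈ (polyRep p ħ κ e c hp he hc).range :=
  ⟨_, polyRep_monomialElt p ħ κ e c hp he hc ha⟩

theorem sigmaOp_mem_range :
    sigmaOp (m := m) ħ e c ∈ (polyRep p ħ κ e c hp he hc).range := by
  have h : xRep ħ (-κ) e c he (0 : Fin (m + 1)) ∈ (polyRep p ħ κ e c hp he hc).range :=
    ⟨_, polyRep_gen p ħ κ e c hp he hc (Gen.x 0)⟩
  have h' := mul_mem h (permRep_mem_range p ħ κ e c hp he hc (finRotate (m + 1)))
  rwa [xRep_zero, mul_assoc, ← map_mul, inv_mul_cancel, map_one (permRep _ _ _ _), mul_one] at h'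

theorem tauOp_mem_range :
    tauOp (m := m) ħ e ∈ (polyRep p ħ κ e c hp he hc).range := by
  have h : yRep ħ (-κ) e he (Fin.last m) ∈ (polyRep p ħ κ e c hp he hc).range :=
    ⟨_, polyRep_gen p ħ κ e c hp he hc (Gen.y (Fin.last m))⟩
  have h' := mul_mem h (permRep_mem_range p ħ κ e c hp he hc (finRotate (m + 1))⁻¹)
  rwa [yRep_last, mul_assoc, ← map_mul, mul_inv_cancel, map_one (permRep _ _ _ _), mul_one] at h'

theorem charOp_mem_range {c' : ℕ → ℂ} (hc' : ∀ j, ¬ p ∣ j → c' j = 0) (i : Fin (m + 1)) :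
    charOp c' i ∈ (polyRep p ħ κ e c hp he hc).range := by
  refine Subalgebra.sum_mem _ fun j _ => ?_
  by_cases hj : p ∣ j
  · refine Subalgebra.smul_mem _ (diagOp_mem_range p ħ κ e c hp he hc ?_) _
    rw [sum_single]
    exact Nat.cast_dvd_cast hj
  · rw [hc' j hj, zero_smul]
    exact zero_mem _

include he in
theorem varOp_zero_add : varOp (0 : Fin (m + 1)) + (algebraMap ℂ _ ħ +
    charOp (fun j => c j * e (-(j : ZMod ℓ))) 0) = sigmaOp (m := m) ħ e c * tauOp ħ e := by
  refine end_ext ħ e he fun q f => ?_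
  rw [row_sigma_mul_tau, sigmaVal]
  simp only [LinearMap.add_apply, map_add, row_varOp, row_charOp, Module.algebraMap_end_apply,
    map_smul]
  rw [Algebra.smul_def]
  rw [charSum_shift, sub_eq_add_neg]
  ring

/-- U_1 is στ minus a constant and a diagonal operator with coefficients only at multiples of p; the
Hecke relation then expresses U_{i+1} through U_i and a transposition. -/
theorem varOp_mem_range (i : Fin (m + 1)) :
    varOp i ∈ (polyRep p ħ κ e c hp he hc).range := by
  induction i using Fin.induction with
  | zero =>
    exact mem_of_add_eq (varOp_zero_add ħ e c he) (mul_mem (sigmaOp_mem_range p ħ κ e c hp he hc)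
      (tauOp_mem_range p ħ κ e c hp he hc)) (add_mem (Subalgebra.algebraMap_mem _ _)
        (charOp_mem_range p ħ κ e c hp he hc (fun j hj => by rw [hc j hj, zero_mul]) 0))
  | succ i ih =>
    have hs := permRep_mem_range p ħ κ e c hp he hc (swap i.castSucc i.succ)
    rw [permRep_swap] at hs
    have hpair : pairOp i.castSucc i.succ ∈ (polyRep p ħ κ e c hp he hc).range :=
      Subalgebra.sum_mem _ fun x _ => diagOp_mem_range p ħ κ e c hp he hc (by
        rw [sum_single_sub]; exact dvd_zero _)
    have h := mem_of_add_eq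
      (defSwap_mul_varOp ħ (-κ) e he (Fin.castSucc_lt_succ (i := i)).ne).symm (mul_mem hs ih)
      (Subalgebra.smul_mem _ hpair (-κ))
    have h' := mul_mem h hs
    rwa [mul_assoc, defSwap_sq ħ e he, mul_one] at h'

theorem varOp_apply {n : ℕ} (i : Fin n) (v : PolyUT ℓ n) :
    varOp i v = (MvPolynomial.X i : PolyU n) • v := by
  ext a : 2
  change (AddMonoidAlgebra.single 0 (MvPolynomial.X i : PolyU n) * v).coeff a = _
  rw [AddMonoidAlgebra.coeff_single_zero_mul]
  simp

theorem exists_polyRep_eq_smul (f : PolyU (m + 1)) :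
    ∃ a, ∀ v : PolyUT ℓ (m + 1), polyRep p ħ κ e c hp he hc a v = f • v := by
  induction f using MvPolynomial.induction_on with
  | C z =>
    refine ⟨algebraMap ℂ _ z, fun v => ?_⟩
    rw [AlgHom.commutes, Module.algebraMap_end_apply]
    exact (algebraMap_smul (PolyU (m + 1)) z v).symm
  | add f g hf hg =>
    obtain ⟨a, ha⟩ := hf
    obtain ⟨b, hb⟩ := hg
    refine ⟨a + b, fun v => ?_⟩
    rw [map_add, LinearMap.add_apply, ha, hb, add_smul]
  | mul_X f i hf =>
    obtain ⟨a, ha⟩ := hf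
    obtain ⟨b, hb⟩ := varOp_mem_range p ħ κ e c hp he hc i
    refine ⟨a * b, fun v => ?_⟩
    rw [map_mul]
    change polyRep p ħ κ e c hp he hc a ((polyRep p ħ κ e c hp he hc).toRingHom b v) = _
    rw [ha, hb, mul_smul, varOp_apply]

end

end Cherednik


/-! ### Leading coefficients of good monomials -/

namespace Cherednik

noncomputable section

open Equiv Equiv.Perm

set_option linter.unusedSectionVars false

theorem mon_eq_monomial {n : ℕ} (s : Multiset (Fin n)) :
    mon s = MvPolynomial.monomial (Multiset.toFinsupp s) 1 := by
  induction s using Multiset.induction_on with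
  | empty => simp [mon_zero]
  | cons i s ih =>
    rw [mon_cons, ih, ← Multiset.singleton_add, map_add, Multiset.toFinsupp_singleton,
      MvPolynomial.X, MvPolynomial.monomial_mul, mul_one, add_comm]

theorem coeff_mon {n : ℕ} (s t : Multiset (Fin n)) :
    MvPolynomial.coeff (Multiset.toFinsupp t) (mon s) = if s = t then 1 else 0 := by
  rw [mon_eq_monomial, MvPolynomial.coeff_monomial]
  simp only [EmbeddingLike.apply_eq_iff_eq]

theorem notMem_filt_of_coeff_ne_zero {n : ℕ} {P : PolyU n} {s : Multiset (Fin n)}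
    (h : MvPolynomial.coeff (Multiset.toFinsupp s) P ≠ 0) :
    algebraMap _ (FractionRing (PolyU n)) P ∉ Filt n (s.card - 1) := fun hmem => by
  have hP : P ≠ 0 := by
    rintro rfl
    exact h (MvPolynomial.coeff_zero _)
  have h1 := totalDegree_le_of_mem_filt hP hmem
  have h2 := (Multiset.toFinsupp_sum_eq s).symm.trans_le
    (MvPolynomial.le_totalDegree (MvPolynomial.mem_support_iff.2 h))
  omega

variable {ℓ p m : ℕ} [NeZero ℓ] {ħ κ : ℂ} {e : AddChar (ZMod ℓ) ℂ} {c : ℕ → ℂ}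
  (hp : p ∣ ℓ) (he : Function.Injective e) (hc : ∀ j, ¬ p ∣ j → c j = 0)

variable (κ) in
/-- The functional `v ↦ ε_1(a v)`. -/
def functional (a : H ℓ p (m + 1) (e 1) ħ κ c) :
    PolyUT ℓ (m + 1) →ₗ[ℂ] FractionRing (PolyU (m + 1)) :=
  (row ħ e 1).comp (polyRep p ħ κ e c hp he hc a)

theorem polyRep_xyMon (st : Multiset (Fin (m + 1)) × Multiset (Fin (m + 1))) :
    HasSymbol ħ e st.1.card (polyRep p ħ κ e c hp he hc (xyMon ℓ p (m + 1) ħ κ e c st))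
      (fun q => (st.1.map (lval ħ q)).prod) (Subst.trans (mult st.1 - mult st.2)) := by
  have h := hasSymbol_mon (Φ := (polyRep p ħ κ e c hp he hc).comp (RCA.xHom _ _ _))
    (Ψ := (polyRep p ħ κ e c hp he hc).comp (RCA.yHom _ _ _)) ħ (-κ) e c he
    (fun i => by
      rw [AlgHom.comp_apply, RCA.xHom, polyHom_X, polyRep_gen]
      rfl)
    (fun i => by
      rw [AlgHom.comp_apply, RCA.yHom, polyHom_X, polyRep_gen]
      rfl) st.1 st.2
  rwa [AlgHom.comp_apply, AlgHom.comp_apply, ← map_mul] at h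

/-- The leading coefficients of a monomial. -/
theorem exists_leading (i : GoodIdx ℓ p m) :
    ∃ X, Represents p ħ (functional κ hp he hc (xyMon ℓ p (m + 1) ħ κ e c i.1)) X ∧
      ∀ d hd, ħ ≠ 0 → X.coeff (latticeShift p ħ d hd) -
        (if mult i.1.1 - mult i.1.2 = d then algebraMap (PolyU (m + 1)) _ (mon i.1.1) else 0) ∈
          Filt (m + 1) (i.1.1.card - 1) := by
  classical
  have hsym := polyRep_xyMon (ħ := ħ) (κ := κ) hp he hc i.1
  obtain ⟨Y, hY, hY'⟩ := exists_represents hp he (hsym.2.2 1 Subst.compatible_one)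
  have hX := represents_row (ħ := ħ) hp he (q := 1 * Subst.trans (mult i.1.1 - mult i.1.2))
    (Subst.compatible_mul Subst.compatible_one (Subst.compatible_trans _))
    (by rw [one_mul]; exact i.2) (i.1.1.map (lval ħ (1 : Subst ℓ (m + 1)))).prod
  have hsum := hY.add hX
  rw [sub_add_cancel] at hsum
  refine ⟨_, hsum, fun d hd hħ => ?_⟩
  -- At the identity substitution the leading coefficient is the monomial U^s itself.
  have hval : (i.1.1.map (lval ħ (1 : Subst ℓ (m + 1)))).prod =
      algebraMap (PolyU (m + 1)) _ (mon i.1.1) := by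
    rw [mon, map_multiset_prod, Multiset.map_map]
    congr 2
    funext j
    simp [lval, Subst.val]
  rw [SkewMonoidAlgebra.coeff_add, Finsupp.add_apply, SkewMonoidAlgebra.coeff_single_apply, hval]
  have hiff : latticeShift p ħ ((1 * Subst.trans (mult i.1.1 - mult i.1.2) : Subst ℓ (m + 1)).d ∘
      (1 * Subst.trans (mult i.1.1 - mult i.1.2) : Subst ℓ (m + 1)).w.symm)
        (by rw [one_mul]; exact i.2) = latticeShift p ħ d hd ↔ mult i.1.1 - mult i.1.2 = d := by
    rw [latticeShift, latticeShift, Subtype.mk_eq_mk, (shift_injective ħ hħ).eq_iff, one_mul]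
    exact Iff.rfl
  simp only [hiff]
  rw [add_sub_cancel_right]
  exact hY' _

end

end Cherednik


/-! ### Preservation of Γ E' and faithfulness of the action -/

namespace Cherednik

noncomputable section

open Equiv Equiv.Perm

set_option linter.unusedSectionVars false

variable {ℓ p m : ℕ} [NeZero ℓ] {ħ κ : ℂ} {e : AddChar (ZMod ℓ) ℂ} {c : ℕ → ℂ}
  (hp : p ∣ ℓ) (he : Function.Injective e) (hc : ∀ j, ¬ p ∣ j → c j = 0)

theorem polyRep_grp_apply (g : complexReflectionGroup ℓ p (m + 1)) {f : PolyU (m + 1)}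
    (hf : f.IsSymmetric) :
    polyRep p ħ κ e c hp he hc (RCA.gen _ _ _ (Gen.grp g)) (f • diagIdempotent ℓ p (m + 1)) =
      f • diagIdempotent ℓ p (m + 1) := by
  rw [polyRep_gen]
  change diagOp (data p e hp he g).1 (permRep ħ (-κ) e he (data p e hp he g).2 _) = _
  rw [permRep_smul_diagIdempotent p ħ (-κ) e he hp hf,
    diagOp_smul_diagIdempotent p e hp he (dvd_data p e hp he g)]

theorem polyRep_e_apply {f : PolyU (m + 1)} (hf : f.IsSymmetric) :
    polyRep p ħ κ e c hp he hc (RCA.e _ _ _) (f • diagIdempotent ℓ p (m + 1)) =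
      f • diagIdempotent ℓ p (m + 1) := by
  have hcard : (Fintype.card (complexReflectionGroup ℓ p (m + 1)) : ℂ) ≠ 0 := by
    exact_mod_cast Fintype.card_ne_zero
  rw [RCA.e, map_smul (polyRep p ħ κ e c hp he hc), map_sum (polyRep p ħ κ e c hp he hc), LinearMap.smul_apply, LinearMap.sum_apply,
    Finset.sum_congr rfl fun g _ => polyRep_grp_apply hp he hc g hf, Finset.sum_const,
    Finset.card_univ, ← Nat.cast_smul_eq_nsmul ℂ, smul_smul, inv_mul_cancel₀ hcard, one_smul]

theorem functional_mul_e (a : H ℓ p (m + 1) (e 1) ħ κ c) {f : PolyU (m + 1)}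
    (hf : f.IsSymmetric) :
    functional κ hp he hc (a * RCA.e _ _ _) (f • diagIdempotent ℓ p (m + 1)) =
      functional κ hp he hc a (f • diagIdempotent ℓ p (m + 1)) := by
  rw [functional, functional, LinearMap.comp_apply, map_mul, Module.End.mul_apply,
    polyRep_e_apply hp he hc hf, LinearMap.comp_apply]

theorem row_one_smul (hp : p ∣ ℓ) (he : Function.Injective e) (g : PolyU (m + 1)) :
    row ħ e 1 (g • diagIdempotent ℓ p (m + 1)) = algebraMap _ _ g := by
  rw [row_smul_diagIdempotent p ħ e hp he ⟨0, fun i => by simp⟩, Subst.onU_one]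

/-- The spherical subalgebra preserves the multiples of the idempotent by symmetric
polynomials. -/
theorem exists_isSymmetric (a : H ℓ p (m + 1) (e 1) ħ κ c) (ha : RCA.e _ _ _ * a = a)
    (f : PolyU (m + 1)) : ∃ g : PolyU (m + 1), g.IsSymmetric ∧
      polyRep p ħ κ e c hp he hc a (f • diagIdempotent ℓ p (m + 1)) =
        g • diagIdempotent ℓ p (m + 1) := by
  set v := polyRep p ħ κ e c hp he hc a (f • diagIdempotent ℓ p (m + 1)) with hv
  have hg (g : complexReflectionGroup ℓ p (m + 1)) :
      polyRep p ħ κ e c hp he hc (RCA.gen _ _ _ (Gen.grp g)) v = v := by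
    have h : RCA.gen _ _ _ (Gen.grp g) * a = a := by
      rw [← ha, ← mul_assoc, RCA.gen_grp_mul_e]
    calc _ = (polyRep p ħ κ e c hp he hc (RCA.gen _ _ _ (Gen.grp g)) *
          polyRep p ħ κ e c hp he hc a) (f • diagIdempotent ℓ p (m + 1)) := rfl
      _ = v := by rw [← map_mul, h]
  refine ⟨ev ħ e 1 v, isSymmetric_ev ħ (-κ) e he fun w => ?_,
    eq_smul_diagIdempotent p ħ e hp he (fun α hα => ?_) fun t => ?_⟩
  · rw [← groupRep_permElt p ħ κ e hp he w]
    exact (congrFun (congrArg DFunLike.coe (polyRep_gen p ħ κ e c hp he hc _)) v).symm.trans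
      (hg (permElt ℓ p w))
  -- Invariance under diagonal matrices and under permutations comes from e on the left of `a`;
  -- invariance under twists comes from the source vector, since twists commute with `a` and fix f
  -- E'.
  · rw [← polyRep_monomialElt p ħ κ e c hp he hc hα]
    exact hg _
  · have h := LinearMap.congr_fun (commute_polyRep p ħ κ e c hp he hc t a).eq
      (f • diagIdempotent ℓ p (m + 1))
    change twistOp p ħ e t v = polyRep p ħ κ e c hp he hc a (twistOp p ħ e t _) at h
    rw [h, twistOp_smul_diagIdempotent p ħ e hp he]

theorem functional_sum {ι : Type*} (F : ι →₀ ℂ) (x : ι → H ℓ p (m + 1) (e 1) ħ κ c) :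
    functional κ hp he hc (F.sum fun i a => a • x i) =
      ∑ i ∈ F.support, F i • functional κ hp he hc (x i) := by
  refine LinearMap.ext fun v => ?_
  simp only [functional, Finsupp.sum, map_sum, map_smul, LinearMap.comp_apply,
    LinearMap.sum_apply, LinearMap.smul_apply]

theorem exists_represents_goodSpan {z : H ℓ p (m + 1) (e 1) ħ κ c}
    (hz : z ∈ goodSpan ℓ p m ħ κ e c) : ∃ X, Represents p ħ (functional κ hp he hc z) X := by
  obtain ⟨F, rfl⟩ := (Finsupp.mem_span_range_iff_exists_finsupp).1 hz
  choose X hX _ using exists_leading (ħ := ħ) (κ := κ) (m := m) hp he hc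
  rw [functional_sum]
  exact ⟨_, Represents.sum F.support fun i _ => (hX i).smul (F i)⟩

theorem mult_injective {n : ℕ} : Function.Injective (mult (n := n)) := fun _ _ h =>
  Multiset.ext.2 fun i => Nat.cast_injective (R := ℤ) (congrFun h i)

theorem algebraMap_smul_mon {n : ℕ} (z : ℂ) (P : PolyU n) :
    algebraMap (PolyU n) (FractionRing (PolyU n)) (z • P) = algebraMap ℂ _ z *
      algebraMap (PolyU n) (FractionRing (PolyU n)) P := by
  rw [Algebra.smul_def, map_mul, ← IsScalarTower.algebraMap_apply]

theorem coeff_finsetSum {ι : Type*} {n : ℕ} (S : Finset ι)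
    (X : ι → GaloisOrder.SkewRing (lattice ℓ p n ħ).toSubmonoid)
    (μ : (lattice ℓ p n ħ).toSubmonoid) :
    (∑ i ∈ S, X i).coeff μ = ∑ i ∈ S, (X i).coeff μ :=
  (DFunLike.congr_fun (map_sum (GaloisOrder.leftCoeff (lattice ℓ p n ħ)) X S) μ).trans
    (Finsupp.finsetSum_apply _ _ _)

open Classical in
/-- The coefficients of highest degree of a sum of monomials. -/
theorem exists_represents_of_leading (hħ : ħ ≠ 0) {ι : Type*} (S : Finset ι) (F : ι → ℂ)
    (x : ι → GoodIdx ℓ p m) {N : ℤ} (hN : ∀ i ∈ S, ((x i).1.1.card : ℤ) ≤ N) :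
    ∃ X, Represents p ħ (∑ i ∈ S, F i • functional κ hp he hc
        (xyMon ℓ p (m + 1) ħ κ e c (x i).1)) X ∧
      ∀ d hd, X.coeff (latticeShift p ħ d hd) - algebraMap (PolyU (m + 1)) _ (∑ i ∈ S,
        if mult (x i).1.1 - mult (x i).1.2 = d then F i • mon (x i).1.1 else 0) ∈
          Filt (m + 1) (N - 1) := by
  choose X hX hX' using exists_leading (ħ := ħ) (κ := κ) (m := m) hp he hc
  refine ⟨_, Represents.sum S fun i _ => (hX (x i)).smul (F i), fun d hd => ?_⟩
  rw [coeff_finsetSum, map_sum, ← Finset.sum_sub_distrib]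
  refine Submodule.sum_mem _ fun i hi => ?_
  have h := Submodule.smul_mem _ (F i) (hX' (x i) d hd hħ)
  rw [coeff_single_mul]
  convert filt_mono (show ((x i).1.1.card : ℤ) - 1 ≤ N - 1 by have := hN i hi; omega) h using 1
  refine Eq.trans ?_ (Algebra.smul_def _ _).symm
  rw [mul_sub]
  congr 1
  split_ifs
  · rw [algebraMap_smul_mon]
  · rw [map_zero, mul_zero]

/-- Among the monomials of highest degree in x, that of (s, t) contributes U^s at the translation s
- t. For a fixed translation s determines t, so top-degree contributions cannot cancel. -/
theorem eq_zero_of_represents_zero (hħ : ħ ≠ 0) {z : H ℓ p (m + 1) (e 1) ħ κ c}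
    (hz : z ∈ goodSpan ℓ p m ħ κ e c) (h : Represents p ħ (functional κ hp he hc z) 0) :
    z = 0 := by
  classical
  obtain ⟨F, rfl⟩ := (Finsupp.mem_span_range_iff_exists_finsupp).1 hz
  rcases F.support.eq_empty_or_nonempty with hF | hF
  · rw [Finsupp.sum, hF, Finset.sum_empty]
  exfalso
  obtain ⟨i₀, hi₀, hmax⟩ := F.support.exists_max_image (fun i => i.1.1.card) hF
  obtain ⟨X, hX, hX'⟩ := exists_represents_of_leading (κ := κ) hp he hc hħ F.support F id
    (N := i₀.1.1.card) fun i hi => by exact_mod_cast hmax i hi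
  rw [functional_sum] at h
  have hX0 : X = 0 := hX.unique hħ h
  have hmem := hX' _ i₀.2
  rw [hX0] at hmem
  change 0 - _ ∈ _ at hmem
  rw [zero_sub, neg_mem_iff] at hmem
  refine notMem_filt_of_coeff_ne_zero ?_ hmem
  -- The coefficient of U^s with s from `i₀` isolates `F i₀`.
  rw [MvPolynomial.coeff_sum, Finset.sum_eq_single i₀]
  · rw [id, if_pos rfl, MvPolynomial.coeff_smul, coeff_mon, if_pos rfl, smul_eq_mul, mul_one]
    exact Finsupp.mem_support_iff.1 hi₀
  · intro i _ hi
    rw [id]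
    split_ifs with hd
    · rw [MvPolynomial.coeff_smul, coeff_mon, if_neg, smul_zero]
      intro hs
      rw [hs, sub_right_inj] at hd
      exact hi (Subtype.ext (Prod.ext hs (mult_injective hd)))
    · exact MvPolynomial.coeff_zero _
  · exact fun h' => absurd hi₀ h'

end

end Cherednik


/-! ### The realization of the spherical subalgebra as a Galois order -/

namespace Cherednik

noncomputable section

open Equiv Equiv.Perm

set_option linter.unusedSectionVars false

/-- An injective ring homomorphism is an isomorphism onto its image. -/
def ringEquivOfInjective {R S : Type*} [Mul R] [Add R] [Ring S] (f : R → S)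
    (hmul : ∀ a b, f (a * b) = f a * f b) (hadd : ∀ a b, f (a + b) = f a + f b) (U : Subring S)
    (hU : ∀ x, x ∈ U ↔ ∃ a, f a = x) (hf : Function.Injective f) : R ≃+* U where
  __ := Equiv.ofBijective (fun a => (⟨f a, (hU _).2 ⟨a, rfl⟩⟩ : U))
    ⟨fun _ _ h => hf (Subtype.mk.inj h), fun ⟨x, h⟩ => by
      obtain ⟨a, rfl⟩ := (hU x).1 h
      exact ⟨a, rfl⟩⟩
  map_mul' a b := Subtype.ext (hmul a b)
  map_add' a b := Subtype.ext (hadd a b)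

variable {ℓ p m : ℕ} [NeZero ℓ] {ħ κ : ℂ} {e : AddChar (ZMod ℓ) ℂ} {c : ℕ → ℂ}
  (hp : p ∣ ℓ) (he : Function.Injective e) (hc : ∀ j, ¬ p ∣ j → c j = 0)

theorem SphericalH.e_mul (a : SphericalH ℓ p (m + 1) (e 1) ħ κ c) : RCA.e _ _ _ * a.1 = a.1 :=
  ((Subsemigroup.mem_corner_iff (RCA.isIdempotentElem_e _ _ _)).1 a.2).1

theorem SphericalH.mul_e (a : SphericalH ℓ p (m + 1) (e 1) ħ κ c) : a.1 * RCA.e _ _ _ = a.1 :=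
  ((Subsemigroup.mem_corner_iff (RCA.isIdempotentElem_e _ _ _)).1 a.2).2

variable (ℓ p m ħ κ e c) in
/-- The element `e a e` of the spherical subalgebra. -/
def toSpherical (a : H ℓ p (m + 1) (e 1) ħ κ c) : SphericalH ℓ p (m + 1) (e 1) ħ κ c :=
  ⟨RCA.e _ _ _ * a * RCA.e _ _ _, (Subsemigroup.mem_corner_iff (RCA.isIdempotentElem_e _ _ _)).2
    ⟨by rw [← mul_assoc, ← mul_assoc, (RCA.isIdempotentElem_e _ _ _).eq],
      by rw [mul_assoc, (RCA.isIdempotentElem_e _ _ _).eq]⟩⟩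

theorem exists_spherical_eq_mul_e (a : SphericalH ℓ p (m + 1) (e 1) ħ κ c) :
    ∃ z ∈ goodSpan ℓ p m ħ κ e c, a.1 = z * RCA.e _ _ _ ∧ ∀ X,
      Represents p ħ (functional κ hp he hc a.1) X ↔
        Represents p ħ (functional κ hp he hc z) X := by
  obtain ⟨z, hz, h⟩ := exists_goodSpan_mul_e hp he a.1
  rw [SphericalH.e_mul, SphericalH.mul_e] at h
  refine ⟨z, hz, h, fun X => forall₂_congr fun f hf => ?_⟩
  rw [h, functional_mul_e hp he hc z hf]

theorem exists_represents_spherical (a : SphericalH ℓ p (m + 1) (e 1) ħ κ c) :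
    ∃ X, Represents p ħ (functional κ hp he hc a.1) X := by
  obtain ⟨z, hz, -, h⟩ := exists_spherical_eq_mul_e hp he hc a
  obtain ⟨X, hX⟩ := exists_represents_goodSpan hp he hc hz
  exact ⟨X, (h X).2 hX⟩

theorem exists_eval_eq {a : H ℓ p (m + 1) (e 1) ħ κ c} (ha : RCA.e _ _ _ * a = a)
    {X : GaloisOrder.SkewRing (lattice ℓ p (m + 1) ħ).toSubmonoid}
    (hX : Represents p ħ (functional κ hp he hc a) X) {f : PolyU (m + 1)} (hf : f.IsSymmetric) :
    ∃ g : PolyU (m + 1), g.IsSymmetric ∧ polyRep p ħ κ e c hp he hc a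
        (f • diagIdempotent ℓ p (m + 1)) = g • diagIdempotent ℓ p (m + 1) ∧
      GaloisOrder.eval X (algebraMap _ _ f) = algebraMap _ _ g := by
  obtain ⟨g, hg, h⟩ := exists_isSymmetric hp he hc a ha f
  refine ⟨g, hg, h, ?_⟩
  rw [hX f hf, functional, LinearMap.comp_apply, h, row_one_smul hp he]

/-- The condition on `b` ensures that b(f E') is again g E' with g symmetric, so the description of
`a` on Γ E' applies to it. -/
theorem represents_mul {a b : H ℓ p (m + 1) (e 1) ħ κ c} (hb : RCA.e _ _ _ * b = b)
    {X Y : GaloisOrder.SkewRing (lattice ℓ p (m + 1) ħ).toSubmonoid}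
    (hX : Represents p ħ (functional κ hp he hc a) X)
    (hY : Represents p ħ (functional κ hp he hc b) Y) :
    Represents p ħ (functional κ hp he hc (a * b)) (X * Y) := fun f hf => by
  obtain ⟨g, hg, h, h'⟩ := exists_eval_eq hp he hc hb hY hf
  rw [GaloisOrder.eval_mul, h', hX g hg, functional, functional, LinearMap.comp_apply,
    LinearMap.comp_apply, map_mul, Module.End.mul_apply, h]

/-- The realization of the spherical subalgebra in the skew group ring. -/
def sphericalHom (hħ : ħ ≠ 0) : SphericalH ℓ p (m + 1) (e 1) ħ κ c →+*
    GaloisOrder.SkewRing (lattice ℓ p (m + 1) ħ).toSubmonoid where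
  toFun a := (exists_represents_spherical hp he hc a).choose
  map_one' := Represents.unique hħ (exists_represents_spherical hp he hc 1).choose_spec
    fun f hf => by
      change _ = functional κ hp he hc (RCA.e _ _ _) _
      rw [GaloisOrder.eval_one, functional, LinearMap.comp_apply, polyRep_e_apply hp he hc hf,
        row_one_smul hp he]
  map_zero' := Represents.unique hħ (exists_represents_spherical hp he hc 0).choose_spec
    fun f _ => by
      change _ = functional κ hp he hc 0 _
      rw [GaloisOrder.eval_zero, functional, LinearMap.comp_apply, map_zero, LinearMap.zero_apply,
        map_zero]
  map_mul' a b := Represents.unique hħ (exists_represents_spherical hp he hc (a * b)).choose_spec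
    (represents_mul hp he hc (SphericalH.e_mul b)
      (exists_represents_spherical hp he hc a).choose_spec
      (exists_represents_spherical hp he hc b).choose_spec)
  map_add' a b := Represents.unique hħ (exists_represents_spherical hp he hc (a + b)).choose_spec
    fun f hf => by
      rw [((exists_represents_spherical hp he hc a).choose_spec.add
        (exists_represents_spherical hp he hc b).choose_spec) f hf]
      change _ = functional κ hp he hc (a.1 + b.1) _
      simp only [functional, map_add, LinearMap.comp_add]

/-- The image of the spherical subalgebra in the skew group ring. -/
def sphericalRange (hħ : ħ ≠ 0) :
    Subring (GaloisOrder.SkewRing (lattice ℓ p (m + 1) ħ).toSubmonoid) :=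
  RingHom.range (R := SphericalH ℓ p (m + 1) (e 1) ħ κ c)
    (S := GaloisOrder.SkewRing (lattice ℓ p (m + 1) ħ).toSubmonoid) (sphericalHom hp he hc hħ)

theorem represents_sphericalHom (hħ : ħ ≠ 0) (a : SphericalH ℓ p (m + 1) (e 1) ħ κ c) :
    Represents p ħ (functional κ hp he hc a.1) (sphericalHom hp he hc hħ a) :=
  (exists_represents_spherical hp he hc a).choose_spec

/-- Every element is z e with z a combination of good monomials. It acts on Γ E' as z does, so
acting by zero forces z = 0. -/
theorem sphericalHom_injective (hħ : ħ ≠ 0) : Function.Injective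
    (sphericalHom (κ := κ) (m := m) hp he hc hħ) := by
  refine (injective_iff_map_eq_zero _).2 fun a ha => ?_
  obtain ⟨z, hz, haz, h⟩ := exists_spherical_eq_mul_e hp he hc a
  have h0 := (h _).1 (represents_sphericalHom hp he hc hħ a)
  rw [ha] at h0
  refine Subtype.ext ?_
  rw [haz, eq_zero_of_represents_zero hp he hc hħ hz h0, zero_mul]
  rfl

theorem functional_toSpherical (a : H ℓ p (m + 1) (e 1) ħ κ c) {f : PolyU (m + 1)}
    (hf : f.IsSymmetric) :
    functional κ hp he hc (toSpherical ℓ p m ħ κ e c a).1 (f • diagIdempotent ℓ p (m + 1)) =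
      functional κ hp he hc (RCA.e _ _ _ * a) (f • diagIdempotent ℓ p (m + 1)) :=
  functional_mul_e hp he hc _ hf

theorem single_algebraMap_mem_range (hħ : ħ ≠ 0) {f : PolyU (m + 1)} (hf : f.IsSymmetric) :
    SkewMonoidAlgebra.single (1 : (lattice ℓ p (m + 1) ħ).toSubmonoid)
      (algebraMap _ (FractionRing (PolyU (m + 1))) f) ∈
        sphericalRange (κ := κ) (m := m) hp he hc hħ := by
  obtain ⟨a, ha⟩ := exists_polyRep_eq_smul p ħ κ e c hp he hc f
  refine ⟨toSpherical ℓ p m ħ κ e c a,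
    (represents_sphericalHom hp he hc hħ _).unique hħ fun g hg => ?_⟩
  rw [functional_toSpherical hp he hc a hg, functional, LinearMap.comp_apply, map_mul,
    Module.End.mul_apply, ha, smul_smul, polyRep_e_apply hp he hc (hf.mul hg),
    row_one_smul hp he, GaloisOrder.eval_single, one_smul, map_mul]

theorem character_eq_one (hp : p ∣ ℓ) {n : ℕ} {χ a : Fin n → ZMod ℓ} (hχ : IsGood ℓ p χ)
    (ha : (p : ZMod ℓ) ∣ ∑ i, a i) (w : Perm (Fin n)) : e (∑ j, χ j * a (w j)) = 1 := by
  have h := scal_eq_one_of_isGood p e hp (q := ⟨1, 0, -χ⟩) (isGood_neg hχ) (a := a ∘ w)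
    (by rwa [← Equiv.sum_comp w a] at ha)
  simpa [Subst.scal] using h

/-- The monomials conjugate to a good one. -/
def conjIdx (i : GoodIdx ℓ p m) (w : Perm (Fin (m + 1))) : GoodIdx ℓ p m :=
  ⟨(i.1.1.map w, i.1.2.map w), by
    rw [mult_map, mult_map]
    exact isGood_comp i.2 w.symm⟩

theorem functional_grp_mul_xyMon (i : GoodIdx ℓ p m)
    (g : complexReflectionGroup ℓ p (m + 1)) {f : PolyU (m + 1)} (hf : f.IsSymmetric) :
    functional κ hp he hc (RCA.gen _ _ _ (Gen.grp g) * xyMon ℓ p (m + 1) ħ κ e c i.1)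
        (f • diagIdempotent ℓ p (m + 1)) =
      functional κ hp he hc (xyMon ℓ p (m + 1) ħ κ e c (conjIdx i (data p e hp he g).2).1)
        (f • diagIdempotent ℓ p (m + 1)) := by
  rw [grp_mul_xyMon hp he, character_eq_one hp i.2 (dvd_data p e hp he g), one_smul,
    functional, LinearMap.comp_apply, map_mul, Module.End.mul_apply, polyRep_grp_apply hp he hc g hf]
  rfl

theorem exists_mult_sub_mult {n : ℕ} (d : Fin n → ℤ) :
    ∃ s t : Multiset (Fin n), mult s - mult t = d := by
  refine ⟨Finsupp.toMultiset (Finsupp.equivFunOnFinite.symm fun i => (d i).toNat),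
    Finsupp.toMultiset (Finsupp.equivFunOnFinite.symm fun i => (-d i).toNat), ?_⟩
  funext i
  rw [Pi.sub_apply, mult, mult, Finsupp.count_toMultiset, Finsupp.count_toMultiset]
  exact Int.toNat_sub_toNat_neg (d i)

/-- For the translation by d = s - t the element e x^s y^t e works: on Γ E' it is the average of the
permuted monomials, and all of these enter with the same positive weight. -/
theorem exists_mem_range_coeff_ne_zero (hħ : ħ ≠ 0) (μ : (lattice ℓ p (m + 1) ħ).toSubmonoid) :
    ∃ X ∈ sphericalRange (κ := κ) (m := m) hp he hc hħ, X.coeff μ ≠ 0 := by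
  classical
  obtain ⟨d, hd, hμ⟩ := (mem_lattice ħ).1 μ.2
  obtain rfl : μ = latticeShift p ħ d hd := Subtype.ext hμ
  obtain ⟨s, t, rfl⟩ := exists_mult_sub_mult d
  set N := (Fintype.card (complexReflectionGroup ℓ p (m + 1)) : ℂ) with hN
  have hN0 : N ≠ 0 := by
    rw [hN]
    exact_mod_cast Fintype.card_ne_zero
  obtain ⟨X, hX, hX'⟩ := exists_represents_of_leading (κ := κ) hp he hc hħ Finset.univ
    (fun _ => N⁻¹) (fun g : complexReflectionGroup ℓ p (m + 1) =>
      conjIdx ⟨(s, t), hd⟩ (data p e hp he g).2) (N := s.card)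
    (fun g _ => by rw [conjIdx, Multiset.card_map])
  have hXa : X = sphericalHom hp he hc hħ
      (toSpherical ℓ p m ħ κ e c (xyMon ℓ p (m + 1) ħ κ e c (s, t))) := by
    refine hX.unique hħ fun f hf => ?_
    rw [represents_sphericalHom hp he hc hħ _ f hf, functional_toSpherical hp he hc _ hf,
      LinearMap.sum_apply, RCA.e, smul_mul_assoc, Finset.sum_mul, functional, map_smul (polyRep p ħ κ e c hp he hc),
      map_sum (polyRep p ħ κ e c hp he hc), LinearMap.comp_apply, LinearMap.smul_apply, LinearMap.sum_apply, map_smul, map_sum,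
      Finset.smul_sum]
    refine Finset.sum_congr rfl fun g _ => ?_
    rw [LinearMap.smul_apply, ← functional_grp_mul_xyMon hp he hc ⟨(s, t), hd⟩ g hf]
    rfl
  refine ⟨X, ⟨_, hXa.symm⟩, fun h0 => ?_⟩
  have h := hX' _ hd
  rw [h0, zero_sub, neg_mem_iff] at h
  refine notMem_filt_of_coeff_ne_zero ?_ h
  have hcoeff (g : complexReflectionGroup ℓ p (m + 1)) : MvPolynomial.coeff (Multiset.toFinsupp s)
      (if mult (s.map (data p e hp he g).2) - mult (t.map (data p e hp he g).2) = mult s - mult t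
        then N⁻¹ • mon (s.map (data p e hp he g).2) else 0) =
      if mult (s.map (data p e hp he g).2) - mult (t.map (data p e hp he g).2) = mult s - mult t ∧
        s.map (data p e hp he g).2 = s then N⁻¹ else 0 := by
    rw [ite_and]
    split_ifs with h1 h2
    · rw [MvPolynomial.coeff_smul, coeff_mon, if_pos h2, smul_eq_mul, mul_one]
    · rw [MvPolynomial.coeff_smul, coeff_mon, if_neg h2, smul_zero]
    · exact MvPolynomial.coeff_zero _
  rw [MvPolynomial.coeff_sum]
  refine ne_of_eq_of_ne (Finset.sum_congr rfl fun g _ => hcoeff g) ?_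
  rw [← Finset.sum_filter, Finset.sum_const, nsmul_eq_mul]
  -- The coefficient of U^s is 1/|W| times the number of group elements whose permutation preserves
  -- both s and s - t; the identity is one of them.
  refine mul_ne_zero (Nat.cast_ne_zero.2 (Finset.card_ne_zero.2 ⟨1, ?_⟩)) (inv_ne_zero hN0)
  rw [Finset.mem_filter, data_one]
  simp

/-- The isomorphism of the spherical subalgebra with its image. -/
def sphericalEquiv (hħ : ħ ≠ 0) : SphericalH ℓ p (m + 1) (e 1) ħ κ c ≃+*
    sphericalRange (κ := κ) (m := m) hp he hc hħ :=
  ringEquivOfInjective (sphericalHom (κ := κ) (m := m) hp he hc hħ)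
    (map_mul (sphericalHom (κ := κ) (m := m) hp he hc hħ))
    (map_add (sphericalHom (κ := κ) (m := m) hp he hc hħ)) _ (fun _ => Iff.rfl)
    (sphericalHom_injective hp he hc hħ)

theorem isPrincipalGaloisOrder_sphericalRange (hħ : ħ ≠ 0) :
    GaloisOrder.IsPrincipalGaloisOrder (symmetricGroup (m + 1))
      (lattice ℓ p (m + 1) ħ).toSubmonoid (sphericalRange (κ := κ) hp he hc hħ) := by
  refine isPrincipalGaloisOrder ħ hħ
    (fun f hf => single_algebraMap_mem_range hp he hc hħ hf) (fun X hX f hf => ?_)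
    (exists_mem_range_coeff_ne_zero hp he hc hħ)
  obtain ⟨a, rfl⟩ := hX
  obtain ⟨g, hg, -, h⟩ := exists_eval_eq hp he hc (SphericalH.e_mul a)
    (represents_sphericalHom hp he hc hħ a) hf
  exact ⟨g, hg, h⟩

theorem exists_eval_sphericalEquiv (hħ : ħ ≠ 0) (a : SphericalH ℓ p (m + 1) (e 1) ħ κ c)
    (f : PolyU (m + 1)) (hf : f.IsSymmetric) :
    ∃ g : PolyU (m + 1), g.IsSymmetric ∧ polyRep p ħ κ e c hp he hc a.1
        (f • diagIdempotent ℓ p (m + 1)) = g • diagIdempotent ℓ p (m + 1) ∧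
      GaloisOrder.eval (sphericalEquiv hp he hc hħ a).1 (algebraMap _ _ f) =
        algebraMap _ _ g :=
  exists_eval_eq hp he hc (SphericalH.e_mul a) (represents_sphericalHom hp he hc hħ a) hf

end

end Cherednik

/-- The spherical subalgebra `e H e` of the rational Cherednik algebra of `G(ℓ, p, n)`, identified
with a ring `U` of elements of `L ⋆ T` through its action on the subspace
`ℂ[U_1, …, U_n] ^ {S_n} E'` of the polynomial representation, is a principal Galois
`ℂ[U_1, …, U_n] ^ {S_n}`-order in `(ℂ(U_1, …, U_n) ⋆ T) ^ {S_n}`. -/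
theorem mainTheorem3 (ℓ p n : ℕ) [NeZero ℓ] [NeZero n] (hp : p ∣ ℓ)
    (ζ : ℂ) (hζ : IsPrimitiveRoot ζ ℓ) (ħ : ℂ) (hħ : ħ ≠ 0) (κ : ℂ) (c : ℕ → ℂ)
    (hc : ∀ m, ¬ p ∣ m → c m = 0) :
    ∃ ρ : Cherednik.H ℓ p n ζ ħ κ c →ₐ[ℂ] Module.End ℂ (Cherednik.PolyUT ℓ n),
      Cherednik.IsPolynomialRepresentation ℓ p n ζ ħ κ c ρ ∧
      ∃ (U : Subring (GaloisOrder.SkewRing (Cherednik.lattice ℓ p n ħ).toSubmonoid))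
        (φ : Cherednik.SphericalH ℓ p n ζ ħ κ c ≃+* U),
        (∀ (a : Cherednik.SphericalH ℓ p n ζ ħ κ c) (f : Cherednik.PolyU n), f.IsSymmetric →
          ∃ g : Cherednik.PolyU n, g.IsSymmetric ∧
            ρ a.1 (f • Cherednik.diagIdempotent ℓ p n) = g • Cherednik.diagIdempotent ℓ p n ∧
            GaloisOrder.eval (φ a).1 (algebraMap _ _ f) = algebraMap _ _ g) ∧
        GaloisOrder.IsPrincipalGaloisOrder (Cherednik.symmetricGroup n)
          (Cherednik.lattice ℓ p n ħ).toSubmonoid U := by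
  obtain ⟨m, rfl⟩ := Nat.exists_eq_add_one_of_ne_zero (NeZero.ne n)
  -- The primitive root enters only through the character x ↦ ζ^x of ℤ/ℓ, and primitivity is its
  -- injectivity.
  obtain ⟨e, he, rfl⟩ : ∃ e : AddChar (ZMod ℓ) ℂ, Function.Injective e ∧ e 1 = ζ := by
    refine ⟨AddChar.zmodChar ℓ hζ.pow_eq_one, fun a b h => ?_, ?_⟩
    · rw [AddChar.zmodChar_apply, AddChar.zmodChar_apply] at h
      exact ZMod.val_injective ℓ (hζ.pow_inj (ZMod.val_lt a) (ZMod.val_lt b) h)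
    · simpa using AddChar.zmodChar_apply' hζ.pow_eq_one 1
  exact ⟨_, Cherednik.isPolynomialRepresentation p ħ κ e c hp he hc,
    Cherednik.sphericalRange hp he hc hħ, Cherednik.sphericalEquiv hp he hc hħ,
    Cherednik.exists_eval_sphericalEquiv hp he hc hħ,
    Cherednik.isPrincipalGaloisOrder_sphericalRange hp he hc hħ⟩
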